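/- **Weighted maximal $L^p$-regularity.** Let $d\ge 1$ be an integer, $\mathbb{T}^d=\mathbb{R}^d/\mathbb{Z}^d$, $T\in(0,\infty)$, $p,q\in(2,\infty)$ and $\lambda>0$. Let $a:\mathbb{R}\to\mathbb{R}$ be measurable with $\lambda^{-1}\le a(t)\le\lambda$ for $t>0$. For $r\in(1,\infty)$, a locally integrable, almost everywhere positive function $w$ on $\mathbb{R}$ belongs to $A_r(\mathbb{R})$ if $$[w]_{A_r}:=\sup_{I}\Big(\frac1{|I|}\int_I w\,dt\Big)\Big(\frac1{|I|}\int_I w^{1-r'}\,dt\Big)^{r-1}<\infty,\qquad \frac1r+\frac1{r'}=1,$$ the supremum being taken over all bounded intervals $I\subset\mathbb{R}$ of positive length. Then for every $w\in A_{p/2}(\mathbb{R})$ and every $f\in L^p(0,T,w;L^q(\mathbb{T}^d))$, where $L^p(0,T,w;X)$ is the $L^p$-space of strongly measurable $X$-valued functions with respect to $w\,dt$ on $(0,T)$, the problem $$\partial_t u+a(t)\Delta^2u=f\ \text{ on }(0,T)\times\mathbb{T}^d,\qquad u(0)=0\ \text{ on }\mathbb{T}^d,$$ has a unique solution $$u\in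 W^{1,p}(0,T,w;L^q(\mathbb{T}^d))\cap L^p(0,T,w;W^{4,q}(\mathbb{T}^d)),$$ where derivatives are weak derivatives, the equation holds in $L^q(\mathbb{T}^d)$ for almost every $t\in(0,T)$, and the initial condition is understood for the representative of $u$ in $C([0,T];L^q(\mathbb{T}^d))$. Moreover, $$\int_0^T\|\partial_tu\|_{L^q(\mathbb{T}^d)}^p\,w\,dt+\int_0^T\|u\|_{W^{4,q}(\mathbb{T}^d)}^p\,w\,dt\le C\int_0^T\|f\|_{L^q(\mathbb{T}^d)}^p\,w\,dt,$$ where $C$ depends only on $d,\lambda,q,p,T$ and $[w]_{A_{p/2}}$; more precisely, for every $K<\infty$ one constant $C=C(d,\lambda,q,p,T,K)$ serves all $w$ with $[w]_{A_{p/2}}\le K$ (and all $a$ and $f$ as above). This holds both for real-valued and for complex-valued functions. -/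

import Mathlib

open MeasureTheory Set
open scoped ENNReal NNReal ContDiff

/-! ### Test functions and partial derivatives on the torus `ℝᵈ / ℤᵈ` -/

/-- The quotient map `ℝᵈ → ℝᵈ / ℤᵈ`. -/
def torusMk {d : ℕ} (x : Fin d → ℝ) : UnitAddTorus (Fin d) := fun i => (x i : UnitAddCircle)

/-- A function on the torus is smooth if its periodic lift to `ℝᵈ` is. -/
def TorusSmooth {d : ℕ} (φ : UnitAddTorus (Fin d) → ℝ) : Prop :=
  ContDiff ℝ ∞ (fun x : Fin d → ℝ => φ (torusMk x))

/-- The `i`-th partial derivative of a function on the torus. -/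
noncomputable def torusPartial {d : ℕ} (i : Fin d) (φ : UnitAddTorus (Fin d) → ℝ) :
    UnitAddTorus (Fin d) → ℝ :=
  fun x => deriv (fun s : ℝ => φ (x + torusMk (Pi.single i s))) 0

/-- The partial derivative `∂^α = ∏ᵢ ∂ᵢ^{αᵢ}` of a function on the torus. -/
noncomputable def torusIteratedPartial {d : ℕ} (α : Fin d → ℕ)
    (φ : UnitAddTorus (Fin d) → ℝ) : UnitAddTorus (Fin d) → ℝ :=
  (List.finRange d).foldr (fun i ψ => (torusPartial i)^[α i] ψ) φ

theorem torusMk_add {d : ℕ} (x y : Fin d → ℝ) : torusMk (x + y) = torusMk x + torusMk y := by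
  funext i
  simp [torusMk]

theorem torusMk_isQuotientMap (d : ℕ) :
    Topology.IsQuotientMap (torusMk : (Fin d → ℝ) → UnitAddTorus (Fin d)) := by
  have h : IsOpenQuotientMap (torusMk : (Fin d → ℝ) → UnitAddTorus (Fin d)) :=
    IsOpenQuotientMap.piMap
      (f := fun (_ : Fin d) (s : ℝ) => (s : UnitAddCircle))
      (fun _ => QuotientAddGroup.isOpenQuotientMap_mk)
  exact h.isQuotientMap

theorem TorusSmooth.continuous {d : ℕ} {φ : UnitAddTorus (Fin d) → ℝ} (h : TorusSmooth φ) :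
    Continuous φ :=
  (torusMk_isQuotientMap d).continuous_iff.2 (ContDiff.continuous h)

theorem TorusSmooth.torusPartial {d : ℕ} {φ : UnitAddTorus (Fin d) → ℝ} (h : TorusSmooth φ)
    (i : Fin d) : TorusSmooth (torusPartial i φ) := by
  have key : (fun x : Fin d → ℝ => _root_.torusPartial i φ (torusMk x)) =
      fun x => fderiv ℝ (fun y : Fin d → ℝ => φ (torusMk y)) x (Pi.single i 1) := by
    funext x
    have hd : DifferentiableAt ℝ (fun y : Fin d → ℝ => φ (torusMk y)) x :=
      (ContDiff.differentiable h (by simp)) x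
    rw [← hd.lineDeriv_eq_fderiv]
    unfold _root_.torusPartial lineDeriv
    congr 1
    funext s
    rw [← torusMk_add, ← Pi.single_smul, smul_eq_mul, mul_one]
  unfold TorusSmooth
  rw [key]
  exact (ContDiff.fderiv_right (m := ∞) h (by simp)).clm_apply contDiff_const

theorem TorusSmooth.torusIteratedPartial {d : ℕ} {φ : UnitAddTorus (Fin d) → ℝ}
    (h : TorusSmooth φ) (α : Fin d → ℕ) : TorusSmooth (torusIteratedPartial α φ) := by
  unfold _root_.torusIteratedPartial
  induction List.finRange d with
  | nil => exact h
  | cons i l ih =>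
    simp only [List.foldr_cons]
    generalize α i = n
    induction n with
    | zero => exact ih
    | succ n ihn =>
      rw [Function.iterate_succ_apply']
      exact ihn.torusPartial i

/-- `v = ∂^α u` in the sense of distributions on the torus. -/
def IsTorusWeakDeriv {𝕜 : Type*} [RCLike 𝕜] {d : ℕ} (α : Fin d → ℕ)
    (u v : UnitAddTorus (Fin d) → 𝕜) : Prop :=
  ∀ φ : UnitAddTorus (Fin d) → ℝ, TorusSmooth φ →
    ∫ x, torusIteratedPartial α φ x • u x = (-1 : ℝ) ^ (∑ i, α i) • ∫ x, φ x • v x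

/-! ### The spaces `L^q(𝕋ᵈ)` and `W^{k,q}(𝕋ᵈ)` -/

/-- `L^q(𝕋ᵈ)`, with respect to the normalized Haar measure of the torus. -/
abbrev TorusLp (𝕜 : Type*) [RCLike 𝕜] (d : ℕ) (q : ℝ≥0∞) : Type _ :=
  Lp 𝕜 q (volume : Measure (UnitAddTorus (Fin d)))

/-- Multi-indices `α ∈ ℕᵈ` of order `|α| ≤ k`. -/
abbrev MultiIndex (d k : ℕ) : Type := {α : Fin d → ℕ // ∑ i, α i ≤ k}

noncomputable instance MultiIndex.instFintype (d k : ℕ) : Fintype (MultiIndex d k) :=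
  Set.Finite.fintype (s := {α : Fin d → ℕ | ∑ i, α i ≤ k})
    ((Set.finite_Iic (fun _ : Fin d => k)).subset fun α hα i =>
      (Finset.single_le_sum (f := α) (fun _ _ => Nat.zero_le _) (Finset.mem_univ i)).trans hα)

/-- The multi-index `0`. -/
def MultiIndex.zero (d k : ℕ) : MultiIndex d k := ⟨0, by simp⟩

/-- The multi-index `2 eᵢ + 2 eⱼ`. -/
def MultiIndex.twoTwo {d : ℕ} (i j : Fin d) : MultiIndex d 4 :=
  ⟨Pi.single i 2 + Pi.single j 2, by simp [Finset.sum_add_distrib]⟩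

instance fact_one_le_ofReal (q : ℝ) [hq : Fact (2 < q)] : Fact (1 ≤ ENNReal.ofReal q) :=
  ⟨ENNReal.one_le_ofReal.2 (by linarith [hq.out])⟩

theorem integrable_smul_torusLp {𝕜 : Type*} [RCLike 𝕜] {d : ℕ} {q : ℝ≥0∞} [hq : Fact (1 ≤ q)]
    {φ : UnitAddTorus (Fin d) → ℝ} (hφ : Continuous φ) (u : TorusLp 𝕜 d q) :
    Integrable (fun x => φ x • u x) := by
  obtain ⟨C, hC⟩ := isCompact_univ.exists_bound_of_continuousOn hφ.continuousOn
  exact ((Lp.memLp u).integrable hq.out).bdd_smul C hφ.aestronglyMeasurable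
    (Filter.Eventually.of_forall fun x => hC x (mem_univ x))

/-- The Sobolev space `W^{k,q}(𝕋ᵈ)`. An element `u` is stored together with its weak derivatives,
as the family `(∂^α u)_{|α| ≤ k}` in `L^q(𝕋ᵈ)`; the function `u` is the member with `α = 0`.
The inherited norm is `(∑_{|α| ≤ k} ‖∂^α u‖_{L^q}^q)^{1/q}` when `q < ∞`. -/
noncomputable def sobolevTorus (𝕜 : Type*) [RCLike 𝕜] (d k : ℕ) (q : ℝ≥0∞) [Fact (1 ≤ q)] :
    Submodule 𝕜 (PiLp q (fun _ : MultiIndex d k => TorusLp 𝕜 d q)) where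
  carrier := {U | ∀ α : MultiIndex d k, IsTorusWeakDeriv α.1 (U (MultiIndex.zero d k)) (U α)}
  zero_mem' := by
    intro α φ _
    have h0 : ∀ ψ : UnitAddTorus (Fin d) → ℝ,
        ∫ x, ψ x • (0 : TorusLp 𝕜 d q) x = 0 := by
      intro ψ
      refine integral_eq_zero_of_ae ?_
      filter_upwards [Lp.coeFn_zero 𝕜 q (volume : Measure (UnitAddTorus (Fin d)))] with x hx
      rw [hx, Pi.zero_apply, smul_zero]
    simp only [PiLp.zero_apply, h0, smul_zero]
  add_mem' := by
    intro U V hU hV α φ hφ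
    have hadd : ∀ ψ : UnitAddTorus (Fin d) → ℝ, TorusSmooth ψ → ∀ a b : TorusLp 𝕜 d q,
        ∫ x, ψ x • (a + b) x = (∫ x, ψ x • a x) + ∫ x, ψ x • b x := by
      intro ψ hψ a b
      rw [← integral_add (integrable_smul_torusLp hψ.continuous a)
        (integrable_smul_torusLp hψ.continuous b)]
      refine integral_congr_ae ?_
      filter_upwards [Lp.coeFn_add a b] with x hx
      rw [hx, Pi.add_apply, smul_add]
    simp only [PiLp.add_apply]
    rw [hadd _ (hφ.torusIteratedPartial α.1), hadd _ hφ, hU α φ hφ, hV α φ hφ, smul_add]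
  smul_mem' := by
    intro c U hU α φ hφ
    have hsmul : ∀ (ψ : UnitAddTorus (Fin d) → ℝ) (a : TorusLp 𝕜 d q),
        ∫ x, ψ x • (c • a) x = c • ∫ x, ψ x • a x := by
      intro ψ a
      rw [← integral_smul]
      refine integral_congr_ae ?_
      filter_upwards [Lp.coeFn_smul c a] with x hx
      simp only [hx, Pi.smul_apply]
      exact smul_comm _ _ _
    simp only [PiLp.smul_apply]
    rw [hsmul, hsmul, hU α φ hφ, smul_comm]

/-- The embedding `W^{k,q}(𝕋ᵈ) ⊆ L^q(𝕋ᵈ)`. -/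
noncomputable def sobolevTorus.toTorusLp {𝕜 : Type*} [RCLike 𝕜] {d k : ℕ} {q : ℝ≥0∞}
    [Fact (1 ≤ q)] (u : sobolevTorus 𝕜 d k q) : TorusLp 𝕜 d q :=
  u.1 (MultiIndex.zero d k)

/-- The bilaplacian `Δ² u = ∑ᵢⱼ ∂ᵢ² ∂ⱼ² u ∈ L^q(𝕋ᵈ)` of `u ∈ W^{4,q}(𝕋ᵈ)`. -/
noncomputable def sobolevTorus.bilaplacian {𝕜 : Type*} [RCLike 𝕜] {d : ℕ} {q : ℝ≥0∞}
    [Fact (1 ≤ q)] (u : sobolevTorus 𝕜 d 4 q) : TorusLp 𝕜 d q :=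
  ∑ i : Fin d, ∑ j : Fin d, u.1 (MultiIndex.twoTwo i j)

/-! ### Muckenhoupt weights on the line -/

/-- The characteristic `[w]_{A_r} = sup_I (⨍_I w) (⨍_I w^{1-r'})^{r-1}`, `1/r + 1/r' = 1`, the
supremum being over all bounded intervals `I` of positive length. -/
noncomputable def apCharacteristic (r : ℝ) (w : ℝ → ℝ) : ℝ≥0∞ :=
  ⨆ (s : ℝ) (t : ℝ) (_ : s < t),
    (⨍⁻ x, ENNReal.ofReal (w x) ∂volume.restrict (Ioo s t)) *
      (⨍⁻ x, ENNReal.ofReal (w x) ^ (1 - r.conjExponent) ∂volume.restrict (Ioo s t)) ^ (r - 1)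

/-- `w ∈ A_r(ℝ)`: a locally integrable, almost everywhere positive function on the line with finite
characteristic. -/
structure IsMuckenhoupt (r : ℝ) (w : ℝ → ℝ) : Prop where
  locallyIntegrable : LocallyIntegrable w
  pos : ∀ᵐ t, 0 < w t
  characteristic_lt_top : apCharacteristic r w < ⊤

/-- The measure `w dt` on the interval `(0, T)`. -/
noncomputable def weightedMeasure (w : ℝ → ℝ) (T : ℝ) : Measure ℝ :=
  (volume.restrict (Ioo 0 T)).withDensity fun t => ENNReal.ofReal (w t)

/-! ### The parabolic problem -/

/-- `v' = ∂ₜ v` in the sense of `E`-valued distributions on `(0, T)`. -/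
structure HasWeakTimeDeriv {E : Type*} [NormedAddCommGroup E] [NormedSpace ℝ E] (T : ℝ)
    (v v' : ℝ → E) : Prop where
  locallyIntegrableOn : LocallyIntegrableOn v (Ioo 0 T)
  locallyIntegrableOn_deriv : LocallyIntegrableOn v' (Ioo 0 T)
  integral_eq : ∀ φ : ℝ → ℝ, ContDiff ℝ ∞ φ → HasCompactSupport φ → tsupport φ ⊆ Ioo 0 T →
    ∫ t in Ioo 0 T, deriv φ t • v t = -∫ t in Ioo 0 T, φ t • v' t

/-- `u ∈ W^{1,p}(0,T,w;L^q(𝕋ᵈ)) ∩ L^p(0,T,w;W^{4,q}(𝕋ᵈ))`, with weak time derivative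
`u' ∈ L^p(0,T,w;L^q(𝕋ᵈ))`, solves `∂ₜ u + a(t) Δ² u = f` on `(0,T) × 𝕋ᵈ` and `u(0) = 0`. The initial
value is that of the representative of `u` which is continuous on `[0,T]` with values in
`L^q(𝕋ᵈ)`. -/
structure IsParabolicSolution {𝕜 : Type*} [RCLike 𝕜] {d : ℕ} {p q : ℝ≥0∞} [Fact (1 ≤ q)]
    (T : ℝ) (w a : ℝ → ℝ) (f : Lp (TorusLp 𝕜 d q) p (weightedMeasure w T))
    (u : Lp (sobolevTorus 𝕜 d 4 q) p (weightedMeasure w T))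
    (u' : Lp (TorusLp 𝕜 d q) p (weightedMeasure w T)) : Prop where
  hasWeakTimeDeriv : HasWeakTimeDeriv T (fun t => sobolevTorus.toTorusLp (u t)) u'
  equation : ∀ᵐ t ∂volume.restrict (Ioo 0 T), u' t + (a t : 𝕜) • sobolevTorus.bilaplacian (u t) = f t
  initial : ∃ v : ℝ → TorusLp 𝕜 d q, ContinuousOn v (Icc 0 T) ∧
    (∀ᵐ t ∂volume.restrict (Ioo 0 T), sobolevTorus.toTorusLp (u t) = v t) ∧ v 0 = 0

/-! The coefficient depends on time only, so the solution is explicit. With b(t) = ∫₀ᵗ a it is u(t)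
= ∫₀ᵗ exp(-(b(t) - b(s))Δ²) f(s) ds, and for |α| = m ≤ 4 the function ∂^α u is an integral of f
against the kernel r^{-(d+m)} Φ(y/r). Here r⁴ = b(t) - b(s) is comparable with t - s, and the
Schwartz function Φ is ∂^α of the biharmonic heat kernel at time one. For m = 4 this is a singular
integral for the parabolic scaling (length ℓ, duration ℓ⁴). Replacing r⁴ by r⁴ + ε removes the
singularity; every bound is uniform in ε, in a and in the weights of bounded characteristic.

The bound on L^p(w; L^q), `exists_lintegral_rpow_lintegral_parabolicOp_le`, rests on four facts. (a)
An L² bound: Parseval in space and Young's inequality in time for each frequency, since the symbol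
|2πn|^m is at most max(1, |2πn|⁴) and the exponential decays at rate at least λ⁻¹|2πn|⁴
(`exists_lintegral_enorm_sq_parabolicOp_le`). (b) On a parabolic cell the mean oscillation of the
operator is at most C (M_t M_x |f|²)^{1/2}. The distant past contributes a function that is almost
constant on the cell, the recent past at distant points is small by the decay of Φ, and the recent
past nearby is controlled by (a) (`exists_cellAvg_parabolicOp_sub_le`). (c) A good-λ inequality for
weights with the A_∞ property turns (b) into a bound on L^q(v; L^q) for every time weight v in
A_{q/2}. The maximal functions act on |f|², which is why the exponents exceed 2. (d) Rubio de
Francia extrapolation in time, applied to squares of L^q norms, passes from (q, A_{q/2}) to (p,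
A_{p/2}). All maximal functions are dyadic. They dominate averages over arbitrary balls and
intervals because translating the dyadic grid by a third gives a second grid, and every short
interval lies in a cell of one of the two.

For the equation, take f to be a finite sum of terms 1_S(t) Re(c eₙ) z. A scalar ordinary
differential equation gives the solution, the regularized operators applied to f converge to its
derivatives, and Fatou's lemma gives the estimate. Such f are dense, and (u, u') ↦ u' + aΔ²u is
bounded on the complete group of pairs with u(0) = 0. An estimate on a dense subgroup of the target
then makes the map surjective with control of the norm. For uniqueness, the trigonometric moments of
a difference of two solutions satisfy linear scalar equations with zero initial value, so they
vanish by Gronwall's lemma. -/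

set_option linter.unusedSectionVars false

/-! ### Maximal functions of nested partitions -/

section NestedPartitions

variable {S ι J : Type*} [MeasurableSpace S] [MeasurableSpace ι]

/-- The cell of level `k` containing `x`, for a sequence of partitions given by labels `P k`. -/
def labelCell {S ι : Type*} (P : ℕ → S → ι) (k : ℕ) (x : S) : Set S := {y | P k y = P k x}

/-- A sequence of measurable partitions, each refining the preceding one. -/
structure IsNestedPartition (P : ℕ → S → ι) : Prop where
  measurable : ∀ k, Measurable (P k)
  nested : ∀ k x y, P (k + 1) x = P (k + 1) y → P k x = P k y

/-- The average of `f` over the cell of level `k` containing `x`. -/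
noncomputable def cellAvg (P : ℕ → S → ι) (μ : Measure S) (f : S → ℝ≥0∞) (k : ℕ) (x : S) : ℝ≥0∞ :=
  (∫⁻ y in labelCell P k x, f y ∂μ) / μ (labelCell P k x)

/-- The maximal function of a sequence of partitions. -/
noncomputable def cellMax (P : ℕ → S → ι) (μ : Measure S) (f : S → ℝ≥0∞) (x : S) : ℝ≥0∞ :=
  ⨆ k, cellAvg P μ f k x

theorem mem_labelCell_self (P : ℕ → S → ι) (k : ℕ) (x : S) : x ∈ labelCell P k x := rfl

theorem labelCell_eq_of_mem {P : ℕ → S → ι} {k : ℕ} {x y : S} (h : y ∈ labelCell P k x) :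
    labelCell P k y = labelCell P k x := by
  have h : P k y = P k x := h
  simp only [labelCell, h]

theorem IsNestedPartition.labelCell_subset {P : ℕ → S → ι} (hP : IsNestedPartition P) {j k : ℕ}
    (hjk : j ≤ k) (x : S) : labelCell P k x ⊆ labelCell P j x := by
  induction k, hjk using Nat.le_induction with
  | base => exact subset_rfl
  | succ k _ ih => exact fun y hy => ih (hP.nested k y x hy)

variable [Countable ι] [MeasurableSingletonClass ι]

theorem IsNestedPartition.measurableSet_labelCell {P : ℕ → S → ι} (hP : IsNestedPartition P) (k : ℕ)
    (x : S) : MeasurableSet (labelCell P k x) :=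
  (hP.measurable k) (measurableSet_singleton (P k x))

theorem IsNestedPartition.measurable_cellAvg {P : ℕ → S → ι} (hP : IsNestedPartition P)
    (μ : Measure S) (f : S → ℝ≥0∞) (k : ℕ) : Measurable (cellAvg P μ f k) := by
  have : cellAvg P μ f k = (fun i => (∫⁻ y in P k ⁻¹' {i}, f y ∂μ) / μ (P k ⁻¹' {i})) ∘ P k := rfl
  rw [this]
  exact (Measurable.of_discrete).comp (hP.measurable k)

theorem IsNestedPartition.measurable_cellMax {P : ℕ → S → ι} (hP : IsNestedPartition P)
    (μ : Measure S) (f : S → ℝ≥0∞) : Measurable (cellMax P μ f) :=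
  Measurable.iSup fun k => hP.measurable_cellAvg μ f k

/-- Comparison of two measures on the maximal cells on which the average of `f` exceeds `c`. -/
theorem IsNestedPartition.measure_lt_cellMax_le {P : ℕ → S → ι} (hP : IsNestedPartition P)
    {μ : Measure S} {f : S → ℝ≥0∞} {c : ℝ≥0∞} {ν₁ ν₂ : Measure S}
    (h : ∀ k x, c < cellAvg P μ f k x → (∀ j < k, cellAvg P μ f j x ≤ c) →
      ν₁ (labelCell P k x) ≤ ν₂ (labelCell P k x)) :
    ν₁ {x | c < cellMax P μ f x} ≤ ν₂ {x | c < cellMax P μ f x} := by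
  classical
  -- Stopping-time decomposition: `E k` collects the points whose average exceeds `c` for the first
  -- time at level `k`. These sets are disjoint and exhaust the level set.
  set E : ℕ → Set S := fun k => {x | c < cellAvg P μ f k x ∧ ∀ j < k, cellAvg P μ f j x ≤ c}
    with hE
  have hEunion : {x | c < cellMax P μ f x} = ⋃ k, E k := by
    ext x
    simp only [mem_ofPred_eq, cellMax, lt_iSup_iff, mem_iUnion, hE]
    constructor
    · intro hx
      exact ⟨Nat.find hx, Nat.find_spec hx, fun j hj => not_lt.1 (Nat.find_min hx hj)⟩
    · rintro ⟨k, hk, _⟩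
      exact ⟨k, hk⟩
  have hEmeas : ∀ k, MeasurableSet (E k) := fun k => by
    have : E k = {x | c < cellAvg P μ f k x} ∩ ⋂ j ∈ Iio k, {x | cellAvg P μ f j x ≤ c} := by
      ext x; simp [hE]
    rw [this]
    refine (measurableSet_lt measurable_const (hP.measurable_cellAvg μ f k)).inter ?_
    exact MeasurableSet.biInter (to_countable _) fun j _ =>
      measurableSet_le (hP.measurable_cellAvg μ f j) measurable_const
  have hEdisj : Pairwise (Function.onFun Disjoint E) := by
    intro j k hjk
    wlog hlt : j < k generalizing j k
    · exact (this hjk.symm (lt_of_le_of_ne (not_lt.1 hlt) hjk.symm)).symm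
    exact disjoint_left.2 fun x hx hx' => absurd hx.1 (not_lt.2 (hx'.2 j hlt))
  rw [hEunion, measure_iUnion hEdisj hEmeas, measure_iUnion hEdisj hEmeas]
  refine ENNReal.tsum_le_tsum fun k => ?_
  -- Averages of level at most `k` are constant on cells of level `k`, so `E k` is a countable union
  -- of such cells, and the hypothesis applies to each of them.
  have hcell : ∀ x ∈ E k, labelCell P k x ⊆ E k := by
    intro x hx y hy
    have : ∀ j ≤ k, cellAvg P μ f j y = cellAvg P μ f j x := fun j hj => by
      simp only [cellAvg, labelCell_eq_of_mem (hP.labelCell_subset hj x hy)]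
    exact ⟨by rw [this k le_rfl]; exact hx.1, fun j hj => by rw [this j hj.le]; exact hx.2 j hj⟩
  have hdec : E k = ⋃ i ∈ P k '' E k, P k ⁻¹' {i} := by
    ext y
    simp only [mem_image, iUnion_exists, mem_iUnion, mem_preimage, mem_singleton_iff, exists_prop]
    constructor
    · intro hy
      exact ⟨P k y, y, ⟨hy, rfl⟩, rfl⟩
    · rintro ⟨i, x, ⟨hx, rfl⟩, hyx⟩
      exact hcell x hx hyx
  have hd : (P k '' E k).PairwiseDisjoint fun i => P k ⁻¹' {i} := fun i _ j _ hij =>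
    (disjoint_singleton.2 hij).preimage _
  have hm : ∀ i ∈ P k '' E k, MeasurableSet (P k ⁻¹' {i}) := fun i _ =>
    hP.measurable k (measurableSet_singleton i)
  rw [hdec, measure_biUnion (to_countable _) hd hm, measure_biUnion (to_countable _) hd hm]
  refine ENNReal.tsum_le_tsum fun i => ?_
  obtain ⟨x, hx, hxi⟩ := i.2
  have := h k x hx.1 hx.2
  rwa [← hxi]

/-- The maximal inequality of weak type `(1,1)`. -/
theorem IsNestedPartition.mul_measure_lt_cellMax_le {P : ℕ → S → ι} (hP : IsNestedPartition P)
    (μ : Measure S) (f : S → ℝ≥0∞) (c : ℝ≥0∞) :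
    c * μ {x | c < cellMax P μ f x} ≤ ∫⁻ x, f x ∂μ := by
  have h := hP.measure_lt_cellMax_le (μ := μ) (f := f) (c := c) (ν₁ := c • μ)
    (ν₂ := μ.withDensity f) (fun k x hx _ => by
      rw [withDensity_apply _ (hP.measurableSet_labelCell k x), Measure.smul_apply, smul_eq_mul]
      exact ENNReal.mul_le_of_le_div hx.le)
  rw [Measure.smul_apply, smul_eq_mul, withDensity_apply _
    (measurableSet_lt measurable_const (hP.measurable_cellMax μ f))] at h
  exact h.trans (setLIntegral_le_lintegral _ _)

/-- The layer-cake formula for a single number, g^s = ∫₀^g s t^{s-1} dt. Finite values come from the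
layer-cake formula for a Dirac measure, and the value ∞ by comparison with all natural numbers. -/
theorem ENNReal.rpow_eq_lintegral_Ioi {s : ℝ} (hs : 0 < s) (g : ℝ≥0∞) :
    g ^ s = ∫⁻ t in Ioi (0 : ℝ), ENNReal.ofReal (s * t ^ (s - 1)) *
      (if ENNReal.ofReal t < g then 1 else 0) := by
  have key : ∀ b : ℝ≥0, (b : ℝ≥0∞) ^ s = ∫⁻ t in Ioi (0 : ℝ), ENNReal.ofReal (s * t ^ (s - 1)) *
      (if ENNReal.ofReal t < b then 1 else 0) := by
    intro b
    have h := lintegral_rpow_eq_lintegral_meas_lt_mul (μ := Measure.dirac ()) (f := fun _ => (b : ℝ))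
      (Filter.Eventually.of_forall fun _ => b.2) aemeasurable_const hs
    rw [lintegral_dirac, ← ENNReal.ofReal_rpow_of_nonneg NNReal.zero_le_coe hs.le, ENNReal.ofReal_coe_nnreal,
      ← lintegral_const_mul'' _ (by
        refine AEMeasurable.mul ?_ (by fun_prop)
        refine Measurable.aemeasurable ?_
        have : (fun t : ℝ => Measure.dirac () {a : Unit | t < (b : ℝ)}) =
          fun t => if t < (b : ℝ) then 1 else 0 := by
          funext t
          split_ifs with h <;> simp [h]
        rw [this]
        exact Measurable.ite measurableSet_Iio measurable_const measurable_const)] at h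
    rw [h]
    refine setLIntegral_congr_fun measurableSet_Ioi fun t ht => ?_
    have ht : 0 < t := ht
    have hb : ENNReal.ofReal t < b ↔ t < (b : ℝ) := by
      rw [← ENNReal.ofReal_coe_nnreal, ENNReal.ofReal_lt_ofReal_iff_of_nonneg ht.le]
    rw [ENNReal.ofReal_mul hs.le]
    by_cases hlt : t < (b : ℝ)
    · simp [hlt, hb]
    · simp [hlt, hb]
  induction g with
  | coe b => exact key b
  | top =>
    rw [ENNReal.top_rpow_of_pos hs, eq_comm, eq_top_iff]
    have : ∀ n : ℕ, ((n : ℝ≥0) : ℝ≥0∞) ^ s ≤ ∫⁻ t in Ioi (0 : ℝ), ENNReal.ofReal (s * t ^ (s - 1)) *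
      (if ENNReal.ofReal t < ⊤ then 1 else 0) := by
      intro n
      rw [key]
      refine lintegral_mono fun t => ?_
      simp only [ENNReal.ofReal_lt_top, if_true]
      gcongr
      split_ifs <;> simp
    refine le_of_tendsto' (x := Filter.atTop) (f := fun n : ℕ => ((n : ℝ≥0) : ℝ≥0∞) ^ s) ?_ this
    rw [← ENNReal.top_rpow_of_pos hs]
    exact (ENNReal.continuous_rpow_const.tendsto _).comp (by
      simpa using ENNReal.tendsto_nat_nhds_top)

/-- Tonelli applied to the pointwise formula. No finiteness of `g` is needed, which matters for
maximal functions, as they may be infinite. -/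
theorem lintegral_rpow_eq_lintegral_Ioi {μ : Measure S} [SFinite μ] {s : ℝ} (hs : 0 < s)
    {g : S → ℝ≥0∞} (hg : Measurable g) :
    ∫⁻ x, g x ^ s ∂μ = ∫⁻ t in Ioi (0 : ℝ), ENNReal.ofReal (s * t ^ (s - 1)) *
      μ {x | ENNReal.ofReal t < g x} := by
  have hset : MeasurableSet {z : S × ℝ | ENNReal.ofReal z.2 < g z.1} :=
    measurableSet_lt (by fun_prop) (by fun_prop)
  simp_rw [ENNReal.rpow_eq_lintegral_Ioi hs]
  rw [lintegral_lintegral_swap]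
  · refine lintegral_congr fun t => ?_
    have hset' : MeasurableSet {x | ENNReal.ofReal t < g x} := measurableSet_lt measurable_const hg
    rw [lintegral_const_mul _ (Measurable.ite hset' measurable_const measurable_const)]
    congr 1
    rw [← lintegral_indicator_one hset']
    refine lintegral_congr fun x => ?_
    simp [indicator_apply]
  · refine Measurable.aemeasurable (Measurable.mul (by fun_prop) ?_)
    exact Measurable.ite hset measurable_const measurable_const

/-- The constant in the maximal inequality of strong type. -/
noncomputable def maximalConst (s : ℝ) : ℝ≥0∞ := ENNReal.ofReal (2 * s / (s - 1) * 2 ^ (s - 1))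

theorem maximalConst_ne_top (s : ℝ) : maximalConst s ≠ ⊤ := ENNReal.ofReal_ne_top

/-- The maximal inequality of strong type. -/
theorem IsNestedPartition.lintegral_cellMax_rpow_le {P : ℕ → S → ι} (hP : IsNestedPartition P)
    (μ : Measure S) [SFinite μ] {f : S → ℝ≥0∞} (hf : Measurable f) {s : ℝ} (hs : 1 < s) :
    ∫⁻ x, cellMax P μ f x ^ s ∂μ ≤ maximalConst s * ∫⁻ x, f x ^ s ∂μ := by
  have hweak : ∀ t : ℝ, 0 < t → μ {x | ENNReal.ofReal t < cellMax P μ f x} ≤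
      ENNReal.ofReal (2 / t) * ∫⁻ x, f x * (if ENNReal.ofReal t < 2 * f x then 1 else 0) ∂μ := by
    intro t ht
    -- The part of `f` above `t / 2`. The rest contributes at most `t / 2` to any average, so the
    -- maximal function of `f` can exceed `t` only where that of `g` exceeds `t / 2`; the weak type
    -- inequality is applied to `g`.
    set g : S → ℝ≥0∞ := fun x => f x * (if ENNReal.ofReal t < 2 * f x then 1 else 0)
    have hsub : {x | ENNReal.ofReal t < cellMax P μ f x} ⊆
        {x | ENNReal.ofReal (t / 2) < cellMax P μ g x} := by
      intro x hx
      by_contra hcon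
      refine absurd (show ENNReal.ofReal t < cellMax P μ f x from hx) (not_lt.2 ?_)
      simp only [mem_ofPred_eq, not_lt] at hcon
      refine iSup_le fun k => ?_
      have h1 : cellAvg P μ f k x ≤ cellAvg P μ g k x + ENNReal.ofReal (t / 2) := by
        have hle : ∫⁻ y in labelCell P k x, f y ∂μ ≤
            (∫⁻ y in labelCell P k x, g y ∂μ) + ENNReal.ofReal (t / 2) * μ (labelCell P k x) := by
          rw [← setLIntegral_const, ← lintegral_add_right _ measurable_const]
          refine lintegral_mono fun y => ?_
          simp only [g]
          split_ifs with h
          · simp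
          · have : 2 * f y ≤ 2 * ENNReal.ofReal (t / 2) := by
              rw [← ENNReal.ofReal_ofNat 2, ← ENNReal.ofReal_mul (by norm_num),
                mul_div_cancel₀ _ (by norm_num : (2 : ℝ) ≠ 0), ENNReal.ofReal_ofNat]
              exact not_lt.1 h
            rw [mul_zero, zero_add]
            exact (ENNReal.mul_le_mul_iff_right (by norm_num) (by norm_num)).1 this
        unfold cellAvg
        refine (ENNReal.div_le_div_right hle _).trans ?_
        rw [ENNReal.add_div]
        gcongr
        exact ENNReal.div_le_of_le_mul le_rfl
      refine h1.trans ?_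
      calc cellAvg P μ g k x + ENNReal.ofReal (t / 2)
          ≤ ENNReal.ofReal (t / 2) + ENNReal.ofReal (t / 2) := by
            gcongr
            exact (le_iSup _ k).trans hcon
        _ = ENNReal.ofReal t := by
            rw [← ENNReal.ofReal_add (by positivity) (by positivity)]; congr 1; ring
    have hw := hP.mul_measure_lt_cellMax_le μ g (ENNReal.ofReal (t / 2))
    have ht2 : ENNReal.ofReal (2 / t) * ENNReal.ofReal (t / 2) = 1 := by
      rw [← ENNReal.ofReal_mul (by positivity), ← ENNReal.ofReal_one]
      congr 1; field_simp
    calc μ {x | ENNReal.ofReal t < cellMax P μ f x}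
        ≤ μ {x | ENNReal.ofReal (t / 2) < cellMax P μ g x} := measure_mono hsub
      _ = ENNReal.ofReal (2 / t) *
          (ENNReal.ofReal (t / 2) * μ {x | ENNReal.ofReal (t / 2) < cellMax P μ g x}) := by
          rw [← mul_assoc, ht2, one_mul]
      _ ≤ _ := by gcongr
  have hset : MeasurableSet {z : ℝ × S | ENNReal.ofReal z.1 < 2 * f z.2} :=
    measurableSet_lt (by fun_prop) (by fun_prop)
  calc ∫⁻ x, cellMax P μ f x ^ s ∂μ
      = ∫⁻ t in Ioi (0 : ℝ), ENNReal.ofReal (s * t ^ (s - 1)) *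
          μ {x | ENNReal.ofReal t < cellMax P μ f x} :=
        lintegral_rpow_eq_lintegral_Ioi (by linarith) (hP.measurable_cellMax μ f)
    _ ≤ ∫⁻ t in Ioi (0 : ℝ), ∫⁻ x, ENNReal.ofReal (2 * s / (s - 1)) * f x *
          (ENNReal.ofReal ((s - 1) * t ^ (s - 1 - 1)) *
          (if ENNReal.ofReal t < 2 * f x then 1 else 0)) ∂μ := by
        refine setLIntegral_mono' measurableSet_Ioi fun t ht => ?_
        have ht : 0 < t := ht
        refine (mul_le_mul_right (hweak t ht) _).trans (le_of_eq ?_)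
        have hset' : MeasurableSet {x | ENNReal.ofReal t < 2 * f x} :=
          measurableSet_lt measurable_const (by fun_prop)
        have hm : Measurable fun x => f x * (if ENNReal.ofReal t < 2 * f x then 1 else 0) :=
          hf.mul (Measurable.ite hset' measurable_const measurable_const)
        rw [← mul_assoc, ← lintegral_const_mul _ hm]
        refine lintegral_congr fun x => ?_
        rw [← ENNReal.ofReal_mul (by positivity)]
        -- Writes the power t^{s-2} as the density of the layer-cake formula with exponent s - 1.
        -- After exchanging the integrals the inner one equals (2f)^{s-1}, whence the constant
        -- 2s/(s-1) · 2^{s-1}.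
        have : s * t ^ (s - 1) * (2 / t) = (2 * s / (s - 1)) * ((s - 1) * t ^ (s - 1 - 1)) := by
          have : s - 1 ≠ 0 := by linarith
          rw [Real.rpow_sub_one ht.ne' (s - 1)]
          field_simp
        rw [this, ENNReal.ofReal_mul (div_nonneg (by linarith) (by linarith))]
        ring
    _ = ∫⁻ x, (∫⁻ t in Ioi (0 : ℝ), ENNReal.ofReal (2 * s / (s - 1)) * f x *
          (ENNReal.ofReal ((s - 1) * t ^ (s - 1 - 1)) *
          (if ENNReal.ofReal t < 2 * f x then 1 else 0))) ∂μ := by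
        refine lintegral_lintegral_swap ?_
        refine Measurable.aemeasurable (Measurable.mul (by fun_prop) (Measurable.mul (by fun_prop) ?_))
        exact Measurable.ite hset measurable_const measurable_const
    _ = ∫⁻ x, maximalConst s * f x ^ s ∂μ := by
        refine lintegral_congr fun x => ?_
        have hm : Measurable fun t : ℝ => ENNReal.ofReal ((s - 1) * t ^ (s - 1 - 1)) *
            (if ENNReal.ofReal t < 2 * f x then 1 else 0) :=
          Measurable.mul (by fun_prop) (Measurable.ite
            (measurableSet_lt (by fun_prop) (by fun_prop)) measurable_const measurable_const)
        rw [lintegral_const_mul _ hm,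
          ← ENNReal.rpow_eq_lintegral_Ioi (by linarith), ENNReal.mul_rpow_of_nonneg _ _ (by linarith),
          maximalConst, ENNReal.ofReal_mul (div_nonneg (by linarith) (by linarith)),
          ← ENNReal.ofReal_rpow_of_nonneg (by norm_num) (by linarith), ENNReal.ofReal_ofNat]
        have : f x ^ s = f x * f x ^ (s - 1) := by
          conv_lhs => rw [show s = 1 + (s - 1) by ring]
          rw [ENNReal.rpow_add_of_nonneg _ _ (by norm_num) (by linarith), ENNReal.rpow_one]
        rw [this]
        ring
    _ = _ := lintegral_const_mul _ (by fun_prop)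

end NestedPartitions

/-! ### Muckenhoupt weights with respect to families of nested partitions -/

section CellWeights

variable {S ι J : Type*} [MeasurableSpace S] [MeasurableSpace ι]

/-- The maximal function of a family of sequences of partitions. -/
noncomputable def dyMax (P : J → ℕ → S → ι) (μ : Measure S) (f : S → ℝ≥0∞) (x : S) : ℝ≥0∞ :=
  ⨆ j, cellMax (P j) μ f x

/-- The `A_r` condition on the cells of a family of partitions. -/
def CellAp (P : J → ℕ → S → ι) (μ : Measure S) (r : ℝ) (K : ℝ≥0∞) (w : S → ℝ≥0∞) : Prop :=
  ∀ j k x, (∫⁻ y in labelCell (P j) k x, w y ∂μ) *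
    (∫⁻ y in labelCell (P j) k x, w y ^ (-1 / (r - 1)) ∂μ) ^ (r - 1) ≤
      K * μ (labelCell (P j) k x) ^ r

/-- A family of nested partitions into cells of positive finite measure. -/
structure IsDyadicFamily (P : J → ℕ → S → ι) (μ : Measure S) : Prop where
  isNestedPartition : ∀ j, IsNestedPartition (P j)
  measure_pos : ∀ j k x, 0 < μ (labelCell (P j) k x)
  measure_lt_top : ∀ j k x, μ (labelCell (P j) k x) < ⊤

theorem cellAvg_le_dyMax (P : J → ℕ → S → ι) (μ : Measure S) (f : S → ℝ≥0∞) (j : J) (k : ℕ)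
    (x : S) : cellAvg (P j) μ f k x ≤ dyMax P μ f x :=
  (le_iSup (fun k => cellAvg (P j) μ f k x) k).trans (le_iSup (fun j => cellMax (P j) μ f x) j)

theorem dyMax_mono (P : J → ℕ → S → ι) (μ : Measure S) {f g : S → ℝ≥0∞} (h : f ≤ g) (x : S) :
    dyMax P μ f x ≤ dyMax P μ g x :=
  iSup_mono fun _ => iSup_mono fun _ => ENNReal.div_le_div_right (lintegral_mono h) _

variable [Countable ι] [MeasurableSingletonClass ι]

theorem IsDyadicFamily.measurable_dyMax [Countable J] {P : J → ℕ → S → ι} {μ : Measure S}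
    (hP : IsDyadicFamily P μ) (ν : Measure S) (f : S → ℝ≥0∞) : Measurable (dyMax P ν f) :=
  Measurable.iSup fun j => (hP.isNestedPartition j).measurable_cellMax ν f

theorem ENNReal.iSup_rpow_le_sum {J : Type*} [Fintype J] (a : J → ℝ≥0∞) {s : ℝ} (hs : 0 < s) :
    (⨆ j, a j) ^ s ≤ ∑ j, a j ^ s := by
  have := (ENNReal.orderIsoRpow s hs).map_iSup a
  simp only [ENNReal.orderIsoRpow_apply] at this
  rw [this]
  exact iSup_le fun j => Finset.single_le_sum (f := fun j => a j ^ s) (fun _ _ => zero_le)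
    (Finset.mem_univ j)

/-- The unweighted maximal inequality for a family of partitions. -/
theorem lintegral_dyMax_rpow_le [Fintype J] {P : J → ℕ → S → ι}
    (hP : ∀ j, IsNestedPartition (P j)) (μ : Measure S) [SFinite μ] {f : S → ℝ≥0∞}
    (hf : Measurable f) {s : ℝ} (hs : 1 < s) :
    ∫⁻ x, dyMax P μ f x ^ s ∂μ ≤ Fintype.card J * maximalConst s * ∫⁻ x, f x ^ s ∂μ := by
  calc ∫⁻ x, dyMax P μ f x ^ s ∂μ ≤ ∫⁻ x, ∑ j, cellMax (P j) μ f x ^ s ∂μ :=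
        lintegral_mono fun x => ENNReal.iSup_rpow_le_sum _ (by linarith)
    _ = ∑ j, ∫⁻ x, cellMax (P j) μ f x ^ s ∂μ :=
        lintegral_finsetSum _ fun j _ => ((hP j).measurable_cellMax μ f).pow_const s
    _ ≤ ∑ j : J, maximalConst s * ∫⁻ x, f x ^ s ∂μ :=
        Finset.sum_le_sum fun j _ => (hP j).lintegral_cellMax_rpow_le μ hf hs
    _ = _ := by simp [mul_assoc]

theorem setLIntegral_pos_of_ae_pos {μ : Measure S} {w : S → ℝ≥0∞} (hw : Measurable w)
    (hpos : ∀ᵐ x ∂μ, 0 < w x) {A : Set S} (hA : 0 < μ A) : ∫⁻ x in A, w x ∂μ ≠ 0 := by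
  intro h
  rw [lintegral_eq_zero_iff hw] at h
  have h2 : ∀ᵐ x ∂μ.restrict A, False := by
    filter_upwards [h, ae_restrict_of_ae hpos] with x h1 h2
    exact h2.ne' h1
  rw [Filter.eventually_false_iff_eq_bot, ae_eq_bot, Measure.restrict_eq_zero] at h2
  exact hA.ne' h2

theorem ENNReal.rpow_pos_and_lt_top {x : ℝ≥0∞} (hx : 0 < x ∧ x < ⊤) (s : ℝ) :
    0 < x ^ s ∧ x ^ s < ⊤ :=
  ⟨ENNReal.rpow_pos hx.1 hx.2.ne, (ENNReal.rpow_ne_top_of_ne_zero hx.1.ne' hx.2.ne).lt_top⟩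

/-- Both factors of the `A_r` product are positive and the product is finite, so each factor is
finite: the weight and its dual are integrable on cells. -/
theorem CellAp.lintegral_ne_top {P : J → ℕ → S → ι} {μ : Measure S} (hP : IsDyadicFamily P μ)
    {r : ℝ} (hr : 1 < r) {K : ℝ≥0∞} (hK : K ≠ ⊤) {w : S → ℝ≥0∞} (hwm : Measurable w)
    (hw : ∀ᵐ x ∂μ, 0 < w x ∧ w x < ⊤) (hA : CellAp P μ r K w) (j : J) (k : ℕ) (x : S) :
    ∫⁻ y in labelCell (P j) k x, w y ∂μ ≠ ⊤ ∧
      ∫⁻ y in labelCell (P j) k x, w y ^ (-1 / (r - 1)) ∂μ ≠ ⊤ := by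
  have h := hA j k x
  have hW : ∫⁻ y in labelCell (P j) k x, w y ∂μ ≠ 0 :=
    setLIntegral_pos_of_ae_pos hwm (hw.mono fun _ h => h.1) (hP.measure_pos j k x)
  have hV : ∫⁻ y in labelCell (P j) k x, w y ^ (-1 / (r - 1)) ∂μ ≠ 0 :=
    setLIntegral_pos_of_ae_pos (hwm.pow_const _)
      (hw.mono fun _ h => (ENNReal.rpow_pos_and_lt_top h _).1) (hP.measure_pos j k x)
  have hfin : K * μ (labelCell (P j) k x) ^ r ≠ ⊤ :=
    ENNReal.mul_ne_top hK (ENNReal.rpow_ne_top_of_nonneg (by linarith) (hP.measure_lt_top j k x).ne)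
  have hne := ne_top_of_le_ne_top hfin h
  have hr1 : 0 < r - 1 := by linarith
  constructor
  · intro ht
    rw [ht, ENNReal.top_mul] at hne
    · exact hne rfl
    · rw [Ne, ENNReal.rpow_eq_zero_iff_of_pos hr1]; exact hV
  · intro ht
    rw [ht, ENNReal.top_rpow_of_pos hr1, ENNReal.mul_top hW] at hne
    exact hne rfl

/-- The weight dual to an `A_r` weight. -/
theorem CellAp.dual {P : J → ℕ → S → ι} {μ : Measure S} {r : ℝ} (hr : 1 < r) {K : ℝ≥0∞}
    {w : S → ℝ≥0∞} (hA : CellAp P μ r K w) :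
    CellAp P μ (r / (r - 1)) (K ^ (1 / (r - 1))) fun x => w x ^ (-1 / (r - 1)) := by
  intro j k x
  have hr1 : 0 < r - 1 := by linarith
  have e1 : r / (r - 1) - 1 = 1 / (r - 1) := by field_simp; ring
  have e2 : -1 / (r - 1) * (-1 / (1 / (r - 1))) = 1 := by field_simp
  simp only [← ENNReal.rpow_mul, e1, e2, ENNReal.rpow_one]
  have := ENNReal.rpow_le_rpow (hA j k x) (z := 1 / (r - 1)) (by positivity)
  rw [ENNReal.mul_rpow_of_nonneg _ _ (by positivity), ENNReal.mul_rpow_of_nonneg _ _ (by positivity),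
    ← ENNReal.rpow_mul, ← ENNReal.rpow_mul, mul_one_div_cancel hr1.ne', ENNReal.rpow_one,
    mul_one_div] at this
  rwa [mul_comm]

/-- The constant in the weighted maximal inequality. -/
noncomputable def muckenhouptConst (r : ℝ) (K : ℝ≥0∞) : ℝ≥0∞ :=
  K ^ (r / (r - 1)) * (maximalConst (r / (r - 1)) * maximalConst r)

theorem muckenhouptConst_ne_top {r : ℝ} (hr : 1 < r) {K : ℝ≥0∞} (hK : K ≠ ⊤) :
    muckenhouptConst r K ≠ ⊤ :=
  ENNReal.mul_ne_top (ENNReal.rpow_ne_top_of_nonneg (div_nonneg (by linarith) (by linarith)) hK)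
    (ENNReal.mul_ne_top (maximalConst_ne_top _) (maximalConst_ne_top _))

/-- A pointwise domination by two maximal functions adapted to the measures σ dμ and w dμ, where σ =
w^{-1/(r-1)} is the dual weight. Each of them is bounded with a norm that does not depend on its
measure, so the weight enters the final inequality only through `K`. -/
theorem cellMax_rpow_le_of_cellAp {P : J → ℕ → S → ι} {μ : Measure S}
    (hP : IsDyadicFamily P μ) {r : ℝ} (hr : 1 < r) {K : ℝ≥0∞} (hK : K ≠ ⊤)
    {w : S → ℝ≥0∞} (hwm : Measurable w) (hw : ∀ᵐ x ∂μ, 0 < w x ∧ w x < ⊤) (hA : CellAp P μ r K w)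
    {f : S → ℝ≥0∞} (hf : Measurable f) (j : J) (x : S) :
    cellMax (P j) μ f x ^ (r - 1) ≤ K * cellMax (P j) (μ.withDensity w)
      (fun y => cellMax (P j) (μ.withDensity fun z => w z ^ (-1 / (r - 1)))
        (fun z => f z * (w z ^ (-1 / (r - 1)))⁻¹) y ^ (r - 1) * (w y)⁻¹) x := by
  have hr1 : 0 < r - 1 := by linarith
  set σ : S → ℝ≥0∞ := fun z => w z ^ (-1 / (r - 1)) with hσ
  have hσm : Measurable σ := hwm.pow_const _
  have hσpos : ∀ᵐ x ∂μ, 0 < σ x ∧ σ x < ⊤ := hw.mono fun _ h => ENNReal.rpow_pos_and_lt_top h _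
  have hfσ : Measurable fun z => f z * (σ z)⁻¹ := hf.mul hσm.inv
  set g := cellMax (P j) (μ.withDensity σ) (fun z => f z * (σ z)⁻¹) with hg
  have hgm : Measurable g := (hP.isNestedPartition j).measurable_cellMax _ _
  set h : S → ℝ≥0∞ := fun y => g y ^ (r - 1) * (w y)⁻¹ with hh
  have hhm : Measurable h := (hgm.pow_const _).mul hwm.inv
  have hsup : cellMax (P j) μ f x ^ (r - 1) = ⨆ k, cellAvg (P j) μ f k x ^ (r - 1) :=
    (ENNReal.orderIsoRpow (r - 1) hr1).map_iSup _
  rw [hsup]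
  refine iSup_le fun k => ?_
  refine le_trans ?_ (mul_le_mul_right
    (le_iSup (fun k => cellAvg (P j) (μ.withDensity w) h k x) k) _)
  set Q := labelCell (P j) k x with hQ
  have hQm : MeasurableSet Q := (hP.isNestedPartition j).measurableSet_labelCell k x
  have hfin := hA.lintegral_ne_top hP hr hK hwm hw j k x
  have hAQ := hA j k x
  have hW0 : ∫⁻ y in Q, w y ∂μ ≠ 0 :=
    setLIntegral_pos_of_ae_pos hwm (hw.mono fun _ h => h.1) (hP.measure_pos j k x)
  have hV0 : ∫⁻ y in Q, σ y ∂μ ≠ 0 :=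
    setLIntegral_pos_of_ae_pos hσm (hσpos.mono fun _ h => h.1) (hP.measure_pos j k x)
  have hm0 := (hP.measure_pos j k x).ne'
  have hmt := (hP.measure_lt_top j k x).ne
  have hI : ∫⁻ y in Q, f y ∂μ = ∫⁻ y in Q, f y * (σ y)⁻¹ ∂(μ.withDensity σ) := by
    rw [setLIntegral_withDensity_eq_setLIntegral_mul _ hσm hfσ hQm]
    refine lintegral_congr_ae ?_
    filter_upwards [ae_restrict_of_ae hσpos] with y hy
    simp only [Pi.mul_apply]
    rw [mul_comm, mul_assoc, ENNReal.inv_mul_cancel hy.1.ne' hy.2.ne, mul_one]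
  have hIg : ∀ y ∈ Q, ∫⁻ y in Q, f y ∂μ ≤ (∫⁻ y in Q, σ y ∂μ) * g y := by
    intro y hy
    have : cellAvg (P j) (μ.withDensity σ) (fun z => f z * (σ z)⁻¹) k y ≤ g y := le_iSup
      (fun k => cellAvg (P j) (μ.withDensity σ) (fun z => f z * (σ z)⁻¹) k y) k
    rw [cellAvg, labelCell_eq_of_mem hy, ← hI, withDensity_apply _ hQm] at this
    rw [mul_comm]
    exact (ENNReal.div_le_iff hV0 hfin.2).1 this
  have hH : ∫⁻ y in Q, g y ^ (r - 1) ∂μ = ∫⁻ y in Q, h y ∂(μ.withDensity w) := by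
    rw [setLIntegral_withDensity_eq_setLIntegral_mul _ hwm hhm hQm]
    refine lintegral_congr_ae ?_
    filter_upwards [ae_restrict_of_ae hw] with y hy
    simp only [Pi.mul_apply, hh]
    rw [mul_comm, mul_assoc, ENNReal.inv_mul_cancel hy.1.ne' hy.2.ne, mul_one]
  -- The σ-average of f/σ over `Q` is at most `g` at every point of `Q`. Raising this to the power r
  -- - 1 and integrating over `Q` brings in the integral of `h` with respect to w; the `A_r`
  -- condition removes the factors w(Q) and σ(Q)^{r-1}.
  have hstep : (∫⁻ y in Q, f y ∂μ) ^ (r - 1) * μ Q ≤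
      (∫⁻ y in Q, σ y ∂μ) ^ (r - 1) * ∫⁻ y in Q, h y ∂(μ.withDensity w) := by
    rw [← hH, ← setLIntegral_const, ← lintegral_const_mul _ (hgm.pow_const _)]
    refine setLIntegral_mono' hQm fun y hy => ?_
    rw [← ENNReal.mul_rpow_of_nonneg _ _ hr1.le]
    exact ENNReal.rpow_le_rpow (hIg y hy) hr1.le
  unfold cellAvg
  rw [← hQ, withDensity_apply _ hQm, ENNReal.div_rpow_of_nonneg _ _ hr1.le,
    ENNReal.div_le_iff ((ENNReal.rpow_pos (hP.measure_pos j k x) hmt).ne')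
      (ENNReal.rpow_ne_top_of_nonneg hr1.le hmt), ← mul_div_assoc, ← ENNReal.mul_div_right_comm,
    ENNReal.le_div_iff_mul_le (Or.inl hW0) (Or.inl hfin.1)]
  rw [← ENNReal.mul_le_mul_iff_left hm0 hmt]
  calc (∫⁻ y in Q, f y ∂μ) ^ (r - 1) * (∫⁻ y in Q, w y ∂μ) * μ Q
      = (∫⁻ y in Q, f y ∂μ) ^ (r - 1) * μ Q * (∫⁻ y in Q, w y ∂μ) := by ring
    _ ≤ (∫⁻ y in Q, σ y ∂μ) ^ (r - 1) * (∫⁻ y in Q, h y ∂(μ.withDensity w)) *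
          (∫⁻ y in Q, w y ∂μ) := by gcongr
    _ = (∫⁻ y in Q, w y ∂μ) * (∫⁻ y in Q, σ y ∂μ) ^ (r - 1) *
          (∫⁻ y in Q, h y ∂(μ.withDensity w)) := by ring
    _ ≤ K * μ Q ^ r * (∫⁻ y in Q, h y ∂(μ.withDensity w)) := by gcongr
    _ = K * (∫⁻ y in Q, h y ∂(μ.withDensity w)) * μ Q ^ (r - 1) * μ Q := by
        have : μ Q ^ r = μ Q ^ (r - 1) * μ Q := by
          conv_lhs => rw [show r = (r - 1) + 1 by ring]
          rw [ENNReal.rpow_add_of_nonneg _ _ hr1.le (by norm_num), ENNReal.rpow_one]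
        rw [this]; ring

/-- The maximal inequality with an `A_r` weight. -/
theorem lintegral_dyMax_rpow_mul_le [Fintype J] {P : J → ℕ → S → ι} {μ : Measure S} [SFinite μ]
    (hP : IsDyadicFamily P μ) {r : ℝ} (hr : 1 < r) {K : ℝ≥0∞} (hK : K ≠ ⊤)
    {w : S → ℝ≥0∞} (hwm : Measurable w) (hw : ∀ᵐ x ∂μ, 0 < w x ∧ w x < ⊤) (hA : CellAp P μ r K w)
    {f : S → ℝ≥0∞} (hf : Measurable f) :
    ∫⁻ x, dyMax P μ f x ^ r * w x ∂μ ≤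
      Fintype.card J * muckenhouptConst r K * ∫⁻ x, f x ^ r * w x ∂μ := by
  have hr1 : 0 < r - 1 := by linarith
  have hr' : 1 < r / (r - 1) := by rw [lt_div_iff₀ hr1]; linarith
  set σ : S → ℝ≥0∞ := fun z => w z ^ (-1 / (r - 1)) with hσ
  have hσm : Measurable σ := hwm.pow_const _
  have hσpos : ∀ᵐ x ∂μ, 0 < σ x ∧ σ x < ⊤ := hw.mono fun _ h => ENNReal.rpow_pos_and_lt_top h _
  have hsingle : ∀ j, ∫⁻ x, cellMax (P j) μ f x ^ r * w x ∂μ ≤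
      muckenhouptConst r K * ∫⁻ x, f x ^ r * w x ∂μ := by
    intro j
    have hfσ : Measurable fun z => f z * (σ z)⁻¹ := hf.mul hσm.inv
    set g := cellMax (P j) (μ.withDensity σ) (fun z => f z * (σ z)⁻¹) with hg
    have hgm : Measurable g := (hP.isNestedPartition j).measurable_cellMax _ _
    set h : S → ℝ≥0∞ := fun y => g y ^ (r - 1) * (w y)⁻¹ with hh
    have hhm : Measurable h := (hgm.pow_const _).mul hwm.inv
    -- The exponent r/(r-1) is conjugate to r; the outer maximal function is used on L^{r/(r-1)}(w),
    -- the inner one on L^r(σ).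
    have hpt : ∀ x, cellMax (P j) μ f x ^ r ≤
        K ^ (r / (r - 1)) * cellMax (P j) (μ.withDensity w) h x ^ (r / (r - 1)) := by
      intro x
      have := ENNReal.rpow_le_rpow (cellMax_rpow_le_of_cellAp hP hr hK hwm hw hA hf j x)
        (z := r / (r - 1)) (by linarith)
      rwa [← ENNReal.rpow_mul, mul_div_cancel₀ _ hr1.ne',
        ENNReal.mul_rpow_of_nonneg _ _ (by linarith)] at this
    have hMhm : Measurable (cellMax (P j) (μ.withDensity w) h) :=
      (hP.isNestedPartition j).measurable_cellMax _ _
    calc ∫⁻ x, cellMax (P j) μ f x ^ r * w x ∂μ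
        ≤ ∫⁻ x, K ^ (r / (r - 1)) *
            (w x * cellMax (P j) (μ.withDensity w) h x ^ (r / (r - 1))) ∂μ := by
          refine lintegral_mono fun x => (mul_le_mul_left (hpt x) _).trans (le_of_eq ?_)
          ring
      _ = K ^ (r / (r - 1)) *
            ∫⁻ x, cellMax (P j) (μ.withDensity w) h x ^ (r / (r - 1)) ∂(μ.withDensity w) := by
          have hm : Measurable fun x =>
              w x * cellMax (P j) (μ.withDensity w) h x ^ (r / (r - 1)) :=
            hwm.mul (hMhm.pow_const _)
          rw [lintegral_const_mul _ hm,
            lintegral_withDensity_eq_lintegral_mul _ hwm (hMhm.pow_const _)]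
          rfl
      _ ≤ K ^ (r / (r - 1)) * (maximalConst (r / (r - 1)) *
            ∫⁻ x, h x ^ (r / (r - 1)) ∂(μ.withDensity w)) := by
          gcongr
          exact (hP.isNestedPartition j).lintegral_cellMax_rpow_le _ hhm hr'
      -- The weights match because w · w^{-r/(r-1)} = σ. In the last equality of the chain they
      -- match because σ^{1-r} = w.
      _ = K ^ (r / (r - 1)) * (maximalConst (r / (r - 1)) *
            ∫⁻ x, g x ^ r ∂(μ.withDensity σ)) := by
          rw [lintegral_withDensity_eq_lintegral_mul _ hwm (hhm.pow_const _),
            lintegral_withDensity_eq_lintegral_mul _ hσm (hgm.pow_const _)]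
          congr 2
          refine lintegral_congr_ae ?_
          filter_upwards [hw] with x hx
          simp only [Pi.mul_apply, hh]
          rw [ENNReal.mul_rpow_of_nonneg _ _ (by linarith), ← ENNReal.rpow_mul,
            mul_div_cancel₀ _ hr1.ne', ← ENNReal.rpow_neg_one, ← ENNReal.rpow_mul, mul_comm (w x),
            mul_assoc, mul_comm (σ x)]
          congr 1
          nth_rewrite 2 [← ENNReal.rpow_one (w x)]
          rw [← ENNReal.rpow_add _ _ hx.1.ne' hx.2.ne]
          simp only [hσ]
          congr 1
          field_simp
          ring
      _ ≤ K ^ (r / (r - 1)) * (maximalConst (r / (r - 1)) * (maximalConst r *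
            ∫⁻ x, (f x * (σ x)⁻¹) ^ r ∂(μ.withDensity σ))) := by
          gcongr
          exact (hP.isNestedPartition j).lintegral_cellMax_rpow_le _ (hf.mul hσm.inv) hr
      _ = muckenhouptConst r K * ∫⁻ x, f x ^ r * w x ∂μ := by
          rw [lintegral_withDensity_eq_lintegral_mul _ hσm (hfσ.pow_const _),
            muckenhouptConst, mul_assoc, mul_assoc]
          congr 3
          refine lintegral_congr_ae ?_
          filter_upwards [hw] with x hx
          have hx' := ENNReal.rpow_pos_and_lt_top hx (-1 / (r - 1))
          simp only [Pi.mul_apply]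
          rw [ENNReal.mul_rpow_of_nonneg _ _ (by linarith), mul_comm, mul_assoc]
          congr 1
          simp only [hσ]
          rw [← ENNReal.rpow_neg_one, ← ENNReal.rpow_mul, ← ENNReal.rpow_mul,
            ← ENNReal.rpow_add _ _ hx.1.ne' hx.2.ne]
          conv_rhs => rw [← ENNReal.rpow_one (w x)]
          congr 1
          field_simp
          ring
  calc ∫⁻ x, dyMax P μ f x ^ r * w x ∂μ
      ≤ ∫⁻ x, ∑ j, cellMax (P j) μ f x ^ r * w x ∂μ := by
        refine lintegral_mono fun x => ?_
        rw [← Finset.sum_mul]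
        gcongr
        exact ENNReal.iSup_rpow_le_sum _ (by linarith)
    _ = ∑ j, ∫⁻ x, cellMax (P j) μ f x ^ r * w x ∂μ := lintegral_finsetSum _ fun j _ =>
        (((hP.isNestedPartition j).measurable_cellMax μ f).pow_const r).mul hwm
    _ ≤ ∑ j : J, muckenhouptConst r K * ∫⁻ x, f x ^ r * w x ∂μ :=
        Finset.sum_le_sum fun j _ => hsingle j
    _ = _ := by simp [mul_assoc]

end CellWeights

/-! ### The sharp maximal function inequality -/

section SharpFunction

variable {S ι E : Type*} [MeasurableSpace S] [MeasurableSpace ι] [Countable ι]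
  [MeasurableSingletonClass ι] [NormedAddCommGroup E]

/-- The good-`λ` inequality between the maximal function and the sharp function. -/
theorem IsNestedPartition.good_lambda {P : ℕ → S → ι} (hP : IsNestedPartition P) {μ ν : Measure S}
    {D δ η γ t : ℝ} (hD0 : 0 ≤ D) (hη : η ≤ 1) (hγ : 0 < γ) (hγη : (2 * D + 2) * γ = η)
    (ht : 0 < t) (hμ : ∀ k x, μ (labelCell P k x) < ⊤)
    (hD : ∀ k x, μ (labelCell P k x) ≤ ENNReal.ofReal D * μ (labelCell P (k + 1) x))
    (hν : ∀ k x A, MeasurableSet A → A ⊆ labelCell P k x → 2 * μ A ≤ μ (labelCell P k x) →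
      ν A ≤ ENNReal.ofReal δ * ν (labelCell P k x))
    {F : S → E} (hF : Measurable fun x => ‖F x‖ₑ) {G : S → ℝ≥0∞} (hG : Measurable G)
    (h0 : ∀ x, cellAvg P μ (fun y => ‖F y‖ₑ) 0 x ≤ G x)
    (hsharp : ∀ k x, ∃ c : E, cellAvg P μ (fun y => ‖F y - c‖ₑ) k x ≤ G x) :
    ν {x | ENNReal.ofReal ((1 + η) * t) < cellMax P μ (fun y => ‖F y‖ₑ) x ∧
        G x ≤ ENNReal.ofReal (γ * t)} ≤
      ENNReal.ofReal δ * ν {x | ENNReal.ofReal t < cellMax P μ (fun y => ‖F y‖ₑ) x} := by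
  have hη0 : 0 < η := by rw [← hγη]; positivity
  have hγη' : γ < η := by nlinarith
  have hγ1 : γ < 1 := by linarith
  set M := cellMax P μ (fun y => ‖F y‖ₑ) with hM
  have hMm : Measurable M := hP.measurable_cellMax μ _
  set B : Set S := {x | ENNReal.ofReal ((1 + η) * t) < M x ∧ G x ≤ ENNReal.ofReal (γ * t)} with hB
  have hBm : MeasurableSet B :=
    (measurableSet_lt measurable_const hMm).inter (measurableSet_le hG measurable_const)
  have hBsub : B ⊆ {x | ENNReal.ofReal t < M x} := fun x hx =>
    lt_of_le_of_lt (ENNReal.ofReal_le_ofReal (by nlinarith)) hx.1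
  -- It suffices to compare ν restricted to the bad set `B` with δν on each cell `Q` where the
  -- average of ‖F‖ exceeds `t` for the first time.
  have hmain := hP.measure_lt_cellMax_le (μ := μ) (f := fun y => ‖F y‖ₑ) (c := ENNReal.ofReal t)
    (ν₁ := ν.restrict B) (ν₂ := ENNReal.ofReal δ • ν) ?_
  · rw [← hM, Measure.restrict_apply (measurableSet_lt measurable_const hMm),
      inter_eq_self_of_subset_right hBsub] at hmain
    exact hmain
  intro k x hx hfirst
  have hQm := hP.measurableSet_labelCell k x
  rw [Measure.restrict_apply hQm, Measure.smul_apply, smul_eq_mul]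
  rcases (labelCell P k x ∩ B).eq_empty_or_nonempty with hemp | ⟨z, hzQ, hzB⟩
  · simp [hemp]
  have hcellz : ∀ j ≤ k, labelCell P j z = labelCell P j x := fun j hj =>
    labelCell_eq_of_mem (hP.labelCell_subset hj x hzQ)
  rcases k with _ | k
  -- A stopping cell of level zero has no parent. There the average is bounded by `G`, hence by γt <
  -- t at a point of `B`, so such a cell does not meet `B`.
  · exfalso
    have h1 := h0 z
    rw [cellAvg, hcellz 0 le_rfl] at h1
    refine absurd (hx.trans_le (h1.trans hzB.2)) (not_lt.2 ?_)
    exact ENNReal.ofReal_le_ofReal (by nlinarith)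
  -- The approximating constant is taken on the parent of the stopping cell: this is the last level
  -- at which the average of ‖F‖ is still at most `t`, which bounds ‖c‖ by (1 + γ)t.
  obtain ⟨c, hc⟩ := hsharp k z
  replace hc := hc.trans hzB.2
  rw [cellAvg, hcellz k (Nat.le_succ k)] at hc
  have hμQ : μ (labelCell P (k + 1) x) ≠ 0 := by
    intro h
    rw [cellAvg, Measure.restrict_eq_zero.2 h, lintegral_zero_measure, ENNReal.zero_div] at hx
    exact not_lt_zero hx
  have hsubQ : labelCell P (k + 1) x ⊆ labelCell P k x := hP.labelCell_subset (Nat.le_succ k) x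
  have hμQ' : μ (labelCell P k x) ≠ 0 := fun h => hμQ (measure_mono_null hsubQ h)
  have hQ'm := hP.measurableSet_labelCell k x
  rw [ENNReal.div_le_iff hμQ' (hμ k x).ne] at hc
  have hcnorm : ‖c‖ₑ ≤ ENNReal.ofReal ((1 + γ) * t) := by
    have h1 := hfirst k (Nat.lt_succ_self k)
    rw [cellAvg, ENNReal.div_le_iff hμQ' (hμ k x).ne] at h1
    rw [← ENNReal.mul_le_mul_iff_left hμQ' (hμ k x).ne, ← setLIntegral_const]
    calc ∫⁻ y in labelCell P k x, ‖c‖ₑ ∂μ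
        ≤ ∫⁻ y in labelCell P k x, (‖F y‖ₑ + ‖F y - c‖ₑ) ∂μ := by
          refine lintegral_mono fun y => ?_
          have : c = F y - (F y - c) := by abel
          calc ‖c‖ₑ = ‖F y - (F y - c)‖ₑ := by rw [← this]
            _ ≤ _ := enorm_sub_le
      _ = (∫⁻ y in labelCell P k x, ‖F y‖ₑ ∂μ) + ∫⁻ y in labelCell P k x, ‖F y - c‖ₑ ∂μ :=
          lintegral_add_left hF _
      _ ≤ ENNReal.ofReal t * μ (labelCell P k x) + ENNReal.ofReal (γ * t) * μ (labelCell P k x) :=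
          add_le_add h1 hc
      _ = _ := by
          rw [← add_mul, ← ENNReal.ofReal_add ht.le (by positivity)]
          congr 2; ring
  set g : S → ℝ≥0∞ := (labelCell P k x).indicator fun y => ‖F y - c‖ₑ with hg
  -- At points of Q ∩ B all averages up to level k are at most `t`, so an average above (1 + η)t
  -- occurs on a cell inside `Q`. Removing `c` leaves more than (1 + η)t - (1 + γ)t for F - c,
  -- truncated to the parent.
  have hsub : labelCell P (k + 1) x ∩ B ⊆ {y | ENNReal.ofReal ((η - γ) * t) < cellMax P μ g y} := by
    rintro y ⟨hyQ, hyB⟩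
    have hcelly : ∀ j ≤ k + 1, labelCell P j y = labelCell P j x := fun j hj =>
      labelCell_eq_of_mem (hP.labelCell_subset hj x hyQ)
    obtain ⟨l, hl⟩ := lt_iSup_iff.1 hyB.1
    have hkl : k + 1 ≤ l := by
      by_contra hlt
      have h1 := hfirst l (not_le.1 hlt)
      rw [cellAvg, hcelly l (not_le.1 hlt).le] at hl
      refine absurd (hl.trans_le h1) (not_lt.2 (ENNReal.ofReal_le_ofReal (by nlinarith)))
    have hsub' : labelCell P l y ⊆ labelCell P k x := by
      refine (hP.labelCell_subset hkl y).trans ?_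
      rw [hcelly (k + 1) le_rfl]
      exact hsubQ
    refine lt_of_lt_of_le ?_ (le_iSup (fun k => cellAvg P μ g k y) l)
    have hle : cellAvg P μ (fun y => ‖F y‖ₑ) l y ≤
        cellAvg P μ g l y + ENNReal.ofReal ((1 + γ) * t) := by
      have : ∫⁻ z in labelCell P l y, ‖F z‖ₑ ∂μ ≤ (∫⁻ z in labelCell P l y, g z ∂μ) +
          ENNReal.ofReal ((1 + γ) * t) * μ (labelCell P l y) := by
        rw [← setLIntegral_const, ← lintegral_add_right _ measurable_const]
        refine setLIntegral_mono' (hP.measurableSet_labelCell l y) fun z hz => ?_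
        rw [hg, indicator_of_mem (hsub' hz)]
        calc ‖F z‖ₑ = ‖(F z - c) + c‖ₑ := by rw [sub_add_cancel]
          _ ≤ ‖F z - c‖ₑ + ‖c‖ₑ := enorm_add_le _ _
          _ ≤ _ := by gcongr
      unfold cellAvg
      refine (ENNReal.div_le_div_right this _).trans ?_
      rw [ENNReal.add_div]
      gcongr
      exact ENNReal.div_le_of_le_mul le_rfl
    have h3 := hl.trans_le hle
    rw [show (1 + η) * t = (η - γ) * t + (1 + γ) * t by ring,
      ENNReal.ofReal_add (mul_nonneg (by linarith) ht.le) (by positivity)] at h3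
    exact lt_of_add_lt_add_right h3
  refine hν (k + 1) x _ (hQm.inter hBm) inter_subset_left ?_
  have hw := hP.mul_measure_lt_cellMax_le μ g (ENNReal.ofReal ((η - γ) * t))
  have hpos : 0 < (η - γ) * t := mul_pos (by linarith) ht
  have h4 : ENNReal.ofReal ((η - γ) * t) * μ (labelCell P (k + 1) x ∩ B) ≤
      ENNReal.ofReal (γ * t * D) * μ (labelCell P (k + 1) x) :=
    calc _ ≤ ENNReal.ofReal ((η - γ) * t) * μ {y | ENNReal.ofReal ((η - γ) * t) <
            cellMax P μ g y} := by gcongr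
      _ ≤ ∫⁻ y in labelCell P k x, ‖F y - c‖ₑ ∂μ := by
          rw [← lintegral_indicator hQ'm]; exact hw
      _ ≤ ENNReal.ofReal (γ * t) * (ENNReal.ofReal D * μ (labelCell P (k + 1) x)) :=
          hc.trans (by gcongr; exact hD k x)
      _ = _ := by rw [← mul_assoc, ← ENNReal.ofReal_mul (by positivity)]
  have h5 : ENNReal.ofReal ((η - γ) * t) * (2 * μ (labelCell P (k + 1) x ∩ B)) ≤
      ENNReal.ofReal ((η - γ) * t) * μ (labelCell P (k + 1) x) := by
    calc _ = 2 * (ENNReal.ofReal ((η - γ) * t) * μ (labelCell P (k + 1) x ∩ B)) := by ring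
      _ ≤ 2 * (ENNReal.ofReal (γ * t * D) * μ (labelCell P (k + 1) x)) := by gcongr
      _ = ENNReal.ofReal (2 * (γ * t * D)) * μ (labelCell P (k + 1) x) := by
          rw [ENNReal.ofReal_mul zero_le_two, ENNReal.ofReal_ofNat]; ring
      _ ≤ _ := by
          refine mul_le_mul_left (ENNReal.ofReal_le_ofReal ?_) _
          -- The relation between γ and η is chosen for this line: the weak type inequality and the
          -- doubling constant `D` give μ(Q ∩ B) ≤ μ(Q)/2, and the hypothesis on ν applies.
          have : (η - γ) * t - 2 * (γ * t * D) = γ * t := by rw [← hγη]; ring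
          nlinarith [mul_pos hγ ht]
  exact (ENNReal.mul_le_mul_iff_right (ENNReal.ofReal_pos.2 hpos).ne' ENNReal.ofReal_ne_top).1 h5

/-- The Fefferman–Stein inequality for the sharp maximal function. -/
theorem exists_lintegral_cellMax_rpow_le_of_sharp {D δ s : ℝ} (hD0 : 0 ≤ D) (hδ0 : 0 ≤ δ)
    (hδ : δ < 1) (hs : 0 < s) :
    ∃ C : ℝ≥0, ∀ P : ℕ → S → ι, IsNestedPartition P → ∀ μ ν : Measure S, IsFiniteMeasure ν →
      (∀ k x, μ (labelCell P k x) < ⊤) →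
      (∀ k x, μ (labelCell P k x) ≤ ENNReal.ofReal D * μ (labelCell P (k + 1) x)) →
      (∀ k x A, MeasurableSet A → A ⊆ labelCell P k x → 2 * μ A ≤ μ (labelCell P k x) →
        ν A ≤ ENNReal.ofReal δ * ν (labelCell P k x)) →
      ∀ (F : S → E) (b : ℝ≥0), (Measurable fun x => ‖F x‖ₑ) → (∀ x, ‖F x‖ₑ ≤ b) →
      ∀ G : S → ℝ≥0∞, Measurable G →
      (∀ x, cellAvg P μ (fun y => ‖F y‖ₑ) 0 x ≤ G x) →
      (∀ k x, ∃ c : E, cellAvg P μ (fun y => ‖F y - c‖ₑ) k x ≤ G x) →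
      ∫⁻ x, cellMax P μ (fun y => ‖F y‖ₑ) x ^ s ∂ν ≤ C * ∫⁻ x, G x ^ s ∂ν := by
  -- Passing from level (1 + η)t to level t costs (1 + η)^s. As δ < 1, a small η keeps the product
  -- below 1, so that the term can be absorbed.
  obtain ⟨η, hη0, hη1, hκ⟩ : ∃ η : ℝ, 0 < η ∧ η ≤ 1 ∧ (1 + η) ^ s * δ < 1 := by
    have hcont : Filter.Tendsto (fun η : ℝ => (1 + η) ^ s * δ) (nhdsWithin 0 (Ioi 0))
        (nhds ((1 + 0) ^ s * δ)) := by
      refine Filter.Tendsto.mono_left ?_ nhdsWithin_le_nhds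
      refine ContinuousAt.tendsto (f := fun η : ℝ => (1 + η) ^ s * δ) ?_
      exact ContinuousAt.mul (ContinuousAt.rpow_const (by fun_prop) (Or.inl (by norm_num)))
        continuousAt_const
    have h1 := hcont.eventually (Iio_mem_nhds (show (1 + 0 : ℝ) ^ s * δ < 1 by simpa using hδ))
    have h2 : ∀ᶠ η : ℝ in nhdsWithin 0 (Ioi 0), η ∈ Ioc (0 : ℝ) 1 :=
      Ioc_mem_nhdsGT (by norm_num)
    obtain ⟨η, h, h'⟩ := (h1.and h2).exists
    exact ⟨η, h'.1, h'.2, h⟩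
  obtain ⟨γ, hγ, hγη⟩ : ∃ γ : ℝ, 0 < γ ∧ (2 * D + 2) * γ = η :=
    ⟨η / (2 * D + 2), by positivity, by field_simp⟩
  set κ := (1 + η) ^ s * δ with hκdef
  have hκ0 : 0 ≤ κ := by positivity
  refine ⟨Real.toNNReal ((1 - κ)⁻¹ * ((1 + η) ^ s * γ⁻¹ ^ s)), ?_⟩
  intro P hP μ ν _ hμ hD hν F b hF hFb G hG h0 hsharp
  set M := cellMax P μ (fun y => ‖F y‖ₑ) with hM
  have hMm : Measurable M := hP.measurable_cellMax μ _
  have hMb : ∀ x, M x ≤ b := fun x => iSup_le fun k => by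
    refine ENNReal.div_le_of_le_mul ?_
    rw [← setLIntegral_const]
    exact lintegral_mono fun y => hFb y
  set X := ∫⁻ x, M x ^ s ∂ν with hX
  set Y := ∫⁻ x, G x ^ s ∂ν with hY
  -- Absorption requires a finite left-hand side. This is the only place where the boundedness of
  -- `F` and the finiteness of ν are needed, and the constant does not depend on them.
  have hXfin : X ≠ ⊤ := by
    refine ne_top_of_le_ne_top ?_ (lintegral_mono fun x => ENNReal.rpow_le_rpow (hMb x) hs.le)
    rw [lintegral_const]
    exact ENNReal.mul_ne_top (ENNReal.rpow_ne_top_of_nonneg hs.le ENNReal.coe_ne_top)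
      (measure_ne_top _ _)
  have hlevel : ∀ t : ℝ, 0 < t → ν {x | ENNReal.ofReal t < ENNReal.ofReal (1 + η)⁻¹ * M x} ≤
      ENNReal.ofReal δ * ν {x | ENNReal.ofReal t < M x} +
        ν {x | ENNReal.ofReal t < ENNReal.ofReal γ⁻¹ * G x} := by
    intro t ht
    -- A point where the maximal function exceeds (1 + η)t either has `G` at most γt, and is covered
    -- by the good-λ inequality, or has `G` larger than γt.
    refine le_trans ?_ (add_le_add_left
      (hP.good_lambda hD0 hη1 hγ hγη ht hμ hD hν hF hG h0 hsharp) _)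
    refine le_trans (measure_mono ?_) (measure_union_le _ _)
    have hscale : ∀ (a : ℝ) (y : ℝ≥0∞), 0 < a →
        (ENNReal.ofReal t < ENNReal.ofReal a⁻¹ * y ↔ ENNReal.ofReal (a * t) < y) := by
      intro a y ha
      rw [← ENNReal.mul_lt_mul_iff_right (a := ENNReal.ofReal a) (ENNReal.ofReal_pos.2 ha).ne'
        ENNReal.ofReal_ne_top, ← mul_assoc, ← ENNReal.ofReal_mul ha.le, ← ENNReal.ofReal_mul ha.le,
        mul_inv_cancel₀ ha.ne', ENNReal.ofReal_one, one_mul]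
    intro x hx
    rw [mem_ofPred_eq, hscale _ _ (by linarith)] at hx
    rw [mem_union, mem_ofPred_eq, mem_ofPred_eq, hscale _ _ hγ]
    rcases le_or_gt (G x) (ENNReal.ofReal (γ * t)) with h | h
    · exact Or.inl ⟨hx, h⟩
    · exact Or.inr h
  have hint : ENNReal.ofReal ((1 + η) ^ s)⁻¹ * X ≤
      ENNReal.ofReal δ * X + ENNReal.ofReal (γ⁻¹ ^ s) * Y := by
    have hmul : ∀ (a : ℝ) (g : S → ℝ≥0∞), 0 ≤ a → Measurable g →
        ENNReal.ofReal (a ^ s) * ∫⁻ x, g x ^ s ∂ν = ∫⁻ x, (ENNReal.ofReal a * g x) ^ s ∂ν := by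
      intro a g ha hg
      rw [← lintegral_const_mul _ (hg.pow_const s)]
      refine lintegral_congr fun x => ?_
      rw [ENNReal.mul_rpow_of_nonneg _ _ hs.le, ENNReal.ofReal_rpow_of_nonneg ha hs.le]
    rw [← Real.inv_rpow (by linarith), hX, hmul _ _ (by positivity) hMm, hY,
      hmul _ _ (by positivity) hG, lintegral_rpow_eq_lintegral_Ioi hs (hMm.const_mul _), lintegral_rpow_eq_lintegral_Ioi hs hMm,
      lintegral_rpow_eq_lintegral_Ioi hs (hG.const_mul _),
      ← lintegral_const_mul' _ _ ENNReal.ofReal_ne_top]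
    have hanti : Measurable fun t : ℝ => ν {x | ENNReal.ofReal t < ENNReal.ofReal γ⁻¹ * G x} :=
      Antitone.measurable fun t t' htt' => measure_mono fun x hx =>
        lt_of_le_of_lt (ENNReal.ofReal_le_ofReal htt') hx
    have hanti' : Measurable fun t : ℝ => ENNReal.ofReal (s * t ^ (s - 1)) *
        ν {x | ENNReal.ofReal t < ENNReal.ofReal γ⁻¹ * G x} := Measurable.mul (by fun_prop) hanti
    rw [← lintegral_add_right _ hanti']
    refine setLIntegral_mono' measurableSet_Ioi fun t ht => ?_
    refine (mul_le_mul_right (hlevel t ht) _).trans (le_of_eq ?_)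
    ring
  have hη' : 0 < (1 + η) ^ s := by positivity
  have h1 : X ≤ ENNReal.ofReal κ * X + ENNReal.ofReal ((1 + η) ^ s * γ⁻¹ ^ s) * Y := by
    have := mul_le_mul_right hint (ENNReal.ofReal ((1 + η) ^ s))
    rw [← mul_assoc, ← ENNReal.ofReal_mul hη'.le, mul_inv_cancel₀ hη'.ne', ENNReal.ofReal_one,
      one_mul, mul_add, ← mul_assoc, ← mul_assoc, ← ENNReal.ofReal_mul hη'.le,
      ← ENNReal.ofReal_mul hη'.le] at this
    exact this
  have h2 : ENNReal.ofReal (1 - κ) * X ≤ ENNReal.ofReal ((1 + η) ^ s * γ⁻¹ ^ s) * Y := by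
    rw [ENNReal.ofReal_sub _ hκ0, ENNReal.ofReal_one, ENNReal.sub_mul (fun _ _ => hXfin), one_mul]
    exact tsub_le_iff_left.2 h1
  have h1κ : 0 < 1 - κ := by linarith
  have h3 := mul_le_mul_right h2 (ENNReal.ofReal (1 - κ)⁻¹)
  rw [← mul_assoc, ← mul_assoc, ← ENNReal.ofReal_mul (by positivity),
    ← ENNReal.ofReal_mul (by positivity), inv_mul_cancel₀ h1κ.ne', ENNReal.ofReal_one, one_mul] at h3
  exact h3

end SharpFunction

/-! ### Consequences of the `A_r` condition and extrapolation -/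

section Extrapolation

variable {S ι J : Type*} [MeasurableSpace S] [MeasurableSpace ι]

/-- An `A_r` weight satisfies an `A_∞` condition. -/
theorem setLIntegral_le_of_two_mul_measure_le {μ : Measure S} {w : S → ℝ≥0∞} (hwm : Measurable w)
    (hw : ∀ᵐ x ∂μ, 0 < w x ∧ w x < ⊤) {r : ℝ} (hr : 1 < r) {K : ℝ} (hK : 1 ≤ K) {Q : Set S}
    (hQ : MeasurableSet Q) (hQ0 : μ Q ≠ 0) (hQt : μ Q ≠ ⊤) (hwQ : ∫⁻ x in Q, w x ∂μ ≠ ⊤)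
    (hA : (∫⁻ x in Q, w x ∂μ) * (∫⁻ x in Q, w x ^ (-1 / (r - 1)) ∂μ) ^ (r - 1) ≤
      ENNReal.ofReal K * μ Q ^ r) {A : Set S} (hAm : MeasurableSet A) (hAQ : A ⊆ Q)
    (h2 : 2 * μ A ≤ μ Q) :
    ∫⁻ x in A, w x ∂μ ≤ ENNReal.ofReal (1 - (2 ^ r * K)⁻¹) * ∫⁻ x in Q, w x ∂μ := by
  have hr1 : 0 < r - 1 := by linarith
  have hr0 : 0 < r := by linarith
  have hpq : r.HolderConjugate (r / (r - 1)) := Real.HolderConjugate.conjExponent hr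
  have hdiff : MeasurableSet (Q \ A) := hQ.diff hAm
  have hsplit : ∀ f : S → ℝ≥0∞, ∫⁻ x in Q, f x ∂μ =
      (∫⁻ x in A, f x ∂μ) + ∫⁻ x in Q \ A, f x ∂μ := fun f => by
    rw [← lintegral_inter_add_diff f Q hAm, inter_eq_self_of_subset_right hAQ]
  have hμ : μ Q ≤ 2 * μ (Q \ A) := by
    have h3 : μ Q = μ A + μ (Q \ A) := by simpa using hsplit 1
    have hAt : μ A ≠ ⊤ := ne_top_of_le_ne_top hQt (measure_mono hAQ)
    have h4 : μ A ≤ μ (Q \ A) := by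
      rw [h3, two_mul] at h2
      exact (ENNReal.add_le_add_iff_left hAt).1 h2
    rw [h3, two_mul]
    gcongr
  -- Hölder's inequality for 1 = w^{1/r} w^{-1/r} on the complement of `A` in `Q`, which carries at
  -- least half of μ(Q).
  have hholder : μ (Q \ A) ^ r ≤ (∫⁻ x in Q \ A, w x ∂μ) *
      (∫⁻ x in Q, w x ^ (-1 / (r - 1)) ∂μ) ^ (r - 1) := by
    have h1 := ENNReal.lintegral_mul_le_Lp_mul_Lq (μ.restrict (Q \ A)) hpq
      (hwm.pow_const (1 / r)).aemeasurable (hwm.pow_const (-1 / r)).aemeasurable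
    have e1 : ∫⁻ x in Q \ A, ((fun x => w x ^ (1 / r)) * fun x => w x ^ (-1 / r)) x ∂μ
        = μ (Q \ A) := by
      rw [← setLIntegral_one]
      refine lintegral_congr_ae ?_
      filter_upwards [ae_restrict_of_ae hw] with x hx
      simp only [Pi.mul_apply]
      rw [← ENNReal.rpow_add _ _ hx.1.ne' hx.2.ne, neg_div, add_neg_cancel, ENNReal.rpow_zero]
    have e2 : ∀ x, (w x ^ (1 / r)) ^ r = w x := fun x => by
      rw [← ENNReal.rpow_mul, one_div_mul_cancel hr0.ne', ENNReal.rpow_one]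
    have e3 : ∀ x, (w x ^ (-1 / r)) ^ (r / (r - 1)) = w x ^ (-1 / (r - 1)) := fun x => by
      rw [← ENNReal.rpow_mul]; congr 1; field_simp
    rw [e1] at h1
    simp only [e2, e3] at h1
    have h2 := ENNReal.rpow_le_rpow h1 hr0.le
    rw [ENNReal.mul_rpow_of_nonneg _ _ hr0.le, ← ENNReal.rpow_mul, ← ENNReal.rpow_mul,
      one_div_mul_cancel hr0.ne', ENNReal.rpow_one,
      show 1 / (r / (r - 1)) * r = r - 1 by field_simp] at h2
    refine h2.trans ?_
    gcongr
    exact diff_subset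
  set W := ∫⁻ x in Q, w x ∂μ with hW
  set V := (∫⁻ x in Q, w x ^ (-1 / (r - 1)) ∂μ) ^ (r - 1)
  have hQr0 : μ Q ^ r ≠ 0 := by rw [Ne, ENNReal.rpow_eq_zero_iff_of_pos hr0]; exact hQ0
  have hQrt : μ Q ^ r ≠ ⊤ := ENNReal.rpow_ne_top_of_nonneg hr0.le hQt
  -- The complement of `A` carries at least the fraction (2^r K)⁻¹ of w(Q), so `A` carries at most
  -- the remaining one.
  have h3 : W ≤ ENNReal.ofReal (2 ^ r * K) * ∫⁻ x in Q \ A, w x ∂μ := by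
    rw [← ENNReal.mul_le_mul_iff_left hQr0 hQrt]
    calc W * μ Q ^ r ≤ W * (2 * μ (Q \ A)) ^ r := by gcongr
      _ = 2 ^ r * (W * μ (Q \ A) ^ r) := by
          rw [ENNReal.mul_rpow_of_nonneg _ _ hr0.le]; ring
      _ ≤ 2 ^ r * (W * ((∫⁻ x in Q \ A, w x ∂μ) * V)) := by gcongr
      _ = 2 ^ r * (∫⁻ x in Q \ A, w x ∂μ) * (W * V) := by ring
      _ ≤ 2 ^ r * (∫⁻ x in Q \ A, w x ∂μ) * (ENNReal.ofReal K * μ Q ^ r) := by gcongr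
      _ = _ := by
          rw [ENNReal.ofReal_mul (by positivity), ← ENNReal.ofReal_rpow_of_nonneg zero_le_two hr0.le,
            ENNReal.ofReal_ofNat]
          ring
  have h2K : 1 ≤ 2 ^ r * K := by
    have := Real.one_le_rpow (one_le_two) hr0.le
    nlinarith
  have h4 : ENNReal.ofReal (2 ^ r * K)⁻¹ * W ≤ ∫⁻ x in Q \ A, w x ∂μ := by
    calc _ ≤ ENNReal.ofReal (2 ^ r * K)⁻¹ * (ENNReal.ofReal (2 ^ r * K) *
          ∫⁻ x in Q \ A, w x ∂μ) := by gcongr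
      _ = _ := by
        rw [← mul_assoc, ← ENNReal.ofReal_mul (by positivity), inv_mul_cancel₀ (by positivity),
          ENNReal.ofReal_one, one_mul]
  rw [ENNReal.ofReal_sub _ (by positivity), ENNReal.ofReal_one,
    ENNReal.sub_mul (fun _ _ => hwQ), one_mul]
  refine ENNReal.le_sub_of_add_le_right (ENNReal.mul_ne_top ENNReal.ofReal_ne_top hwQ) ?_
  calc _ ≤ (∫⁻ x in A, w x ∂μ) + ∫⁻ x in Q \ A, w x ∂μ := by gcongr
    _ = W := (hsplit w).symm

/-- The Rubio de Francia iteration `∑ₖ (2A)⁻ᵏ Mᵏ h`. -/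
noncomputable def rubioIter (P : J → ℕ → S → ι) (μ : Measure S) (A : ℝ≥0∞) (h : S → ℝ≥0∞) (x : S) :
    ℝ≥0∞ :=
  ∑' k : ℕ, ((2 * A) ^ k)⁻¹ * (dyMax P μ)^[k] h x

theorem le_rubioIter (P : J → ℕ → S → ι) (μ : Measure S) (A : ℝ≥0∞) (h : S → ℝ≥0∞) (x : S) :
    h x ≤ rubioIter P μ A h x := by
  refine le_trans (le_of_eq ?_) (ENNReal.le_tsum 0)
  simp

variable [Countable ι] [MeasurableSingletonClass ι] [Fintype J]

theorem IsDyadicFamily.measurable_iterate_dyMax {P : J → ℕ → S → ι} {μ : Measure S}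
    (hP : IsDyadicFamily P μ) {h : S → ℝ≥0∞} (hh : Measurable h) (k : ℕ) :
    Measurable ((dyMax P μ)^[k] h) := by
  cases k with
  | zero => exact hh
  | succ k => rw [Function.iterate_succ_apply']; exact hP.measurable_dyMax μ _

theorem IsDyadicFamily.measurable_rubioIter {P : J → ℕ → S → ι} {μ : Measure S}
    (hP : IsDyadicFamily P μ) (A : ℝ≥0∞) {h : S → ℝ≥0∞} (hh : Measurable h) :
    Measurable (rubioIter P μ A h) :=
  Measurable.ennreal_tsum fun k => (hP.measurable_iterate_dyMax hh k).const_mul _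

/-- Averages pass through the series, and the maximal operator moves each term to the next one at
the cost of a factor 2A. Thus the iteration is an `A₁` weight, whatever `h` is. -/
theorem IsDyadicFamily.dyMax_rubioIter_le {P : J → ℕ → S → ι} {μ : Measure S}
    (hP : IsDyadicFamily P μ) {A : ℝ≥0∞} (hA0 : A ≠ 0) (hAt : A ≠ ⊤) {h : S → ℝ≥0∞}
    (hh : Measurable h) (x : S) :
    dyMax P μ (rubioIter P μ A h) x ≤ 2 * A * rubioIter P μ A h x := by
  refine iSup_le fun j => iSup_le fun k => ?_
  have h1 : cellAvg (P j) μ (rubioIter P μ A h) k x =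
      ∑' l : ℕ, ((2 * A) ^ l)⁻¹ * cellAvg (P j) μ ((dyMax P μ)^[l] h) k x := by
    unfold cellAvg rubioIter
    rw [lintegral_tsum fun l => ((hP.measurable_iterate_dyMax hh l).const_mul _).aemeasurable,
      div_eq_mul_inv, ← ENNReal.tsum_mul_right]
    refine tsum_congr fun l => ?_
    rw [lintegral_const_mul _ (hP.measurable_iterate_dyMax hh l), mul_assoc, div_eq_mul_inv]
  have h20 : 2 * A ≠ 0 := mul_ne_zero two_ne_zero hA0
  have h2t : 2 * A ≠ ⊤ := ENNReal.mul_ne_top (by norm_num) hAt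
  rw [h1, rubioIter, ← ENNReal.tsum_mul_left]
  calc ∑' l : ℕ, ((2 * A) ^ l)⁻¹ * cellAvg (P j) μ ((dyMax P μ)^[l] h) k x
      ≤ ∑' l : ℕ, 2 * A * (((2 * A) ^ (l + 1))⁻¹ * (dyMax P μ)^[l + 1] h x) := by
        refine ENNReal.tsum_le_tsum fun l => ?_
        rw [← mul_assoc, pow_succ, ENNReal.mul_inv (Or.inr h2t) (Or.inr h20), mul_comm (2 * A),
          mul_assoc _ _ (2 * A), ENNReal.inv_mul_cancel h20 h2t, mul_one]
        gcongr
        rw [Function.iterate_succ_apply']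
        exact cellAvg_le_dyMax P μ _ j k x
    _ ≤ _ := ENNReal.tsum_comp_le_tsum_of_injective (add_left_injective 1)
        fun l => 2 * A * (((2 * A) ^ l)⁻¹ * (dyMax P μ)^[l] h x)

theorem ENNReal.tsum_two_pow_inv : ∑' k : ℕ, ((2 : ℝ≥0∞) ^ k)⁻¹ = 2 := by
  simp_rw [ENNReal.inv_pow, ENNReal.tsum_geometric, ENNReal.one_sub_inv_two, inv_inv]

/-- Jensen's inequality for the masses 2⁻ᵏ, whose total is 2. It is derived from Hölder's inequality
for the counting measure. -/
theorem ENNReal.tsum_two_pow_inv_mul_rpow_le {r : ℝ} (hr : 1 < r) (a : ℕ → ℝ≥0∞) :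
    (∑' k : ℕ, ((2 : ℝ≥0∞) ^ k)⁻¹ * a k) ^ r ≤
      2 ^ (r - 1) * ∑' k : ℕ, ((2 : ℝ≥0∞) ^ k)⁻¹ * a k ^ r := by
  have hr0 : 0 < r := by linarith
  have hr1 : 0 < r - 1 := by linarith
  have hpq : r.HolderConjugate (r / (r - 1)) := Real.HolderConjugate.conjExponent hr
  have h1 := ENNReal.lintegral_mul_le_Lp_mul_Lq (Measure.count : Measure ℕ) hpq
    (f := fun k => (((2 : ℝ≥0∞) ^ k)⁻¹) ^ (1 / r) * a k)
    (g := fun k => (((2 : ℝ≥0∞) ^ k)⁻¹) ^ (1 / (r / (r - 1))))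
    Measurable.of_discrete.aemeasurable Measurable.of_discrete.aemeasurable
  simp only [lintegral_count, Pi.mul_apply] at h1
  have e1 : ∀ k : ℕ, (((2 : ℝ≥0∞) ^ k)⁻¹) ^ (1 / r) * a k *
      (((2 : ℝ≥0∞) ^ k)⁻¹) ^ (1 / (r / (r - 1))) = ((2 : ℝ≥0∞) ^ k)⁻¹ * a k := fun k => by
    rw [mul_right_comm, ← ENNReal.rpow_add_of_nonneg _ _ (by positivity) (by positivity),
      show 1 / r + 1 / (r / (r - 1)) = 1 by field_simp; ring, ENNReal.rpow_one]
  have e2 : ∀ k : ℕ, ((((2 : ℝ≥0∞) ^ k)⁻¹) ^ (1 / r) * a k) ^ r = ((2 : ℝ≥0∞) ^ k)⁻¹ * a k ^ r :=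
    fun k => by
      rw [ENNReal.mul_rpow_of_nonneg _ _ hr0.le, ← ENNReal.rpow_mul, one_div_mul_cancel hr0.ne',
        ENNReal.rpow_one]
  have e3 : ∀ k : ℕ, ((((2 : ℝ≥0∞) ^ k)⁻¹) ^ (1 / (r / (r - 1)))) ^ (r / (r - 1)) =
      ((2 : ℝ≥0∞) ^ k)⁻¹ := fun k => by
    rw [← ENNReal.rpow_mul, one_div_mul_cancel (by positivity), ENNReal.rpow_one]
  simp only [e1, e2, e3, ENNReal.tsum_two_pow_inv] at h1
  have h2 := ENNReal.rpow_le_rpow h1 hr0.le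
  rw [ENNReal.mul_rpow_of_nonneg _ _ hr0.le, ← ENNReal.rpow_mul, ← ENNReal.rpow_mul,
    one_div_mul_cancel hr0.ne', ENNReal.rpow_one,
    show 1 / (r / (r - 1)) * r = r - 1 by field_simp, mul_comm] at h2
  exact h2

/-- If `A` bounds the norm of the maximal operator, the k-th iterate has norm at most Aᵏ, and the
factors 2⁻ᵏ make the series converge in L^r(w). The constant is 2^{r-1} from Jensen times the sum 2
of the masses. -/
theorem IsDyadicFamily.lintegral_rubioIter_rpow_le {P : J → ℕ → S → ι} {μ : Measure S}
    (hP : IsDyadicFamily P μ) {A : ℝ≥0∞} (hA0 : A ≠ 0) (hAt : A ≠ ⊤) {r : ℝ} (hr : 1 < r)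
    {w : S → ℝ≥0∞} (hw : Measurable w)
    (hM : ∀ f : S → ℝ≥0∞, Measurable f →
      ∫⁻ x, dyMax P μ f x ^ r * w x ∂μ ≤ A ^ r * ∫⁻ x, f x ^ r * w x ∂μ)
    {h : S → ℝ≥0∞} (hh : Measurable h) :
    ∫⁻ x, rubioIter P μ A h x ^ r * w x ∂μ ≤ 2 ^ r * ∫⁻ x, h x ^ r * w x ∂μ := by
  have hr0 : 0 < r := by linarith
  have hmk := hP.measurable_iterate_dyMax hh
  have hiter : ∀ k : ℕ, ((A ^ k)⁻¹) ^ r * ∫⁻ x, (dyMax P μ)^[k] h x ^ r * w x ∂μ ≤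
      ∫⁻ x, h x ^ r * w x ∂μ := by
    intro k
    induction k with
    | zero => simp
    | succ k ih =>
      refine le_trans ?_ ih
      rw [Function.iterate_succ_apply']
      refine (mul_le_mul_right (hM _ (hmk k)) _).trans (le_of_eq ?_)
      rw [pow_succ, ENNReal.mul_inv (Or.inr hAt) (Or.inr hA0), ENNReal.mul_rpow_of_nonneg _ _ hr0.le,
        mul_assoc, ← mul_assoc (A⁻¹ ^ r), ← ENNReal.mul_rpow_of_nonneg _ _ hr0.le,
        ENNReal.inv_mul_cancel hA0 hAt, ENNReal.one_rpow, one_mul]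
  calc ∫⁻ x, rubioIter P μ A h x ^ r * w x ∂μ
      ≤ ∫⁻ x, ∑' k : ℕ, 2 ^ (r - 1) * (((2 : ℝ≥0∞) ^ k)⁻¹ * (((A ^ k)⁻¹) ^ r *
          ((dyMax P μ)^[k] h x ^ r * w x))) ∂μ := by
        refine lintegral_mono fun x => ?_
        have h1 : rubioIter P μ A h x =
            ∑' k : ℕ, ((2 : ℝ≥0∞) ^ k)⁻¹ * ((A ^ k)⁻¹ * (dyMax P μ)^[k] h x) := by
          unfold rubioIter
          refine tsum_congr fun k => ?_
          rw [mul_pow, ENNReal.mul_inv (Or.inl (by simp)) (Or.inl (by simp)), mul_assoc]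
        have h2 := ENNReal.tsum_two_pow_inv_mul_rpow_le hr
          fun k => (A ^ k)⁻¹ * (dyMax P μ)^[k] h x
        rw [← h1] at h2
        refine (mul_le_mul_left h2 (w x)).trans (le_of_eq ?_)
        rw [mul_assoc, ← ENNReal.tsum_mul_right, ← ENNReal.tsum_mul_left]
        refine tsum_congr fun k => ?_
        rw [ENNReal.mul_rpow_of_nonneg _ _ hr0.le]
        ring
    _ = ∑' k : ℕ, 2 ^ (r - 1) * (((2 : ℝ≥0∞) ^ k)⁻¹ * (((A ^ k)⁻¹) ^ r *
          ∫⁻ x, (dyMax P μ)^[k] h x ^ r * w x ∂μ)) := by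
        have hm : ∀ k, Measurable fun x => (dyMax P μ)^[k] h x ^ r * w x := fun k =>
          ((hmk k).pow_const r).mul hw
        rw [lintegral_tsum fun k =>
          ((((hm k).const_mul _).const_mul _).const_mul _).aemeasurable]
        refine tsum_congr fun k => ?_
        rw [lintegral_const_mul _ (((hm k).const_mul _).const_mul _),
          lintegral_const_mul _ ((hm k).const_mul _), lintegral_const_mul _ (hm k)]
    _ ≤ ∑' k : ℕ, 2 ^ (r - 1) * (((2 : ℝ≥0∞) ^ k)⁻¹ * ∫⁻ x, h x ^ r * w x ∂μ) := by
        gcongr with k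
        exact hiter k
    _ = _ := by
        rw [ENNReal.tsum_mul_left, ENNReal.tsum_mul_right, ENNReal.tsum_two_pow_inv, ← mul_assoc]
        congr 1
        conv_rhs => rw [show r = (r - 1) + 1 by ring]
        rw [ENNReal.rpow_add_of_nonneg _ _ (by linarith) (by norm_num), ENNReal.rpow_one]

/-- The products of `A_1` weights which occur in extrapolation are `A_r` weights. -/
theorem IsDyadicFamily.cellAp_of_dyMax_le {P : J → ℕ → S → ι} {μ : Measure S}
    (hP : IsDyadicFamily P μ) {r : ℝ} (hr : 1 < r) {a b : ℝ≥0∞} (ha0 : a ≠ 0) (hat : a ≠ ⊤)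
    (hb0 : b ≠ 0) (hbt : b ≠ ⊤) {U V : S → ℝ≥0∞} (hUm : Measurable U) (hVm : Measurable V)
    (hU : ∀ᵐ x ∂μ, 0 < U x ∧ U x < ⊤) (hV : ∀ᵐ x ∂μ, 0 < V x ∧ V x < ⊤)
    (hMU : ∀ x, dyMax P μ U x ≤ a * U x) (hMV : ∀ x, dyMax P μ V x ≤ b * V x) :
    CellAp P μ r (a ^ (r - 1) * b) fun x => (U x ^ (r - 1))⁻¹ * V x := by
  intro j k x
  have hr1 : 0 < r - 1 := by linarith
  set Q := labelCell (P j) k x with hQ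
  have hQm : MeasurableSet Q := (hP.isNestedPartition j).measurableSet_labelCell k x
  have hm0 := (hP.measure_pos j k x).ne'
  have hmt := (hP.measure_lt_top j k x).ne
  set m := μ Q
  -- On a cell an `A₁` weight is bounded below by its mean divided by its constant. The lower bound
  -- replaces `U` in the integral of U^{1-r} V, and `V` in the integral of the dual weight U
  -- V^{-1/(r-1)}; the remaining integrals are means, and everything but the constants cancels.
  have hgen : ∀ (c : ℝ≥0∞) (f : S → ℝ≥0∞), c ≠ 0 → c ≠ ⊤ → Measurable f →
      (∀ᵐ x ∂μ, 0 < f x ∧ f x < ⊤) → (∀ x, dyMax P μ f x ≤ c * f x) →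
      (∫⁻ y in Q, f y ∂μ) / m / c ≠ 0 ∧ (∫⁻ y in Q, f y ∂μ) / m / c ≠ ⊤ ∧
      (∫⁻ y in Q, f y ∂μ) = (∫⁻ y in Q, f y ∂μ) / m / c * (c * m) ∧
      ∀ y ∈ Q, (∫⁻ y in Q, f y ∂μ) / m / c ≤ f y := by
    intro c f hc0 hct hfm hf hMf
    have hle : ∀ y ∈ Q, (∫⁻ y in Q, f y ∂μ) / m / c ≤ f y := by
      intro y hy
      refine ENNReal.div_le_of_le_mul' ?_
      refine le_trans ?_ (hMf y)
      refine le_trans (le_of_eq ?_) (cellAvg_le_dyMax P μ f j k y)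
      rw [cellAvg, labelCell_eq_of_mem hy]
    have hI0 : ∫⁻ y in Q, f y ∂μ ≠ 0 :=
      setLIntegral_pos_of_ae_pos hfm (hf.mono fun _ h => h.1) (hP.measure_pos j k x)
    refine ⟨?_, ?_, ?_, hle⟩
    · exact (ENNReal.div_pos (ENNReal.div_pos hI0 hmt).ne' hct).ne'
    · obtain ⟨y, hyQ, hy⟩ : ∃ y ∈ Q, f y < ⊤ := by
        by_contra hcon
        push Not at hcon
        refine hm0 (measure_mono_null (t := {y | ¬ (0 < f y ∧ f y < ⊤)}) ?_ hf)
        intro y hy h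
        exact absurd h.2 (not_lt.2 (hcon y hy))
      exact ne_top_of_le_ne_top hy.ne (hle y hyQ)
    · rw [← mul_assoc, ENNReal.div_mul_cancel hc0 hct, ENNReal.div_mul_cancel hm0 hmt]
  obtain ⟨hu0, hut, hIU, hleU⟩ := hgen a U ha0 hat hUm hU hMU
  obtain ⟨hv0, hvt, hIV, hleV⟩ := hgen b V hb0 hbt hVm hV hMV
  set u := (∫⁻ y in Q, U y ∂μ) / m / a
  set v := (∫⁻ y in Q, V y ∂μ) / m / b
  have h1 : ∫⁻ y in Q, (U y ^ (r - 1))⁻¹ * V y ∂μ ≤ (u ^ (r - 1))⁻¹ * (v * (b * m)) := by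
    rw [← hIV, ← lintegral_const_mul _ hVm]
    refine setLIntegral_mono' hQm fun y hy => ?_
    gcongr
    exact hleU y hy
  have h2 : ∫⁻ y in Q, ((U y ^ (r - 1))⁻¹ * V y) ^ (-1 / (r - 1)) ∂μ ≤
      (v ^ (1 / (r - 1)))⁻¹ * (u * (a * m)) := by
    rw [← hIU, ← lintegral_const_mul _ hUm]
    refine setLIntegral_mono_ae' hQm ?_
    filter_upwards [hU, hV] with y hyU hyV hyQ
    have e1 : ((U y ^ (r - 1))⁻¹ * V y) ^ (-1 / (r - 1)) = (V y ^ (1 / (r - 1)))⁻¹ * U y := by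
      have hp := ENNReal.rpow_pos_and_lt_top hyU (r - 1)
      rw [ENNReal.mul_rpow_of_ne_zero (ENNReal.inv_ne_zero.2 hp.2.ne) hyV.1.ne', ← ENNReal.rpow_neg,
        ← ENNReal.rpow_mul, ← ENNReal.rpow_neg, show -(r - 1) * (-1 / (r - 1)) = 1 by field_simp,
        ENNReal.rpow_one, neg_div, mul_comm]
    rw [e1]
    gcongr
    exact hleV y hyQ
  calc _ ≤ (u ^ (r - 1))⁻¹ * (v * (b * m)) *
        ((v ^ (1 / (r - 1)))⁻¹ * (u * (a * m))) ^ (r - 1) := by gcongr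
    _ = (u ^ (r - 1) * (u ^ (r - 1))⁻¹) * (v * v⁻¹) * (a ^ (r - 1) * b * (m ^ (r - 1) * m)) := by
        rw [ENNReal.mul_rpow_of_nonneg _ _ hr1.le, ENNReal.mul_rpow_of_nonneg _ _ hr1.le,
          ENNReal.mul_rpow_of_nonneg _ _ hr1.le, ENNReal.inv_rpow, ← ENNReal.rpow_mul,
          one_div_mul_cancel hr1.ne', ENNReal.rpow_one]
        ring
    _ = _ := by
        have hp := ENNReal.rpow_pos_and_lt_top ⟨pos_iff_ne_zero.2 hu0, hut.lt_top⟩ (r - 1)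
        rw [ENNReal.mul_inv_cancel hp.1.ne' hp.2.ne, ENNReal.mul_inv_cancel hv0 hvt, one_mul, one_mul]
        congr 1
        conv_rhs => rw [show r = (r - 1) + 1 by ring]
        rw [ENNReal.rpow_add_of_nonneg _ _ hr1.le (by norm_num), ENNReal.rpow_one]

/-- The operator norm of the maximal function on `L^r(w)` for an `A_r` weight with constant `K`. -/
noncomputable def weightedMaximalNorm (J : Type*) [Fintype J] (r : ℝ) (K : ℝ≥0∞) : ℝ≥0∞ :=
  -- The summand 1 makes the norm nonzero, since the iteration divides by its powers.
  (Fintype.card J * muckenhouptConst r K) ^ (1 / r) + 1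

theorem weightedMaximalNorm_ne_top (J : Type*) [Fintype J] {r : ℝ} (hr : 1 < r) {K : ℝ≥0∞}
    (hK : K ≠ ⊤) : weightedMaximalNorm J r K ≠ ⊤ :=
  ENNReal.add_ne_top.2 ⟨ENNReal.rpow_ne_top_of_nonneg (by positivity)
    (ENNReal.mul_ne_top (by simp) (muckenhouptConst_ne_top hr hK)), by simp⟩

theorem weightedMaximalNorm_ne_zero (J : Type*) [Fintype J] (r : ℝ) (K : ℝ≥0∞) :
    weightedMaximalNorm J r K ≠ 0 := by
  simp [weightedMaximalNorm]

theorem IsDyadicFamily.lintegral_dyMax_le_norm {P : J → ℕ → S → ι} {μ : Measure S} [SFinite μ]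
    (hP : IsDyadicFamily P μ) {r : ℝ} (hr : 1 < r) {K : ℝ≥0∞} (hK : K ≠ ⊤)
    {w : S → ℝ≥0∞} (hwm : Measurable w) (hw : ∀ᵐ x ∂μ, 0 < w x ∧ w x < ⊤) (hA : CellAp P μ r K w)
    {f : S → ℝ≥0∞} (hf : Measurable f) :
    ∫⁻ x, dyMax P μ f x ^ r * w x ∂μ ≤
      weightedMaximalNorm J r K ^ r * ∫⁻ x, f x ^ r * w x ∂μ := by
  refine (lintegral_dyMax_rpow_mul_le hP hr hK hwm hw hA hf).trans ?_
  gcongr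
  have h : (Fintype.card J * muckenhouptConst r K) ^ (1 / r) ≤ weightedMaximalNorm J r K :=
    le_self_add
  have := ENNReal.rpow_le_rpow h (z := r) (by linarith)
  rwa [← ENNReal.rpow_mul, one_div_mul_cancel (by linarith), ENNReal.rpow_one] at this

/-- The `A_{r₀}` constant of the weights constructed in extrapolation. -/
noncomputable def extrapolationConst (J : Type*) [Fintype J] (r₀ r : ℝ) (K : ℝ≥0∞) : ℝ≥0∞ :=
  (2 * weightedMaximalNorm J r K) ^ (r₀ - 1) *
    (2 * weightedMaximalNorm J (r / (r - 1)) (K ^ (1 / (r - 1))))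

theorem extrapolationConst_ne_top (J : Type*) [Fintype J] {r₀ r : ℝ} (hr₀ : 1 < r₀) (hr : 1 < r)
    {K : ℝ≥0∞} (hK : K ≠ ⊤) : extrapolationConst J r₀ r K ≠ ⊤ := by
  have hr1 : 0 < r - 1 := by linarith
  have hr' : 1 < r / (r - 1) := by rw [lt_div_iff₀ hr1]; linarith
  exact ENNReal.mul_ne_top (ENNReal.rpow_ne_top_of_nonneg (by linarith)
    (ENNReal.mul_ne_top (by simp) (weightedMaximalNorm_ne_top J hr hK)))
    (ENNReal.mul_ne_top (by simp) (weightedMaximalNorm_ne_top J hr'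
      (ENNReal.rpow_ne_top_of_nonneg (by positivity) hK)))

/-- Provides strictly positive perturbations of small weighted norm. In extrapolation they are added
to the functions being iterated, so that the weights built from them are positive everywhere. -/
theorem exists_pos_lintegral_rpow_mul_lt {μ : Measure S} [SigmaFinite μ] {w : S → ℝ≥0∞}
    (hwm : Measurable w) (hw : ∀ᵐ x ∂μ, 0 < w x ∧ w x < ⊤) {r : ℝ} (hr : 0 < r) {ε : ℝ≥0∞}
    (hε : ε ≠ 0) :
    ∃ h : S → ℝ≥0∞, Measurable h ∧ (∀ x, 0 < h x) ∧ ∫⁻ x, h x ^ r * w x ∂μ < ε := by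
  have : SigmaFinite (μ.withDensity w) :=
    SigmaFinite.withDensity_of_ne_top (hw.mono fun _ h => h.2.ne)
  obtain ⟨g, hg0, hgm, hg⟩ := exists_pos_lintegral_lt_of_sigmaFinite (μ.withDensity w) hε
  refine ⟨fun x => (g x : ℝ≥0∞) ^ (1 / r), by fun_prop, fun x => ?_, ?_⟩
  · exact ENNReal.rpow_pos (by exact_mod_cast hg0 x) ENNReal.coe_ne_top
  · rw [lintegral_withDensity_eq_lintegral_mul _ hwm (by fun_prop)] at hg
    refine lt_of_le_of_lt (lintegral_mono fun x => ?_) hg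
    rw [← ENNReal.rpow_mul, one_div_mul_cancel hr.ne', ENNReal.rpow_one, mul_comm]
    rfl

theorem ae_lt_top_of_lintegral_rpow_mul_ne_top {μ : Measure S} {U w : S → ℝ≥0∞}
    (hU : Measurable U) (hwm : Measurable w) (hw : ∀ᵐ x ∂μ, 0 < w x) {r : ℝ} (hr : 0 < r)
    (h : ∫⁻ x, U x ^ r * w x ∂μ ≠ ⊤) : ∀ᵐ x ∂μ, U x < ⊤ := by
  filter_upwards [ae_lt_top ((hU.pow_const r).mul hwm) h, hw] with x hx hwx
  by_contra hcon
  rw [not_lt, top_le_iff] at hcon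
  simp only [Pi.mul_apply, hcon, ENNReal.top_rpow_of_pos hr, ENNReal.top_mul hwx.ne'] at hx
  exact lt_irrefl _ hx

theorem lintegral_add_rpow_mul_le {μ : Measure S} {f g w : S → ℝ≥0∞} (hf : Measurable f)
    (hw : Measurable w) {r : ℝ} (hr : 1 ≤ r) :
    ∫⁻ x, (f x + g x) ^ r * w x ∂μ ≤
      2 ^ r * ((∫⁻ x, f x ^ r * w x ∂μ) + ∫⁻ x, g x ^ r * w x ∂μ) := by
  have hm : Measurable fun x => f x ^ r * w x := (hf.pow_const r).mul hw
  rw [← lintegral_add_left hm, ← lintegral_const_mul' _ _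
    (ENNReal.rpow_ne_top_of_nonneg (by linarith) (by norm_num))]
  refine lintegral_mono fun x => ?_
  rw [← add_mul, ← mul_assoc]
  gcongr
  refine (ENNReal.rpow_add_le_mul_rpow_add_rpow _ _ hr).trans ?_
  gcongr
  · norm_num
  · linarith

/-- Rubio de Francia's extrapolation theorem. -/
theorem IsDyadicFamily.extrapolation {P : J → ℕ → S → ι} {μ : Measure S} [SigmaFinite μ]
    (hP : IsDyadicFamily P μ) {r₀ r : ℝ} (hr₀ : 1 < r₀) (hr : 1 < r) {K : ℝ≥0∞} (hK : K ≠ ⊤)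
    {N : ℝ≥0∞} (hN : N ≠ 0) (hNt : N ≠ ⊤) {F G : S → ℝ≥0∞} (hF : Measurable F) (hG : Measurable G)
    (h : ∀ v : S → ℝ≥0∞, Measurable v → (∀ᵐ x ∂μ, 0 < v x ∧ v x < ⊤) →
      CellAp P μ r₀ (extrapolationConst J r₀ r K) v →
      ∫⁻ x, F x ^ r₀ * v x ∂μ ≤ N * ∫⁻ x, G x ^ r₀ * v x ∂μ)
    {w : S → ℝ≥0∞} (hwm : Measurable w) (hw : ∀ᵐ x ∂μ, 0 < w x ∧ w x < ⊤) (hA : CellAp P μ r K w)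
    (hFfin : ∫⁻ x, F x ^ r * w x ∂μ ≠ ⊤) :
    ∫⁻ x, F x ^ r * w x ∂μ ≤ (32 * N ^ (1 / r₀)) ^ r * ∫⁻ x, G x ^ r * w x ∂μ := by
  have hr0 : 0 < r := by linarith
  have hr1 : 0 < r - 1 := by linarith
  have hr' : 1 < r / (r - 1) := by rw [lt_div_iff₀ hr1]; linarith
  have hr'0 : 0 < r / (r - 1) := by linarith
  have hr₀0 : 0 < r₀ := by linarith
  have hr₀1 : 0 < r₀ - 1 := by linarith
  have hpq : r.HolderConjugate (r / (r - 1)) := Real.HolderConjugate.conjExponent hr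
  have hpq₀ : r₀.HolderConjugate (r₀ / (r₀ - 1)) := Real.HolderConjugate.conjExponent hr₀
  set σ : S → ℝ≥0∞ := fun x => w x ^ (-1 / (r - 1)) with hσ
  have hσm : Measurable σ := hwm.pow_const _
  have hσpos : ∀ᵐ x ∂μ, 0 < σ x ∧ σ x < ⊤ := hw.mono fun _ h => ENNReal.rpow_pos_and_lt_top h _
  have hK' : K ^ (1 / (r - 1)) ≠ ⊤ := ENNReal.rpow_ne_top_of_nonneg (by positivity) hK
  set A := weightedMaximalNorm J r K with hAdef
  set A' := weightedMaximalNorm J (r / (r - 1)) (K ^ (1 / (r - 1))) with hA'def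
  have hA0 : A ≠ 0 := weightedMaximalNorm_ne_zero J _ _
  have hA'0 : A' ≠ 0 := weightedMaximalNorm_ne_zero J _ _
  have hAt : A ≠ ⊤ := weightedMaximalNorm_ne_top J hr hK
  have hA't : A' ≠ ⊤ := weightedMaximalNorm_ne_top J hr' hK'
  set X := ∫⁻ x, F x ^ r * w x ∂μ with hX
  set Y := ∫⁻ x, G x ^ r * w x ∂μ with hY
  have hC0 : (32 * N ^ (1 / r₀)) ^ r ≠ 0 := by
    rw [Ne, ENNReal.rpow_eq_zero_iff_of_pos hr0, mul_eq_zero, not_or,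
      ENNReal.rpow_eq_zero_iff_of_pos (by positivity)]
    exact ⟨by norm_num, hN⟩
  rcases eq_or_ne X 0 with hX0 | hX0
  · rw [hX0]; exact zero_le
  have hCt : (32 * N ^ (1 / r₀)) ^ r ≠ ⊤ := ENNReal.rpow_ne_top_of_nonneg hr0.le
    (ENNReal.mul_ne_top (by simp) (ENNReal.rpow_ne_top_of_nonneg (by positivity) hNt))
  rcases eq_or_ne Y ⊤ with hYt | hYt
  · rw [hYt, ENNReal.mul_top hC0]; exact le_top
  -- The error δ accounts for the perturbation `h₁` of `G`.
  suffices hδ : ∀ δ : ℝ≥0∞, δ ≠ 0 → δ ≠ ⊤ → X ≤ (32 * N ^ (1 / r₀)) ^ r * (Y + δ) by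
    refine ENNReal.le_of_forall_pos_le_add fun ε hε _ => ?_
    have := hδ (ε / (32 * N ^ (1 / r₀)) ^ r) (ENNReal.div_pos (by simpa using hε.ne') hCt).ne'
      (ENNReal.div_ne_top (by simp) hC0)
    rwa [mul_add, ENNReal.mul_div_cancel hC0 hCt] at this
  intro δ hδ0 hδt
  obtain ⟨h₁, h₁m, h₁pos, hh₁⟩ := exists_pos_lintegral_rpow_mul_lt hwm hw hr0 hδ0
  obtain ⟨h₂, h₂m, h₂pos, hh₂⟩ := exists_pos_lintegral_rpow_mul_lt hσm hσpos hr'0 hX0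
  have hFw : Measurable fun x => F x ^ (r - 1) * w x := (hF.pow_const _).mul hwm
  -- `U` is an `A₁` majorant of `G` in L^r(w). `V` is an `A₁` majorant of F^{r-1} w, which has norm
  -- X^{1/r'} in L^{r'}(σ), where r' = r/(r-1).
  set U := rubioIter P μ A fun x => G x + h₁ x with hUdef
  set V := rubioIter P μ A' fun x => F x ^ (r - 1) * w x + h₂ x with hVdef
  have hUm : Measurable U := hP.measurable_rubioIter A (hG.add h₁m)
  have hVm : Measurable V := hP.measurable_rubioIter A' (hFw.add h₂m)
  have hGU : ∀ x, G x + h₁ x ≤ U x := le_rubioIter P μ A fun x => G x + h₁ x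
  have hFV : ∀ x, F x ^ (r - 1) * w x + h₂ x ≤ V x :=
    le_rubioIter P μ A' fun x => F x ^ (r - 1) * w x + h₂ x
  have hUint : ∫⁻ x, U x ^ r * w x ∂μ ≤ 2 ^ r * (2 ^ r * (Y + δ)) := by
    refine (hP.lintegral_rubioIter_rpow_le hA0 hAt hr hwm
      (fun f hf => hP.lintegral_dyMax_le_norm hr hK hwm hw hA hf) (hG.add h₁m)).trans ?_
    gcongr
    refine (lintegral_add_rpow_mul_le hG hwm hr.le).trans ?_
    gcongr
  have hVint : ∫⁻ x, V x ^ (r / (r - 1)) * σ x ∂μ ≤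
      2 ^ (r / (r - 1)) * (2 ^ (r / (r - 1)) * (X + X)) := by
    refine (hP.lintegral_rubioIter_rpow_le hA'0 hA't hr' hσm
      (fun f hf => hP.lintegral_dyMax_le_norm hr' hK' hσm hσpos (hA.dual hr) hf)
      (hFw.add h₂m)).trans ?_
    gcongr
    refine (lintegral_add_rpow_mul_le hFw hσm hr'.le).trans ?_
    gcongr
    refine le_of_eq (lintegral_congr_ae ?_)
    filter_upwards [hw] with x hx
    rw [ENNReal.mul_rpow_of_nonneg _ _ hr'0.le, ← ENNReal.rpow_mul, mul_div_cancel₀ _ hr1.ne',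
      mul_assoc]
    congr 1
    rw [hσ, ← ENNReal.rpow_add _ _ hx.1.ne' hx.2.ne]
    conv_rhs => rw [← ENNReal.rpow_one (w x)]
    congr 1
    field_simp
    ring
  have h2r : ∀ s : ℝ, 0 < s → (2 : ℝ≥0∞) ^ s ≠ ⊤ := fun s hs =>
    ENNReal.rpow_ne_top_of_nonneg hs.le (by norm_num)
  have hUfin : ∀ᵐ x ∂μ, U x < ⊤ := ae_lt_top_of_lintegral_rpow_mul_ne_top hUm hwm
    (hw.mono fun _ h => h.1) hr0 (ne_top_of_le_ne_top (ENNReal.mul_ne_top (h2r _ hr0)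
      (ENNReal.mul_ne_top (h2r _ hr0) (ENNReal.add_ne_top.2 ⟨hYt, hδt⟩))) hUint)
  have hVfin : ∀ᵐ x ∂μ, V x < ⊤ := ae_lt_top_of_lintegral_rpow_mul_ne_top hVm hσm
    (hσpos.mono fun _ h => h.1) hr'0 (ne_top_of_le_ne_top (ENNReal.mul_ne_top (h2r _ hr'0)
      (ENNReal.mul_ne_top (h2r _ hr'0) (ENNReal.add_ne_top.2 ⟨hFfin, hFfin⟩))) hVint)
  have hUpos : ∀ x, 0 < U x := fun x => (h₁pos x).trans_le (le_add_self.trans (hGU x))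
  have hVpos : ∀ x, 0 < V x := fun x => (h₂pos x).trans_le (le_add_self.trans (hFV x))
  have hU : ∀ᵐ x ∂μ, 0 < U x ∧ U x < ⊤ := hUfin.mono fun x hx => ⟨hUpos x, hx⟩
  have hV : ∀ᵐ x ∂μ, 0 < V x ∧ V x < ⊤ := hVfin.mono fun x hx => ⟨hVpos x, hx⟩
  have h2A0 : 2 * A ≠ 0 := mul_ne_zero two_ne_zero hA0
  have h2A'0 : 2 * A' ≠ 0 := mul_ne_zero two_ne_zero hA'0
  have h2At : 2 * A ≠ ⊤ := ENNReal.mul_ne_top (by norm_num) hAt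
  have h2A't : 2 * A' ≠ ⊤ := ENNReal.mul_ne_top (by norm_num) hA't
  -- A quotient of `A₁` weights of this form is an `A_{r₀}` weight, to which the hypothesis applies.
  -- Since G ≤ U, the right-hand side G^{r₀} v is at most U V.
  set v : S → ℝ≥0∞ := fun x => (U x ^ (r₀ - 1))⁻¹ * V x with hv
  have hvm : Measurable v := (hUm.pow_const _).inv.mul hVm
  have hbase := h v hvm (by
    filter_upwards [hU, hV] with x hxU hxV
    have hp := ENNReal.rpow_pos_and_lt_top hxU (r₀ - 1)
    exact ⟨ENNReal.mul_pos (ENNReal.inv_ne_zero.2 hp.2.ne) hxV.1.ne',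
      ENNReal.mul_lt_top (ENNReal.inv_lt_top.2 hp.1) hxV.2⟩)
    (hP.cellAp_of_dyMax_le hr₀ h2A0 h2At h2A'0 h2A't hUm hVm hU hV
      (hP.dyMax_rubioIter_le hA0 hAt (hG.add h₁m))
      (hP.dyMax_rubioIter_le hA'0 hA't (hFw.add h₂m)))
  set Z := ∫⁻ x, U x * V x ∂μ with hZ
  have hGZ : ∫⁻ x, G x ^ r₀ * v x ∂μ ≤ Z := by
    refine lintegral_mono_ae ?_
    filter_upwards [hU] with x hxU
    have hp := ENNReal.rpow_pos_and_lt_top hxU (r₀ - 1)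
    calc G x ^ r₀ * v x ≤ U x ^ r₀ * ((U x ^ (r₀ - 1))⁻¹ * V x) := by
          gcongr
          exact le_self_add.trans (hGU x)
      _ = U x * (U x ^ (r₀ - 1) * (U x ^ (r₀ - 1))⁻¹) * V x := by
          have : U x ^ r₀ = U x * U x ^ (r₀ - 1) := by
            conv_lhs => rw [show r₀ = 1 + (r₀ - 1) by ring]
            rw [ENNReal.rpow_add_of_nonneg _ _ (by norm_num) hr₀1.le, ENNReal.rpow_one]
          rw [this]; ring
      _ = U x * V x := by rw [ENNReal.mul_inv_cancel hp.1.ne' hp.2.ne, mul_one]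
  -- F^r w is at most F V = (F v^{1/r₀}) (U V)^{1/r₀'}, to which Hölder's inequality with the
  -- exponent r₀ applies.
  have hXZ : X ≤ N ^ (1 / r₀) * Z := by
    have hm1 : Measurable fun x => F x * v x ^ (1 / r₀) := hF.mul (hvm.pow_const _)
    have hm2 : Measurable fun x => (U x * V x) ^ (1 / (r₀ / (r₀ - 1))) :=
      (hUm.mul hVm).pow_const _
    have hH := ENNReal.lintegral_mul_le_Lp_mul_Lq μ hpq₀ hm1.aemeasurable hm2.aemeasurable
    have e1 : ∀ x, (F x * v x ^ (1 / r₀)) ^ r₀ = F x ^ r₀ * v x := fun x => by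
      rw [ENNReal.mul_rpow_of_nonneg _ _ hr₀0.le, ← ENNReal.rpow_mul, one_div_mul_cancel hr₀0.ne',
        ENNReal.rpow_one]
    have e2 : ∀ x, ((U x * V x) ^ (1 / (r₀ / (r₀ - 1)))) ^ (r₀ / (r₀ - 1)) = U x * V x := fun x => by
      rw [← ENNReal.rpow_mul, one_div_mul_cancel (by positivity), ENNReal.rpow_one]
    simp only [e1, e2] at hH
    calc X ≤ ∫⁻ x, ((fun x => F x * v x ^ (1 / r₀)) *
          fun x => (U x * V x) ^ (1 / (r₀ / (r₀ - 1)))) x ∂μ := by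
          refine lintegral_mono_ae ?_
          filter_upwards [hU, hV] with x hxU hxV
          have hp := ENNReal.rpow_pos_and_lt_top hxU (1 / (r₀ / (r₀ - 1)))
          have ep : U x ^ ((r₀ - 1) * (1 / r₀)) = U x ^ (1 / (r₀ / (r₀ - 1))) := by
            congr 1; field_simp
          have eF : F x ^ r = F x * F x ^ (r - 1) := by
            conv_lhs => rw [show r = 1 + (r - 1) by ring]
            rw [ENNReal.rpow_add_of_nonneg _ _ (by norm_num) hr1.le, ENNReal.rpow_one]
          have eV : V x ^ (1 / r₀) * V x ^ (1 / (r₀ / (r₀ - 1))) = V x := by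
            rw [← ENNReal.rpow_add _ _ hxV.1.ne' hxV.2.ne,
              show 1 / r₀ + 1 / (r₀ / (r₀ - 1)) = 1 by field_simp; ring, ENNReal.rpow_one]
          simp only [Pi.mul_apply, hv]
          rw [ENNReal.mul_rpow_of_nonneg _ _ (by positivity),
            ENNReal.mul_rpow_of_nonneg _ _ (by positivity), ENNReal.inv_rpow, ← ENNReal.rpow_mul, ep]
          calc F x ^ r * w x = F x * (F x ^ (r - 1) * w x) := by rw [eF, mul_assoc]
            _ ≤ F x * V x := by gcongr; exact le_self_add.trans (hFV x)
            _ = F x * (U x ^ (1 / (r₀ / (r₀ - 1))) * (U x ^ (1 / (r₀ / (r₀ - 1))))⁻¹) *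
                (V x ^ (1 / r₀) * V x ^ (1 / (r₀ / (r₀ - 1)))) := by
                rw [ENNReal.mul_inv_cancel hp.1.ne' hp.2.ne, eV, mul_one]
            _ = _ := by ring
      _ ≤ _ := hH
      _ ≤ (N * Z) ^ (1 / r₀) * Z ^ (1 / (r₀ / (r₀ - 1))) := by
          gcongr
          exact hbase.trans (by gcongr)
      _ = _ := by
          rw [ENNReal.mul_rpow_of_nonneg _ _ (by positivity), mul_assoc,
            ← ENNReal.rpow_add_of_nonneg _ _ (by positivity) (by positivity),
            show 1 / r₀ + 1 / (r₀ / (r₀ - 1)) = 1 by field_simp; ring, ENNReal.rpow_one]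
  -- Duality of L^r(w) and L^{r'}(σ), since w^{1/r} σ^{1/r'} = 1. In 32 = 4 · 8 each of `U` and `V`
  -- contributes 2 · 2, from the iteration and from the sum with the perturbation; the last factor 2
  -- bounds the root of 2 in X + X = 2X.
  have hZle : Z ≤ 32 * ((Y + δ) ^ (1 / r) * X ^ (1 / (r / (r - 1)))) := by
    have hm1 : Measurable fun x => U x * w x ^ (1 / r) := hUm.mul (hwm.pow_const _)
    have hm2 : Measurable fun x => V x * σ x ^ (1 / (r / (r - 1))) := hVm.mul (hσm.pow_const _)
    have hH := ENNReal.lintegral_mul_le_Lp_mul_Lq μ hpq hm1.aemeasurable hm2.aemeasurable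
    have e1 : ∀ x, (U x * w x ^ (1 / r)) ^ r = U x ^ r * w x := fun x => by
      rw [ENNReal.mul_rpow_of_nonneg _ _ hr0.le, ← ENNReal.rpow_mul, one_div_mul_cancel hr0.ne',
        ENNReal.rpow_one]
    have e2 : ∀ x, (V x * σ x ^ (1 / (r / (r - 1)))) ^ (r / (r - 1)) =
        V x ^ (r / (r - 1)) * σ x := fun x => by
      rw [ENNReal.mul_rpow_of_nonneg _ _ hr'0.le, ← ENNReal.rpow_mul, one_div_mul_cancel hr'0.ne',
        ENNReal.rpow_one]
    simp only [e1, e2] at hH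
    calc Z ≤ ∫⁻ x, ((fun x => U x * w x ^ (1 / r)) *
          fun x => V x * σ x ^ (1 / (r / (r - 1)))) x ∂μ := by
          refine lintegral_mono_ae ?_
          filter_upwards [hw] with x hx
          refine le_of_eq ?_
          simp only [Pi.mul_apply, hσ]
          rw [mul_mul_mul_comm, ← ENNReal.rpow_mul, ← ENNReal.rpow_add _ _ hx.1.ne' hx.2.ne,
            show 1 / r + -1 / (r - 1) * (1 / (r / (r - 1))) = 0 by field_simp; ring,
            ENNReal.rpow_zero, mul_one]
      _ ≤ _ := hH
      _ ≤ (2 ^ r * (2 ^ r * (Y + δ))) ^ (1 / r) *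
          (2 ^ (r / (r - 1)) * (2 ^ (r / (r - 1)) * (X + X))) ^ (1 / (r / (r - 1))) := by
          gcongr
      _ ≤ (2 * (2 * (Y + δ) ^ (1 / r))) * (2 * (2 * (2 * X ^ (1 / (r / (r - 1)))))) := by
          have hroot : ∀ (s : ℝ) (a : ℝ≥0∞), 0 < s →
              (2 ^ s * (2 ^ s * a)) ^ (1 / s) = 2 * (2 * a ^ (1 / s)) := fun s a hs => by
            rw [ENNReal.mul_rpow_of_nonneg _ _ (by positivity),
              ENNReal.mul_rpow_of_nonneg _ _ (by positivity), ← ENNReal.rpow_mul,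
              mul_one_div_cancel hs.ne', ENNReal.rpow_one]
          rw [hroot _ _ hr0, hroot _ _ hr'0, ← two_mul,
            ENNReal.mul_rpow_of_nonneg _ _ (by positivity)]
          gcongr
          calc (2 : ℝ≥0∞) ^ (1 / (r / (r - 1))) ≤ 2 ^ (1 : ℝ) :=
                ENNReal.rpow_le_rpow_of_exponent_le (by norm_num)
                  (by rw [div_le_one hr'0]; exact hr'.le)
            _ = 2 := ENNReal.rpow_one 2
      _ = _ := by ring
  have hXX : X = X ^ (1 / r) * X ^ (1 / (r / (r - 1))) := by
    rw [← ENNReal.rpow_add _ _ hX0 hFfin, show 1 / r + 1 / (r / (r - 1)) = 1 by field_simp; ring,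
      ENNReal.rpow_one]
  have hXp := ENNReal.rpow_pos_and_lt_top ⟨pos_iff_ne_zero.2 hX0, lt_top_iff_ne_top.2 hFfin⟩
    (1 / (r / (r - 1)))
  -- Division by X^{1/r'}, which is legitimate because `X` is finite and nonzero.
  have hroot : X ^ (1 / r) ≤ 32 * N ^ (1 / r₀) * (Y + δ) ^ (1 / r) := by
    rw [← ENNReal.mul_le_mul_iff_left hXp.1.ne' hXp.2.ne, ← hXX]
    calc X ≤ N ^ (1 / r₀) * Z := hXZ
      _ ≤ N ^ (1 / r₀) * (32 * ((Y + δ) ^ (1 / r) * X ^ (1 / (r / (r - 1))))) := by gcongr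
      _ = _ := by ring
  have := ENNReal.rpow_le_rpow hroot hr0.le
  rwa [← ENNReal.rpow_mul, one_div_mul_cancel hr0.ne', ENNReal.rpow_one,
    ENNReal.mul_rpow_of_nonneg _ _ hr0.le, ← ENNReal.rpow_mul, one_div_mul_cancel hr0.ne',
    ENNReal.rpow_one] at this

end Extrapolation

/-! ### Dyadic intervals and their translates by a third -/

theorem floor_two_pow_mul_eq_of_succ {k : ℕ} {u v : ℝ}
    (h : ⌊(2 : ℝ) ^ (k + 1) * u⌋ = ⌊(2 : ℝ) ^ (k + 1) * v⌋) :
    ⌊(2 : ℝ) ^ k * u⌋ = ⌊(2 : ℝ) ^ k * v⌋ := by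
  have key : ∀ u : ℝ, ⌊(2 : ℝ) ^ k * u⌋ = ⌊(2 : ℝ) ^ (k + 1) * u⌋ / 2 := by
    intro u
    have h1 : 2 * ⌊(2 : ℝ) ^ k * u⌋ ≤ ⌊(2 : ℝ) ^ (k + 1) * u⌋ := by
      refine Int.le_floor.2 ?_
      push_cast
      have := Int.floor_le ((2 : ℝ) ^ k * u)
      rw [pow_succ]; linarith
    have h2 : ⌊(2 : ℝ) ^ (k + 1) * u⌋ < 2 * ⌊(2 : ℝ) ^ k * u⌋ + 2 := by
      refine Int.floor_lt.2 ?_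
      push_cast
      have := Int.lt_floor_add_one ((2 : ℝ) ^ k * u)
      rw [pow_succ]; linarith
    omega
  rw [key u, key v, h]

theorem floor_two_pow_mul_eq_of_le {j k : ℕ} (hjk : j ≤ k) {u v : ℝ}
    (h : ⌊(2 : ℝ) ^ k * u⌋ = ⌊(2 : ℝ) ^ k * v⌋) : ⌊(2 : ℝ) ^ j * u⌋ = ⌊(2 : ℝ) ^ j * v⌋ := by
  induction k, hjk using Nat.le_induction with
  | base => exact h
  | succ k _ ih => exact ih (floor_two_pow_mul_eq_of_succ h)

/-- A short interval lies in a dyadic interval or in a dyadic interval translated by `1/3`. -/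
theorem exists_floor_two_pow_eq {a b : ℝ} (hab : a ≤ b) {k : ℕ} (h : 3 * 2 ^ k * (b - a) ≤ 1) :
    ∃ j : Fin 2, ∀ x ∈ Icc a b, ∀ y ∈ Icc a b,
      ⌊(2 : ℝ) ^ k * (x - (j : ℝ) / 3)⌋ = ⌊(2 : ℝ) ^ k * (y - (j : ℝ) / 3)⌋ := by
  have h2 : (0 : ℝ) < 2 ^ k := by positivity
  have mono : ∀ c : ℝ, ⌊(2 : ℝ) ^ k * (a - c)⌋ = ⌊(2 : ℝ) ^ k * (b - c)⌋ →
      ∀ x ∈ Icc a b, ⌊(2 : ℝ) ^ k * (x - c)⌋ = ⌊(2 : ℝ) ^ k * (b - c)⌋ := by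
    intro c hc x hx
    refine le_antisymm (Int.floor_mono ?_) (hc ▸ Int.floor_mono ?_)
    · exact mul_le_mul_of_nonneg_left (by linarith [hx.2]) h2.le
    · exact mul_le_mul_of_nonneg_left (by linarith [hx.1]) h2.le
  have bad : ∀ c : ℝ, ⌊(2 : ℝ) ^ k * (a - c)⌋ ≠ ⌊(2 : ℝ) ^ k * (b - c)⌋ →
      ∃ z : ℤ, (2 : ℝ) ^ k * (a - c) < z ∧ (z : ℝ) ≤ 2 ^ k * (b - c) := by
    intro c hc
    refine ⟨⌊(2 : ℝ) ^ k * (b - c)⌋, ?_, Int.floor_le _⟩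
    refine Int.floor_lt.1 (lt_of_le_of_ne (Int.floor_mono ?_) hc)
    exact mul_le_mul_of_nonneg_left (by linarith) h2.le
  by_cases h0 : ⌊(2 : ℝ) ^ k * (a - 0)⌋ = ⌊(2 : ℝ) ^ k * (b - 0)⌋
  · refine ⟨0, fun x hx y hy => ?_⟩
    have := mono 0 h0
    simp only [Fin.val_zero, Nat.cast_zero, zero_div]
    rw [this x hx, this y hy]
  by_cases h1 : ⌊(2 : ℝ) ^ k * (a - 1 / 3)⌋ = ⌊(2 : ℝ) ^ k * (b - 1 / 3)⌋
  · refine ⟨1, fun x hx y hy => ?_⟩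
    have := mono (1 / 3) h1
    simp only [Fin.val_one, Nat.cast_one]
    rw [this x hx, this y hy]
  -- If the interval crosses both grids, it contains a point z/2ᵏ and a point 1/3 + z'/2ᵏ. Their
  -- distance is too small for the integer 3(z - z') - 2ᵏ to be nonzero, and 3 does not divide 2ᵏ.
  exfalso
  obtain ⟨z, hz1, hz2⟩ := bad 0 h0
  obtain ⟨z', hz1', hz2'⟩ := bad _ h1
  have e1 : (3 * (z - z') - 2 ^ k : ℝ) < 1 := by nlinarith
  have e2 : -1 < (3 * (z - z') - 2 ^ k : ℝ) := by nlinarith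
  have e1' : 3 * (z - z') - 2 ^ k < (1 : ℤ) := by exact_mod_cast e1
  have e2' : (-1 : ℤ) < 3 * (z - z') - 2 ^ k := by exact_mod_cast e2
  have e3 : (3 : ℤ) ∣ 2 ^ k := ⟨z - z', by omega⟩
  have := (Int.prime_three.dvd_of_dvd_pow e3)
  omega

/-- Selects the finest scale at which the translated grids can be used; the second inequality bounds
the cell length 2⁻ᵏ by 6L. -/
theorem exists_three_mul_two_pow_mul_le {L : ℝ} (hL : 0 < L) (hL' : 3 * L ≤ 1) :
    ∃ k : ℕ, 3 * 2 ^ k * L ≤ 1 ∧ 1 < 6 * 2 ^ k * L := by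
  obtain ⟨k, hk1, hk2⟩ := exists_nat_pow_near (x := 1 / (3 * L)) (y := (2 : ℝ))
    (by rw [le_div_iff₀ (by positivity)]; linarith) (by norm_num)
  rw [le_div_iff₀ (by positivity)] at hk1
  rw [div_lt_iff₀ (by positivity), pow_succ] at hk2
  exact ⟨k, by linarith, by linarith⟩

/-- The dyadic intervals of length `2^{m-k}`, `k ≥ 0`, and their translates by `2^m/3`. -/
noncomputable def timeLabel (m : ℕ) (j : Fin 2) (k : ℕ) (t : ℝ) : ℤ :=
  ⌊(2 : ℝ) ^ k * (t / 2 ^ m - (j : ℝ) / 3)⌋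

theorem labelCell_timeLabel (m : ℕ) (j : Fin 2) (k : ℕ) (t : ℝ) :
    ∃ c : ℝ, labelCell (timeLabel m j) k t = Ico c (c + 2 ^ m / 2 ^ k) := by
  refine ⟨2 ^ m * (timeLabel m j k t / 2 ^ k + (j : ℝ) / 3), ?_⟩
  ext s
  have h1 : (0 : ℝ) < 2 ^ k := by positivity
  have h2 : (0 : ℝ) < 2 ^ m := by positivity
  have e1 : s / 2 ^ m * 2 ^ m = s := by field_simp
  simp only [labelCell, mem_ofPred_eq, mem_Ico]
  generalize timeLabel m j k t = z
  rw [timeLabel, Int.floor_eq_iff]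
  have e2 : (z : ℝ) / 2 ^ k * 2 ^ k = z := by field_simp
  have e3 : (2 : ℝ) ^ m / 2 ^ k * 2 ^ k = 2 ^ m := by field_simp
  constructor
  · rintro ⟨ha, hb⟩
    constructor
    · have : (z : ℝ) / 2 ^ k ≤ s / 2 ^ m - (j : ℝ) / 3 := by
        rw [div_le_iff₀ h1]; linarith
      have := mul_le_mul_of_nonneg_left this h2.le
      nlinarith
    · have : s / 2 ^ m - (j : ℝ) / 3 < (z + 1 : ℝ) / 2 ^ k := by
        rw [lt_div_iff₀ h1]; linarith
      have := mul_lt_mul_of_pos_left this h2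
      have e4 : (z + 1 : ℝ) / 2 ^ k = z / 2 ^ k + 1 / 2 ^ k := by ring
      have e5 : (2 : ℝ) ^ m / 2 ^ k = 2 ^ m * (1 / 2 ^ k) := by ring
      rw [e4] at this
      rw [e5]
      nlinarith
  · rintro ⟨ha, hb⟩
    have hs : s / 2 ^ m * 2 ^ m = s := e1
    constructor
    · have : z / 2 ^ k + (j : ℝ) / 3 ≤ s / 2 ^ m := by rw [le_div_iff₀ h2]; linarith
      have := mul_le_mul_of_nonneg_left this h1.le
      nlinarith
    · have : s / 2 ^ m < z / 2 ^ k + (j : ℝ) / 3 + 1 / 2 ^ k := by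
        rw [div_lt_iff₀ h2]
        have e5 : (2 : ℝ) ^ m / 2 ^ k = 2 ^ m * (1 / 2 ^ k) := by ring
        rw [e5] at hb
        linarith
      have := mul_lt_mul_of_pos_left this h1
      have e6 : (2 : ℝ) ^ k * (1 / 2 ^ k) = 1 := by field_simp
      nlinarith

theorem volume_labelCell_timeLabel (m : ℕ) (j : Fin 2) (k : ℕ) (t : ℝ) :
    volume (labelCell (timeLabel m j) k t) = ENNReal.ofReal (2 ^ m / 2 ^ k) := by
  obtain ⟨c, hc⟩ := labelCell_timeLabel m j k t
  rw [hc, Real.volume_Ico, add_sub_cancel_left]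

theorem isDyadicFamily_timeLabel (m : ℕ) : IsDyadicFamily (timeLabel m) (volume : Measure ℝ) where
  isNestedPartition j :=
    { measurable := fun k => by unfold timeLabel; fun_prop
      nested := fun k x y h => floor_two_pow_mul_eq_of_succ h }
  measure_pos j k x := by
    rw [volume_labelCell_timeLabel]
    exact ENNReal.ofReal_pos.2 (by positivity)
  measure_lt_top j k x := by
    rw [volume_labelCell_timeLabel]
    exact ENNReal.ofReal_lt_top

/-- Cells are half-open intervals, which differ from open ones by a null set. Multiplying the
averages by the powers of the length gives the form without denominators. -/
theorem cellAp_timeLabel_of_apCharacteristic_le {r : ℝ} (hr : 1 < r) {w : ℝ → ℝ} {K : ℝ≥0∞}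
    (h : apCharacteristic r w ≤ K) (m : ℕ) :
    CellAp (timeLabel m) volume r K fun t => ENNReal.ofReal (w t) := by
  intro j k x
  rw [volume_labelCell_timeLabel]
  obtain ⟨c, hc⟩ := labelCell_timeLabel m j k x
  have hL : (0 : ℝ) < 2 ^ m / 2 ^ k := by positivity
  set L : ℝ := 2 ^ m / 2 ^ k with hLdef
  have h1 : 1 - r.conjExponent = -1 / (r - 1) := by
    rw [Real.conjExponent]
    have : r - 1 ≠ 0 := by linarith
    field_simp
    ring
  have h2 := (le_iSup_of_le c (le_iSup_of_le (c + L) (le_iSup_of_le (by linarith) le_rfl))).trans h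
  rw [setLAverage_eq, setLAverage_eq, Real.volume_Ioo, add_sub_cancel_left, h1,
    ENNReal.div_rpow_of_nonneg _ _ (by linarith), restrict_Ioo_eq_restrict_Ico] at h2
  rw [hc]
  generalize (∫⁻ y in Ico c (c + L), ENNReal.ofReal (w y)) = A at h2 ⊢
  generalize (∫⁻ y in Ico c (c + L), ENNReal.ofReal (w y) ^ (-1 / (r - 1))) ^ (r - 1) = B at h2 ⊢
  have hl0 : ENNReal.ofReal L ≠ 0 := (ENNReal.ofReal_pos.2 hL).ne'
  have hlt : ENNReal.ofReal L ≠ ⊤ := ENNReal.ofReal_ne_top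
  have e : ENNReal.ofReal L ^ r = ENNReal.ofReal L * ENNReal.ofReal L ^ (r - 1) := by
    have := ENNReal.rpow_add 1 (r - 1) hl0 hlt
    rwa [ENNReal.rpow_one, add_sub_cancel] at this
  have hz0 : ENNReal.ofReal L ^ (r - 1) ≠ 0 := by
    simp [ENNReal.rpow_eq_zero_iff, hl0, hlt]
  have hzt : ENNReal.ofReal L ^ (r - 1) ≠ ⊤ := ENNReal.rpow_ne_top_of_nonneg (by linarith) hlt
  rw [e]
  have : A * B = A / ENNReal.ofReal L * (B / ENNReal.ofReal L ^ (r - 1)) *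
      (ENNReal.ofReal L * ENNReal.ofReal L ^ (r - 1)) := by
    rw [show A / ENNReal.ofReal L * (B / ENNReal.ofReal L ^ (r - 1)) *
      (ENNReal.ofReal L * ENNReal.ofReal L ^ (r - 1)) = (A / ENNReal.ofReal L * ENNReal.ofReal L) *
        (B / ENNReal.ofReal L ^ (r - 1) * ENNReal.ofReal L ^ (r - 1)) by ring,
      ENNReal.div_mul_cancel hl0 hlt, ENNReal.div_mul_cancel hz0 hzt]
  rw [this]
  exact mul_le_mul_left h2 _

theorem setLIntegral_le_dyMax_of_subset {S ι J : Type*} [MeasurableSpace S] [MeasurableSpace ι]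
    {P : J → ℕ → S → ι} {μ : Measure S} (hP : IsDyadicFamily P μ) {j : J} {k : ℕ} {x : S}
    {B : Set S} (hB : B ⊆ labelCell (P j) k x) (f : S → ℝ≥0∞) :
    ∫⁻ y in B, f y ∂μ ≤ μ (labelCell (P j) k x) * dyMax P μ f x := by
  refine (lintegral_mono_set hB).trans ?_
  have h := cellAvg_le_dyMax P μ f j k x
  rw [cellAvg, ENNReal.div_le_iff' (hP.measure_pos j k x).ne' (hP.measure_lt_top j k x).ne] at h
  exact h

/-- The interval lies in a cell at most six times as long, of one of the two grids. The coarsest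
cells have length 2^m, whence the restriction on b - a. -/
theorem setLIntegral_Icc_le_dyMax {m : ℕ} {a b x : ℝ} (hab : a < b) (hm : 3 * (b - a) ≤ 2 ^ m)
    (hx : x ∈ Icc a b) (f : ℝ → ℝ≥0∞) :
    ∫⁻ y in Icc a b, f y ≤ ENNReal.ofReal (6 * (b - a)) * dyMax (timeLabel m) volume f x := by
  have h2 : (0 : ℝ) < 2 ^ m := by positivity
  obtain ⟨k, hk1, hk2⟩ := exists_three_mul_two_pow_mul_le (L := (b - a) / 2 ^ m)
    (div_pos (by linarith) h2) (by rw [← mul_div_assoc, div_le_one h2]; exact hm)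
  obtain ⟨j, hj⟩ := exists_floor_two_pow_eq (a := a / 2 ^ m) (b := b / 2 ^ m) (k := k) (by gcongr)
    (by rw [← sub_div]; exact hk1)
  have hsub : Icc a b ⊆ labelCell (timeLabel m j) k x := by
    intro y hy
    refine hj _ ⟨?_, ?_⟩ _ ⟨?_, ?_⟩
    · have := hy.1; gcongr
    · have := hy.2; gcongr
    · have := hx.1; gcongr
    · have := hx.2; gcongr
  refine (setLIntegral_le_dyMax_of_subset (isDyadicFamily_timeLabel m) hsub f).trans ?_
  rw [volume_labelCell_timeLabel]
  refine mul_le_mul_left (ENNReal.ofReal_le_ofReal ?_) _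
  have h1 : (0 : ℝ) < 2 ^ k := by positivity
  rw [div_le_iff₀ h1]
  rw [← mul_div_assoc, lt_div_iff₀ h2] at hk2
  linarith

/-! ### Dyadic cubes of the torus -/

instance isNegInvariant_volume_unitAddTorus {d : ℕ} :
    Measure.IsNegInvariant (volume : Measure (UnitAddTorus (Fin d))) :=
  Measure.pi.isNegInvariant _

instance isProbabilityMeasure_volume_unitAddTorus {d : ℕ} :
    IsProbabilityMeasure (volume : Measure (UnitAddTorus (Fin d))) where
  measure_univ := by
    rw [volume_pi, Measure.pi_univ]
    simp

theorem volume_unitAddCircle : (volume : Measure UnitAddCircle) = AddCircle.haarAddCircle := by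
  rw [AddCircle.volume_eq_smul_haarAddCircle]; simp

theorem lintegral_torus_eq {d : ℕ} (f : UnitAddTorus (Fin d) → ℝ≥0∞) (a : Fin d → ℝ) :
    ∫⁻ x, f x = ∫⁻ x in {x : Fin d → ℝ | ∀ i, x i ∈ Ioc (a i) (a i + 1)}, f (torusMk x) := by
  have h := UnitAddTorus.lintegral_preimage f a
  refine Eq.trans ?_ h
  congr 1
  rw [volume_pi]
  simp only [volume_unitAddCircle]
  rfl

theorem unitAddCircle_norm_coe_le (s : ℝ) : ‖(s : UnitAddCircle)‖ ≤ |s| := by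
  rw [UnitAddCircle.norm_eq]
  simpa using round_le s 0

theorem norm_torusMk_le {d : ℕ} (y : Fin d → ℝ) : ‖torusMk y‖ ≤ ‖y‖ :=
  (pi_norm_le_iff_of_nonneg (norm_nonneg y)).2 fun i =>
    (unitAddCircle_norm_coe_le _).trans (norm_le_pi_norm y i)

theorem continuous_torusMk {d : ℕ} : Continuous (torusMk : (Fin d → ℝ) → UnitAddTorus (Fin d)) :=
  (torusMk_isQuotientMap d).continuous

theorem measurable_torusMk {d : ℕ} : Measurable (torusMk : (Fin d → ℝ) → UnitAddTorus (Fin d)) :=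
  continuous_torusMk.measurable

theorem torusMk_surjective {d : ℕ} :
    Function.Surjective (torusMk : (Fin d → ℝ) → UnitAddTorus (Fin d)) :=
  (torusMk_isQuotientMap d).surjective

theorem torusMk_neg {d : ℕ} (x : Fin d → ℝ) : torusMk (-x) = -torusMk x := by
  funext i
  simp [torusMk]

/-- The dyadic arcs of length `2^{-k}` of the circle, and their translates by a third. -/
noncomputable def circleLabel (j : Fin 2) (k : ℕ) (x : UnitAddCircle) : ℤ :=
  ⌊(2 : ℝ) ^ k * (AddCircle.equivIco (1 : ℝ) 0 (x - (((j : ℝ) / 3 : ℝ) : UnitAddCircle)) : ℝ)⌋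

theorem circleLabel_coe (j : Fin 2) (k : ℕ) (ξ : ℝ) :
    circleLabel j k (ξ : UnitAddCircle) = ⌊(2 : ℝ) ^ k * Int.fract (ξ - (j : ℝ) / 3)⌋ := by
  rw [circleLabel, ← AddCircle.coe_sub, AddCircle.coe_equivIco_mk_apply]
  simp

/-- Passing to the fractional part subtracts the integer 2ᵏ⌊v⌋ from the label ⌊2ᵏv⌋, and ⌊v⌋ is
itself determined by that label. So equal labels on the line give equal labels on the circle. -/
theorem circleLabel_coe_eq {j : Fin 2} {k : ℕ} {ξ η : ℝ}
    (h : ⌊(2 : ℝ) ^ k * (ξ - (j : ℝ) / 3)⌋ = ⌊(2 : ℝ) ^ k * (η - (j : ℝ) / 3)⌋) :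
    circleLabel j k (ξ : UnitAddCircle) = circleLabel j k (η : UnitAddCircle) := by
  have h0 : ⌊ξ - (j : ℝ) / 3⌋ = ⌊η - (j : ℝ) / 3⌋ := by
    simpa using floor_two_pow_mul_eq_of_le (Nat.zero_le k) h
  have key : ∀ v : ℝ, ⌊(2 : ℝ) ^ k * Int.fract v⌋ = ⌊(2 : ℝ) ^ k * v⌋ - 2 ^ k * ⌊v⌋ := by
    intro v
    rw [← Int.self_sub_floor, mul_sub, ← Int.floor_sub_intCast]
    push_cast
    rfl
  rw [circleLabel_coe, circleLabel_coe, key, key, h, h0]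

theorem measurable_circleLabel (j : Fin 2) (k : ℕ) : Measurable (circleLabel j k) := by
  have h : Measurable fun x : UnitAddCircle => (AddCircle.equivIco (1 : ℝ) 0 x : ℝ) :=
    measurable_subtype_coe.comp (AddCircle.measurableEquivIco (1 : ℝ) 0).measurable
  exact Int.measurable_floor.comp
    ((h.comp (measurable_id.sub_const _)).const_mul ((2 : ℝ) ^ k))

theorem isNestedPartition_circleLabel (j : Fin 2) : IsNestedPartition (circleLabel j) where
  measurable := measurable_circleLabel j
  nested _ _ _ h := floor_two_pow_mul_eq_of_succ h

theorem circleLabel_zero (j : Fin 2) (x : UnitAddCircle) : circleLabel j 0 x = 0 := by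
  have h := (AddCircle.equivIco (1 : ℝ) 0 (x - (((j : ℝ) / 3 : ℝ) : UnitAddCircle))).2
  rw [circleLabel, Int.floor_eq_iff]
  simpa only [pow_zero, one_mul, Int.cast_zero, zero_add, mem_Ico] using h

/-- Translation invariance reduces to the untranslated arcs, which lift to intervals [z/2ᵏ,
(z+1)/2ᵏ) of the fundamental domain [0, 1). -/
theorem volume_labelCell_circleLabel (j : Fin 2) (k : ℕ) (x : UnitAddCircle) :
    volume (labelCell (circleLabel j) k x) = ENNReal.ofReal ((2 ^ k)⁻¹) := by
  have h2 : (0 : ℝ) < 2 ^ k := by positivity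
  have hm := (isNestedPartition_circleLabel j).measurableSet_labelCell k x
  set c : ℝ := (j : ℝ) / 3
  obtain ⟨z, hz, h0, h1⟩ : ∃ z : ℤ, circleLabel j k x = z ∧ (0 : ℝ) ≤ z ∧ (z + 1 : ℝ) ≤ 2 ^ k := by
    refine ⟨_, rfl, ?_, ?_⟩
    · have h := (AddCircle.equivIco (1 : ℝ) 0 (x - (((j : ℝ) / 3 : ℝ) : UnitAddCircle))).2
      have : 0 ≤ circleLabel j k x := Int.floor_nonneg.2 (mul_nonneg h2.le h.1)
      exact_mod_cast this
    · have h := (AddCircle.equivIco (1 : ℝ) 0 (x - (((j : ℝ) / 3 : ℝ) : UnitAddCircle))).2.2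
      have : circleLabel j k x < 2 ^ k := by
        refine Int.floor_lt.2 ?_
        push_cast
        nlinarith
      exact_mod_cast this
  have e1 : (fun y : UnitAddCircle => y + (c : UnitAddCircle)) ⁻¹' labelCell (circleLabel j) k x =
      {y | ⌊(2 : ℝ) ^ k * (AddCircle.equivIco (1 : ℝ) 0 y : ℝ)⌋ = z} := by
    ext y
    simp only [labelCell, mem_preimage, mem_ofPred_eq, hz]
    rw [circleLabel, add_sub_cancel_right]
  rw [← (measurePreserving_add_right (volume : Measure UnitAddCircle) (c : UnitAddCircle)).measure_preimage
    hm.nullMeasurableSet, e1]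
  have hm2 : MeasurableSet {y : UnitAddCircle | ⌊(2 : ℝ) ^ k * (AddCircle.equivIco (1 : ℝ) 0 y : ℝ)⌋ = z} := by
    rw [← e1]
    exact (measurable_add_const _) hm
  have := AddCircle.add_projection_respects_measure 1 0 hm2
  rw [this, ← measure_congr ((ae_eq_refl _).inter (Ico_ae_eq_Ioc (μ := volume) (a := (0 : ℝ)) (b := 0 + 1)))]
  have e2 : (QuotientAddGroup.mk ⁻¹' {y : UnitAddCircle |
      ⌊(2 : ℝ) ^ k * (AddCircle.equivIco (1 : ℝ) 0 y : ℝ)⌋ = z} ∩ Ico (0 : ℝ) (0 + 1) : Set ℝ) =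
      Ico (z / 2 ^ k : ℝ) ((z + 1) / 2 ^ k) := by
    ext s
    have hs : (0 ≤ s ∧ s < 1) → (AddCircle.equivIco (1 : ℝ) 0 (s : UnitAddCircle) : ℝ) = s := by
      intro h
      rw [AddCircle.coe_equivIco_mk_apply, div_one, mul_one]
      exact Int.fract_eq_self.2 h
    simp only [mem_inter_iff, mem_preimage, mem_ofPred_eq, mem_Ico, zero_add]
    rw [div_le_iff₀ h2, lt_div_iff₀ h2]
    constructor
    · rintro ⟨ha, hb⟩
      erw [hs hb, Int.floor_eq_iff] at ha
      constructor <;> linarith [ha.1, ha.2]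
    · rintro ⟨ha, hb⟩
      have hb' : 0 ≤ s ∧ s < 1 := by
        constructor
        · by_contra! h; nlinarith
        · by_contra! h; nlinarith
      refine ⟨?_, hb'⟩
      erw [hs hb', Int.floor_eq_iff]
      constructor <;> linarith
  rw [e2, Real.volume_Ico]
  congr 1
  field_simp
  ring

/-- The dyadic cubes of the torus, translated by a third in the coordinates selected by `J`. -/
noncomputable def torusLabel {d : ℕ} (J : Fin d → Fin 2) (k : ℕ) (x : UnitAddTorus (Fin d)) :
    Fin d → ℤ :=
  fun i => circleLabel (J i) k (x i)

theorem labelCell_torusLabel {d : ℕ} (J : Fin d → Fin 2) (k : ℕ) (x : UnitAddTorus (Fin d)) :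
    labelCell (torusLabel J) k x = univ.pi fun i => labelCell (circleLabel (J i)) k (x i) := by
  ext y
  simp only [labelCell, torusLabel, mem_ofPred_eq, mem_univ_pi, funext_iff]

theorem volume_labelCell_torusLabel {d : ℕ} (J : Fin d → Fin 2) (k : ℕ)
    (x : UnitAddTorus (Fin d)) :
    volume (labelCell (torusLabel J) k x) = ENNReal.ofReal (((2 ^ k)⁻¹) ^ d) := by
  rw [labelCell_torusLabel, volume_pi_pi]
  simp only [volume_labelCell_circleLabel, Finset.prod_const, Finset.card_univ, Fintype.card_fin]
  rw [ENNReal.ofReal_pow (by positivity)]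

theorem isDyadicFamily_torusLabel (d : ℕ) :
    IsDyadicFamily (torusLabel (d := d)) (volume : Measure (UnitAddTorus (Fin d))) where
  isNestedPartition J :=
    { measurable := fun k => measurable_pi_lambda _ fun i =>
        (measurable_circleLabel (J i) k).comp (measurable_pi_apply i)
      nested := fun k x y h => funext fun i =>
        (isNestedPartition_circleLabel (J i)).nested k _ _ (congrFun h i) }
  measure_pos J k x := by
    rw [volume_labelCell_torusLabel]
    exact ENNReal.ofReal_pos.2 (by positivity)
  measure_lt_top J k x := by
    rw [volume_labelCell_torusLabel]
    exact ENNReal.ofReal_lt_top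

/-- The dyadic maximal function of the torus. -/
noncomputable abbrev torusMax {d : ℕ} (g : UnitAddTorus (Fin d) → ℝ≥0∞)
    (x : UnitAddTorus (Fin d)) : ℝ≥0∞ :=
  dyMax torusLabel volume g x

/-- The cell of level zero is the whole torus, of measure one. -/
theorem lintegral_le_torusMax {d : ℕ} (g : UnitAddTorus (Fin d) → ℝ≥0∞)
    (x : UnitAddTorus (Fin d)) : ∫⁻ y, g y ≤ torusMax g x := by
  have h := setLIntegral_le_dyMax_of_subset (isDyadicFamily_torusLabel d) (j := fun _ => 0) (k := 0)
    (x := x) (B := univ) (by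
      intro y _
      exact funext fun i => (circleLabel_zero _ _).trans (circleLabel_zero _ _).symm) g
  rwa [volume_labelCell_torusLabel, Measure.restrict_univ, pow_zero, inv_one, one_pow,
    ENNReal.ofReal_one, one_mul] at h

theorem exists_coe_eq_of_norm_sub_le {x y : UnitAddCircle} {ξ : ℝ} (hξ : (ξ : UnitAddCircle) = x)
    {R : ℝ} (h : ‖y - x‖ ≤ R) : ∃ η : ℝ, (η : UnitAddCircle) = y ∧ |η - ξ| ≤ R := by
  obtain ⟨η, rfl⟩ := QuotientAddGroup.mk_surjective y
  subst hξ
  have h' : |(η - ξ) - round (η - ξ)| ≤ R := by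
    rw [← UnitAddCircle.norm_eq]
    exact h
  refine ⟨η - round (η - ξ), ?_, by rw [sub_right_comm]; exact h'⟩
  rw [AddCircle.coe_sub, sub_eq_self]
  exact (AddCircle.coe_eq_zero_iff 1).2 ⟨round (η - ξ), by simp⟩

/-- For 6R ≤ 1 the choice between the two grids is made in each coordinate separately and gives a
cube of side less than 12R that contains the ball. For larger R the whole torus serves. -/
theorem setLIntegral_closedBall_le_torusMax {d : ℕ} (g : UnitAddTorus (Fin d) → ℝ≥0∞)
    (x : UnitAddTorus (Fin d)) {R : ℝ} (hR : 0 < R) :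
    ∫⁻ y in Metric.closedBall x R, g y ≤ ENNReal.ofReal ((12 * R) ^ d) * torusMax g x := by
  rcases le_or_gt (6 * R) 1 with h6 | h6
  · obtain ⟨k, hk1, hk2⟩ := exists_three_mul_two_pow_mul_le (L := 2 * R) (by linarith) (by linarith)
    choose ξ hξ using fun i => QuotientAddGroup.mk_surjective (x i)
    have hJ := fun i => exists_floor_two_pow_eq (a := ξ i - R) (b := ξ i + R) (by linarith) (k := k)
      (by rw [show ξ i + R - (ξ i - R) = 2 * R by ring]; exact hk1)
    choose J hJ using hJ
    have hsub : Metric.closedBall x R ⊆ labelCell (torusLabel J) k x := by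
      intro y hy
      rw [mem_closedBall_iff_norm, pi_norm_le_iff_of_nonneg hR.le] at hy
      refine funext fun i => ?_
      obtain ⟨η, hη, hηξ⟩ := exists_coe_eq_of_norm_sub_le (hξ i) (hy i)
      rw [abs_le] at hηξ
      have := circleLabel_coe_eq (hJ i η ⟨by linarith, by linarith⟩ (ξ i) ⟨by linarith, by linarith⟩)
      rw [torusLabel, torusLabel, ← hη, this]
      congr 1
      exact hξ i
    refine (setLIntegral_le_dyMax_of_subset (isDyadicFamily_torusLabel d) hsub g).trans ?_
    rw [volume_labelCell_torusLabel]
    refine mul_le_mul_left (ENNReal.ofReal_le_ofReal (pow_le_pow_left₀ (by positivity) ?_ d)) _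
    rw [inv_le_iff_one_le_mul₀ (by positivity)]
    linarith
  · refine (setLIntegral_le_lintegral _ _).trans ((lintegral_le_torusMax g x).trans ?_)
    conv_lhs => rw [← one_mul (torusMax g x)]
    refine mul_le_mul_left ?_ _
    rw [ENNReal.one_le_ofReal]
    exact one_le_pow₀ (by linarith)

/-- The integral over a ball of `ℝᵈ` of a function lifted from the torus. -/
theorem setLIntegral_torusMk_le_torusMax {d : ℕ} (g : UnitAddTorus (Fin d) → ℝ≥0∞)
    (hg : Measurable g) (x : UnitAddTorus (Fin d)) {R : ℝ} (hR : 0 < R) :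
    ∫⁻ y in Metric.closedBall (0 : Fin d → ℝ) R, g (x - torusMk y) ≤
      ENNReal.ofReal ((12 * R) ^ d) * torusMax g x := by
  have htr : ∫⁻ z, g (x - z) = ∫⁻ z, g z := lintegral_sub_left_eq_self g x
  have hgm : Measurable fun y => g (x - torusMk y) :=
    hg.comp (measurable_torusMk.const_sub x)
  rcases lt_or_ge R (1 / 2) with h | h
  -- A ball of radius below 1/2 lies in a fundamental domain, so it projects without overlap into
  -- the ball of the torus.
  · have key : ∫⁻ y in Metric.closedBall (0 : Fin d → ℝ) R, g (x - torusMk y) ≤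
        ∫⁻ z, (Metric.closedBall (0 : UnitAddTorus (Fin d)) R).indicator (fun z => g (x - z)) z := by
      rw [lintegral_torus_eq _ (fun _ => -(1 / 2))]
      have hsub : Metric.closedBall (0 : Fin d → ℝ) R ⊆
          {y : Fin d → ℝ | ∀ i, y i ∈ Ioc (-(1 / 2) : ℝ) (-(1 / 2) + 1)} := by
        intro y hy i
        rw [mem_closedBall_zero_iff, pi_norm_le_iff_of_nonneg hR.le] at hy
        have := abs_le.1 (hy i)
        constructor <;> linarith [this.1, this.2]
      refine le_trans (le_of_eq ?_) (lintegral_mono_set hsub)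
      refine setLIntegral_congr_fun Metric.isClosed_closedBall.measurableSet fun y hy => ?_
      rw [indicator_of_mem]
      rw [mem_closedBall_zero_iff] at hy ⊢
      exact (norm_torusMk_le y).trans hy
    refine key.trans (le_trans (le_of_eq ?_) (setLIntegral_closedBall_le_torusMax g x hR))
    rw [← lintegral_sub_left_eq_self _ x]
    rw [← lintegral_indicator Metric.isClosed_closedBall.measurableSet]
    refine lintegral_congr fun y => ?_
    by_cases hy : y ∈ Metric.closedBall x R
    · rw [indicator_of_mem, indicator_of_mem hy, sub_sub_cancel]
      rw [mem_closedBall_zero_iff, ← norm_neg, neg_sub]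
      exact mem_closedBall_iff_norm.1 hy
    · rw [indicator_of_notMem, indicator_of_notMem hy]
      rw [mem_closedBall_zero_iff, ← norm_neg, neg_sub]
      exact fun h => hy (mem_closedBall_iff_norm.2 h)
  -- A large ball is covered by (2n + 1)^d unit cubes, each contributing the integral over the
  -- torus. The count is admissible because 2⌈R⌉ + 3 < 2R + 5 ≤ 12R for R ≥ 1/2.
  · set n : ℤ := ⌈R⌉ + 1 with hn
    have hcover : Metric.closedBall (0 : Fin d → ℝ) R ⊆
        ⋃ v ∈ Fintype.piFinset (fun _ : Fin d => Finset.Icc (-n) n),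
          {y : Fin d → ℝ | ∀ i, y i ∈ Ioc ((v i : ℝ) - 1 / 2) ((v i : ℝ) - 1 / 2 + 1)} := by
      intro y hy
      rw [mem_closedBall_zero_iff, pi_norm_le_iff_of_nonneg hR.le] at hy
      simp only [mem_iUnion, Fintype.mem_piFinset, Finset.mem_Icc]
      refine ⟨fun i => ⌈y i - 1 / 2⌉, fun i => ?_, fun i => ?_⟩
      · have h1 := abs_le.1 (hy i)
        have h2 := Int.le_ceil R
        have h3 := Int.le_ceil (y i - 1 / 2)
        constructor
        · have : (-n : ℝ) ≤ ⌈y i - 1 / 2⌉ := by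
            rw [hn]; push_cast; linarith [h1.1]
          exact_mod_cast this
        · refine Int.ceil_le.2 ?_
          rw [hn]; push_cast; linarith [h1.2]
      · have h3 := Int.le_ceil (y i - 1 / 2)
        have h4 := Int.ceil_lt_add_one (y i - 1 / 2)
        constructor <;> linarith
    refine (lintegral_mono_set hcover).trans ?_
    rw [← Finset.set_biUnion_coe, biUnion_eq_iUnion]
    refine (lintegral_iUnion_le _ _).trans ?_
    rw [tsum_fintype]
    have e : ∀ v : Fin d → ℤ, ∫⁻ y in {y : Fin d → ℝ | ∀ i, y i ∈ Ioc ((v i : ℝ) - 1 / 2)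
        ((v i : ℝ) - 1 / 2 + 1)}, g (x - torusMk y) = ∫⁻ z, g z := by
      intro v
      rw [← lintegral_torus_eq (fun z => g (x - z)) (fun i => (v i : ℝ) - 1 / 2), htr]
    simp only [e, Finset.sum_const, Finset.coe_sort_coe, Fintype.card_coe, Fintype.card_piFinset, Int.card_Icc, Finset.prod_const,
      Finset.card_univ, Fintype.card_fin, nsmul_eq_mul]
    refine mul_le_mul' ?_ (lintegral_le_torusMax g x)
    rw [← ENNReal.ofReal_natCast]
    refine ENNReal.ofReal_le_ofReal ?_
    push_cast
    refine pow_le_pow_left₀ (by positivity) ?_ d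
    have h2 := Int.ceil_lt_add_one R
    have h3 := Int.ceil_pos.2 hR
    have : ((n + 1 - -n).toNat : ℝ) = 2 * (⌈R⌉ : ℝ) + 3 := by
      have : ((n + 1 - -n).toNat : ℤ) = 2 * ⌈R⌉ + 3 := by omega
      exact_mod_cast this
    rw [this]
    linarith

theorem setLIntegral_euclidean_le_torusMax {d : ℕ} (g : UnitAddTorus (Fin d) → ℝ≥0∞)
    (hg : Measurable g) (x : UnitAddTorus (Fin d)) {R : ℝ} (hR : 0 < R) :
    ∫⁻ y in Metric.closedBall (0 : EuclideanSpace ℝ (Fin d)) R, g (x - torusMk y.ofLp) ≤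
      ENNReal.ofReal ((12 * R) ^ d) * torusMax g x := by
  refine le_trans ?_ (setLIntegral_torusMk_le_torusMax g hg x hR)
  have hmp := PiLp.volume_preserving_ofLp (Fin d)
  have h := hmp.setLIntegral_comp_preimage (s := Metric.closedBall (0 : Fin d → ℝ) R)
    Metric.isClosed_closedBall.measurableSet (hg.comp (measurable_torusMk.const_sub x))
  refine le_trans (lintegral_mono_set ?_) (le_of_eq h)
  intro y hy
  rw [mem_closedBall_zero_iff] at hy
  rw [mem_preimage, mem_closedBall_zero_iff, pi_norm_le_iff_of_nonneg hR.le]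
  exact fun i => (PiLp.norm_apply_le y i).trans hy

/-! ### Decomposition into shells -/

/-- Summation over the shells where r + ρ is about 2ʲr. Decay of order m + θ against growth R^m of
the mass leaves a geometric series of ratio 2^{-θ} and the gain r^{-θ}; the decay beyond the growth
is what makes kernel estimates scale correctly. -/
theorem lintegral_inv_pow_mul_le_of_shells {S : Type*} [MeasurableSpace S] {μ : Measure S}
    {g : S → ℝ≥0∞} (hg : Measurable g) {ρ : S → ℝ} (hρm : Measurable ρ) (hρ : ∀ x, 0 ≤ ρ x)
    {r : ℝ} (hr : 0 < r) {A : ℝ≥0∞} {m θ : ℕ} (hθ : 1 ≤ θ)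
    (h : ∀ R, r ≤ R → ∫⁻ x in {x | ρ x ≤ R}, g x ∂μ ≤ A * ENNReal.ofReal (R ^ m)) :
    ∫⁻ x, ENNReal.ofReal (((r + ρ x) ^ (m + θ))⁻¹) * g x ∂μ ≤
      ENNReal.ofReal (2 ^ (m + θ + 1) * (r ^ θ)⁻¹) * A := by
  set B : ℕ → Set S := fun j => {x | ρ x ≤ 2 ^ j * r}
  have hB : ∀ j, MeasurableSet (B j) := fun j => measurableSet_le hρm measurable_const
  set c : ℕ → ℝ := fun j => ((2 ^ j * r / 2) ^ (m + θ))⁻¹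
  have hpt : ∀ x, ENNReal.ofReal (((r + ρ x) ^ (m + θ))⁻¹) * g x ≤
      ∑' j, (B j).indicator (fun x => ENNReal.ofReal (c j) * g x) x := by
    intro x
    obtain ⟨j, hj1, hj2⟩ := exists_nat_pow_near (x := (r + ρ x) / r) (y := (2 : ℝ))
      (by rw [le_div_iff₀ hr]; linarith [hρ x]) (by norm_num)
    rw [le_div_iff₀ hr] at hj1
    rw [div_lt_iff₀ hr] at hj2
    -- A point with 2ʲr ≤ r + ρ < 2ʲ⁺¹r is charged to the ball of index j + 1; the halving in the
    -- definition of `c` compensates for this shift.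
    refine le_trans ?_ (ENNReal.le_tsum (j + 1))
    have hmem : x ∈ B (j + 1) := show ρ x ≤ 2 ^ (j + 1) * r by linarith
    rw [indicator_of_mem hmem]
    refine mul_le_mul_left (ENNReal.ofReal_le_ofReal ?_) _
    refine inv_anti₀ (by positivity) (pow_le_pow_left₀ (by positivity) ?_ _)
    rw [pow_succ]; linarith
  refine (lintegral_mono hpt).trans ?_
  rw [lintegral_tsum fun j => ((hg.const_mul _).indicator (hB j)).aemeasurable]
  have hterm : ∀ j, ∫⁻ x, (B j).indicator (fun x => ENNReal.ofReal (c j) * g x) x ∂μ ≤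
      ENNReal.ofReal (2 ^ (m + θ) * (r ^ θ)⁻¹) * A * (2 ^ j)⁻¹ := by
    intro j
    rw [lintegral_indicator (hB j), lintegral_const_mul _ hg]
    refine (mul_le_mul_right (h (2 ^ j * r) ?_) _).trans ?_
    · nlinarith [one_le_pow₀ (M₀ := ℝ) (a := 2) one_le_two (n := j)]
    have e : ((2 : ℝ≥0∞) ^ j)⁻¹ = ENNReal.ofReal ((2 ^ j)⁻¹) := by
      rw [ENNReal.ofReal_inv_of_pos (by positivity), ENNReal.ofReal_pow (by norm_num)]
      simp
    rw [e, mul_left_comm, ← ENNReal.ofReal_mul (by positivity), mul_right_comm,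
      ← ENNReal.ofReal_mul (by positivity), mul_comm]
    refine mul_le_mul_left (ENNReal.ofReal_le_ofReal ?_) _
    have h2 : (0 : ℝ) < 2 ^ j := by positivity
    have e1 : c j * (2 ^ j * r) ^ m = 2 ^ (m + θ) * (r ^ θ)⁻¹ * ((2 ^ j) ^ θ)⁻¹ := by
      simp only [c]
      rw [div_pow, mul_pow, mul_pow, pow_add (2 ^ j : ℝ), pow_add r]
      field_simp
    rw [e1]
    refine mul_le_mul_of_nonneg_left ?_ (by positivity)
    refine inv_anti₀ h2 (le_self_pow₀ (one_le_pow₀ one_le_two) (by omega))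
  refine (ENNReal.tsum_le_tsum hterm).trans ?_
  rw [ENNReal.tsum_mul_left, ENNReal.tsum_two_pow_inv, mul_right_comm]
  refine mul_le_mul_left (le_of_eq ?_) _
  rw [pow_succ _ (m + θ), mul_right_comm, ENNReal.ofReal_mul (p := _ * _) (by positivity)]
  simp

/-! ### Measurable dependence of maximal functions on parameters -/

theorem measurable_dyMax_uncurry {X S ι J : Type*} [MeasurableSpace X] [MeasurableSpace S]
    [MeasurableSpace ι] [Countable ι] [MeasurableSingletonClass ι] [Countable J]
    {P : J → ℕ → S → ι} {μ : Measure S} [SFinite μ] (hP : IsDyadicFamily P μ)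
    {g : X × S → ℝ≥0∞} (hg : Measurable g) :
    Measurable fun z : X × S => dyMax P μ (fun s => g (z.1, s)) z.2 := by
  refine Measurable.iSup fun j => Measurable.iSup fun k => Measurable.div ?_ ?_
  · have e : (fun z : X × S => ∫⁻ y in labelCell (P j) k z.2, g (z.1, y) ∂μ) =
        fun z => ∫⁻ y, {y : (X × S) × S | P j k y.2 = P j k y.1.2}.indicator
          (fun y => g (y.1.1, y.2)) (z, y) ∂μ := by
      funext z
      rw [← lintegral_indicator (((hP.isNestedPartition j).measurableSet_labelCell k z.2))]
      rfl
    rw [e]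
    refine Measurable.lintegral_prod_right' (Measurable.indicator (by fun_prop) ?_)
    have hm := (hP.isNestedPartition j).measurable k
    exact measurableSet_eq_fun (hm.comp measurable_snd)
      (hm.comp (measurable_snd.comp measurable_fst))
  · have e : (fun z : X × S => μ (labelCell (P j) k z.2)) =
        (fun i => μ (P j k ⁻¹' {i})) ∘ P j k ∘ Prod.snd := rfl
    rw [e]
    exact Measurable.of_discrete.comp (((hP.isNestedPartition j).measurable k).comp measurable_snd)

/-! ### Parabolic dyadic cells in space-time -/

section SpaceTimeCells

variable {d : ℕ}

/-- The parabolic cells of length `16^{-k}` in time and side `2^{-k}` in space. -/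
noncomputable def stLabel (m k : ℕ) (z : ℝ × UnitAddTorus (Fin d)) : ℤ × (Fin d → ℤ) :=
  -- Time cells of level zero have length 2^m, so level m + 4k has length 16⁻ᵏ. Only the
  -- untranslated grids occur here, because the sharp function inequality needs one nested sequence
  -- of partitions.
  (timeLabel m 0 (m + 4 * k) z.1, torusLabel (fun _ => 0) k z.2)

theorem labelCell_stLabel (m k : ℕ) (z : ℝ × UnitAddTorus (Fin d)) :
    labelCell (stLabel m) k z =
      labelCell (timeLabel m 0) (m + 4 * k) z.1 ×ˢ labelCell (torusLabel fun _ => 0) k z.2 := by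
  ext y
  simp only [labelCell, stLabel, mem_ofPred_eq, Prod.mk.injEq, mem_prod]

theorem isNestedPartition_stLabel (m : ℕ) :
    IsNestedPartition (stLabel m : ℕ → ℝ × UnitAddTorus (Fin d) → ℤ × (Fin d → ℤ)) where
  measurable k := by
    have h1 := ((isDyadicFamily_timeLabel m).isNestedPartition 0).measurable (m + 4 * k)
    have h2 := ((isDyadicFamily_torusLabel d).isNestedPartition fun _ => 0).measurable k
    exact (h1.comp measurable_fst).prodMk (h2.comp measurable_snd)
  nested k x y h := by
    rw [stLabel, stLabel, Prod.mk.injEq] at h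
    have h1 := ((isDyadicFamily_timeLabel m).isNestedPartition 0).labelCell_subset
      (show m + 4 * k ≤ m + 4 * (k + 1) by omega) y.1 h.1
    have h2 := ((isDyadicFamily_torusLabel d).isNestedPartition fun _ => 0).labelCell_subset
      (Nat.le_succ k) y.2 h.2
    exact Prod.ext h1 h2

/-- The volume on `[0, N) × 𝕋ᵈ`. -/
noncomputable def slabMeasure (d N : ℕ) : Measure (ℝ × UnitAddTorus (Fin d)) :=
  (volume.restrict (Ico (0 : ℝ) N)).prod volume

instance (N : ℕ) : IsFiniteMeasure (slabMeasure d N) := by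
  unfold slabMeasure; infer_instance

/-- From level m on, the time cells refine the unit intervals between integers. Hence the slab [0,
N) × 𝕋ᵈ is a union of parabolic cells. -/
theorem floor_eq_of_mem_labelCell {m k : ℕ} {s t : ℝ}
    (h : s ∈ labelCell (timeLabel m 0) (m + 4 * k) t) : ⌊s⌋ = ⌊t⌋ := by
  have h1 := ((isDyadicFamily_timeLabel m).isNestedPartition 0).labelCell_subset
    (show m ≤ m + 4 * k by omega) t h
  have e : ∀ u : ℝ, timeLabel m 0 m u = ⌊u⌋ := by
    intro u
    simp only [timeLabel, Fin.val_zero, Nat.cast_zero, zero_div, sub_zero]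
    congr 1
    field_simp
  have h2 : timeLabel m 0 m s = timeLabel m 0 m t := h1
  rwa [e, e] at h2

theorem mem_Ico_natCast_iff {N : ℕ} {s t : ℝ} (h : ⌊s⌋ = ⌊t⌋) :
    s ∈ Ico (0 : ℝ) N ↔ t ∈ Ico (0 : ℝ) N := by
  have e : ∀ u : ℝ, u ∈ Ico (0 : ℝ) N ↔ 0 ≤ ⌊u⌋ ∧ ⌊u⌋ < N := by
    intro u
    rw [mem_Ico, Int.floor_nonneg, Int.floor_lt]
    simp
  rw [e, e, h]

theorem slabMeasure_restrict_labelCell {m N k : ℕ} {z : ℝ × UnitAddTorus (Fin d)}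
    (hz : z.1 ∈ Ico (0 : ℝ) N) :
    (slabMeasure d N).restrict (labelCell (stLabel m) k z) =
      (volume.restrict (labelCell (timeLabel m 0) (m + 4 * k) z.1)).prod
        (volume.restrict (labelCell (torusLabel fun _ => 0) k z.2)) := by
  rw [labelCell_stLabel, slabMeasure, ← Measure.prod_restrict, Measure.restrict_restrict
    (((isDyadicFamily_timeLabel m).isNestedPartition 0).measurableSet_labelCell _ _),
    inter_eq_self_of_subset_left]
  exact fun s hs => (mem_Ico_natCast_iff (floor_eq_of_mem_labelCell hs)).2 hz

theorem slabMeasure_labelCell {m N k : ℕ} {z : ℝ × UnitAddTorus (Fin d)}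
    (hz : z.1 ∈ Ico (0 : ℝ) N) :
    slabMeasure d N (labelCell (stLabel m) k z) =
      volume (labelCell (timeLabel m 0) (m + 4 * k) z.1) *
        volume (labelCell (torusLabel fun _ => 0) k z.2) := by
  rw [← Measure.restrict_apply_univ, slabMeasure_restrict_labelCell hz, ← univ_prod_univ,
    Measure.prod_prod, Measure.restrict_apply_univ, Measure.restrict_apply_univ]

theorem slabMeasure_labelCell_eq_ofReal {m N k : ℕ} {z : ℝ × UnitAddTorus (Fin d)}
    (hz : z.1 ∈ Ico (0 : ℝ) N) :
    slabMeasure d N (labelCell (stLabel m) k z) = ENNReal.ofReal ((16 ^ k)⁻¹ * ((2 ^ k)⁻¹) ^ d) := by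
  rw [slabMeasure_labelCell hz, volume_labelCell_timeLabel, volume_labelCell_torusLabel,
    ← ENNReal.ofReal_mul (by positivity), pow_add, pow_mul]
  congr 2
  field_simp
  norm_num

theorem slabMeasure_labelCell_of_notMem {m N k : ℕ} {z : ℝ × UnitAddTorus (Fin d)}
    (hz : z.1 ∉ Ico (0 : ℝ) N) : slabMeasure d N (labelCell (stLabel m) k z) = 0 := by
  have hI := ((isDyadicFamily_timeLabel m).isNestedPartition 0).measurableSet_labelCell
    (m + 4 * k) z.1
  rw [labelCell_stLabel, slabMeasure, Measure.prod_prod, Measure.restrict_apply hI]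
  have : labelCell (timeLabel m 0) (m + 4 * k) z.1 ∩ Ico (0 : ℝ) N = ∅ := by
    refine eq_empty_of_forall_notMem fun s hs => hz ?_
    exact (mem_Ico_natCast_iff (floor_eq_of_mem_labelCell hs.1)).1 hs.2
  rw [this, measure_empty, zero_mul]

theorem slabMeasure_labelCell_le (m N k : ℕ) (z : ℝ × UnitAddTorus (Fin d)) :
    slabMeasure d N (labelCell (stLabel m) k z) ≤
      ENNReal.ofReal (16 * 2 ^ d) * slabMeasure d N (labelCell (stLabel m) (k + 1) z) := by
  by_cases hz : z.1 ∈ Ico (0 : ℝ) N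
  · rw [slabMeasure_labelCell_eq_ofReal hz, slabMeasure_labelCell_eq_ofReal hz,
      ← ENNReal.ofReal_mul (by positivity)]
    refine ENNReal.ofReal_le_ofReal (le_of_eq ?_)
    rw [pow_succ, pow_succ, mul_inv, mul_inv, mul_pow, inv_pow 2 d]
    field_simp
  · rw [slabMeasure_labelCell_of_notMem hz]
    exact zero_le

theorem lintegral_slabMeasure_fst (N : ℕ) {g : ℝ → ℝ≥0∞} (hg : Measurable g) :
    ∫⁻ z, g z.1 ∂(slabMeasure d N) = ∫⁻ t in Ico (0 : ℝ) N, g t := by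
  have hm : Measurable fun z : ℝ × UnitAddTorus (Fin d) => g z.1 := hg.comp measurable_fst
  rw [slabMeasure, lintegral_prod _ hm.aemeasurable]
  simp

theorem setLIntegral_labelCell_slabMeasure_fst {m N k : ℕ} {z : ℝ × UnitAddTorus (Fin d)}
    (hz : z.1 ∈ Ico (0 : ℝ) N) {g : ℝ → ℝ≥0∞} (hg : Measurable g) :
    ∫⁻ y in labelCell (stLabel m) k z, g y.1 ∂(slabMeasure d N) =
      (∫⁻ t in labelCell (timeLabel m 0) (m + 4 * k) z.1, g t) *
        volume (labelCell (torusLabel fun _ => 0) k z.2) := by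
  have hm : Measurable fun z : ℝ × UnitAddTorus (Fin d) => g z.1 := hg.comp measurable_fst
  rw [slabMeasure_restrict_labelCell hz, lintegral_prod _ hm.aemeasurable]
  simp only [lintegral_const, Measure.restrict_apply_univ]
  rw [lintegral_mul_const _ hg]

/-- The `A_∞` property on parabolic cells of a weight depending only on time. -/
theorem withDensity_fst_le_of_two_mul_measure_le {m N k : ℕ} {z : ℝ × UnitAddTorus (Fin d)}
    {v : ℝ → ℝ≥0∞} (hvm : Measurable v) (hv : ∀ᵐ t, 0 < v t ∧ v t < ⊤) {r : ℝ} (hr : 1 < r)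
    {K : ℝ} (hK : 1 ≤ K) (hA : CellAp (timeLabel m) volume r (ENNReal.ofReal K) v)
    {A : Set (ℝ × UnitAddTorus (Fin d))} (hAm : MeasurableSet A)
    (hAQ : A ⊆ labelCell (stLabel m) k z)
    (h2 : 2 * slabMeasure d N A ≤ slabMeasure d N (labelCell (stLabel m) k z)) :
    (slabMeasure d N).withDensity (fun y => v y.1) A ≤ ENNReal.ofReal (1 - (2 ^ r * K)⁻¹) *
      (slabMeasure d N).withDensity (fun y => v y.1) (labelCell (stLabel m) k z) := by
  have hQ := (isNestedPartition_stLabel (d := d) m).measurableSet_labelCell k z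
  by_cases hz : z.1 ∈ Ico (0 : ℝ) N
  · have hv' : ∀ᵐ y ∂(slabMeasure d N), 0 < v y.1 ∧ v y.1 < ⊤ := by
      have : ∀ᵐ t ∂(volume.restrict (Ico (0 : ℝ) N)), 0 < v t ∧ v t < ⊤ := ae_restrict_of_ae hv
      exact Measure.quasiMeasurePreserving_fst.ae this
    have hr1 : 0 ≤ r - 1 := by linarith
    set I := labelCell (timeLabel m 0) (m + 4 * k) z.1
    set c := volume (labelCell (torusLabel (d := d) fun _ => 0) k z.2) with hc
    have hc0 : c ≠ 0 := ((isDyadicFamily_torusLabel d).measure_pos _ _ _).ne'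
    have hct : c ≠ ⊤ := ((isDyadicFamily_torusLabel d).measure_lt_top _ _ _).ne
    have hfin := hA.lintegral_ne_top (isDyadicFamily_timeLabel m) hr ENNReal.ofReal_ne_top hvm hv 0
      (m + 4 * k) z.1
    rw [withDensity_apply _ hAm, withDensity_apply _ hQ]
    have hm : Measurable fun z : ℝ × UnitAddTorus (Fin d) => v z.1 := hvm.comp measurable_fst
    refine setLIntegral_le_of_two_mul_measure_le hm hv' hr hK hQ ?_ ?_ ?_ ?_
      hAm hAQ h2
    · rw [slabMeasure_labelCell_eq_ofReal hz]
      exact (ENNReal.ofReal_pos.2 (by positivity)).ne'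
    · exact measure_ne_top _ _
    · rw [setLIntegral_labelCell_slabMeasure_fst hz hvm]
      exact ENNReal.mul_ne_top hfin.1 hct
    -- The cell is a product and the weight depends on time only, so its measure `c` in space
    -- factors out of both integrals. The condition becomes that of `v` on the time cell, multiplied
    -- by c^r.
    · rw [setLIntegral_labelCell_slabMeasure_fst hz hvm,
        setLIntegral_labelCell_slabMeasure_fst hz (hvm.pow_const _), slabMeasure_labelCell hz,
        ENNReal.mul_rpow_of_nonneg _ _ hr1, ENNReal.mul_rpow_of_nonneg _ _ (by linarith)]
      have e : c ^ r = c * c ^ (r - 1) := by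
        have := ENNReal.rpow_add 1 (r - 1) hc0 hct
        rwa [ENNReal.rpow_one, add_sub_cancel] at this
      rw [e, mul_mul_mul_comm, ← mul_assoc (ENNReal.ofReal K)]
      exact mul_le_mul_left (hA 0 (m + 4 * k) z.1) _
  · have h0 : (slabMeasure d N).withDensity (fun y => v y.1) (labelCell (stLabel m) k z) = 0 :=
      withDensity_absolutelyContinuous _ _ (slabMeasure_labelCell_of_notMem hz)
    rw [h0, mul_zero]
    exact (measure_mono hAQ).trans h0.le

/-- Points of a cell differ by a short vector. -/
theorem exists_add_torusMk_eq_of_mem_labelCell {k : ℕ} {x x₀ : UnitAddTorus (Fin d)}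
    (h : x ∈ labelCell (torusLabel fun _ => 0) k x₀) :
    ∃ e : EuclideanSpace ℝ (Fin d), x = x₀ + torusMk e.ofLp ∧ ‖e‖ ≤ d * (2 ^ k)⁻¹ := by
  have h2 : (0 : ℝ) < 2 ^ k := by positivity
  set ρ : UnitAddCircle → ℝ := fun y => (AddCircle.equivIco (1 : ℝ) 0 y : ℝ)
  have hρ : ∀ y, ((ρ y : ℝ) : UnitAddCircle) = y := fun y => AddCircle.coe_equivIco
  have hlab : ∀ y, circleLabel 0 k y = ⌊(2 : ℝ) ^ k * ρ y⌋ := by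
    intro y
    simp [circleLabel, ρ]
  have hd : ∀ i, |ρ (x i) - ρ (x₀ i)| ≤ (2 ^ k)⁻¹ := by
    intro i
    have hi : circleLabel 0 k (x i) = circleLabel 0 k (x₀ i) := congrFun h i
    rw [hlab, hlab] at hi
    have := Int.abs_sub_lt_one_of_floor_eq_floor hi
    rw [← mul_sub, abs_mul, abs_of_pos h2] at this
    rw [inv_eq_one_div, le_div_iff₀ h2]
    linarith
  refine ⟨WithLp.toLp 2 fun i => ρ (x i) - ρ (x₀ i), ?_, ?_⟩
  · funext i
    simp only [Pi.add_apply, torusMk, AddCircle.coe_sub, hρ, add_sub_cancel]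
  · rw [EuclideanSpace.norm_eq]
    refine Real.sqrt_le_iff.2 ⟨by positivity, ?_⟩
    calc ∑ i, ‖ρ (x i) - ρ (x₀ i)‖ ^ 2 ≤ ∑ _i : Fin d, ((2 ^ k)⁻¹ : ℝ) ^ 2 :=
          Finset.sum_le_sum fun i _ => pow_le_pow_left₀ (norm_nonneg _) (hd i) 2
      _ = d * ((2 ^ k)⁻¹ : ℝ) ^ 2 := by simp
      _ ≤ (d * (2 ^ k)⁻¹) ^ 2 := by
          rw [mul_pow]
          refine mul_le_mul_of_nonneg_right ?_ (by positivity)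
          exact_mod_cast Nat.le_self_pow two_ne_zero d

end SpaceTimeCells
open scoped SchwartzMap

/-! ### Rescaled Schwartz functions -/

section ScaledKernel

variable {d : ℕ}

theorem SchwartzMap.exists_norm_le_inv_one_add_pow (Φ : 𝓢(EuclideanSpace ℝ (Fin d), ℂ)) (n : ℕ) :
    ∃ A : ℝ, 0 ≤ A ∧ ∀ y, ‖Φ y‖ ≤ A * ((1 + ‖y‖) ^ n)⁻¹ ∧
      ‖fderiv ℝ Φ y‖ ≤ A * ((1 + ‖y‖) ^ n)⁻¹ := by
  set A : ℝ := 2 ^ n * ((Finset.Iic (n, 1)).sup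
    (fun m : ℕ × ℕ => SchwartzMap.seminorm ℝ m.1 m.2)) Φ
  refine ⟨A, by positivity, fun y => ⟨?_, ?_⟩⟩
  · have h := SchwartzMap.one_add_le_sup_seminorm_apply (𝕜 := ℝ) (m := (n, 1)) le_rfl
      (Nat.zero_le _) Φ y
    rw [norm_iteratedFDeriv_zero] at h
    rw [← div_eq_mul_inv, le_div_iff₀ (by positivity), mul_comm]
    exact h
  · have h := SchwartzMap.one_add_le_sup_seminorm_apply (𝕜 := ℝ) (m := (n, 1)) le_rfl
      le_rfl Φ y
    rw [norm_iteratedFDeriv_one] at h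
    rw [← div_eq_mul_inv, le_div_iff₀ (by positivity), mul_comm]
    exact h

/-- The function `r^{-(d+m)} Φ(y/r)`. -/
noncomputable def scaledKernel (m : ℕ) (Φ : EuclideanSpace ℝ (Fin d) → ℂ) (r : ℝ)
    (y : EuclideanSpace ℝ (Fin d)) : ℂ :=
  ((r ^ (d + m))⁻¹ : ℝ) • Φ (r⁻¹ • y)

/-- Rescaling of decay: the left-hand side equals r^{n-m} (r + u)^{-n}, and the remaining power of r
is bounded because r ≤ R. -/
theorem inv_pow_mul_inv_one_add_pow_le {m n : ℕ} (hmn : m ≤ n) {r R : ℝ} (hr : 0 < r)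
    (hrR : r ≤ R) (hR : 1 ≤ R) {u : ℝ} (hu : 0 ≤ u) {j : ℕ} (hj : n ≤ m + j) :
    (r ^ m)⁻¹ * ((1 + r⁻¹ * u) ^ n)⁻¹ ≤ R ^ j * ((r + u) ^ n)⁻¹ := by
  have e : (r ^ m)⁻¹ * ((1 + r⁻¹ * u) ^ n)⁻¹ = r ^ (n - m) * ((r + u) ^ n)⁻¹ := by
    have h1 : 1 + r⁻¹ * u = (r + u) / r := by field_simp
    obtain ⟨i, rfl⟩ := Nat.exists_eq_add_of_le hmn
    rw [h1, div_pow, inv_div, Nat.add_sub_cancel_left, pow_add r]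
    field_simp
  rw [e]
  refine mul_le_mul_of_nonneg_right ?_ (by positivity)
  exact (pow_le_pow_left₀ hr.le hrR _).trans (pow_le_pow_right₀ hR (by omega))

/-- The size bound with the critical order d + 4. Derivatives of order below four are less singular
and obey the same bound on a bounded range of radii, so all m ≤ 4 are treated together. -/
theorem norm_scaledKernel_le (Φ : 𝓢(EuclideanSpace ℝ (Fin d), ℂ)) {R : ℝ} (hR : 1 ≤ R) :
    ∃ A : ℝ, 0 ≤ A ∧ ∀ m ≤ 4, ∀ r, 0 < r → r ≤ R → ∀ y,
      ‖scaledKernel m Φ r y‖ ≤ A * ((r + ‖y‖) ^ (d + 4))⁻¹ := by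
  obtain ⟨A, hA, h⟩ := Φ.exists_norm_le_inv_one_add_pow (d + 4)
  refine ⟨A * R ^ 4, by positivity, fun m hm r hr hrR y => ?_⟩
  have h1 := (h (r⁻¹ • y)).1
  rw [norm_smul, norm_inv, Real.norm_of_nonneg hr.le] at h1
  rw [scaledKernel, norm_smul, norm_inv, Real.norm_of_nonneg (by positivity)]
  have h2 := inv_pow_mul_inv_one_add_pow_le (m := d + m) (n := d + 4) (by omega) hr hrR hR
    (norm_nonneg y) (j := 4) (by omega)
  calc (r ^ (d + m))⁻¹ * ‖Φ (r⁻¹ • y)‖ ≤ (r ^ (d + m))⁻¹ * (A * ((1 + r⁻¹ * ‖y‖) ^ (d + 4))⁻¹) :=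
        mul_le_mul_of_nonneg_left h1 (by positivity)
    _ = A * ((r ^ (d + m))⁻¹ * ((1 + r⁻¹ * ‖y‖) ^ (d + 4))⁻¹) := by ring
    _ ≤ A * (R ^ 4 * ((r + ‖y‖) ^ (d + 4))⁻¹) := mul_le_mul_of_nonneg_left h2 hA
    _ = _ := by ring

/-- The mean value inequality on a segment of bounded length, along which 1 + ‖x‖ is comparable with
1 + ‖a‖. -/
theorem norm_add_sub_le_of_norm_fderiv_le {Φ : EuclideanSpace ℝ (Fin d) → ℂ}
    (hΦ : Differentiable ℝ Φ) {A : ℝ} (hA : 0 ≤ A) {n : ℕ}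
    (h : ∀ y, ‖fderiv ℝ Φ y‖ ≤ A * ((1 + ‖y‖) ^ n)⁻¹) {Λ : ℝ} (a : EuclideanSpace ℝ (Fin d))
    {v : EuclideanSpace ℝ (Fin d)} (hv : ‖v‖ ≤ Λ) :
    ‖Φ (a + v) - Φ a‖ ≤ A * (1 + Λ) ^ n * ((1 + ‖a‖) ^ n)⁻¹ * ‖v‖ := by
  have hΛ : 0 ≤ Λ := (norm_nonneg v).trans hv
  have := (convex_segment a (a + v)).norm_image_sub_le_of_norm_fderiv_le (𝕜 := ℝ) (f := Φ)
    (fun x _ => hΦ x) (C := A * (1 + Λ) ^ n * ((1 + ‖a‖) ^ n)⁻¹) (fun x hx => ?_)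
    (left_mem_segment ℝ _ _) (right_mem_segment ℝ _ _)
  · simpa using this
  · refine (h x).trans ?_
    have hxa : ‖x - a‖ ≤ Λ := by
      rw [segment_eq_image'] at hx
      obtain ⟨θ, hθ, rfl⟩ := hx
      simp only [add_sub_cancel_left, norm_smul, Real.norm_of_nonneg hθ.1]
      exact (mul_le_of_le_one_left (norm_nonneg v) hθ.2).trans hv
    have h1 : 1 + ‖a‖ ≤ (1 + Λ) * (1 + ‖x‖) := by
      have : ‖a‖ ≤ ‖x‖ + ‖x - a‖ := by
        have := norm_sub_le x (x - a)
        rwa [sub_sub_cancel] at this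
      nlinarith [norm_nonneg x]
    rw [mul_assoc]
    refine mul_le_mul_of_nonneg_left ?_ hA
    rw [← div_eq_mul_inv, le_div_iff₀ (by positivity), inv_mul_le_iff₀ (by positivity), ← mul_pow,
      mul_comm (1 + ‖x‖)]
    exact pow_le_pow_left₀ (by positivity) h1 n

theorem hasDerivAt_scaledKernel {Φ : EuclideanSpace ℝ (Fin d) → ℂ} (hΦ : Differentiable ℝ Φ) (m : ℕ)
    (y : EuclideanSpace ℝ (Fin d)) {r : ℝ} (hr : 0 < r) :
    HasDerivAt (fun r => scaledKernel m Φ r y)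
      ((r ^ (d + m))⁻¹ • fderiv ℝ Φ (r⁻¹ • y) ((-(r ^ 2)⁻¹) • y) +
        (-((d + m : ℕ) * r ^ (d + m - 1)) / (r ^ (d + m)) ^ 2) • Φ (r⁻¹ • y)) r := by
  have h1 : HasDerivAt (fun r : ℝ => r⁻¹ • y) ((-(r ^ 2)⁻¹) • y) r :=
    (hasDerivAt_inv hr.ne').smul_const y
  have h2 : HasDerivAt (fun r : ℝ => Φ (r⁻¹ • y)) (fderiv ℝ Φ (r⁻¹ • y) ((-(r ^ 2)⁻¹) • y)) r :=
    (hΦ (r⁻¹ • y)).hasFDerivAt.comp_hasDerivAt r h1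
  exact ((hasDerivAt_pow (d + m) r).inv (by positivity)).smul h2

/-- Each derivative in r costs a factor 1/r. Differentiating y/r also produces a factor ‖y‖/r, which
is paid for by one of the powers of decay: order d + 6 is assumed and d + 5 remains. -/
theorem norm_deriv_scaledKernel_le {Φ : EuclideanSpace ℝ (Fin d) → ℂ} {A : ℝ} (hA : 0 ≤ A)
    (h : ∀ y, ‖Φ y‖ ≤ A * ((1 + ‖y‖) ^ (d + 6))⁻¹ ∧ ‖fderiv ℝ Φ y‖ ≤ A * ((1 + ‖y‖) ^ (d + 6))⁻¹)
    {R : ℝ} (hR : 1 ≤ R) {m : ℕ} (hm : m ≤ 4) {r : ℝ} (hr : 0 < r) (hrR : r ≤ R)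
    (y : EuclideanSpace ℝ (Fin d)) :
    ‖(r ^ (d + m))⁻¹ • fderiv ℝ Φ (r⁻¹ • y) ((-(r ^ 2)⁻¹) • y) +
        (-((d + m : ℕ) * r ^ (d + m - 1)) / (r ^ (d + m)) ^ 2) • Φ (r⁻¹ • y)‖ ≤
      (d + 5) * A * R ^ 4 * ((r + ‖y‖) ^ (d + 5))⁻¹ := by
  set u := r⁻¹ * ‖y‖ with hu
  have hu0 : 0 ≤ u := by positivity
  have hn : ‖r⁻¹ • y‖ = u := by rw [norm_smul, norm_inv, Real.norm_of_nonneg hr.le]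
  set Z := ((1 + u) ^ (d + 5))⁻¹ with hZ
  have hZ6 : ((1 + u) ^ (d + 6))⁻¹ * (1 + u) = Z := by
    rw [hZ, pow_succ _ (d + 5)]; field_simp
  have hZ6' : ((1 + u) ^ (d + 6))⁻¹ ≤ Z := by
    rw [← hZ6]; exact le_mul_of_one_le_right (by positivity) (by linarith)
  have h1 : ‖(r ^ (d + m))⁻¹ • fderiv ℝ Φ (r⁻¹ • y) ((-(r ^ 2)⁻¹) • y)‖ ≤
      (r ^ (d + m + 1))⁻¹ * (A * Z) := by
    rw [norm_smul, norm_inv, Real.norm_of_nonneg (by positivity)]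
    have e1 : ‖(-(r ^ 2)⁻¹) • y‖ = r⁻¹ * u := by
      rw [norm_smul, norm_neg, norm_inv, Real.norm_of_nonneg (by positivity), hu]
      field_simp
    have e2 := (fderiv ℝ Φ (r⁻¹ • y)).le_opNorm ((-(r ^ 2)⁻¹) • y)
    rw [e1] at e2
    have e3 := (h (r⁻¹ • y)).2
    rw [hn] at e3
    have e4 : ‖fderiv ℝ Φ (r⁻¹ • y)‖ * (r⁻¹ * u) ≤ A * ((1 + u) ^ (d + 6))⁻¹ * (r⁻¹ * u) :=
      mul_le_mul_of_nonneg_right e3 (by positivity)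
    have e5 : ((1 + u) ^ (d + 6))⁻¹ * u ≤ Z := by
      rw [← hZ6]; exact mul_le_mul_of_nonneg_left (by linarith) (by positivity)
    calc (r ^ (d + m))⁻¹ * ‖fderiv ℝ Φ (r⁻¹ • y) ((-(r ^ 2)⁻¹) • y)‖
        ≤ (r ^ (d + m))⁻¹ * (A * ((1 + u) ^ (d + 6))⁻¹ * (r⁻¹ * u)) :=
          mul_le_mul_of_nonneg_left (e2.trans e4) (by positivity)
      _ = (r ^ (d + m + 1))⁻¹ * (A * (((1 + u) ^ (d + 6))⁻¹ * u)) := by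
          rw [pow_succ r, mul_inv]; ring
      _ ≤ _ := by gcongr
  have h2 : ‖(-((d + m : ℕ) * r ^ (d + m - 1)) / (r ^ (d + m)) ^ 2) • Φ (r⁻¹ • y)‖ ≤
      (r ^ (d + m + 1))⁻¹ * ((d + 4) * (A * Z)) := by
    have e0 : ‖(-((d + m : ℕ) * r ^ (d + m - 1)) / (r ^ (d + m)) ^ 2)‖ =
        (d + m : ℕ) * (r ^ (d + m + 1))⁻¹ := by
      rw [norm_div, norm_neg, Real.norm_of_nonneg (by positivity),
        Real.norm_of_nonneg (by positivity)]
      rcases Nat.eq_zero_or_pos (d + m) with h0 | h0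
      · simp [h0]
      · obtain ⟨i, hi⟩ := Nat.exists_eq_succ_of_ne_zero h0.ne'
        rw [hi]
        simp only [Nat.succ_eq_add_one, Nat.add_sub_cancel]
        field_simp
        ring
    have e3 := (h (r⁻¹ • y)).1
    rw [hn] at e3
    have e6 : ((d + m : ℕ) : ℝ) ≤ d + 4 := by exact_mod_cast Nat.add_le_add_left hm d
    rw [norm_smul, e0]
    calc (d + m : ℕ) * (r ^ (d + m + 1))⁻¹ * ‖Φ (r⁻¹ • y)‖
        ≤ (d + 4) * (r ^ (d + m + 1))⁻¹ * (A * Z) := by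
          gcongr
          exact e3.trans (by gcongr)
      _ = _ := by ring
  have h3 := inv_pow_mul_inv_one_add_pow_le (m := d + m + 1) (n := d + 5) (by omega) hr hrR hR
    (norm_nonneg y) (j := 4) (by omega)
  calc _ ≤ (r ^ (d + m + 1))⁻¹ * (A * Z) + (r ^ (d + m + 1))⁻¹ * ((d + 4) * (A * Z)) :=
        (norm_add_le _ _).trans (add_le_add h1 h2)
    _ = (d + 5) * A * ((r ^ (d + m + 1))⁻¹ * Z) := by ring
    _ ≤ (d + 5) * A * (R ^ 4 * ((r + ‖y‖) ^ (d + 5))⁻¹) :=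
        mul_le_mul_of_nonneg_left h3 (by positivity)
    _ = _ := by ring

/-- The smoothness condition of Calderón–Zygmund theory: a change of radius or position gains one
order of decay over the size bound. The common lower bound ρ for the two radii sets the scale. -/
theorem norm_scaledKernel_sub_le (Φ : 𝓢(EuclideanSpace ℝ (Fin d), ℂ)) {R : ℝ} (hR : 1 ≤ R)
    {Λ : ℝ} (hΛ : 0 ≤ Λ) :
    ∃ A : ℝ, 0 ≤ A ∧ ∀ m ≤ 4, ∀ ρ r r₀, 0 < ρ → ρ ≤ r → ρ ≤ r₀ → r ≤ R → r₀ ≤ R → ∀ e y,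
      ‖e‖ ≤ Λ * ρ → ‖scaledKernel m Φ r (y + e) - scaledKernel m Φ r₀ y‖ ≤
        A * (|r - r₀| + ‖e‖) * ((ρ + ‖y‖) ^ (d + 5))⁻¹ := by
  obtain ⟨A, hA, h⟩ := Φ.exists_norm_le_inv_one_add_pow (d + 5)
  obtain ⟨B, hB, h'⟩ := Φ.exists_norm_le_inv_one_add_pow (d + 6)
  have hd : Differentiable ℝ Φ := Φ.differentiable
  set A₁ := A * (1 + Λ) ^ (d + 5) * R ^ 4
  set A₂ := (d + 5) * B * R ^ 4
  have hA₁ : 0 ≤ A₁ := by positivity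
  have hA₂ : 0 ≤ A₂ := by positivity
  refine ⟨A₁ + A₂, by positivity, fun m hm ρ r r₀ hρ hr hr₀ hrR hr₀R e y he => ?_⟩
  have hr0 : 0 < r := hρ.trans_le hr
  have hanti : ∀ r, ρ ≤ r → ((r + ‖y‖) ^ (d + 5))⁻¹ ≤ ((ρ + ‖y‖) ^ (d + 5))⁻¹ := fun r hr =>
    inv_anti₀ (by positivity) (pow_le_pow_left₀ (by positivity) (by linarith) _)
  have h1 : ‖scaledKernel m Φ r (y + e) - scaledKernel m Φ r y‖ ≤
      A₁ * ‖e‖ * ((ρ + ‖y‖) ^ (d + 5))⁻¹ := by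
    have hv : ‖r⁻¹ • e‖ ≤ Λ := by
      rw [norm_smul, norm_inv, Real.norm_of_nonneg hr0.le, inv_mul_le_iff₀ hr0]
      exact he.trans (by rw [mul_comm r]; exact mul_le_mul_of_nonneg_left hr hΛ)
    have h2 := norm_add_sub_le_of_norm_fderiv_le hd hA (fun y => (h y).2) (r⁻¹ • y) hv
    rw [← smul_add, norm_smul, norm_smul, norm_inv, Real.norm_of_nonneg hr0.le] at h2
    have h3 := inv_pow_mul_inv_one_add_pow_le (m := d + m + 1) (n := d + 5) (by omega) hr0 hrR hR
      (norm_nonneg y) (j := 4) (by omega)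
    rw [scaledKernel, scaledKernel, ← smul_sub, norm_smul, norm_inv,
      Real.norm_of_nonneg (by positivity)]
    calc (r ^ (d + m))⁻¹ * ‖Φ (r⁻¹ • (y + e)) - Φ (r⁻¹ • y)‖
        ≤ (r ^ (d + m))⁻¹ * (A * (1 + Λ) ^ (d + 5) * ((1 + r⁻¹ * ‖y‖) ^ (d + 5))⁻¹ *
            (r⁻¹ * ‖e‖)) := mul_le_mul_of_nonneg_left h2 (by positivity)
      _ = A * (1 + Λ) ^ (d + 5) * ‖e‖ * ((r ^ (d + m + 1))⁻¹ *
            ((1 + r⁻¹ * ‖y‖) ^ (d + 5))⁻¹) := by rw [pow_succ r, mul_inv]; ring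
      _ ≤ A * (1 + Λ) ^ (d + 5) * ‖e‖ * (R ^ 4 * ((ρ + ‖y‖) ^ (d + 5))⁻¹) := by
          refine mul_le_mul_of_nonneg_left (h3.trans ?_) (by positivity)
          exact mul_le_mul_of_nonneg_left (hanti r hr) (by positivity)
      _ = _ := by simp only [A₁]; ring
  have h2 : ‖scaledKernel m Φ r y - scaledKernel m Φ r₀ y‖ ≤
      A₂ * ((ρ + ‖y‖) ^ (d + 5))⁻¹ * |r - r₀| := by
    refine (convex_Icc ρ R).norm_image_sub_le_of_norm_hasDerivWithin_le
      (f := fun r => scaledKernel m Φ r y)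
      (fun s hs => (hasDerivAt_scaledKernel hd m y (hρ.trans_le hs.1)).hasDerivWithinAt)
      (fun s hs => ?_) ⟨hr₀, hr₀R⟩ ⟨hr, hrR⟩
    refine (norm_deriv_scaledKernel_le hB h' hR hm (hρ.trans_le hs.1) hs.2 y).trans ?_
    exact mul_le_mul_of_nonneg_left (hanti s hs.1) hA₂
  calc _ ≤ ‖scaledKernel m Φ r (y + e) - scaledKernel m Φ r y‖ +
        ‖scaledKernel m Φ r y - scaledKernel m Φ r₀ y‖ := norm_sub_le_norm_sub_add_norm_sub _ _ _
    _ ≤ _ := add_le_add h1 h2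
    _ ≤ _ := by
      have : 0 ≤ ((ρ + ‖y‖) ^ (d + 5))⁻¹ := by positivity
      nlinarith [mul_nonneg (mul_nonneg hA₁ (abs_nonneg (r - r₀))) this,
        mul_nonneg (mul_nonneg hA₂ (norm_nonneg e)) this]

/-- The quotient (r⁴ - r₀⁴)/(r - r₀) is at least ρ³. A change of time of size ℓ⁴ thus moves a radius
of size at least ℓ by at most about ℓ. -/
theorem abs_sub_le_div_of_abs_pow_four_sub_le {ρ r r₀ D : ℝ} (hρ : 0 < ρ) (hr : ρ ≤ r)
    (hr₀ : ρ ≤ r₀) (h : |r ^ 4 - r₀ ^ 4| ≤ D) : |r - r₀| ≤ D / ρ ^ 3 := by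
  rw [le_div_iff₀ (by positivity)]
  refine le_trans ?_ h
  have e : r ^ 4 - r₀ ^ 4 = (r - r₀) * (r ^ 3 + r ^ 2 * r₀ + r * r₀ ^ 2 + r₀ ^ 3) := by ring
  have h1 : 0 < r := hρ.trans_le hr
  have h2 : 0 < r₀ := hρ.trans_le hr₀
  rw [e, abs_mul, abs_of_pos (a := r ^ 3 + _ + _ + _) (by positivity)]
  refine mul_le_mul_of_nonneg_left ?_ (abs_nonneg _)
  have : ρ ^ 3 ≤ r ^ 3 := pow_le_pow_left₀ hρ.le hr 3
  have : 0 ≤ r ^ 2 * r₀ + r * r₀ ^ 2 + r₀ ^ 3 := by positivity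
  linarith

end ScaledKernel
open scoped SchwartzMap

/-! ### The parabolic integral operator -/

section ParabolicOperator

/-- A function on the line whose difference quotients lie between `lam⁻¹` and `lam`. -/
structure IsEllipticPrimitive (lam : ℝ) (b : ℝ → ℝ) : Prop where
  one_le : 1 ≤ lam
  lower : ∀ s t, s ≤ t → lam⁻¹ * (t - s) ≤ b t - b s
  upper : ∀ s t, s ≤ t → b t - b s ≤ lam * (t - s)

/-- The parabolic radius `(b(t) - b(s) + ε)^{1/4}`. -/
noncomputable def parabolicRadius (b : ℝ → ℝ) (ε t s : ℝ) : ℝ := √√(b t - b s + ε)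

instance isAddRightInvariant_volume_prod_euclideanSpace (d : ℕ) :
    Measure.IsAddRightInvariant (volume : Measure (ℝ × EuclideanSpace ℝ (Fin d))) :=
  inferInstanceAs (Measure.IsAddRightInvariant
    ((volume : Measure ℝ).prod (volume : Measure (EuclideanSpace ℝ (Fin d)))))

variable {d : ℕ} {lam ε : ℝ} {b : ℝ → ℝ} {m : ℕ}

/-- The kernel `(s, y) ↦ r^{-(d+m)} Φ(y/r)`, `r = (b(t) - b(s) + ε)^{1/4}`, for `0 < s < t`. -/
noncomputable def causalKernel (m : ℕ) (Φ : EuclideanSpace ℝ (Fin d) → ℂ) (b : ℝ → ℝ) (ε t : ℝ)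
    (z : ℝ × EuclideanSpace ℝ (Fin d)) : ℂ :=
  (Ioo 0 t).indicator (fun s => scaledKernel m Φ (parabolicRadius b ε t s) z.2) z.1

/-- The integral operator on functions on space-time with the kernel `causalKernel`. -/
noncomputable def parabolicOp (m : ℕ) (Φ : EuclideanSpace ℝ (Fin d) → ℂ) (b : ℝ → ℝ) (ε : ℝ)
    (f : ℝ × UnitAddTorus (Fin d) → ℂ) (z : ℝ × UnitAddTorus (Fin d)) : ℂ :=
  ∫ y, causalKernel m Φ b ε z.1 y * f (y.1, z.2 - torusMk y.2.ofLp)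

theorem IsEllipticPrimitive.pos (hb : IsEllipticPrimitive lam b) : 0 < lam :=
  zero_lt_one.trans_le hb.one_le

theorem IsEllipticPrimitive.abs_sub_le (hb : IsEllipticPrimitive lam b) (s t : ℝ) :
    |b t - b s| ≤ lam * |t - s| := by
  have hl := inv_pos.2 hb.pos
  rcases le_total s t with h | h
  · have h1 := hb.lower s t h
    rw [abs_of_nonneg (by nlinarith), abs_of_nonneg (by linarith)]
    exact hb.upper s t h
  · have h1 := hb.lower t s h
    rw [abs_sub_comm, abs_sub_comm t, abs_of_nonneg (by nlinarith), abs_of_nonneg (by linarith)]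
    exact hb.upper t s h

theorem IsEllipticPrimitive.continuous (hb : IsEllipticPrimitive lam b) : Continuous b := by
  refine (LipschitzWith.of_dist_le_mul (K := lam.toNNReal) fun t s => ?_).continuous
  rw [Real.dist_eq, Real.dist_eq, Real.coe_toNNReal _ hb.pos.le]
  exact hb.abs_sub_le s t

theorem sqrt_sqrt_le_of_le {x R : ℝ} (hR : 1 ≤ R) (h : x ≤ R) : √√x ≤ R := by
  have h1 : √x ≤ R := Real.sqrt_le_iff.2 ⟨by linarith, by nlinarith⟩
  exact Real.sqrt_le_iff.2 ⟨by linarith, by nlinarith⟩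

theorem sqrt_sqrt_pow_four {x : ℝ} (hx : 0 ≤ x) : √√x ^ 4 = x := by
  rw [show 4 = 2 * 2 by rfl, pow_mul, Real.sq_sqrt (Real.sqrt_nonneg x), Real.sq_sqrt hx]

theorem IsEllipticPrimitive.le_radius (hb : IsEllipticPrimitive lam b) (hε : 0 < ε) {s t : ℝ}
    (hst : s ≤ t) : √√(lam⁻¹ * (t - s)) ≤ parabolicRadius b ε t s :=
  Real.sqrt_le_sqrt (Real.sqrt_le_sqrt (by linarith [hb.lower s t hst]))

theorem IsEllipticPrimitive.sqrt_sqrt_le_radius (hb : IsEllipticPrimitive lam b) {s t : ℝ}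
    (hst : s ≤ t) : √√ε ≤ parabolicRadius b ε t s := by
  have := mul_nonneg (inv_nonneg.2 hb.pos.le) (sub_nonneg.2 hst)
  exact Real.sqrt_le_sqrt (Real.sqrt_le_sqrt (by linarith [hb.lower s t hst]))

theorem IsEllipticPrimitive.radius_le (hb : IsEllipticPrimitive lam b) (hε : ε ≤ 1) {N : ℕ}
    {s t : ℝ} (hs : 0 ≤ s) (hst : s ≤ t) (ht : t ≤ N) : parabolicRadius b ε t s ≤ lam * N + 1 := by
  have h1 := hb.upper s t hst
  have h2 : lam * (t - s) ≤ lam * N := mul_le_mul_of_nonneg_left (by linarith) hb.pos.le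
  have h3 : 0 ≤ lam * N := mul_nonneg hb.pos.le (Nat.cast_nonneg N)
  exact sqrt_sqrt_le_of_le (by linarith) (by linarith)

theorem IsEllipticPrimitive.radius_pow_four (hb : IsEllipticPrimitive lam b) (hε : 0 < ε) {s t : ℝ}
    (hst : s ≤ t) : parabolicRadius b ε t s ^ 4 = b t - b s + ε := by
  have := mul_nonneg (inv_nonneg.2 hb.pos.le) (sub_nonneg.2 hst)
  exact sqrt_sqrt_pow_four (by linarith [hb.lower s t hst])

theorem IsEllipticPrimitive.abs_radius_sub_le (hb : IsEllipticPrimitive lam b) (hε : 0 < ε)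
    {s t t₀ ρ : ℝ} (hst : s ≤ t) (hst₀ : s ≤ t₀) (hρ : 0 < ρ) (h : ρ ≤ parabolicRadius b ε t s)
    (h₀ : ρ ≤ parabolicRadius b ε t₀ s) :
    |parabolicRadius b ε t s - parabolicRadius b ε t₀ s| ≤ lam * |t - t₀| / ρ ^ 3 := by
  refine abs_sub_le_div_of_abs_pow_four_sub_le hρ h h₀ ?_
  rw [hb.radius_pow_four hε hst, hb.radius_pow_four hε hst₀, add_sub_add_right_eq_sub,
    sub_sub_sub_cancel_right]
  exact hb.abs_sub_le t₀ t

theorem measurable_causalKernel (hb : IsEllipticPrimitive lam b) (m : ℕ)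
    (Φ : 𝓢(EuclideanSpace ℝ (Fin d), ℂ)) (ε : ℝ) :
    Measurable fun z : ℝ × (ℝ × EuclideanSpace ℝ (Fin d)) => causalKernel m Φ b ε z.1 z.2 := by
  have hbm : Measurable b := hb.continuous.measurable
  have hΦ : Measurable Φ := Φ.continuous.measurable
  have e : (fun z : ℝ × (ℝ × EuclideanSpace ℝ (Fin d)) => causalKernel m Φ b ε z.1 z.2) =
      {z : ℝ × (ℝ × EuclideanSpace ℝ (Fin d)) | 0 < z.2.1 ∧ z.2.1 < z.1}.indicator
        fun z => scaledKernel m Φ (parabolicRadius b ε z.1 z.2.1) z.2.2 := rfl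
  rw [e]
  refine Measurable.indicator ?_ ?_
  · unfold scaledKernel parabolicRadius
    fun_prop
  · exact (measurableSet_lt measurable_const (measurable_fst.comp measurable_snd)).inter
      (measurableSet_lt (measurable_fst.comp measurable_snd) measurable_fst)

theorem integrable_inv_add_norm_pow {ρ : ℝ} (hρ : 0 < ρ) {n : ℕ} (hn : d < n) :
    Integrable fun y : EuclideanSpace ℝ (Fin d) => ((ρ + ‖y‖) ^ n)⁻¹ := by
  have h1 : Integrable fun y : EuclideanSpace ℝ (Fin d) => (1 + ‖y‖) ^ (-(n : ℝ)) :=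
    integrable_one_add_norm (by simpa using hn)
  set c := min ρ 1
  have hc : 0 < c := lt_min hρ one_pos
  refine (h1.const_mul ((c ^ n)⁻¹)).mono' ?_ (Filter.Eventually.of_forall fun y => ?_)
  · refine Continuous.aestronglyMeasurable ?_
    exact Continuous.inv₀ (by fun_prop) fun y => by positivity
  · rw [Real.norm_of_nonneg (by positivity), Real.rpow_neg (by positivity), Real.rpow_natCast,
      ← mul_inv, ← mul_pow]
    refine inv_anti₀ (by positivity) (pow_le_pow_left₀ (by positivity) ?_ n)
    have := min_le_left ρ 1
    have := mul_le_mul_of_nonneg_right (min_le_right ρ 1) (norm_nonneg y)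
    linarith

/-- A bound for the kernel by a fixed integrable function. -/
theorem exists_norm_causalKernel_le (lam : ℝ) (hlam : 1 ≤ lam) (N : ℕ)
    (Φ : 𝓢(EuclideanSpace ℝ (Fin d), ℂ)) :
    ∃ A : ℝ, 0 ≤ A ∧ ∀ m ≤ 4, ∀ b ε, IsEllipticPrimitive lam b → 0 < ε → ε ≤ 1 → ∀ t ≤ (N : ℝ), ∀ z,
      ‖causalKernel m Φ b ε t z‖ ≤
        (Ioo (0 : ℝ) N).indicator (fun _ => A) z.1 * ((√√ε + ‖z.2‖) ^ (d + 4))⁻¹ := by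
  have hR : (1 : ℝ) ≤ lam * N + 1 := by
    have : 0 ≤ lam * N := mul_nonneg (by linarith) (Nat.cast_nonneg N)
    linarith
  obtain ⟨A, hA, h⟩ := norm_scaledKernel_le Φ hR
  refine ⟨A, hA, fun m hm b ε hb hε hε1 t ht z => ?_⟩
  have hε' : 0 < √√ε := Real.sqrt_pos.2 (Real.sqrt_pos.2 hε)
  by_cases hz : z.1 ∈ Ioo 0 t
  · have hz' : z.1 ∈ Ioo (0 : ℝ) N := ⟨hz.1, hz.2.trans_le ht⟩
    rw [causalKernel, indicator_of_mem hz, indicator_of_mem hz']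
    have h1 := hb.sqrt_sqrt_le_radius (ε := ε) hz.2.le
    refine (h m hm _ (hε'.trans_le h1) (hb.radius_le hε1 hz.1.le hz.2.le ht) z.2).trans ?_
    refine mul_le_mul_of_nonneg_left ?_ hA
    exact inv_anti₀ (by positivity) (pow_le_pow_left₀ (by positivity) (by linarith) _)
  · rw [causalKernel, indicator_of_notMem hz, norm_zero]
    exact mul_nonneg (indicator_nonneg (fun _ _ => hA) _) (by positivity)

theorem integrable_indicator_mul_inv_pow {ρ : ℝ} (hρ : 0 < ρ) (N : ℕ) (A : ℝ) :
    Integrable fun z : ℝ × EuclideanSpace ℝ (Fin d) =>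
      (Ioo (0 : ℝ) N).indicator (fun _ => A) z.1 * ((ρ + ‖z.2‖) ^ (d + 4))⁻¹ := by
  refine Integrable.mul_prod (f := (Ioo (0 : ℝ) N).indicator fun _ => A) ?_
    (integrable_inv_add_norm_pow hρ (by omega))
  exact (integrableOn_const (by simp)).integrable_indicator measurableSet_Ioo

theorem integrable_causalKernel (hb : IsEllipticPrimitive lam b) (hε : 0 < ε) (hε1 : ε ≤ 1)
    (hm : m ≤ 4) (Φ : 𝓢(EuclideanSpace ℝ (Fin d), ℂ)) (t : ℝ) :
    Integrable (causalKernel m Φ b ε t) := by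
  obtain ⟨N, hN⟩ := exists_nat_ge t
  obtain ⟨A, hA, h⟩ := exists_norm_causalKernel_le lam hb.one_le N Φ
  refine (integrable_indicator_mul_inv_pow (ρ := √√ε)
    (Real.sqrt_pos.2 (Real.sqrt_pos.2 hε)) N A).mono' ?_ (Filter.Eventually.of_forall fun z => ?_)
  · exact ((measurable_causalKernel hb m Φ ε).comp
      measurable_prodMk_left).aestronglyMeasurable
  · exact h m hm b ε hb hε hε1 t hN z

theorem measurable_sub_torusMk (x : UnitAddTorus (Fin d)) :
    Measurable fun y : ℝ × EuclideanSpace ℝ (Fin d) => (y.1, x - torusMk y.2.ofLp) := by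
  refine measurable_fst.prodMk (Measurable.const_sub ?_ x)
  exact measurable_torusMk.comp ((PiLp.continuous_ofLp 2 _).measurable.comp measurable_snd)

variable {f : ℝ × UnitAddTorus (Fin d) → ℂ}

theorem integrable_causalKernel_mul (hb : IsEllipticPrimitive lam b) (hε : 0 < ε) (hε1 : ε ≤ 1)
    (hm : m ≤ 4) (Φ : 𝓢(EuclideanSpace ℝ (Fin d), ℂ)) (hf : Measurable f) {B : ℝ}
    (hB : ∀ z, ‖f z‖ ≤ B) (z : ℝ × UnitAddTorus (Fin d)) :
    Integrable fun y => causalKernel m Φ b ε z.1 y * f (y.1, z.2 - torusMk y.2.ofLp) :=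
  (integrable_causalKernel hb hε hε1 hm Φ z.1).mul_bdd (c := B)
    (hf.comp (measurable_sub_torusMk z.2)).aestronglyMeasurable
    (Filter.Eventually.of_forall fun _ => hB _)

theorem parabolicOp_add (hb : IsEllipticPrimitive lam b) (hε : 0 < ε) (hε1 : ε ≤ 1)
    (hm : m ≤ 4) (Φ : 𝓢(EuclideanSpace ℝ (Fin d), ℂ)) {f g : ℝ × UnitAddTorus (Fin d) → ℂ}
    (hf : Measurable f) (hg : Measurable g) {B : ℝ} (hB : ∀ z, ‖f z‖ ≤ B) (hB' : ∀ z, ‖g z‖ ≤ B)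
    (z : ℝ × UnitAddTorus (Fin d)) :
    parabolicOp m Φ b ε (fun y => f y + g y) z =
      parabolicOp m Φ b ε f z + parabolicOp m Φ b ε g z := by
  simp only [parabolicOp, mul_add]
  exact integral_add (integrable_causalKernel_mul hb hε hε1 hm Φ hf hB z)
    (integrable_causalKernel_mul hb hε hε1 hm Φ hg hB' z)

theorem stronglyMeasurable_parabolicOp (hb : IsEllipticPrimitive lam b)
    (Φ : 𝓢(EuclideanSpace ℝ (Fin d), ℂ)) (hf : Measurable f) :
    StronglyMeasurable (parabolicOp m Φ b ε f) := by
  refine StronglyMeasurable.integral_prod_right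
    (f := fun (z : ℝ × UnitAddTorus (Fin d)) (y : ℝ × EuclideanSpace ℝ (Fin d)) => causalKernel m Φ b ε z.1 y * f (y.1, z.2 - torusMk y.2.ofLp)) ?_
  refine Measurable.stronglyMeasurable ?_
  have h1 : Measurable fun z : (ℝ × UnitAddTorus (Fin d)) × (ℝ × EuclideanSpace ℝ (Fin d)) =>
      causalKernel m Φ b ε z.1.1 z.2 :=
    (measurable_causalKernel hb m Φ ε).comp
      ((measurable_fst.comp measurable_fst).prodMk measurable_snd)
  have h2 : Measurable fun z : (ℝ × UnitAddTorus (Fin d)) × (ℝ × EuclideanSpace ℝ (Fin d)) =>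
      f (z.2.1, z.1.2 - torusMk z.2.2.ofLp) := by
    refine hf.comp ((measurable_fst.comp measurable_snd).prodMk
      (Measurable.sub (measurable_snd.comp measurable_fst) ?_))
    exact measurable_torusMk.comp ((PiLp.continuous_ofLp 2 _).measurable.comp
      (measurable_snd.comp measurable_snd))
  exact h1.mul h2

/-- Translation of the space variable into the kernel. -/
theorem parabolicOp_add_torusMk (Φ : EuclideanSpace ℝ (Fin d) → ℂ) (t : ℝ)
    (x : UnitAddTorus (Fin d)) (e : EuclideanSpace ℝ (Fin d)) :
    parabolicOp m Φ b ε f (t, x + torusMk e.ofLp) =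
      ∫ y : ℝ × EuclideanSpace ℝ (Fin d), causalKernel m Φ b ε t (y.1, y.2 + e) *
        f (y.1, x - torusMk y.2.ofLp) := by
  rw [parabolicOp]
  rw [← integral_add_right_eq_self _ ((0 : ℝ), e)]
  refine integral_congr_ae (Filter.Eventually.of_forall fun y => ?_)
  simp [torusMk_add, Prod.add_def]

theorem integrable_causalKernel_add_mul (hb : IsEllipticPrimitive lam b) (hε : 0 < ε) (hε1 : ε ≤ 1)
    (hm : m ≤ 4) (Φ : 𝓢(EuclideanSpace ℝ (Fin d), ℂ)) (hf : Measurable f) {B : ℝ}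
    (hB : ∀ z, ‖f z‖ ≤ B) (t : ℝ) (x : UnitAddTorus (Fin d)) (e : EuclideanSpace ℝ (Fin d)) :
    Integrable fun y : ℝ × EuclideanSpace ℝ (Fin d) => causalKernel m Φ b ε t (y.1, y.2 + e) *
      f (y.1, x - torusMk y.2.ofLp) := by
  have h := (integrable_causalKernel hb hε hε1 hm Φ t).comp_add_right ((0 : ℝ), e)
  refine Integrable.mul_bdd (c := B) ?_ (hf.comp (measurable_sub_torusMk x)).aestronglyMeasurable
    (Filter.Eventually.of_forall fun _ => hB _)
  refine h.congr (Filter.Eventually.of_forall fun y => ?_)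
  simp [Prod.add_def]

/-- A qualitative bound whose constant depends on ε. It serves only to guarantee finiteness in the
absorption and extrapolation arguments. -/
theorem norm_parabolicOp_le (hb : IsEllipticPrimitive lam b) (hε : 0 < ε) (hε1 : ε ≤ 1)
    (hm : m ≤ 4) (Φ : 𝓢(EuclideanSpace ℝ (Fin d), ℂ)) (N : ℕ) (B : ℝ) :
    ∃ M : ℝ, 0 ≤ M ∧ ∀ f : ℝ × UnitAddTorus (Fin d) → ℂ, (∀ z, ‖f z‖ ≤ B) →
      ∀ z : ℝ × UnitAddTorus (Fin d), z.1 ≤ N → ‖parabolicOp m Φ b ε f z‖ ≤ M := by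
  obtain ⟨A, hA, h⟩ := exists_norm_causalKernel_le lam hb.one_le N Φ
  have hint := integrable_indicator_mul_inv_pow (d := d) (ρ := √√ε)
    (Real.sqrt_pos.2 (Real.sqrt_pos.2 hε)) N A
  have hn : ∀ y : ℝ × EuclideanSpace ℝ (Fin d),
      0 ≤ (Ioo (0 : ℝ) N).indicator (fun _ => A) y.1 * ((√√ε + ‖y.2‖) ^ (d + 4))⁻¹ := fun y =>
    mul_nonneg (indicator_nonneg (fun _ _ => hA) _) (by positivity)
  refine ⟨∫ y : ℝ × EuclideanSpace ℝ (Fin d),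
    (Ioo (0 : ℝ) N).indicator (fun _ => A) y.1 * ((√√ε + ‖y.2‖) ^ (d + 4))⁻¹ * |B|,
    integral_nonneg fun y => mul_nonneg (hn y) (abs_nonneg B), fun f hB z hz => ?_⟩
  refine norm_integral_le_of_norm_le (hint.mul_const _) (Filter.Eventually.of_forall fun y => ?_)
  rw [norm_mul]
  exact mul_le_mul (h m hm b ε hb hε hε1 _ hz y) ((hB _).trans (le_abs_self B)) (norm_nonneg _)
    (hn y)

end ParabolicOperator
open scoped SchwartzMap

/-! ### Pointwise estimates of the parabolic operator by the maximal function -/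

section PointwiseEstimates

theorem lintegral_le_sqrt_mul_sqrt {S : Type*} [MeasurableSpace S] {μ : Measure S} {g : S → ℝ≥0∞}
    (hg : Measurable g) :
    ∫⁻ x, g x ∂μ ≤ μ univ ^ (1 / 2 : ℝ) * (∫⁻ x, g x ^ 2 ∂μ) ^ (1 / 2 : ℝ) := by
  have h := ENNReal.lintegral_mul_le_Lp_mul_Lq μ Real.HolderConjugate.two_two
    (f := fun _ => 1) aemeasurable_const hg.aemeasurable
  simpa using h

variable {d : ℕ} {lam ε : ℝ} {b : ℝ → ℝ} {m : ℕ}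

theorem torusMax_one_le (x : UnitAddTorus (Fin d)) : torusMax (fun _ => 1) x ≤ 1 := by
  refine iSup_le fun j => iSup_le fun k => ?_
  rw [cellAvg, lintegral_const, Measure.restrict_apply_univ, one_mul]
  exact ENNReal.div_self_le_one

/-- The iterated dyadic maximal function of `|f|²`, in space and then in time. -/
noncomputable def stMax (n : ℕ) (f : ℝ × UnitAddTorus (Fin d) → ℂ)
    (z : ℝ × UnitAddTorus (Fin d)) : ℝ≥0∞ :=
  dyMax (timeLabel n) volume (fun s => torusMax (fun y => ‖f (s, y)‖ₑ ^ 2) z.2) z.1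

variable {f : ℝ × UnitAddTorus (Fin d) → ℂ}

theorem measurable_torusMax_enorm_sq (hf : Measurable f) :
    Measurable fun z : ℝ × UnitAddTorus (Fin d) => torusMax (fun y => ‖f (z.1, y)‖ₑ ^ 2) z.2 := by
  have h := measurable_dyMax_uncurry (isDyadicFamily_torusLabel d)
    (g := fun z : ℝ × UnitAddTorus (Fin d) => ‖f z‖ₑ ^ 2) (hf.enorm.pow_const 2)
  exact h

theorem measurable_stMax (n : ℕ) (hf : Measurable f) : Measurable (stMax n f) := by
  have h1 := (measurable_torusMax_enorm_sq hf).comp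
    (measurable_swap (α := UnitAddTorus (Fin d)) (β := ℝ))
  have h2 := (measurable_dyMax_uncurry (isDyadicFamily_timeLabel n) h1).comp
    (measurable_swap (α := ℝ) (β := UnitAddTorus (Fin d)))
  exact h2

theorem stMax_mono (n : ℕ) {f g : ℝ × UnitAddTorus (Fin d) → ℂ} (h : ∀ z, ‖f z‖ ≤ ‖g z‖)
    (z : ℝ × UnitAddTorus (Fin d)) : stMax n f z ≤ stMax n g z :=
  dyMax_mono _ _ (fun s => dyMax_mono _ _ (fun y =>
    pow_le_pow_left₀ zero_le (enorm_le_iff_norm_le.2 (h (s, y))) 2) _) _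

/-- The integrand lives on [0, N], so a window of any length can be cut down to this interval, which
is short compared with the coarsest cells. -/
theorem setLIntegral_Icc_le_dyMax_of_support {n N : ℕ} (hn : 3 * (N : ℝ) ≤ 2 ^ n) {g : ℝ → ℝ≥0∞}
    (hg : ∀ s ∉ Icc (0 : ℝ) N, g s = 0) {a c t : ℝ} (ht : t ∈ Icc (0 : ℝ) N)
    (hat : a ≤ t) (htc : t ≤ c) :
    ∫⁻ s in Icc a c, g s ≤ ENNReal.ofReal (6 * (c - a)) * dyMax (timeLabel n) volume g t := by
  have h1 : ∫⁻ s in Icc a c, g s = ∫⁻ s in Icc (max a 0) (min c N), g s := by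
    rw [← Icc_inter_Icc, ← lintegral_indicator measurableSet_Icc,
      ← lintegral_indicator (measurableSet_Icc.inter measurableSet_Icc)]
    refine lintegral_congr fun s => ?_
    by_cases hs : s ∈ Icc (0 : ℝ) N
    · by_cases hs' : s ∈ Icc a c
      · rw [indicator_of_mem hs', indicator_of_mem (mem_inter hs' hs)]
      · rw [indicator_of_notMem hs', indicator_of_notMem fun h => hs' h.1]
    · rw [indicator_of_notMem (fun h => hs h.2 : s ∉ Icc a c ∩ Icc (0 : ℝ) N)]
      by_cases hs' : s ∈ Icc a c
      · rw [indicator_of_mem hs', hg s hs]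
      · rw [indicator_of_notMem hs']
  rw [h1]
  have h2 : max a 0 ≤ t := max_le hat ht.1
  have h3 : t ≤ min c N := le_min htc ht.2
  rcases (h2.trans h3).eq_or_lt with h | h
  · rw [h, Icc_self, Measure.restrict_singleton]
    simp
  · have h4 := le_max_left a 0
    have h5 := le_max_right a 0
    have h6 := min_le_left c (N : ℝ)
    have h7 := min_le_right c (N : ℝ)
    refine (setLIntegral_Icc_le_dyMax (m := n) h (by linarith) ⟨h2, h3⟩ g).trans ?_
    exact mul_le_mul_left (ENNReal.ofReal_le_ofReal (by linarith)) _

theorem setLIntegral_enorm_sq_le_stMax {n N : ℕ} (hn : 3 * (N : ℝ) ≤ 2 ^ n) (hf : Measurable f)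
    (hsupp : ∀ z : ℝ × UnitAddTorus (Fin d), z.1 ∉ Icc (0 : ℝ) N → f z = 0) {a c t : ℝ}
    (ht : t ∈ Icc (0 : ℝ) N) (hat : a ≤ t) (htc : t ≤ c) (x : UnitAddTorus (Fin d)) (q : ℝ) 
    {g : ℝ → ℝ≥0∞} (hg : ∀ s, g s ≤ ENNReal.ofReal q * torusMax (fun y => ‖f (s, y)‖ₑ ^ 2) x) :
    ∫⁻ s in Icc a c, g s ≤
      ENNReal.ofReal q * (ENNReal.ofReal (6 * (c - a)) * stMax n f (t, x)) := by
  refine (lintegral_mono hg).trans ?_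
  rw [lintegral_const_mul]
  · refine mul_le_mul_right ?_ _
    refine setLIntegral_Icc_le_dyMax_of_support hn (fun s hs => ?_) ht hat htc
    have : (fun y => ‖f (s, y)‖ₑ ^ 2) = fun _ => 0 := by
      funext y
      simp [hsupp (s, y) hs]
    rw [this]
    simp [torusMax, dyMax, cellMax, cellAvg]
  · have h := (measurable_torusMax_enorm_sq hf).comp (measurable_prodMk_right (y := x))
    exact h

/-- Cauchy–Schwarz on a cylinder. The square of f is controlled by the maximal function in space at
each time and by the one in time afterwards; the volume obeys the same bound, being the integral of
1. -/
theorem setLIntegral_enorm_le_stMax {n N : ℕ} (hn : 3 * (N : ℝ) ≤ 2 ^ n) (hf : Measurable f)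
    (hsupp : ∀ z : ℝ × UnitAddTorus (Fin d), z.1 ∉ Icc (0 : ℝ) N → f z = 0) {a c t : ℝ}
    (ht : t ∈ Icc (0 : ℝ) N) (hat : a ≤ t) (htc : t ≤ c) (x : UnitAddTorus (Fin d)) {R : ℝ}
    (hR : 0 < R) :
    ∫⁻ y in Icc a c ×ˢ Metric.closedBall (0 : EuclideanSpace ℝ (Fin d)) R,
        ‖f (y.1, x - torusMk y.2.ofLp)‖ₑ ≤
      ENNReal.ofReal (6 * (c - a) * (12 * R) ^ d) * stMax n f (t, x) ^ (1 / 2 : ℝ) := by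
  have hfm : Measurable fun y : ℝ × EuclideanSpace ℝ (Fin d) =>
      ‖f (y.1, x - torusMk y.2.ofLp)‖ₑ := (hf.comp (measurable_sub_torusMk x)).enorm
  have hca : 0 ≤ c - a := by linarith
  set q := (12 * R) ^ d with hq
  have hq0 : 0 ≤ q := by positivity
  have h1 : volume (Icc a c ×ˢ Metric.closedBall (0 : EuclideanSpace ℝ (Fin d)) R) ≤
      ENNReal.ofReal (6 * (c - a) * q) := by
    rw [Measure.volume_eq_prod, Measure.prod_prod, Real.volume_Icc]
    have := setLIntegral_euclidean_le_torusMax (fun _ => 1) measurable_const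
      (0 : UnitAddTorus (Fin d)) hR
    rw [lintegral_const, one_mul, Measure.restrict_apply_univ] at this
    have h2 := this.trans (mul_le_mul_right (torusMax_one_le _) _)
    rw [mul_one] at h2
    refine (mul_le_mul_right h2 _).trans ?_
    rw [← ENNReal.ofReal_mul hca]
    exact ENNReal.ofReal_le_ofReal (by nlinarith [mul_nonneg hca hq0])
  have h2 : ∫⁻ y in Icc a c ×ˢ Metric.closedBall (0 : EuclideanSpace ℝ (Fin d)) R,
      ‖f (y.1, x - torusMk y.2.ofLp)‖ₑ ^ 2 ≤
        ENNReal.ofReal (6 * (c - a) * q) * stMax n f (t, x) := by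
    rw [Measure.volume_eq_prod, ← Measure.prod_restrict,
      lintegral_prod _ (hfm.pow_const 2).aemeasurable]
    refine (setLIntegral_enorm_sq_le_stMax hn hf hsupp ht hat htc x q fun s => ?_).trans ?_
    · exact setLIntegral_euclidean_le_torusMax (fun y => ‖f (s, y)‖ₑ ^ 2)
        ((hf.comp measurable_prodMk_left).enorm.pow_const 2) x hR
    · rw [← mul_assoc, ← ENNReal.ofReal_mul hq0, mul_comm q]
  refine (lintegral_le_sqrt_mul_sqrt hfm).trans ?_
  rw [Measure.restrict_apply_univ]
  calc _ ≤ ENNReal.ofReal (6 * (c - a) * q) ^ (1 / 2 : ℝ) *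
        (ENNReal.ofReal (6 * (c - a) * q) * stMax n f (t, x)) ^ (1 / 2 : ℝ) :=
        mul_le_mul' (ENNReal.rpow_le_rpow h1 (by norm_num)) (ENNReal.rpow_le_rpow h2 (by norm_num))
    _ = _ := by
        rw [ENNReal.mul_rpow_of_nonneg _ _ (by norm_num), ← mul_assoc,
          ← ENNReal.rpow_add_of_nonneg _ _ (by norm_num) (by norm_num)]
        norm_num

/-- The contribution of the distant past is regular. -/
theorem exists_enorm_parabolicOp_sub_le (lam : ℝ) (hlam : 1 ≤ lam) {n N : ℕ}
    (hn : 3 * (N : ℝ) ≤ 2 ^ n) (Φ : 𝓢(EuclideanSpace ℝ (Fin d), ℂ)) :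
    ∃ C : ℝ≥0, ∀ m ≤ 4, ∀ b ε, IsEllipticPrimitive lam b → 0 < ε → ε ≤ 1 →
      ∀ f : ℝ × UnitAddTorus (Fin d) → ℂ, Measurable f → ∀ B : ℝ, (∀ z, ‖f z‖ ≤ B) →
      (∀ z : ℝ × UnitAddTorus (Fin d), z.1 ∉ Icc (0 : ℝ) N → f z = 0) →
      ∀ (ℓ a t t₀ : ℝ) (x : UnitAddTorus (Fin d)) (e : EuclideanSpace ℝ (Fin d)), 0 < ℓ → 0 ≤ a → a ≤ t → a ≤ t₀ → t ≤ a + ℓ ^ 4 → t₀ ≤ a + ℓ ^ 4 →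
      t ≤ N → t₀ ≤ N → ‖e‖ ≤ d * ℓ →
      (∀ z : ℝ × UnitAddTorus (Fin d), a - ℓ ^ 4 ≤ z.1 → f z = 0) →
      ‖parabolicOp m Φ b ε f (t, x + torusMk e.ofLp) - parabolicOp m Φ b ε f (t₀, x)‖ₑ ≤
        C * stMax n f (t₀, x) ^ (1 / 2 : ℝ) := by
  have hlam0 : 0 < lam := by linarith
  have hR : (1 : ℝ) ≤ lam * N + 1 := by
    have : 0 ≤ lam * N := mul_nonneg (by linarith) (Nat.cast_nonneg N)
    linarith
  -- Ellipticity gives radii of at least c₀ (t - s)^{1/4}.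
  set c₀ := √√lam⁻¹ with hc₀
  have hc₀0 : 0 < c₀ := Real.sqrt_pos.2 (Real.sqrt_pos.2 (inv_pos.2 hlam0))
  have hc₀1 : c₀ ≤ 1 := sqrt_sqrt_le_of_le le_rfl (inv_le_one_of_one_le₀ hlam)
  obtain ⟨A, hA, hker⟩ := norm_scaledKernel_sub_le Φ hR (Λ := d / c₀) (by positivity)
  set D := A * (lam / c₀ ^ 3 + d) * ((c₀ / 2) ^ (d + 5))⁻¹ with hD
  have hD0 : 0 ≤ D := by positivity
  refine ⟨(D * 2 ^ (d + 4 + 1 + 1) * 12 ^ (d + 1)).toNNReal,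
    fun m hm b ε hb hε hε1 f hf B hB hsupp ℓ a t t₀ x e hℓ ha hat hat₀ hta hta₀ htN ht₀N he hpast => ?_⟩
  set g : ℝ × EuclideanSpace ℝ (Fin d) → ℝ≥0∞ := fun y => ‖f (y.1, x - torusMk y.2.ofLp)‖ₑ
  have hgm : Measurable g := (hf.comp (measurable_sub_torusMk x)).enorm
  -- Parabolic distance to the bottom of the cell, used only for times before `a`.
  set ρ : ℝ × EuclideanSpace ℝ (Fin d) → ℝ := fun y => max (√√(a - y.1)) ‖y.2‖ with hρdef
  have hρm : Measurable ρ := by fun_prop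
  set H : Set (ℝ × EuclideanSpace ℝ (Fin d)) := {y | y.1 < a} with hH
  have hHm : MeasurableSet H := measurableSet_lt measurable_fst measurable_const
  have hpt : ∀ y : ℝ × EuclideanSpace ℝ (Fin d),
      ‖causalKernel m Φ b ε t (y.1, y.2 + e) * f (y.1, x - torusMk y.2.ofLp) -
        causalKernel m Φ b ε t₀ y * f (y.1, x - torusMk y.2.ofLp)‖ₑ ≤
      H.indicator (fun y => ENNReal.ofReal (D * ℓ) *
        (ENNReal.ofReal (((ℓ + ρ y) ^ (d + 4 + 1))⁻¹) * g y)) y := by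
    intro y
    rw [← sub_mul, enorm_mul]
    by_cases hy : a - ℓ ^ 4 ≤ y.1
    · rw [hpast _ hy, enorm_zero, mul_zero]
      exact zero_le
    push Not at hy
    have hℓ4 : 0 < ℓ ^ 4 := by positivity
    have hyH : y ∈ H := show y.1 < a by linarith
    rw [indicator_of_mem hyH, ← mul_assoc]
    refine mul_le_mul_left ?_ _
    rw [← ENNReal.ofReal_mul (by positivity), ← ofReal_norm]
    refine ENNReal.ofReal_le_ofReal ?_
    have hρ0 : 0 ≤ ρ y := le_max_of_le_right (norm_nonneg _)
    by_cases hy0 : 0 < y.1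
    swap
    · rw [causalKernel, causalKernel, indicator_of_notMem fun h => hy0 h.1,
        indicator_of_notMem fun h => hy0 h.1, sub_zero, norm_zero]
      positivity
    have hay : 0 ≤ a - y.1 := by linarith
    set q := √√(a - y.1) with hqdef
    have hq4 : q ^ 4 = a - y.1 := sqrt_sqrt_pow_four hay
    have hqℓ : ℓ ≤ q := by
      refine le_of_pow_le_pow_left₀ (n := 4) (by norm_num) (by positivity) ?_
      rw [hq4]; linarith
    have hq0 : 0 < q := hℓ.trans_le hqℓ
    have hrad : ∀ u, a ≤ u → c₀ * q ≤ parabolicRadius b ε u y.1 := by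
      intro u hu
      refine le_trans ?_ (hb.le_radius hε (by linarith))
      rw [hc₀, hqdef, ← Real.sqrt_mul (Real.sqrt_nonneg _), ← Real.sqrt_mul (by positivity)]
      refine Real.sqrt_le_sqrt (Real.sqrt_le_sqrt ?_)
      exact mul_le_mul_of_nonneg_left (by linarith) (by positivity)
    rw [causalKernel, causalKernel, indicator_of_mem (show y.1 ∈ Ioo 0 t from ⟨hy0, by linarith⟩),
      indicator_of_mem (show y.1 ∈ Ioo 0 t₀ from ⟨hy0, by linarith⟩)]
    have hrd := hb.abs_radius_sub_le hε (s := y.1) (t := t) (t₀ := t₀) (by linarith) (by linarith)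
      (ρ := c₀ * q) (by positivity) (hrad t hat) (hrad t₀ hat₀)
    -- Times in the cell differ by at most ℓ⁴, and `q` is at least ℓ, since `f` vanishes later than
    -- ℓ⁴ before the cell. So the radius changes by a multiple of ℓ, like the position.
    have hrd2 : lam * |t - t₀| / (c₀ * q) ^ 3 ≤ lam / c₀ ^ 3 * ℓ := by
      have h1 : |t - t₀| ≤ ℓ ^ 4 := abs_le.2 ⟨by linarith, by linarith⟩
      rw [div_le_iff₀ (by positivity), mul_pow]
      have h2 : ℓ ^ 4 ≤ ℓ * q ^ 3 := by
        rw [show ℓ ^ 4 = ℓ * ℓ ^ 3 by ring]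
        exact mul_le_mul_of_nonneg_left (pow_le_pow_left₀ hℓ.le hqℓ 3) hℓ.le
      have h3 : lam / c₀ ^ 3 * ℓ * (c₀ ^ 3 * q ^ 3) = lam * (ℓ * q ^ 3) := by field_simp
      rw [h3]
      exact mul_le_mul_of_nonneg_left (h1.trans h2) hlam0.le
    refine (hker m hm (c₀ * q) _ _ (by positivity) (hrad t hat) (hrad t₀ hat₀)
      (hb.radius_le hε1 hy0.le (by linarith) htN) (hb.radius_le hε1 hy0.le (by linarith) ht₀N) e y.2
      ?_).trans ?_
    · rw [div_mul_eq_mul_div, ← mul_assoc, mul_right_comm, mul_div_assoc, div_self hc₀0.ne', mul_one]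
      exact he.trans (mul_le_mul_of_nonneg_left hqℓ (Nat.cast_nonneg d))
    · have h5 : ((c₀ * q + ‖y.2‖) ^ (d + 5))⁻¹ ≤
          ((c₀ / 2) ^ (d + 5))⁻¹ * ((ℓ + ρ y) ^ (d + 4 + 1))⁻¹ := by
        rw [← mul_inv, ← mul_pow]
        refine inv_anti₀ (by positivity) (pow_le_pow_left₀ (by positivity) ?_ _)
        have h6 : ρ y ≤ q + ‖y.2‖ := max_le (by linarith [norm_nonneg y.2]) (by linarith)
        have h7 := mul_le_mul_of_nonneg_left h6 hc₀0.le
        have h8 := mul_le_mul_of_nonneg_left hqℓ hc₀0.le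
        have h9 := mul_le_mul_of_nonneg_right hc₀1 (norm_nonneg y.2)
        nlinarith [norm_nonneg y.2]
      calc _ ≤ A * ((lam / c₀ ^ 3 + d) * ℓ) *
            (((c₀ / 2) ^ (d + 5))⁻¹ * ((ℓ + ρ y) ^ (d + 4 + 1))⁻¹) := by
            refine mul_le_mul (mul_le_mul_of_nonneg_left ?_ hA) h5 (by positivity) (by positivity)
            linarith
        _ = _ := by rw [hD]; ring
  have hdiff : parabolicOp m Φ b ε f (t, x + torusMk e.ofLp) - parabolicOp m Φ b ε f (t₀, x) =
      ∫ y : ℝ × EuclideanSpace ℝ (Fin d),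
        (causalKernel m Φ b ε t (y.1, y.2 + e) * f (y.1, x - torusMk y.2.ofLp) -
        causalKernel m Φ b ε t₀ y * f (y.1, x - torusMk y.2.ofLp)) := by
    rw [parabolicOp_add_torusMk, parabolicOp]
    exact (integral_sub (integrable_causalKernel_add_mul hb hε hε1 hm Φ hf hB t x e)
      (integrable_causalKernel_mul hb hε hε1 hm Φ hf hB (t₀, x))).symm
  rw [hdiff]
  refine (enorm_integral_le_lintegral_enorm _).trans ((lintegral_mono hpt).trans ?_)
  have hm1 : Measurable fun y : ℝ × EuclideanSpace ℝ (Fin d) =>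
      ENNReal.ofReal (((ℓ + ρ y) ^ (d + 4 + 1))⁻¹) * g y :=
    (((hρm.const_add ℓ).pow_const _).inv.ennreal_ofReal).mul hgm
  rw [lintegral_indicator hHm, lintegral_const_mul _ hm1]
  -- The mass of |f| within parabolic distance R grows like R^{d+4}, and the kernel difference is ℓ
  -- times a decay of order d + 5. The shells give ℓ⁻¹, which cancels ℓ.
  have hshell := lintegral_inv_pow_mul_le_of_shells (μ := volume.restrict H) hgm hρm
    (fun y => le_max_of_le_right (norm_nonneg _)) hℓ (m := d + 4) (θ := 1)
    (A := ENNReal.ofReal (12 ^ (d + 1)) * stMax n f (t₀, x) ^ (1 / 2 : ℝ)) le_rfl (fun R hR' => ?_)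
  · refine (mul_le_mul_right hshell _).trans ?_
    rw [← mul_assoc, ← mul_assoc, ← ENNReal.ofReal_mul (by positivity),
      ← ENNReal.ofReal_mul (by positivity)]
    refine mul_le_mul_left (ENNReal.ofReal_le_ofReal (le_of_eq ?_)) _
    field_simp
  · have hR0 : 0 < R := hℓ.trans_le hR'
    rw [Measure.restrict_restrict (measurableSet_le hρm measurable_const)]
    have hsub : {y | ρ y ≤ R} ∩ H ⊆
        Icc (a - R ^ 4) (a + ℓ ^ 4) ×ˢ Metric.closedBall (0 : EuclideanSpace ℝ (Fin d)) R := by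
      rintro y ⟨hy1, hy2⟩
      have hy1 : ρ y ≤ R := hy1
      have hy2 : y.1 < a := hy2
      have hℓ4 : 0 < ℓ ^ 4 := by positivity
      refine ⟨⟨?_, by linarith⟩, ?_⟩
      · have h1 : √√(a - y.1) ≤ R := (le_max_left _ _).trans hy1
        have h2 := pow_le_pow_left₀ (Real.sqrt_nonneg _) h1 4
        rw [sqrt_sqrt_pow_four (by linarith)] at h2
        linarith
      · rw [mem_closedBall_zero_iff]
        exact (le_max_right _ _).trans hy1
    have hR4 : 0 < R ^ 4 := by positivity
    refine (lintegral_mono_set hsub).trans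
      ((setLIntegral_enorm_le_stMax hn hf hsupp (t := t₀) ⟨by linarith, ht₀N⟩ (by linarith)
        hta₀ x hR0).trans ?_)
    rw [mul_right_comm (ENNReal.ofReal _), ← ENNReal.ofReal_mul (by positivity)]
    refine mul_le_mul_left (ENNReal.ofReal_le_ofReal ?_) _
    have h4 : ℓ ^ 4 ≤ R ^ 4 := pow_le_pow_left₀ hℓ.le hR' 4
    calc 6 * (a + ℓ ^ 4 - (a - R ^ 4)) * (12 * R) ^ d ≤ 6 * (2 * R ^ 4) * (12 * R) ^ d := by
          refine mul_le_mul_of_nonneg_right ?_ (by positivity)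
          linarith
      _ = _ := by rw [mul_pow, pow_add, pow_succ]; ring

/-- The contribution of the recent past at distant points is small. -/
theorem exists_enorm_parabolicOp_le (hd : 1 ≤ d) (lam : ℝ) (hlam : 1 ≤ lam) {n N : ℕ}
    (hn : 3 * (N : ℝ) ≤ 2 ^ n) (Φ : 𝓢(EuclideanSpace ℝ (Fin d), ℂ)) {Λ : ℝ} (hΛ : 0 ≤ Λ) :
    ∃ C : ℝ≥0, ∀ m ≤ 4, ∀ b ε, IsEllipticPrimitive lam b → 0 < ε → ε ≤ 1 →
      ∀ f : ℝ × UnitAddTorus (Fin d) → ℂ, Measurable f →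
      (∀ z : ℝ × UnitAddTorus (Fin d), z.1 ∉ Icc (0 : ℝ) N → f z = 0) →
      ∀ (ℓ a L t t₀ : ℝ) (x : UnitAddTorus (Fin d)) (e : EuclideanSpace ℝ (Fin d)), 0 < ℓ → L ≤ Λ * ℓ ^ 4 → a ≤ t₀ → t₀ ≤ a + L → 0 ≤ t₀ →
      t ≤ N → t₀ ≤ N → ‖e‖ ≤ d * ℓ →
      (∀ s y, f (s, x - torusMk y) ≠ 0 → s ∈ Icc a (a + L) ∧ 2 * d * ℓ ≤ ‖y‖) →
      ‖parabolicOp m Φ b ε f (t, x + torusMk e.ofLp)‖ₑ ≤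
        C * stMax n f (t₀, x) ^ (1 / 2 : ℝ) := by
  have hlam0 : 0 < lam := by linarith
  have hd' : (1 : ℝ) ≤ d := by exact_mod_cast hd
  have hR : (1 : ℝ) ≤ lam * N + 1 := by
    have : 0 ≤ lam * N := mul_nonneg (by linarith) (Nat.cast_nonneg N)
    linarith
  obtain ⟨A, hA, hker⟩ := norm_scaledKernel_le Φ hR
  set D := A * 4 ^ (d + 4) with hD
  have hD0 : 0 ≤ D := by positivity
  refine ⟨(D * 2 ^ (d + 4 + 1) * (6 * Λ * 12 ^ d)).toNNReal,
    fun m hm b ε hb hε hε1 f hf hsupp ℓ a L t t₀ x e hℓ hLℓ hat₀ hta₀ ht₀ htN ht₀N he hloc => ?_⟩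
  set g : ℝ × EuclideanSpace ℝ (Fin d) → ℝ≥0∞ := fun y => ‖f (y.1, x - torusMk y.2.ofLp)‖ₑ
  have hgm : Measurable g := (hf.comp (measurable_sub_torusMk x)).enorm
  set ρ : ℝ × EuclideanSpace ℝ (Fin d) → ℝ := fun y => ‖y.2‖ with hρdef
  have hρm : Measurable ρ := by fun_prop
  set H : Set (ℝ × EuclideanSpace ℝ (Fin d)) := {y | y.1 ∈ Icc a (a + L)} with hH
  have hHm : MeasurableSet H := measurable_fst measurableSet_Icc
  have hpt : ∀ y : ℝ × EuclideanSpace ℝ (Fin d),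
      ‖causalKernel m Φ b ε t (y.1, y.2 + e) * f (y.1, x - torusMk y.2.ofLp)‖ₑ ≤
      H.indicator (fun y => ENNReal.ofReal D *
        (ENNReal.ofReal (((ℓ + ρ y) ^ (d + 4))⁻¹) * g y)) y := by
    intro y
    rw [enorm_mul]
    by_cases hy : f (y.1, x - torusMk y.2.ofLp) = 0
    · rw [hy, enorm_zero, mul_zero]
      exact zero_le
    obtain ⟨hyH, hyℓ⟩ := hloc _ _ hy
    rw [indicator_of_mem (show y ∈ H from hyH), ← mul_assoc]
    refine mul_le_mul_left ?_ _
    rw [← ENNReal.ofReal_mul (by positivity), ← ofReal_norm]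
    refine ENNReal.ofReal_le_ofReal ?_
    have hρ0 : 0 ≤ ρ y := norm_nonneg _
    by_cases hy0 : y.1 ∈ Ioo 0 t
    swap
    · rw [causalKernel, indicator_of_notMem hy0, norm_zero]
      positivity
    rw [causalKernel, indicator_of_mem hy0]
    have hyn : 2 * d * ℓ ≤ ‖y.2‖ := hyℓ.trans
      ((pi_norm_le_iff_of_nonneg (norm_nonneg _)).2 fun i => PiLp.norm_apply_le y.2 i)
    have hr := (Real.sqrt_pos.2 (Real.sqrt_pos.2 hε)).trans_le
      (hb.sqrt_sqrt_le_radius (ε := ε) hy0.2.le)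
    refine (hker m hm _ hr (hb.radius_le hε1 hy0.1.le hy0.2.le htN) _).trans ?_
    rw [hD, mul_assoc]
    refine mul_le_mul_of_nonneg_left ?_ hA
    have h4 : (4 : ℝ) ^ (d + 4) * ((ℓ + ρ y) ^ (d + 4))⁻¹ = (((ℓ + ρ y) / 4) ^ (d + 4))⁻¹ := by
      rw [div_pow, inv_div, div_eq_mul_inv]
    rw [h4]
    refine inv_anti₀ (by positivity) (pow_le_pow_left₀ (by positivity) ?_ _)
    have h1 : ‖y.2‖ ≤ ‖y.2 + e‖ + ‖e‖ := by
      have := norm_sub_le (y.2 + e) e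
      rwa [add_sub_cancel_right] at this
    -- The shift `e` is at most half of ‖y‖, and so is ℓ because d ≥ 1. Therefore ‖y + e‖ is at
    -- least a quarter of ℓ + ‖y‖, independently of how small the radius is.
    have h2 : ℓ ≤ d * ℓ := le_mul_of_one_le_left hℓ.le hd'
    simp only [hρdef]
    linarith
  rw [parabolicOp_add_torusMk]
  refine (enorm_integral_le_lintegral_enorm _).trans ((lintegral_mono hpt).trans ?_)
  have hm1 : Measurable fun y : ℝ × EuclideanSpace ℝ (Fin d) =>
      ENNReal.ofReal (((ℓ + ρ y) ^ (d + 4))⁻¹) * g y :=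
    (((hρm.const_add ℓ).pow_const _).inv.ennreal_ofReal).mul hgm
  rw [lintegral_indicator hHm, lintegral_const_mul _ hm1]
  have hL : 0 ≤ L := by linarith
  -- The time window is fixed, so the mass grows only like L R^d. Decay of order d + 4 gains ℓ⁻⁴,
  -- which compensates for L ≤ Λℓ⁴.
  have hshell := lintegral_inv_pow_mul_le_of_shells (μ := volume.restrict H) hgm hρm
    (fun y => norm_nonneg _) hℓ (m := d) (θ := 4)
    (A := ENNReal.ofReal (6 * L * 12 ^ d) * stMax n f (t₀, x) ^ (1 / 2 : ℝ)) (by norm_num)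
    (fun R hR' => ?_)
  · refine (mul_le_mul_right hshell _).trans ?_
    rw [← mul_assoc, ← mul_assoc, ← ENNReal.ofReal_mul (by positivity),
      ← ENNReal.ofReal_mul (by positivity)]
    refine mul_le_mul_left (ENNReal.ofReal_le_ofReal ?_) _
    have h1 : (ℓ ^ 4)⁻¹ * L ≤ Λ := by
      rw [inv_mul_le_iff₀ (by positivity), mul_comm]; exact hLℓ
    calc D * (2 ^ (d + 4 + 1) * (ℓ ^ 4)⁻¹) * (6 * L * 12 ^ d) =
          D * 2 ^ (d + 4 + 1) * (6 * ((ℓ ^ 4)⁻¹ * L) * 12 ^ d) := by ring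
      _ ≤ _ := by gcongr
  · have hR0 : 0 < R := hℓ.trans_le hR'
    rw [Measure.restrict_restrict (measurableSet_le hρm measurable_const)]
    have hsub : {y | ρ y ≤ R} ∩ H ⊆
        Icc a (a + L) ×ˢ Metric.closedBall (0 : EuclideanSpace ℝ (Fin d)) R :=
      fun y hy => ⟨hy.2, mem_closedBall_zero_iff.2 hy.1⟩
    refine (lintegral_mono_set hsub).trans
      ((setLIntegral_enorm_le_stMax hn hf hsupp (t := t₀) ⟨ht₀, ht₀N⟩ hat₀
        hta₀ x hR0).trans ?_)
    rw [mul_right_comm (ENNReal.ofReal _), ← ENNReal.ofReal_mul (by positivity),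
      add_sub_cancel_left, mul_pow]
    exact le_of_eq (by ring_nf)

end PointwiseEstimates
open scoped SchwartzMap

/-! ### Fourier coefficients on the torus and the `L²` estimate -/

section FourierCoefficients

open UnitAddTorus (mFourier)

variable {d : ℕ} {lam ε : ℝ} {b : ℝ → ℝ} {m : ℕ}

theorem mFourier_apply_add (n : Fin d → ℤ) (x y : UnitAddTorus (Fin d)) :
    mFourier n (x + y) = mFourier n x * mFourier n y := by
  simp only [mFourier, ContinuousMap.coe_mk, ← Finset.prod_mul_distrib]
  refine Finset.prod_congr rfl fun i _ => ?_
  simp only [fourier_apply, Pi.add_apply, smul_add, AddCircle.toCircle_add, Circle.coe_mul]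

theorem norm_mFourier_apply (n : Fin d → ℤ) (x : UnitAddTorus (Fin d)) : ‖mFourier n x‖ = 1 := by
  simp only [mFourier, ContinuousMap.coe_mk, fourier_apply, norm_prod, Circle.norm_coe,
    Finset.prod_const_one]

theorem mFourier_torusMk (n : Fin d → ℤ) (y : Fin d → ℝ) :
    mFourier n (torusMk y) = Complex.exp (2 * Real.pi * Complex.I * ∑ i, (n i : ℂ) * y i) := by
  simp only [mFourier, ContinuousMap.coe_mk, torusMk, fourier_coe_apply, Finset.mul_sum,
    Complex.exp_sum]
  refine Finset.prod_congr rfl fun i _ => ?_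
  congr 1
  push_cast
  ring

/-- The Fourier coefficients of a function on the torus. -/
noncomputable def torusCoeff (g : UnitAddTorus (Fin d) → ℂ) (n : Fin d → ℤ) : ℂ :=
  ∫ x, mFourier (-n) x * g x

theorem volume_unitAddTorus :
    (volume : Measure (UnitAddTorus (Fin d))) = Measure.pi fun _ => AddCircle.haarAddCircle := by
  rw [volume_pi]
  simp only [volume_unitAddCircle]

theorem hasSum_sq_norm_torusCoeff (g : Lp ℂ 2 (volume : Measure (UnitAddTorus (Fin d)))) :
    HasSum (fun n => ‖torusCoeff g n‖ ^ 2) (∫ x, ‖g x‖ ^ 2) := by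
  have key : ∀ g : Lp ℂ 2 (Measure.pi fun _ : Fin d => AddCircle.haarAddCircle),
      HasSum (fun n => ‖∫ x, mFourier (-n) x * g x ∂(Measure.pi fun _ => AddCircle.haarAddCircle)‖ ^ 2)
        (∫ x, ‖g x‖ ^ 2 ∂(Measure.pi fun _ => AddCircle.haarAddCircle)) :=
    fun g => UnitAddTorus.hasSum_sq_mFourierCoeff g
  rw [← volume_unitAddTorus] at key
  exact key g

theorem tsum_enorm_sq_torusCoeff {g : UnitAddTorus (Fin d) → ℂ} (hg : MemLp g 2) :
    ∑' n, ‖torusCoeff g n‖ₑ ^ 2 = ∫⁻ x, ‖g x‖ₑ ^ 2 := by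
  have h := hasSum_sq_norm_torusCoeff (hg.toLp g)
  have e1 : ∀ n, torusCoeff (hg.toLp g) n = torusCoeff g n := fun n =>
    integral_congr_ae (by filter_upwards [hg.coeFn_toLp] with x hx; rw [hx])
  have e2 : ∫ x, ‖hg.toLp g x‖ ^ 2 = ∫ x, ‖g x‖ ^ 2 :=
    integral_congr_ae (by filter_upwards [hg.coeFn_toLp] with x hx; rw [hx])
  simp only [e1, e2] at h
  have h2 : ∀ z : ℂ, ‖z‖ₑ ^ 2 = ENNReal.ofReal (‖z‖ ^ 2) := fun z => by
    rw [ENNReal.ofReal_pow (norm_nonneg _), ofReal_norm]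
  simp only [h2]
  rw [← ENNReal.ofReal_tsum_of_nonneg (fun n => by positivity) h.summable, h.tsum_eq]
  exact ofReal_integral_eq_lintegral_ofReal ((memLp_two_iff_integrable_sq_norm hg.1).1 hg)
    (Filter.Eventually.of_forall fun x => by positivity)

theorem torusCoeff_sub_right (g : UnitAddTorus (Fin d) → ℂ) (z : UnitAddTorus (Fin d))
    (n : Fin d → ℤ) :
    torusCoeff (fun x => g (x - z)) n = mFourier (-n) z * torusCoeff g n := by
  rw [torusCoeff, torusCoeff, ← integral_const_mul,
    ← integral_sub_right_eq_self (fun x => mFourier (-n) z * (mFourier (-n) x * g x)) z]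
  refine integral_congr_ae (Filter.Eventually.of_forall fun x => ?_)
  simp only
  rw [← mul_assoc, ← mFourier_apply_add, add_sub_cancel]

theorem memLp_of_norm_le {g : UnitAddTorus (Fin d) → ℂ} (hg : Measurable g) {B : ℝ}
    (hB : ∀ x, ‖g x‖ ≤ B) (p : ℝ≥0∞) : MemLp g p :=
  MemLp.of_bound hg.aestronglyMeasurable B (Filter.Eventually.of_forall hB)

/-- The symbol `|2πn|⁴` of the bilaplacian. -/
noncomputable def bilapSymbol (n : Fin d → ℤ) : ℝ := (∑ i, (2 * Real.pi * n i) ^ 2) ^ 2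

theorem bilapSymbol_nonneg (n : Fin d → ℤ) : 0 ≤ bilapSymbol n := sq_nonneg _

/-- The rescalings of `Φ` have the Fourier coefficients `σ(n) exp(-r⁴|2πn|⁴)`. -/
def HasParabolicSymbol (m : ℕ) (Φ : EuclideanSpace ℝ (Fin d) → ℂ) (σ : (Fin d → ℤ) → ℂ) : Prop :=
  ∀ r, 0 < r → ∀ n, ∫ y : EuclideanSpace ℝ (Fin d),
    scaledKernel m Φ r y * mFourier (-n) (torusMk y.ofLp) =
      σ n * (Real.exp (-(r ^ 4 * bilapSymbol n)) : ℂ)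

variable {f : ℝ × UnitAddTorus (Fin d) → ℂ}

theorem stronglyMeasurable_torusCoeff (hf : Measurable f) (n : Fin d → ℤ) :
    StronglyMeasurable fun s => torusCoeff (fun x => f (s, x)) n := by
  refine StronglyMeasurable.integral_prod_right
    (f := fun (s : ℝ) (x : UnitAddTorus (Fin d)) => mFourier (-n) x * f (s, x)) ?_
  exact ((((mFourier (-n)).continuous.measurable).comp measurable_snd).mul hf).stronglyMeasurable

theorem norm_torusCoeff_le {g : UnitAddTorus (Fin d) → ℂ} {B : ℝ} (hB : ∀ x, ‖g x‖ ≤ B)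
    (n : Fin d → ℤ) : ‖torusCoeff g n‖ ≤ B := by
  have h := norm_integral_le_of_norm_le_const (μ := (volume : Measure (UnitAddTorus (Fin d))))
    (f := fun x => mFourier (-n) x * g x) (C := B) (Filter.Eventually.of_forall fun x => by
      rw [norm_mul, norm_mFourier_apply, one_mul]; exact hB x)
  rwa [probReal_univ, mul_one] at h

/-- The operator is diagonal in Fourier variables. By Fubini and translation, the kernel at each
time s contributes its symbol, in which r⁴ equals b(t) - b(s) + ε. -/
theorem torusCoeff_parabolicOp (hb : IsEllipticPrimitive lam b) (hε : 0 < ε) (hε1 : ε ≤ 1)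
    (hm : m ≤ 4) {Φ : 𝓢(EuclideanSpace ℝ (Fin d), ℂ)} {σ : (Fin d → ℤ) → ℂ}
    (hΦ : HasParabolicSymbol m Φ σ) (hf : Measurable f) {B : ℝ} (hB : ∀ z, ‖f z‖ ≤ B)
    (t : ℝ) (n : Fin d → ℤ) :
    torusCoeff (fun x => parabolicOp m Φ b ε f (t, x)) n =
      ∫ s in Ioo 0 t, σ n * (Real.exp (-((b t - b s + ε) * bilapSymbol n)) : ℂ) *
        torusCoeff (fun x => f (s, x)) n := by
  have hK := integrable_causalKernel hb hε hε1 hm Φ t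
  have hcont : Continuous (mFourier (-n) : UnitAddTorus (Fin d) → ℂ) := (mFourier (-n)).continuous
  have hint : Integrable (Function.uncurry fun (x : UnitAddTorus (Fin d))
      (y : ℝ × EuclideanSpace ℝ (Fin d)) => mFourier (-n) x *
        (causalKernel m Φ b ε t y * f (y.1, x - torusMk y.2.ofLp))) (volume.prod volume) := by
    have h1 : Integrable (fun z : UnitAddTorus (Fin d) × (ℝ × EuclideanSpace ℝ (Fin d)) =>
        mFourier (-n) z.1 * causalKernel m Φ b ε t z.2) (volume.prod volume) :=
      ((memLp_of_norm_le hcont.measurable (fun x => (norm_mFourier_apply _ x).le) 1).integrable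
        le_rfl).mul_prod hK
    have h2 : Measurable fun z : UnitAddTorus (Fin d) × (ℝ × EuclideanSpace ℝ (Fin d)) =>
        f (z.2.1, z.1 - torusMk z.2.2.ofLp) := by
      refine hf.comp ((measurable_fst.comp measurable_snd).prodMk (measurable_fst.sub ?_))
      exact measurable_torusMk.comp ((PiLp.continuous_ofLp 2 _).measurable.comp
        (measurable_snd.comp measurable_snd))
    refine (h1.mul_bdd (c := B) h2.aestronglyMeasurable
      (Filter.Eventually.of_forall fun _ => hB _)).congr (Filter.Eventually.of_forall fun z => ?_)
    simp only [Function.uncurry]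
    ring
  have e1 : torusCoeff (fun x => parabolicOp m Φ b ε f (t, x)) n =
      ∫ y : ℝ × EuclideanSpace ℝ (Fin d), causalKernel m Φ b ε t y *
        (mFourier (-n) (torusMk y.2.ofLp) * torusCoeff (fun x => f (y.1, x)) n) := by
    simp only [torusCoeff, parabolicOp, ← integral_const_mul]
    rw [integral_integral_swap hint]
    refine integral_congr_ae (Filter.Eventually.of_forall fun y => ?_)
    have h3 := torusCoeff_sub_right (fun x => f (y.1, x)) (torusMk y.2.ofLp) n
    simp only [torusCoeff] at h3
    simp only [integral_const_mul]
    rw [← h3, ← integral_const_mul]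
    refine integral_congr_ae (Filter.Eventually.of_forall fun x => ?_)
    simp only
    ring
  have hint2 : Integrable (fun y : ℝ × EuclideanSpace ℝ (Fin d) => causalKernel m Φ b ε t y *
      (mFourier (-n) (torusMk y.2.ofLp) * torusCoeff (fun x => f (y.1, x)) n)) := by
    refine hK.mul_bdd (c := B) (Measurable.aestronglyMeasurable ?_)
      (Filter.Eventually.of_forall fun y => ?_)
    · exact (hcont.measurable.comp (measurable_torusMk.comp
        ((PiLp.continuous_ofLp 2 _).measurable.comp measurable_snd))).mul
        ((stronglyMeasurable_torusCoeff hf n).measurable.comp measurable_fst)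
    · rw [norm_mul, norm_mFourier_apply, one_mul]
      exact norm_torusCoeff_le (fun x => hB _) n
  rw [e1, Measure.volume_eq_prod, integral_prod _ (by rwa [Measure.volume_eq_prod] at hint2),
    ← integral_indicator measurableSet_Ioo]
  refine integral_congr_ae (Filter.Eventually.of_forall fun s => ?_)
  simp only
  by_cases hs : s ∈ Ioo 0 t
  · simp only [causalKernel, indicator_of_mem hs]
    have hr : 0 < parabolicRadius b ε t s := (Real.sqrt_pos.2 (Real.sqrt_pos.2 hε)).trans_le
      (hb.sqrt_sqrt_le_radius hs.2.le)
    rw [← hb.radius_pow_four hε hs.2.le, ← hΦ _ hr n, ← integral_mul_const]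
    refine integral_congr_ae (Filter.Eventually.of_forall fun y => ?_)
    simp only
    ring
  · simp only [causalKernel, indicator_of_notMem hs, zero_mul, integral_zero]

/-- Young's inequality for the convolution with a decaying exponential. -/
theorem lintegral_sq_lintegral_exp_le {κ c : ℝ} (hκ : 0 < κ) (hc : 0 < c) (T : ℝ) {g : ℝ → ℝ≥0∞}
    (hg : Measurable g) :
    ∫⁻ t in Ioo 0 T, (∫⁻ s in Ioo 0 t, ENNReal.ofReal (κ * Real.exp (-(κ * c * (t - s)))) * g s) ^ 2 ≤
      ENNReal.ofReal (c⁻¹ ^ 2) * ∫⁻ s in Ioo 0 T, g s ^ 2 := by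
  set k : ℝ → ℝ≥0∞ := fun u => (Ioi 0).indicator
    (fun u => ENNReal.ofReal (κ * Real.exp (-(κ * c * u)))) u with hk
  have hkm : Measurable k := Measurable.indicator (by fun_prop) measurableSet_Ioi
  have hk1 : ∫⁻ u, k u = ENNReal.ofReal c⁻¹ := by
    rw [hk, lintegral_indicator measurableSet_Ioi]
    have hkc : 0 < κ * c := by positivity
    have h1 := integral_exp_mul_Ioi (a := -(κ * c)) (by linarith) 0
    have h2 := integrableOn_exp_mul_Ioi (a := -(κ * c)) (by linarith) 0
    rw [← ofReal_integral_eq_lintegral_ofReal]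
    · congr 1
      rw [integral_const_mul]
      simp only [← neg_mul (κ * c)]
      rw [h1]
      simp
      field_simp
    · simp only [← neg_mul (κ * c)]
      exact h2.const_mul κ
    · exact Filter.Eventually.of_forall fun u => by positivity
  set G : ℝ → ℝ≥0∞ := (Ioo 0 T).indicator g with hG
  have hGm : Measurable G := hg.indicator measurableSet_Ioo
  -- Cauchy–Schwarz with respect to the measure k(t - s) ds, of total mass c⁻¹. The integration in t
  -- gives c⁻¹ once more.
  have hle : ∀ t ∈ Ioo 0 T, (∫⁻ s in Ioo 0 t,
      ENNReal.ofReal (κ * Real.exp (-(κ * c * (t - s)))) * g s) ^ 2 ≤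
        ENNReal.ofReal c⁻¹ * ∫⁻ s, k (t - s) * G s ^ 2 := by
    intro t ht
    have hkt : Measurable fun s => k (t - s) := hkm.comp (measurable_const_sub t)
    have h1 : ∫⁻ s in Ioo 0 t, ENNReal.ofReal (κ * Real.exp (-(κ * c * (t - s)))) * g s ≤
        ∫⁻ s, G s ∂(volume.withDensity fun s => k (t - s)) := by
      rw [lintegral_withDensity_eq_lintegral_mul _ hkt hGm, ← lintegral_indicator measurableSet_Ioo]
      refine lintegral_mono fun s => ?_
      by_cases hs : s ∈ Ioo 0 t
      · rw [indicator_of_mem hs, Pi.mul_apply, hG,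
          indicator_of_mem (show s ∈ Ioo 0 T from ⟨hs.1, hs.2.trans ht.2⟩), hk]
        simp only
        rw [indicator_of_mem (show t - s ∈ Ioi 0 from sub_pos.2 hs.2)]
      · rw [indicator_of_notMem hs]
        exact zero_le
    have h2 := lintegral_le_sqrt_mul_sqrt (μ := volume.withDensity fun s => k (t - s)) hGm
    have h3 : (volume.withDensity fun s => k (t - s)) univ = ENNReal.ofReal c⁻¹ := by
      rw [withDensity_apply _ MeasurableSet.univ, Measure.restrict_univ,
        lintegral_sub_left_eq_self k t, hk1]
    have h4 : ∫⁻ s, G s ^ 2 ∂(volume.withDensity fun s => k (t - s)) =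
        ∫⁻ s, k (t - s) * G s ^ 2 := by
      rw [lintegral_withDensity_eq_lintegral_mul _ hkt (hGm.pow_const 2)]
      rfl
    rw [h3, h4, ← ENNReal.mul_rpow_of_nonneg _ _ (by norm_num)] at h2
    refine (pow_le_pow_left₀ zero_le (h1.trans h2) 2).trans (le_of_eq ?_)
    rw [← ENNReal.rpow_natCast, ← ENNReal.rpow_mul]
    norm_num
  refine (setLIntegral_mono' measurableSet_Ioo hle).trans ?_
  refine (setLIntegral_le_lintegral _ _).trans ?_
  have hm2 : Measurable fun z : ℝ × ℝ => k (z.1 - z.2) * G z.2 ^ 2 :=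
    (hkm.comp (measurable_fst.sub measurable_snd)).mul ((hGm.comp measurable_snd).pow_const 2)
  rw [lintegral_const_mul _ hm2.lintegral_prod_right', lintegral_lintegral_swap hm2.aemeasurable]
  have h5 : ∀ s, ∫⁻ t, k (t - s) * G s ^ 2 = ENNReal.ofReal c⁻¹ * G s ^ 2 := by
    intro s
    have hks : Measurable fun t => k (t - s) := hkm.comp (measurable_sub_const s)
    rw [lintegral_mul_const _ hks, lintegral_sub_right_eq_self k s, hk1]
  simp only [h5]
  rw [lintegral_const_mul _ (hGm.pow_const 2), ← mul_assoc, ← sq, ENNReal.ofReal_pow (by positivity)]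
  refine mul_le_mul_right (le_of_eq ?_) _
  rw [← lintegral_indicator measurableSet_Ioo]
  refine lintegral_congr fun s => ?_
  by_cases hs : s ∈ Ioo 0 T
  · rw [hG, indicator_of_mem hs, indicator_of_mem hs]
  · rw [hG, indicator_of_notMem hs, indicator_of_notMem hs, zero_pow two_ne_zero]

/-- Parseval reduces to one frequency. There the symbol has size at most κ and the exponential
decays at a rate comparable with κ, so the norm of the time convolution does not depend on the
frequency or on ε. -/
theorem exists_lintegral_enorm_sq_parabolicOp_le (d : ℕ) (lam : ℝ) (N : ℕ) :
    ∃ C : ℝ≥0, ∀ m ≤ 4, ∀ b ε, IsEllipticPrimitive lam b → 0 < ε → ε ≤ 1 →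
      ∀ (Φ : 𝓢(EuclideanSpace ℝ (Fin d), ℂ)) (σ : (Fin d → ℤ) → ℂ), HasParabolicSymbol m Φ σ →
      (∀ n, ‖σ n‖ ≤ max 1 (bilapSymbol n)) →
      ∀ f : ℝ × UnitAddTorus (Fin d) → ℂ, Measurable f → ∀ B : ℝ, (∀ z, ‖f z‖ ≤ B) →
      ∫⁻ z, ‖parabolicOp m Φ b ε f z‖ₑ ^ 2 ∂(slabMeasure d N) ≤
        C * ∫⁻ z, ‖f z‖ₑ ^ 2 ∂(slabMeasure d N) := by
  set A := Real.exp (lam⁻¹ * N) with hA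
  refine ⟨(A ^ 2 * lam ^ 2).toNNReal,
    fun m hm b ε hb hε hε1 Φ σ hΦ hσ f hf B hB => ?_⟩
  have hlam := hb.pos
  have hslab : ∀ g : ℝ × UnitAddTorus (Fin d) → ℂ, Measurable g → (∀ t ≤ (N : ℝ), ∃ B : ℝ, ∀ x, ‖g (t, x)‖ ≤ B) →
      ∫⁻ z, ‖g z‖ₑ ^ 2 ∂(slabMeasure d N) =
        ∑' n, ∫⁻ t in Ioo (0 : ℝ) N, ‖torusCoeff (fun x => g (t, x)) n‖ₑ ^ 2 := by
    intro g hg hgB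
    have hgm := hg.enorm.pow_const 2
    rw [slabMeasure, lintegral_prod _ hgm.aemeasurable, ← restrict_Ioo_eq_restrict_Ico,
      ← lintegral_tsum fun n => ((stronglyMeasurable_torusCoeff hg n).enorm.pow_const 2).aemeasurable]
    refine setLIntegral_congr_fun measurableSet_Ioo fun t ht => ?_
    obtain ⟨B, hB⟩ := hgB t ht.2.le
    have hgt : Measurable fun x => g (t, x) := hg.comp measurable_prodMk_left
    rw [tsum_enorm_sq_torusCoeff (memLp_of_norm_le hgt hB 2)]
  obtain ⟨M, -, hM⟩ := norm_parabolicOp_le hb hε hε1 hm Φ N B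
  rw [hslab _ (stronglyMeasurable_parabolicOp hb Φ hf).measurable
      fun t ht => ⟨M, fun x => hM f hB (t, x) ht⟩, hslab f hf fun t _ => ⟨B, fun x => hB _⟩,
    ← ENNReal.tsum_mul_left]
  refine ENNReal.tsum_le_tsum fun n => ?_
  set κ := max 1 (bilapSymbol n) with hκ
  have hκ1 : 1 ≤ κ := le_max_left _ _
  have hgm : Measurable fun s => ‖torusCoeff (fun x => f (s, x)) n‖ₑ :=
    (stronglyMeasurable_torusCoeff hf n).measurable.enorm
  have hpt : ∀ t ∈ Ioo (0 : ℝ) N, ‖torusCoeff (fun x => parabolicOp m Φ b ε f (t, x)) n‖ₑ ^ 2 ≤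
      ENNReal.ofReal (A ^ 2) * (∫⁻ s in Ioo 0 t, ENNReal.ofReal (κ * Real.exp (-(κ * lam⁻¹ * (t - s)))) *
        ‖torusCoeff (fun x => f (s, x)) n‖ₑ) ^ 2 := by
    intro t ht
    rw [ENNReal.ofReal_pow (by positivity), ← mul_pow]
    refine pow_le_pow_left₀ zero_le ?_ 2
    rw [torusCoeff_parabolicOp hb hε hε1 hm hΦ hf hB]
    refine (enorm_integral_le_lintegral_enorm _).trans ?_
    have hm3 : Measurable fun s => ENNReal.ofReal (κ * Real.exp (-(κ * lam⁻¹ * (t - s)))) *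
        ‖torusCoeff (fun x => f (s, x)) n‖ₑ := by
      refine Measurable.mul ?_ hgm
      fun_prop
    rw [← lintegral_const_mul _ hm3]
    refine setLIntegral_mono' measurableSet_Ioo fun s hs => ?_
    rw [enorm_mul, ← mul_assoc, ← ENNReal.ofReal_mul (by positivity), ← ofReal_norm]
    refine mul_le_mul_left (ENNReal.ofReal_le_ofReal ?_) _
    rw [norm_mul, Complex.norm_real, Real.norm_of_nonneg (Real.exp_nonneg _)]
    have h1 := hb.lower s t hs.2.le
    have h2 := bilapSymbol_nonneg n
    have hl : 0 < lam⁻¹ := inv_pos.2 hlam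
    -- Replacing the symbol by κ ≤ 1 + |2πn|⁴ in the exponent makes the rate positive at n = 0 as
    -- well. On [0, N] this costs the factor exp(λ⁻¹N).
    have h3 : -((b t - b s + ε) * bilapSymbol n) ≤ lam⁻¹ * N + -(κ * lam⁻¹ * (t - s)) := by
      have h4 : κ ≤ 1 + bilapSymbol n := max_le (by linarith) (by linarith)
      have h5 : lam⁻¹ * (t - s) * bilapSymbol n ≤ (b t - b s + ε) * bilapSymbol n :=
        mul_le_mul_of_nonneg_right (by linarith) h2
      have h6 : 0 ≤ lam⁻¹ * (t - s) := mul_nonneg hl.le (by linarith [hs.2])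
      have h7 := mul_le_mul_of_nonneg_left h4 h6
      have h8 : lam⁻¹ * (t - s) ≤ lam⁻¹ * N :=
        mul_le_mul_of_nonneg_left (by linarith [hs.1, ht.2]) hl.le
      linarith
    calc ‖σ n‖ * Real.exp (-((b t - b s + ε) * bilapSymbol n))
        ≤ κ * Real.exp (lam⁻¹ * N + -(κ * lam⁻¹ * (t - s))) :=
          mul_le_mul (hσ n) (Real.exp_le_exp.2 h3) (Real.exp_nonneg _) (by linarith)
      _ = _ := by rw [Real.exp_add, hA]; ring
  refine (setLIntegral_mono' measurableSet_Ioo hpt).trans ?_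
  rw [lintegral_const_mul' _ _ ENNReal.ofReal_ne_top]
  refine (mul_le_mul_right (lintegral_sq_lintegral_exp_le (by linarith) (inv_pos.2 hlam) N hgm)
    _).trans ?_
  rw [← mul_assoc, ← ENNReal.ofReal_mul (by positivity), inv_inv]
  rfl

end FourierCoefficients
open scoped SchwartzMap

/-! ### Oscillation estimates on parabolic cells -/

section Oscillation

variable {d : ℕ} {lam ε : ℝ} {b : ℝ → ℝ} {m : ℕ}

theorem parabolicOp_congr_of_lt {Φ : EuclideanSpace ℝ (Fin d) → ℂ}
    {f g : ℝ × UnitAddTorus (Fin d) → ℂ} {z : ℝ × UnitAddTorus (Fin d)}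
    (h : ∀ s x, s < z.1 → f (s, x) = g (s, x)) :
    parabolicOp m Φ b ε f z = parabolicOp m Φ b ε g z := by
  refine integral_congr_ae (Filter.Eventually.of_forall fun y => ?_)
  simp only
  by_cases hy : y.1 ∈ Ioo 0 z.1
  · rw [h _ _ hy.2]
  · rw [causalKernel, indicator_of_notMem hy, zero_mul, zero_mul]

theorem labelCell_stLabel_pow (k : ℕ) :
    ENNReal.ofReal ((16 ^ k)⁻¹ * ((2 ^ k)⁻¹) ^ d) = ENNReal.ofReal (((2 ^ k : ℝ)⁻¹) ^ (d + 4)) := by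
  congr 1
  rw [pow_add, mul_comm, inv_pow, inv_pow, ← pow_mul, ← pow_mul, mul_comm k 4, pow_mul 2 4]
  norm_num

theorem cellAvg_le_of_lintegral_sq_le {S ι : Type*} [MeasurableSpace S] {P : ℕ → S → ι}
    {μ : Measure S} {k : ℕ} {x : S} {g : S → ℝ≥0∞} (hg : Measurable g)
    (h0 : μ (labelCell P k x) ≠ 0) (ht : μ (labelCell P k x) ≠ ⊤) {A : ℝ≥0∞}
    (h : ∫⁻ y, g y ^ 2 ∂μ ≤ μ (labelCell P k x) * A) :
    cellAvg P μ g k x ≤ A ^ (1 / 2 : ℝ) := by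
  rw [cellAvg, ENNReal.div_le_iff' h0 ht]
  refine (lintegral_le_sqrt_mul_sqrt hg).trans ?_
  rw [Measure.restrict_apply_univ]
  refine (mul_le_mul_right (ENNReal.rpow_le_rpow ((setLIntegral_le_lintegral _ _).trans h)
    (by norm_num)) _).trans (le_of_eq ?_)
  rw [ENNReal.mul_rpow_of_nonneg _ _ (by norm_num), ← mul_assoc,
    ← ENNReal.rpow_add_of_nonneg _ _ (by norm_num) (by norm_num)]
  norm_num

theorem cellAvg_le_add {S ι : Type*} [MeasurableSpace S] [MeasurableSpace ι] [Countable ι]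
    [MeasurableSingletonClass ι] {P : ℕ → S → ι} (hP : IsNestedPartition P)
    {μ : Measure S} {k : ℕ} {x : S} {g h : S → ℝ≥0∞} {A : ℝ≥0∞} (hh : Measurable h)
    (H : ∀ y ∈ labelCell P k x, g y ≤ A + h y) :
    cellAvg P μ g k x ≤ A + cellAvg P μ h k x := by
  rw [cellAvg, cellAvg]
  refine (ENNReal.div_le_div_right (setLIntegral_mono' (hP.measurableSet_labelCell k x) H) _).trans ?_
  rw [lintegral_add_right _ hh, lintegral_const, Measure.restrict_apply_univ, ENNReal.add_div]
  refine add_le_add_left ?_ _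
  rw [mul_div_assoc]
  exact mul_le_of_le_one_right zero_le ENNReal.div_self_le_one

/-- The average over a cell of the operator applied to a function supported in a time window of
comparable length. -/
theorem exists_cellAvg_parabolicOp_le_of_window (hd : 1 ≤ d) (lam : ℝ) (hlam : 1 ≤ lam) {n N : ℕ}
    (hn : 3 * (N : ℝ) ≤ 2 ^ n) {m : ℕ} (hm : m ≤ 4) (Φ : 𝓢(EuclideanSpace ℝ (Fin d), ℂ))
    {σ : (Fin d → ℤ) → ℂ} (hΦ : HasParabolicSymbol m Φ σ) (hσ : ∀ n, ‖σ n‖ ≤ max 1 (bilapSymbol n))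
    {Λ : ℝ} (hΛ : 0 ≤ Λ) :
    ∃ C : ℝ≥0, ∀ b ε, IsEllipticPrimitive lam b → 0 < ε → ε ≤ 1 →
      ∀ f : ℝ × UnitAddTorus (Fin d) → ℂ, Measurable f → ∀ B : ℝ, (∀ z, ‖f z‖ ≤ B) →
      (∀ z : ℝ × UnitAddTorus (Fin d), z.1 ∉ Icc (0 : ℝ) N → f z = 0) →
      ∀ (k : ℕ) (z : ℝ × UnitAddTorus (Fin d)) (a L : ℝ), z.1 ∈ Ico (0 : ℝ) N →
      L ≤ Λ * ((2 ^ k : ℝ)⁻¹) ^ 4 → a ≤ z.1 → z.1 ≤ a + L →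
      (∀ y : ℝ × UnitAddTorus (Fin d), y.1 ∉ Icc a (a + L) → f y = 0) →
      cellAvg (stLabel n) (slabMeasure d N) (fun y => ‖parabolicOp m Φ b ε f y‖ₑ) k z ≤
        C * stMax n f z ^ (1 / 2 : ℝ) := by
  obtain ⟨C₁, hC₁⟩ := exists_enorm_parabolicOp_le hd lam hlam hn Φ hΛ
  obtain ⟨C₂, hC₂⟩ := exists_lintegral_enorm_sq_parabolicOp_le d lam N
  set D : ℝ := (24 * d) ^ d * (6 * Λ) with hD
  have hD0 : 0 ≤ D := by positivity
  set E : ℝ≥0∞ := (C₂ * ENNReal.ofReal D) ^ (1 / 2 : ℝ) with hE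
  have hEt : E ≠ ⊤ := ENNReal.rpow_ne_top_of_nonneg (by norm_num)
    (ENNReal.mul_ne_top ENNReal.coe_ne_top ENNReal.ofReal_ne_top)
  refine ⟨C₁ + E.toNNReal, fun b ε hb hε hε1 f hf B hB hsupp k z a L hz hL haz hzL hloc => ?_⟩
  obtain ⟨t₀, x₀⟩ := z
  simp only at hz haz hzL
  set ℓ : ℝ := (2 ^ k : ℝ)⁻¹ with hℓdef
  have hℓ : 0 < ℓ := by positivity
  have hd0 : (0 : ℝ) < d := by exact_mod_cast hd
  -- Points of the cell are within dℓ of x₀, so outside this ball the kernel is evaluated away from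
  -- its singularity and the pointwise bound applies. Inside, only the L² bound is available.
  set S : Set (ℝ × UnitAddTorus (Fin d)) := {y | y.2 ∈ Metric.closedBall x₀ (2 * d * ℓ)} with hS
  have hSm : MeasurableSet S := measurable_snd Metric.isClosed_closedBall.measurableSet
  have hB0 : 0 ≤ B := (norm_nonneg _).trans (hB (t₀, x₀))
  have hind : ∀ (T : Set (ℝ × UnitAddTorus (Fin d))) z, ‖T.indicator f z‖ ≤ ‖f z‖ := fun T z =>
    norm_indicator_le_norm_self _ _
  have hX : ∀ T : Set (ℝ × UnitAddTorus (Fin d)), stMax n (T.indicator f) (t₀, x₀) ^ (1 / 2 : ℝ) ≤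
      stMax n f (t₀, x₀) ^ (1 / 2 : ℝ) := fun T =>
    ENNReal.rpow_le_rpow (stMax_mono n (hind T) _) (by norm_num)
  have hsplit : ∀ y, parabolicOp m Φ b ε f y =
      parabolicOp m Φ b ε (Sᶜ.indicator f) y + parabolicOp m Φ b ε (S.indicator f) y := by
    intro y
    rw [← parabolicOp_add hb hε hε1 hm Φ (hf.indicator hSm.compl) (hf.indicator hSm) (B := B)
      (fun z => (hind _ z).trans (hB z)) (fun z => (hind _ z).trans (hB z))]
    congr 1
    funext z
    exact (congrFun (indicator_compl_add_self S f) z).symm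
  have hfar : ∀ y ∈ labelCell (stLabel n) k (t₀, x₀),
      ‖parabolicOp m Φ b ε (Sᶜ.indicator f) y‖ₑ ≤ C₁ * stMax n f (t₀, x₀) ^ (1 / 2 : ℝ) := by
    rintro ⟨t, x⟩ hy
    rw [labelCell_stLabel] at hy
    obtain ⟨e, rfl, he⟩ := exists_add_torusMk_eq_of_mem_labelCell hy.2
    have htN : t ∈ Ico (0 : ℝ) N := (mem_Ico_natCast_iff (floor_eq_of_mem_labelCell hy.1)).2 hz
    refine (hC₁ m hm b ε hb hε hε1 (Sᶜ.indicator f) (hf.indicator hSm.compl) (fun z hz => ?_) ℓ a L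
      t t₀ x₀ e hℓ hL haz hzL hz.1 htN.2.le hz.2.le he (fun s y hsy => ?_)).trans
      (mul_le_mul_right (hX _) _)
    · by_cases h : z ∈ Sᶜ
      · rw [indicator_of_mem h, hsupp z hz]
      · rw [indicator_of_notMem h]
    · have h1 := mem_of_indicator_ne_zero hsy
      rw [indicator_of_mem h1] at hsy
      refine ⟨by_contra fun h => hsy (hloc _ h), ?_⟩
      have h2 : ¬ (x₀ - torusMk y ∈ Metric.closedBall x₀ (2 * d * ℓ)) := h1
      rw [mem_closedBall_iff_norm, sub_sub_cancel_left, norm_neg, not_le] at h2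
      exact h2.le.trans (norm_torusMk_le y)
  have hFm : Measurable fun y => ‖parabolicOp m Φ b ε (S.indicator f) y‖ₑ :=
    (stronglyMeasurable_parabolicOp hb Φ (hf.indicator hSm)).measurable.enorm
  -- The near part of `f` lives on a cylinder of radius 2dℓ and duration at most Λℓ⁴. Its L² mass is
  -- therefore at most the measure of the cell times the maximal function.
  have hL2 : ∫⁻ y, ‖S.indicator f y‖ₑ ^ 2 ∂(slabMeasure d N) ≤
      ENNReal.ofReal (ℓ ^ (d + 4)) * (ENNReal.ofReal D * stMax n f (t₀, x₀)) := by
    have h1 : ∀ s, ∫⁻ x, ‖S.indicator f (s, x)‖ₑ ^ 2 =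
        ∫⁻ x in Metric.closedBall x₀ (2 * d * ℓ), ‖f (s, x)‖ₑ ^ 2 := by
      intro s
      rw [← lintegral_indicator Metric.isClosed_closedBall.measurableSet]
      refine lintegral_congr fun x => ?_
      by_cases hx : x ∈ Metric.closedBall x₀ (2 * d * ℓ)
      · rw [indicator_of_mem hx, indicator_of_mem (show (s, x) ∈ S from hx)]
      · rw [indicator_of_notMem hx, indicator_of_notMem (show (s, x) ∉ S from hx)]
        simp
    rw [slabMeasure, lintegral_prod _ ((hf.indicator hSm).enorm.pow_const 2).aemeasurable]
    simp only [h1]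
    have h2 : ∫⁻ s in Ico (0 : ℝ) N, ∫⁻ x in Metric.closedBall x₀ (2 * d * ℓ), ‖f (s, x)‖ₑ ^ 2 ≤
        ∫⁻ s in Icc a (a + L), ∫⁻ x in Metric.closedBall x₀ (2 * d * ℓ), ‖f (s, x)‖ₑ ^ 2 := by
      refine (setLIntegral_le_lintegral _ _).trans ?_
      rw [← lintegral_indicator measurableSet_Icc]
      refine lintegral_mono fun s => ?_
      by_cases hs : s ∈ Icc a (a + L)
      · rw [indicator_of_mem hs]
      · simp [hloc (s, _) hs]
    refine h2.trans ((setLIntegral_enorm_sq_le_stMax hn hf hsupp ⟨hz.1, hz.2.le⟩ haz hzL x₀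
      ((12 * (2 * d * ℓ)) ^ d) fun s => setLIntegral_closedBall_le_torusMax _ _ (by positivity)).trans ?_)
    rw [← mul_assoc (ENNReal.ofReal _) (ENNReal.ofReal _),
      ← mul_assoc (ENNReal.ofReal (ℓ ^ _)) (ENNReal.ofReal _), ← ENNReal.ofReal_mul (by positivity),
      ← ENNReal.ofReal_mul (by positivity)]
    refine mul_le_mul_left (ENNReal.ofReal_le_ofReal ?_) _
    rw [add_sub_cancel_left]
    calc (12 * (2 * d * ℓ)) ^ d * (6 * L) ≤ (12 * (2 * d * ℓ)) ^ d * (6 * (Λ * ℓ ^ 4)) := by gcongr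
      _ = _ := by rw [hD, pow_add, ← mul_assoc 12, ← mul_assoc 12, mul_pow]; ring
  have hμ : slabMeasure d N (labelCell (stLabel n) k (t₀, x₀)) = ENNReal.ofReal (ℓ ^ (d + 4)) := by
    rw [slabMeasure_labelCell_eq_ofReal hz, labelCell_stLabel_pow]
  have hnear : cellAvg (stLabel n) (slabMeasure d N)
      (fun y => ‖parabolicOp m Φ b ε (S.indicator f) y‖ₑ) k (t₀, x₀) ≤
        E * stMax n f (t₀, x₀) ^ (1 / 2 : ℝ) := by
    rw [hE, ← ENNReal.mul_rpow_of_nonneg _ _ (by norm_num)]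
    refine cellAvg_le_of_lintegral_sq_le hFm ?_ ?_ ?_
    · rw [hμ]; exact (ENNReal.ofReal_pos.2 (by positivity)).ne'
    · rw [hμ]; exact ENNReal.ofReal_ne_top
    · refine (hC₂ m hm b ε hb hε hε1 Φ σ hΦ hσ _ (hf.indicator hSm) B
        fun z => (hind _ z).trans (hB z)).trans ?_
      refine (mul_le_mul_right hL2 _).trans (le_of_eq ?_)
      rw [hμ]
      ring
  refine (cellAvg_le_add (isNestedPartition_stLabel n) hFm (A := C₁ * stMax n f (t₀, x₀) ^ (1 / 2 : ℝ))
    fun y hy => ?_).trans ?_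
  · rw [hsplit]
    exact (enorm_add_le _ _).trans (add_le_add_left (hfar y hy) _)
  · refine (add_le_add_right hnear _).trans (le_of_eq ?_)
    rw [ENNReal.coe_add, ENNReal.coe_toNNReal hEt, add_mul]

/-- The mean oscillations of the parabolic operator. -/
theorem exists_cellAvg_parabolicOp_sub_le (hd : 1 ≤ d) (lam : ℝ) (hlam : 1 ≤ lam) {n N : ℕ}
    (hn : 3 * (N : ℝ) ≤ 2 ^ n) {m : ℕ} (hm : m ≤ 4) (Φ : 𝓢(EuclideanSpace ℝ (Fin d), ℂ))
    {σ : (Fin d → ℤ) → ℂ} (hΦ : HasParabolicSymbol m Φ σ)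
    (hσ : ∀ n, ‖σ n‖ ≤ max 1 (bilapSymbol n)) :
    ∃ C : ℝ≥0, ∀ b ε, IsEllipticPrimitive lam b → 0 < ε → ε ≤ 1 →
      ∀ f : ℝ × UnitAddTorus (Fin d) → ℂ, Measurable f → ∀ B : ℝ, (∀ z, ‖f z‖ ≤ B) →
      (∀ z : ℝ × UnitAddTorus (Fin d), z.1 ∉ Icc (0 : ℝ) N → f z = 0) →
      (∀ z, cellAvg (stLabel n) (slabMeasure d N) (fun y => ‖parabolicOp m Φ b ε f y‖ₑ) 0 z ≤
        C * stMax n f z ^ (1 / 2 : ℝ)) ∧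
      ∀ k z, ∃ c : ℂ, cellAvg (stLabel n) (slabMeasure d N)
        (fun y => ‖parabolicOp m Φ b ε f y - c‖ₑ) k z ≤ C * stMax n f z ^ (1 / 2 : ℝ) := by
  obtain ⟨C₁, hC₁⟩ := exists_enorm_parabolicOp_sub_le lam hlam hn Φ
  -- Λ = N + 2 covers both uses: at level zero, where ℓ = 1, the window is all of [0, N]; at the
  -- other levels it has length 2ℓ⁴.
  obtain ⟨C₂, hC₂⟩ := exists_cellAvg_parabolicOp_le_of_window hd lam hlam hn hm Φ hΦ hσ
    (Λ := N + 2) (by positivity)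
  refine ⟨C₁ + C₂, fun b ε hb hε hε1 f hf B hB hsupp => ⟨fun z => ?_, fun k z => ?_⟩⟩
  · by_cases hz : z.1 ∈ Ico (0 : ℝ) N
    · refine (hC₂ b ε hb hε hε1 f hf B hB hsupp 0 z 0 N hz (by simp) hz.1 (by simpa using hz.2.le)
        (by simpa using hsupp)).trans ?_
      gcongr
      simp
    · rw [cellAvg, setLIntegral_measure_zero _ _ (slabMeasure_labelCell_of_notMem hz), ENNReal.zero_div]
      exact zero_le
  by_cases hz : z.1 ∈ Ico (0 : ℝ) N
  swap
  · refine ⟨0, ?_⟩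
    rw [cellAvg, setLIntegral_measure_zero _ _ (slabMeasure_labelCell_of_notMem hz), ENNReal.zero_div]
    exact zero_le
  obtain ⟨t₀, x₀⟩ := z
  simp only at hz
  set ℓ : ℝ := (2 ^ k : ℝ)⁻¹ with hℓdef
  have hℓ : 0 < ℓ := by positivity
  have hℓ4 : 0 < ℓ ^ 4 := by positivity
  obtain ⟨a, ha⟩ := labelCell_timeLabel n 0 (n + 4 * k) t₀
  have hlen : (2 : ℝ) ^ n / 2 ^ (n + 4 * k) = ℓ ^ 4 := by
    rw [hℓdef, pow_add, inv_pow, ← pow_mul, mul_comm k 4]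
    field_simp
  rw [hlen] at ha
  have hIN : ∀ t ∈ Ico a (a + ℓ ^ 4), t ∈ Ico (0 : ℝ) N := by
    intro t ht
    rw [← ha] at ht
    exact (mem_Ico_natCast_iff (floor_eq_of_mem_labelCell ht)).2 hz
  have ht₀ : t₀ ∈ Ico a (a + ℓ ^ 4) := ha ▸ mem_labelCell_self _ _ _
  have ha0 : 0 ≤ a := (hIN a ⟨le_rfl, by linarith⟩).1
  -- Distant past and recent past, separated at one cell duration before the cell. The window of
  -- `S₂` ends with the cell; later values of `f` have no influence, by causality.
  set S₁ : Set (ℝ × UnitAddTorus (Fin d)) := {y | y.1 < a - ℓ ^ 4} with hS₁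
  set S₂ : Set (ℝ × UnitAddTorus (Fin d)) :=
    {y | y.1 ∈ Icc (a - ℓ ^ 4) (a - ℓ ^ 4 + 2 * ℓ ^ 4)} with hS₂
  have hS₁m : MeasurableSet S₁ := measurableSet_lt measurable_fst measurable_const
  have hS₂m : MeasurableSet S₂ := measurable_fst measurableSet_Icc
  have hind : ∀ (T : Set (ℝ × UnitAddTorus (Fin d))) z, ‖T.indicator f z‖ ≤ ‖f z‖ := fun T z =>
    norm_indicator_le_norm_self _ _
  have hindB : ∀ (T : Set (ℝ × UnitAddTorus (Fin d))) z, ‖T.indicator f z‖ ≤ B := fun T z =>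
    (hind T z).trans (hB z)
  have hsuppi : ∀ (T : Set (ℝ × UnitAddTorus (Fin d))) (z : ℝ × UnitAddTorus (Fin d)),
      z.1 ∉ Icc (0 : ℝ) N → T.indicator f z = 0 := by
    intro T z hz
    by_cases h : z ∈ T
    · rw [indicator_of_mem h, hsupp z hz]
    · rw [indicator_of_notMem h]
  have hX : ∀ T : Set (ℝ × UnitAddTorus (Fin d)), stMax n (T.indicator f) (t₀, x₀) ^ (1 / 2 : ℝ) ≤
      stMax n f (t₀, x₀) ^ (1 / 2 : ℝ) := fun T =>
    ENNReal.rpow_le_rpow (stMax_mono n (hind T) _) (by norm_num)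
  have hsplit : ∀ y ∈ labelCell (stLabel n) k (t₀, x₀), parabolicOp m Φ b ε f y =
      parabolicOp m Φ b ε (S₁.indicator f) y + parabolicOp m Φ b ε (S₂.indicator f) y := by
    intro y hy
    rw [labelCell_stLabel] at hy
    have hy1 : y.1 ∈ Ico a (a + ℓ ^ 4) := ha ▸ hy.1
    rw [← parabolicOp_add hb hε hε1 hm Φ (hf.indicator hS₁m) (hf.indicator hS₂m) (hindB _) (hindB _)]
    refine parabolicOp_congr_of_lt fun s x hs => ?_
    rcases lt_or_ge s (a - ℓ ^ 4) with h | h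
    · rw [indicator_of_mem (show (s, x) ∈ S₁ from h),
        indicator_of_notMem (fun h' : (s, x) ∈ S₂ => absurd h'.1 (not_le.2 h)), add_zero]
    · rw [indicator_of_notMem (fun h' : (s, x) ∈ S₁ => absurd h' (not_lt.2 h)),
        indicator_of_mem (show (s, x) ∈ S₂ from ⟨h, by simp only; linarith [hy1.2]⟩), zero_add]
  have hnear := hC₂ b ε hb hε hε1 (S₂.indicator f) (hf.indicator hS₂m) B (hindB _) (hsuppi _) k
    (t₀, x₀) (a - ℓ ^ 4) (2 * ℓ ^ 4) hz (by nlinarith [Nat.cast_nonneg (α := ℝ) N])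
    (by simp only; linarith [ht₀.1]) (by simp only; linarith [ht₀.2])
    (fun y hy => indicator_of_notMem (show y ∉ S₂ from hy) _)
  -- The approximating constant is the contribution of the distant past at the given point. It
  -- almost equals this contribution on the whole cell, while the recent past is small in mean.
  refine ⟨parabolicOp m Φ b ε (S₁.indicator f) (t₀, x₀), ?_⟩
  refine (cellAvg_le_add (isNestedPartition_stLabel n)
    (h := fun y => ‖parabolicOp m Φ b ε (S₂.indicator f) y‖ₑ)
    (stronglyMeasurable_parabolicOp hb Φ (hf.indicator hS₂m)).measurable.enorm
    (A := C₁ * stMax n f (t₀, x₀) ^ (1 / 2 : ℝ)) fun y hy => ?_).trans ?_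
  · rw [hsplit y hy, add_sub_right_comm]
    refine (enorm_add_le _ _).trans (add_le_add_left ?_ _)
    obtain ⟨t, x⟩ := y
    rw [labelCell_stLabel] at hy
    have hy1 : t ∈ Ico a (a + ℓ ^ 4) := ha ▸ hy.1
    obtain ⟨e, rfl, he⟩ := exists_add_torusMk_eq_of_mem_labelCell hy.2
    refine (hC₁ m hm b ε hb hε hε1 (S₁.indicator f) (hf.indicator hS₁m) B (hindB _) (hsuppi _) ℓ a t
      t₀ x₀ e hℓ ha0 hy1.1 ht₀.1 hy1.2.le ht₀.2.le (hIN t hy1).2.le hz.2.le he fun z hz => ?_).trans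
      (mul_le_mul_right (hX _) _)
    exact indicator_of_notMem (fun h' : z ∈ S₁ => absurd h' (not_lt.2 hz)) _
  · refine (add_le_add_right (hnear.trans (mul_le_mul_right (hX _) _)) _).trans (le_of_eq ?_)
    rw [ENNReal.coe_add, add_mul]

end Oscillation
open scoped SchwartzMap

/-! ### Weighted bounds for the parabolic operator -/

section WeightedBounds

variable {d : ℕ} {lam ε : ℝ} {b : ℝ → ℝ} {m : ℕ}

theorem tendsto_causalKernel (hb : IsEllipticPrimitive lam b) (hε : 0 < ε) (m : ℕ)
    (Φ : 𝓢(EuclideanSpace ℝ (Fin d), ℂ)) {t : ℕ → ℝ} {t₀ : ℝ}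
    (ht : Filter.Tendsto t Filter.atTop (nhds t₀)) {e : ℕ → EuclideanSpace ℝ (Fin d)}
    (he : Filter.Tendsto e Filter.atTop (nhds 0)) {y : ℝ × EuclideanSpace ℝ (Fin d)}
    (hy : y.1 ≠ t₀) :
    Filter.Tendsto (fun k => causalKernel m Φ b ε (t k) (y.1, y.2 + e k)) Filter.atTop
      (nhds (causalKernel m Φ b ε t₀ y)) := by
  by_cases h0 : 0 < y.1
  swap
  · have : ∀ t, ∀ v, causalKernel m Φ b ε t (y.1, v) = 0 := fun t v =>
      indicator_of_notMem (fun h => h0 h.1) _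
    have h' : causalKernel m Φ b ε t₀ y = 0 := this t₀ y.2
    simp only [this, h']
    exact tendsto_const_nhds
  rcases lt_or_gt_of_ne hy with h | h
  · rw [causalKernel, indicator_of_mem (show y.1 ∈ Ioo 0 t₀ from ⟨h0, h⟩)]
    have hev : ∀ᶠ k in Filter.atTop, scaledKernel m Φ (parabolicRadius b ε (t k) y.1) (y.2 + e k) =
        causalKernel m Φ b ε (t k) (y.1, y.2 + e k) := by
      filter_upwards [ht.eventually (lt_mem_nhds h)] with k hk
      rw [causalKernel, indicator_of_mem (show y.1 ∈ Ioo 0 (t k) from ⟨h0, hk⟩)]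
    refine Filter.Tendsto.congr' hev ?_
    have hr : Filter.Tendsto (fun k => parabolicRadius b ε (t k) y.1) Filter.atTop
        (nhds (parabolicRadius b ε t₀ y.1)) := by
      have hc : Continuous fun t => parabolicRadius b ε t y.1 := by
        have := hb.continuous
        unfold parabolicRadius
        fun_prop
      exact (hc.tendsto t₀).comp ht
    have hr0 : 0 < parabolicRadius b ε t₀ y.1 := (Real.sqrt_pos.2 (Real.sqrt_pos.2 hε)).trans_le
      (hb.sqrt_sqrt_le_radius h.le)
    have hye : Filter.Tendsto (fun k => y.2 + e k) Filter.atTop (nhds y.2) := by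
      simpa using he.const_add y.2
    have hri := hr.inv₀ hr0.ne'
    exact ((hr.pow (d + m)).inv₀ (by positivity)).smul
      ((Φ.continuous.tendsto _).comp (hri.smul hye))
  · rw [causalKernel, indicator_of_notMem (fun h' => absurd h'.2 (not_lt.2 h.le))]
    refine tendsto_const_nhds.congr' ?_
    filter_upwards [ht.eventually (gt_mem_nhds h)] with k hk
    rw [causalKernel, indicator_of_notMem (fun h' => absurd h'.2 (not_lt.2 hk.le))]

/-- For ε > 0 the kernel is bounded and, away from s = t₀, continuous, so dominated convergence
gives continuity. It is stated for sequences in the form in which cells shrink to a point. -/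
theorem tendsto_parabolicOp (hb : IsEllipticPrimitive lam b) (hε : 0 < ε) (hε1 : ε ≤ 1)
    (hm : m ≤ 4) (Φ : 𝓢(EuclideanSpace ℝ (Fin d), ℂ)) {f : ℝ × UnitAddTorus (Fin d) → ℂ}
    (hf : Measurable f) {B : ℝ} (hB : ∀ z, ‖f z‖ ≤ B) {N : ℕ} {t : ℕ → ℝ} {t₀ : ℝ}
    (htN : ∀ k, t k ≤ N) (ht : Filter.Tendsto t Filter.atTop (nhds t₀))
    {e : ℕ → EuclideanSpace ℝ (Fin d)} (hed : ∀ k, ‖e k‖ ≤ d)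
    (he : Filter.Tendsto e Filter.atTop (nhds 0)) (x : UnitAddTorus (Fin d)) :
    Filter.Tendsto (fun k => parabolicOp m Φ b ε f (t k, x + torusMk (e k).ofLp)) Filter.atTop
      (nhds (parabolicOp m Φ b ε f (t₀, x))) := by
  obtain ⟨A, hA, h⟩ := exists_norm_causalKernel_le lam hb.one_le N Φ
  set ρ := √√ε with hρdef
  have hρ : 0 < ρ := Real.sqrt_pos.2 (Real.sqrt_pos.2 hε)
  have hint := (integrable_indicator_mul_inv_pow (d := d) hρ N A).const_mul
    ((1 + d / ρ) ^ (d + 4) * |B|)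
  simp only [parabolicOp_add_torusMk]
  rw [parabolicOp]
  refine tendsto_integral_of_dominated_convergence _ (fun k =>
    (integrable_causalKernel_add_mul hb hε hε1 hm Φ hf hB (t k) x (e k)).1) hint
    (fun k => Filter.Eventually.of_forall fun y => ?_) ?_
  · rw [norm_mul]
    have h1 := h m hm b ε hb hε hε1 (t k) (htN k) (y.1, y.2 + e k)
    have h2 : ((ρ + ‖y.2 + e k‖) ^ (d + 4))⁻¹ ≤
        (1 + d / ρ) ^ (d + 4) * ((ρ + ‖y.2‖) ^ (d + 4))⁻¹ := by
      rw [← div_eq_mul_inv, ← div_pow, ← inv_pow]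
      refine pow_le_pow_left₀ (by positivity) ?_ _
      rw [inv_eq_one_div, div_le_div_iff₀ (by positivity) (by positivity), one_mul]
      have h3 : ‖y.2‖ ≤ ‖y.2 + e k‖ + ‖e k‖ := by
        have := norm_sub_le (y.2 + e k) (e k)
        rwa [add_sub_cancel_right] at this
      have h4 : (1 + d / ρ) * (ρ + ‖y.2 + e k‖) =
          ρ + ‖y.2 + e k‖ + d + d / ρ * ‖y.2 + e k‖ := by field_simp; ring
      rw [h4]
      have h5 : 0 ≤ d / ρ * ‖y.2 + e k‖ := by positivity
      linarith [hed k]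
    have h6 : 0 ≤ (Ioo (0 : ℝ) N).indicator (fun _ => A) y.1 := indicator_nonneg (fun _ _ => hA) _
    calc _ ≤ ((Ioo (0 : ℝ) N).indicator (fun _ => A) y.1 * ((ρ + ‖y.2 + e k‖) ^ (d + 4))⁻¹) * |B| :=
          mul_le_mul h1 ((hB _).trans (le_abs_self B)) (norm_nonneg _)
            (mul_nonneg h6 (by positivity))
      _ ≤ ((Ioo (0 : ℝ) N).indicator (fun _ => A) y.1 *
            ((1 + d / ρ) ^ (d + 4) * ((ρ + ‖y.2‖) ^ (d + 4))⁻¹)) * |B| :=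
          mul_le_mul_of_nonneg_right (mul_le_mul_of_nonneg_left h2 h6) (abs_nonneg B)
      _ = _ := by ring
  · have hnull : ∀ᵐ y : ℝ × EuclideanSpace ℝ (Fin d), y.1 ≠ t₀ := by
      have h1 : ∀ᵐ s : ℝ, s ≠ t₀ := by
        simp [ae_iff]
      exact Measure.quasiMeasurePreserving_fst.ae h1
    filter_upwards [hnull] with y hy
    exact (tendsto_causalKernel hb hε m Φ ht he hy).mul_const _

theorem ae_slabMeasure_mem (N : ℕ) : ∀ᵐ z ∂(slabMeasure d N), z.1 ∈ Ico (0 : ℝ) N :=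
  Measure.quasiMeasurePreserving_fst.ae (ae_restrict_mem measurableSet_Ico)

/-- Continuity takes the place of Lebesgue's differentiation theorem: on small cells around the
point the function stays above any number below its value there, hence so do its averages. -/
theorem enorm_parabolicOp_le_cellMax (hb : IsEllipticPrimitive lam b) (hε : 0 < ε) (hε1 : ε ≤ 1)
    (hm : m ≤ 4) (Φ : 𝓢(EuclideanSpace ℝ (Fin d), ℂ)) {f : ℝ × UnitAddTorus (Fin d) → ℂ}
    (hf : Measurable f) {B : ℝ} (hB : ∀ z, ‖f z‖ ≤ B) {n N : ℕ} {z : ℝ × UnitAddTorus (Fin d)}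
    (hz : z.1 ∈ Ico (0 : ℝ) N) :
    ‖parabolicOp m Φ b ε f z‖ₑ ≤
      cellMax (stLabel n) (slabMeasure d N) (fun y => ‖parabolicOp m Φ b ε f y‖ₑ) z := by
  refine le_of_forall_lt fun c hc => ?_
  obtain ⟨c', hcc', hc'⟩ := exists_between hc
  refine hcc'.trans_le ?_
  obtain ⟨k, hk⟩ : ∃ k, ∀ y ∈ labelCell (stLabel n) k z, c' ≤ ‖parabolicOp m Φ b ε f y‖ₑ := by
    by_contra! hcon
    choose y hy hyc using hcon
    have hy' := fun k => labelCell_stLabel (d := d) n k z ▸ hy k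
    choose e hex he using fun k => exists_add_torusMk_eq_of_mem_labelCell (hy' k).2
    have hpow : Filter.Tendsto (fun k : ℕ => ((2 : ℝ) ^ k)⁻¹) Filter.atTop (nhds 0) :=
      tendsto_inv_atTop_zero.comp (tendsto_pow_atTop_atTop_of_one_lt one_lt_two)
    have het : Filter.Tendsto e Filter.atTop (nhds 0) := by
      refine squeeze_zero_norm he ?_
      simpa using hpow.const_mul (d : ℝ)
    have hed : ∀ k, ‖e k‖ ≤ d := fun k => (he k).trans
      (mul_le_of_le_one_right (Nat.cast_nonneg d) (inv_le_one_of_one_le₀ (one_le_pow₀ one_le_two)))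
    have htN : ∀ k, (y k).1 ≤ (N : ℝ) := fun k =>
      ((mem_Ico_natCast_iff (floor_eq_of_mem_labelCell (hy' k).1)).2 hz).2.le
    have htt : Filter.Tendsto (fun k => (y k).1) Filter.atTop (nhds z.1) := by
      refine tendsto_iff_norm_sub_tendsto_zero.2 ?_
      refine squeeze_zero (fun k => norm_nonneg _) (fun k => ?_) hpow
      obtain ⟨a, ha⟩ := labelCell_timeLabel n 0 (n + 4 * k) z.1
      have h1 : (y k).1 ∈ Ico a _ := ha ▸ (hy' k).1
      have h2 : z.1 ∈ Ico a _ := ha ▸ mem_labelCell_self _ _ _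
      have h3 : (2 : ℝ) ^ n / 2 ^ (n + 4 * k) ≤ (2 ^ k)⁻¹ := by
        rw [pow_add, div_mul_cancel_left₀ (by positivity)]
        exact inv_anti₀ (by positivity) (pow_le_pow_right₀ one_le_two (by omega))
      rw [Real.norm_eq_abs, abs_le]
      constructor <;> linarith [h1.1, h1.2, h2.1, h2.2]
    have hlim := (tendsto_parabolicOp hb hε hε1 hm Φ hf hB htN htt hed het z.2).enorm
    refine absurd hc' (not_lt.2 (le_of_tendsto hlim (Filter.Eventually.of_forall fun k => ?_)))
    have : (((y k).1, z.2 + torusMk (e k).ofLp) : ℝ × UnitAddTorus (Fin d)) = y k := by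
      rw [← hex k]
    rw [this]
    exact (hyc k).le
  refine le_trans ?_ (le_iSup (fun k => cellAvg (stLabel n) (slabMeasure d N)
    (fun y => ‖parabolicOp m Φ b ε f y‖ₑ) k z) k)
  have h0 : slabMeasure d N (labelCell (stLabel n) k z) ≠ 0 := by
    rw [slabMeasure_labelCell_eq_ofReal hz]
    exact (ENNReal.ofReal_pos.2 (by positivity)).ne'
  rw [cellAvg, ENNReal.le_div_iff_mul_le (Or.inl h0) (Or.inl (measure_ne_top _ _))]
  rw [← Measure.restrict_apply_univ, ← lintegral_const]
  exact setLIntegral_mono' ((isNestedPartition_stLabel n).measurableSet_labelCell k z) hk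

/-- For fixed x the maximal function in time is bounded by Muckenhoupt's theorem with the weight v.
For fixed t the weight is a constant, and the unweighted inequality handles the maximal function in
space. -/
theorem lintegral_stMax_rpow_mul_le {n N : ℕ} {f : ℝ × UnitAddTorus (Fin d) → ℂ} (hf : Measurable f)
    (hsupp : ∀ z : ℝ × UnitAddTorus (Fin d), z.1 ∉ Ico (0 : ℝ) N → f z = 0) {r : ℝ} (hr : 1 < r)
    {K : ℝ≥0∞} (hK : K ≠ ⊤) {v : ℝ → ℝ≥0∞} (hvm : Measurable v) (hv : ∀ᵐ t, 0 < v t ∧ v t < ⊤)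
    (hA : CellAp (timeLabel n) volume r K v) :
    ∫⁻ z, stMax n f z ^ r * v z.1 ∂(slabMeasure d N) ≤
      Fintype.card (Fin 2) * muckenhouptConst r K *
        (Fintype.card (Fin d → Fin 2) * maximalConst r) *
        ∫⁻ z, ‖f z‖ₑ ^ (2 * r) * v z.1 ∂(slabMeasure d N) := by
  have hg := measurable_torusMax_enorm_sq hf
  have hle : slabMeasure d N ≤ (volume : Measure ℝ).prod volume := by
    rw [slabMeasure]
    exact Measure.prod_mono Measure.restrict_le_self le_rfl
  have hvm' : Measurable fun z : ℝ × UnitAddTorus (Fin d) => v z.1 := hvm.comp measurable_fst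
  have hm1 : Measurable fun z : ℝ × UnitAddTorus (Fin d) => stMax n f z ^ r * v z.1 :=
    ((measurable_stMax n hf).pow_const r).mul hvm'
  have hm2 : Measurable fun z : ℝ × UnitAddTorus (Fin d) =>
      torusMax (fun y => ‖f (z.1, y)‖ₑ ^ 2) z.2 ^ r * v z.1 := (hg.pow_const r).mul hvm'
  have hm3 : Measurable fun z : ℝ × UnitAddTorus (Fin d) => ‖f z‖ₑ ^ (2 * r) * v z.1 :=
    (hf.enorm.pow_const _).mul hvm'
  have h1 : ∀ x : UnitAddTorus (Fin d), ∫⁻ t, stMax n f (t, x) ^ r * v t ≤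
      Fintype.card (Fin 2) * muckenhouptConst r K *
        ∫⁻ t, torusMax (fun y => ‖f (t, y)‖ₑ ^ 2) x ^ r * v t := by
    intro x
    have hgx : Measurable fun t => torusMax (fun y => ‖f (t, y)‖ₑ ^ 2) x := by
      have h := hg.comp (measurable_prodMk_right (y := x))
      exact h
    have h := lintegral_dyMax_rpow_mul_le (isDyadicFamily_timeLabel n) hr hK hvm hv hA hgx
    exact h
  have h2 : ∀ t : ℝ, ∫⁻ x, torusMax (fun y => ‖f (t, y)‖ₑ ^ 2) x ^ r * v t ≤
      Fintype.card (Fin d → Fin 2) * maximalConst r * ∫⁻ x, ‖f (t, x)‖ₑ ^ (2 * r) * v t := by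
    intro t
    have hft : Measurable fun x => ‖f (t, x)‖ₑ ^ 2 :=
      (hf.comp measurable_prodMk_left).enorm.pow_const 2
    have hmt : Measurable fun x => torusMax (fun y => ‖f (t, y)‖ₑ ^ 2) x ^ r :=
      ((isDyadicFamily_torusLabel d).measurable_dyMax _ _).pow_const r
    have hft2 : Measurable fun x => ‖f (t, x)‖ₑ ^ (2 * r) :=
      (hf.comp measurable_prodMk_left).enorm.pow_const _
    rw [lintegral_mul_const _ hmt, lintegral_mul_const _ hft2, ← mul_assoc]
    refine mul_le_mul_left ?_ _
    refine (lintegral_dyMax_rpow_le (isDyadicFamily_torusLabel d).isNestedPartition volume hft hr).trans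
      (le_of_eq ?_)
    simp only [ENNReal.rpow_mul, ENNReal.rpow_ofNat]
  refine (lintegral_mono' hle le_rfl).trans ?_
  rw [lintegral_prod_symm _ hm1.aemeasurable]
  refine (lintegral_mono h1).trans ?_
  rw [lintegral_const_mul _ hm2.lintegral_prod_left',
    mul_assoc (_ * muckenhouptConst r K) (_ * maximalConst r)]
  refine mul_le_mul_right ?_ _
  rw [← lintegral_prod_symm _ hm2.aemeasurable, lintegral_prod _ hm2.aemeasurable]
  refine (lintegral_mono h2).trans ?_
  rw [lintegral_const_mul _ hm3.lintegral_prod_right']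
  refine mul_le_mul_right (α := ℝ≥0∞) (le_of_eq ?_) _
  rw [slabMeasure, lintegral_prod _ hm3.aemeasurable, ← lintegral_indicator measurableSet_Ico]
  refine lintegral_congr fun t => ?_
  by_cases ht : t ∈ Ico (0 : ℝ) N
  · rw [indicator_of_mem ht]
  · have h0 : ∀ x, f (t, x) = 0 := fun x => hsupp (t, x) ht
    rw [indicator_of_notMem ht]
    simp [h0, show 0 < r by linarith]

/-- Boundedness of the parabolic operator on `L^q` with respect to weights in time. -/
theorem exists_lintegral_parabolicOp_rpow_mul_le (hd : 1 ≤ d) (lam : ℝ) (hlam : 1 ≤ lam) {n N : ℕ}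
    (hn : 3 * (N : ℝ) ≤ 2 ^ n) {m : ℕ} (hm : m ≤ 4) (Φ : 𝓢(EuclideanSpace ℝ (Fin d), ℂ))
    {σ : (Fin d → ℤ) → ℂ} (hΦ : HasParabolicSymbol m Φ σ)
    (hσ : ∀ n, ‖σ n‖ ≤ max 1 (bilapSymbol n)) {r : ℝ} (hr : 1 < r) {K : ℝ≥0∞} (hK : K ≠ ⊤) :
    ∃ C : ℝ≥0, ∀ b ε, IsEllipticPrimitive lam b → 0 < ε → ε ≤ 1 →
      ∀ f : ℝ × UnitAddTorus (Fin d) → ℂ, Measurable f → ∀ B : ℝ, (∀ z, ‖f z‖ ≤ B) →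
      (∀ z : ℝ × UnitAddTorus (Fin d), z.1 ∉ Ico (0 : ℝ) N → f z = 0) →
      ∀ v : ℝ → ℝ≥0∞, Measurable v → (∀ᵐ t, 0 < v t ∧ v t < ⊤) →
      CellAp (timeLabel n) volume r K v →
      ∫⁻ z, ‖parabolicOp m Φ b ε f z‖ₑ ^ (2 * r) * v z.1 ∂(slabMeasure d N) ≤
        C * ∫⁻ z, ‖f z‖ₑ ^ (2 * r) * v z.1 ∂(slabMeasure d N) := by
  set K' : ℝ := max 1 K.toReal with hK'
  have hK1 : 1 ≤ K' := le_max_left _ _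
  have hKK' : K ≤ ENNReal.ofReal K' := by
    rw [← ENNReal.ofReal_toReal hK]
    exact ENNReal.ofReal_le_ofReal (le_max_right _ _)
  have h2K : 1 ≤ 2 ^ r * K' := by
    have := Real.one_le_rpow (x := 2) one_le_two (by linarith : 0 ≤ r)
    nlinarith
  -- A parabolic cell has 16 · 2^d children of equal measure, which gives the doubling constant. The
  -- number δ is the one in the A_∞ property of an `A_r` weight with constant K'.
  obtain ⟨C₁, hC₁⟩ := exists_lintegral_cellMax_rpow_le_of_sharp
    (S := ℝ × UnitAddTorus (Fin d)) (ι := ℤ × (Fin d → ℤ)) (E := ℂ) (D := 16 * 2 ^ d)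
    (δ := 1 - (2 ^ r * K')⁻¹) (s := 2 * r) (by positivity)
    (sub_nonneg.2 (inv_le_one_of_one_le₀ h2K)) (sub_lt_self _ (by positivity)) (by linarith)
  obtain ⟨C₂, hC₂⟩ := exists_cellAvg_parabolicOp_sub_le hd lam hlam hn hm Φ hΦ hσ
  set E : ℝ≥0∞ := C₁ * ((C₂ : ℝ≥0∞) ^ (2 * r) * (Fintype.card (Fin 2) * muckenhouptConst r K *
        (Fintype.card (Fin d → Fin 2) * maximalConst r))) with hE
  have hEt : E ≠ ⊤ := by
    refine ENNReal.mul_ne_top ENNReal.coe_ne_top (ENNReal.mul_ne_top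
      (ENNReal.rpow_ne_top_of_nonneg (by linarith) ENNReal.coe_ne_top) ?_)
    exact ENNReal.mul_ne_top (ENNReal.mul_ne_top (ENNReal.natCast_ne_top _)
      (muckenhouptConst_ne_top hr hK)) (ENNReal.mul_ne_top (ENNReal.natCast_ne_top _)
      (maximalConst_ne_top r))
  refine ⟨E.toNNReal, fun b ε hb hε hε1 f hf B hB hsupp v hvm hv hA => ?_⟩
  rw [ENNReal.coe_toNNReal hEt]
  have hsupp' : ∀ z : ℝ × UnitAddTorus (Fin d), z.1 ∉ Icc (0 : ℝ) N → f z = 0 := fun z hz =>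
    hsupp z fun h => hz (Ico_subset_Icc_self h)
  have hA' : CellAp (timeLabel n) volume r (ENNReal.ofReal K') v := fun j k x =>
    (hA j k x).trans (mul_le_mul_left hKK' _)
  have hvm' : Measurable fun z : ℝ × UnitAddTorus (Fin d) => v z.1 := hvm.comp measurable_fst
  set ν := (slabMeasure d N).withDensity fun z => v z.1 with hν
  -- The interval [0, N) lies in the coarsest time cell [0, 2ⁿ), on which `v` is integrable.
  have hνfin : IsFiniteMeasure ν := by
    refine ⟨?_⟩
    rw [hν, withDensity_apply _ MeasurableSet.univ, Measure.restrict_univ,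
      lintegral_slabMeasure_fst N hvm]
    refine lt_of_le_of_lt (lintegral_mono_set ?_) (hA.lintegral_ne_top (isDyadicFamily_timeLabel n) hr
      hK hvm hv 0 0 0).1.lt_top
    intro t ht
    have hN : (0 : ℝ) ≤ N := Nat.cast_nonneg N
    have h2 : (0 : ℝ) < 2 ^ n := by positivity
    simp only [labelCell, timeLabel, mem_ofPred_eq]
    simp only [pow_zero, Fin.val_zero, Nat.cast_zero, zero_div, sub_zero, one_mul, Int.floor_zero,
      Int.floor_eq_zero_iff, mem_Ico]
    exact ⟨div_nonneg ht.1 h2.le, by rw [div_lt_one h2]; linarith [ht.2]⟩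
  -- The operator is bounded only for times up to N. The truncation makes it bounded everywhere and
  -- is invisible to the slab measure.
  set F : ℝ × UnitAddTorus (Fin d) → ℂ :=
    {z : ℝ × UnitAddTorus (Fin d) | z.1 < N}.indicator (parabolicOp m Φ b ε f) with hF
  have hFm : Measurable F := (stronglyMeasurable_parabolicOp hb Φ hf).measurable.indicator
    (measurableSet_lt measurable_fst measurable_const)
  have hFeq : ∀ᵐ z ∂(slabMeasure d N), F z = parabolicOp m Φ b ε f z := by
    filter_upwards [ae_slabMeasure_mem N] with z hz
    exact indicator_of_mem (show z ∈ {z : ℝ × UnitAddTorus (Fin d) | z.1 < N} from hz.2) _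
  have havg : ∀ c k z, cellAvg (stLabel n) (slabMeasure d N) (fun y => ‖F y - c‖ₑ) k z =
      cellAvg (stLabel n) (slabMeasure d N) (fun y => ‖parabolicOp m Φ b ε f y - c‖ₑ) k z := by
    intro c k z
    rw [cellAvg, cellAvg, lintegral_congr_ae]
    filter_upwards [ae_restrict_of_ae hFeq] with y hy
    rw [hy]
  have havg0 : ∀ k z, cellAvg (stLabel n) (slabMeasure d N) (fun y => ‖F y‖ₑ) k z =
      cellAvg (stLabel n) (slabMeasure d N) (fun y => ‖parabolicOp m Φ b ε f y‖ₑ) k z := by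
    intro k z
    simpa only [sub_zero] using havg 0 k z
  obtain ⟨M, hM0, hM⟩ := norm_parabolicOp_le hb hε hε1 hm Φ N B
  obtain ⟨hlev0, hosc⟩ := hC₂ b ε hb hε hε1 f hf B hB hsupp'
  have hGm : Measurable fun z => C₂ * stMax n f z ^ (1 / 2 : ℝ) :=
    ((measurable_stMax n hf).pow_const _).const_mul _
  have hsharp := hC₁ (stLabel n) (isNestedPartition_stLabel n) (slabMeasure d N) ν hνfin
    (fun k z => measure_lt_top _ _) (fun k z => slabMeasure_labelCell_le n N k z)
    (fun k z A hAm hAQ h2 => withDensity_fst_le_of_two_mul_measure_le hvm hv hr hK1 hA' hAm hAQ h2)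
    F M.toNNReal hFm.enorm
    (fun z => by
      rw [← ofReal_norm]
      refine ENNReal.ofReal_le_ofReal ?_
      by_cases hz : z ∈ {z : ℝ × UnitAddTorus (Fin d) | z.1 < N}
      · rw [hF, indicator_of_mem hz]
        exact hM f hB z (le_of_lt hz)
      · rw [hF, indicator_of_notMem hz, norm_zero]
        exact hM0)
    (fun z => C₂ * stMax n f z ^ (1 / 2 : ℝ)) hGm
    (fun z => by rw [havg0]; exact hlev0 z)
    (fun k z => by
      obtain ⟨c, hc⟩ := hosc k z
      exact ⟨c, by rw [havg]; exact hc⟩)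
  have hcm : Measurable (cellMax (stLabel n) (slabMeasure d N) fun y => ‖F y‖ₑ) :=
    (isNestedPartition_stLabel n).measurable_cellMax _ _
  have hν1 : ∀ g : ℝ × UnitAddTorus (Fin d) → ℝ≥0∞, Measurable g →
      ∫⁻ z, g z ∂ν = ∫⁻ z, g z * v z.1 ∂(slabMeasure d N) := by
    intro g hg
    rw [hν, lintegral_withDensity_eq_lintegral_mul _ hvm' hg]
    simp only [Pi.mul_apply, mul_comm]
  rw [hν1 _ (hcm.pow_const _), hν1 _ (hGm.pow_const _)] at hsharp
  calc ∫⁻ z, ‖parabolicOp m Φ b ε f z‖ₑ ^ (2 * r) * v z.1 ∂(slabMeasure d N)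
      ≤ ∫⁻ z, cellMax (stLabel n) (slabMeasure d N) (fun y => ‖F y‖ₑ) z ^ (2 * r) * v z.1
          ∂(slabMeasure d N) := by
        refine lintegral_mono_ae ?_
        filter_upwards [ae_slabMeasure_mem N] with z hz
        refine mul_le_mul_left (ENNReal.rpow_le_rpow ?_ (by linarith)) _
        have h1 := enorm_parabolicOp_le_cellMax (n := n) hb hε hε1 hm Φ hf hB hz
        have h2 : cellMax (stLabel n) (slabMeasure d N) (fun y => ‖F y‖ₑ) z =
            cellMax (stLabel n) (slabMeasure d N) (fun y => ‖parabolicOp m Φ b ε f y‖ₑ) z :=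
          iSup_congr fun k => havg0 k z
        rwa [h2]
    _ ≤ C₁ * ∫⁻ z, (C₂ * stMax n f z ^ (1 / 2 : ℝ)) ^ (2 * r) * v z.1 ∂(slabMeasure d N) := hsharp
    _ = C₁ * ((C₂ : ℝ≥0∞) ^ (2 * r) * ∫⁻ z, stMax n f z ^ r * v z.1 ∂(slabMeasure d N)) := by
        congr 1
        have hm1 : Measurable fun z : ℝ × UnitAddTorus (Fin d) => stMax n f z ^ r * v z.1 :=
          ((measurable_stMax n hf).pow_const r).mul hvm'
        rw [← lintegral_const_mul _ hm1]
        refine lintegral_congr fun z => ?_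
        rw [ENNReal.mul_rpow_of_nonneg _ _ (by linarith), ← ENNReal.rpow_mul,
          show 1 / 2 * (2 * r) = r by ring, mul_assoc]
    _ ≤ _ := by
        rw [hE, mul_assoc, mul_assoc (_ ^ _)]
        exact mul_le_mul_right (mul_le_mul_right
          (lintegral_stMax_rpow_mul_le hf hsupp hr hK hvm hv hA) _) _

/-- Boundedness of the parabolic operator on `L^p(w; L^q)`. -/
theorem exists_lintegral_rpow_lintegral_parabolicOp_le (hd : 1 ≤ d) (lam : ℝ) (hlam : 1 ≤ lam)
    {n N : ℕ} (hn : 3 * (N : ℝ) ≤ 2 ^ n) {m : ℕ} (hm : m ≤ 4)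
    (Φ : 𝓢(EuclideanSpace ℝ (Fin d), ℂ)) {σ : (Fin d → ℤ) → ℂ} (hΦ : HasParabolicSymbol m Φ σ)
    (hσ : ∀ n, ‖σ n‖ ≤ max 1 (bilapSymbol n)) {p q : ℝ} (hp : 2 < p) (hq : 2 < q) {K : ℝ≥0∞}
    (hK : K ≠ ⊤) :
    ∃ C : ℝ≥0, ∀ b ε, IsEllipticPrimitive lam b → 0 < ε → ε ≤ 1 →
      ∀ f : ℝ × UnitAddTorus (Fin d) → ℂ, Measurable f → ∀ B : ℝ, (∀ z, ‖f z‖ ≤ B) →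
      (∀ z : ℝ × UnitAddTorus (Fin d), z.1 ∉ Ico (0 : ℝ) N → f z = 0) →
      ∀ w : ℝ → ℝ≥0∞, Measurable w → (∀ᵐ t, 0 < w t ∧ w t < ⊤) →
      CellAp (timeLabel n) volume (p / 2) K w →
      ∫⁻ t in Ico (0 : ℝ) N, (∫⁻ x, ‖parabolicOp m Φ b ε f (t, x)‖ₑ ^ q) ^ (p / q) * w t ≤
        C * ∫⁻ t in Ico (0 : ℝ) N, (∫⁻ x, ‖f (t, x)‖ₑ ^ q) ^ (p / q) * w t := by
  have hr₀ : 1 < q / 2 := by linarith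
  have hr : 1 < p / 2 := by linarith
  have hq0 : 0 < q := by linarith
  have hp0 : 0 < p := by linarith
  obtain ⟨C₁, hC₁⟩ := exists_lintegral_parabolicOp_rpow_mul_le hd lam hlam hn hm Φ hΦ hσ hr₀
    (extrapolationConst_ne_top (Fin 2) hr₀ hr hK)
  -- The extrapolation theorem requires a nonzero constant.
  set A : ℝ≥0∞ := C₁ + 1 with hA
  have hA0 : A ≠ 0 := by simp [hA]
  have hAt : A ≠ ⊤ := by simp [hA]
  have hEt : (32 * A ^ (1 / (q / 2))) ^ (p / 2) ≠ ⊤ :=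
    ENNReal.rpow_ne_top_of_nonneg (by linarith) (ENNReal.mul_ne_top (by norm_num)
      (ENNReal.rpow_ne_top_of_nonneg (by positivity) hAt))
  refine ⟨((32 * A ^ (1 / (q / 2))) ^ (p / 2)).toNNReal,
    fun b ε hb hε hε1 f hf B hB hsupp w hwm hw hcell => ?_⟩
  rw [ENNReal.coe_toNNReal hEt]
  -- Extrapolation is applied to the squares of the L^q norms in space. For these the known bound
  -- has exponent q/2 with weights in `A_{q/2}`, and the desired one has exponent p/2 with weights
  -- in `A_{p/2}`.
  set Nrm : (ℝ × UnitAddTorus (Fin d) → ℂ) → ℝ → ℝ≥0∞ := fun g =>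
    (Ico (0 : ℝ) N).indicator fun t => (∫⁻ x, ‖g (t, x)‖ₑ ^ q) ^ (2 / q) with hNrm
  have hNm : ∀ g, Measurable g → Measurable (Nrm g) := fun g hg =>
    ((hg.enorm.pow_const q).lintegral_prod_right'.pow_const _).indicator measurableSet_Ico
  have hN1 : ∀ g, ∀ s > 0, ∀ v : ℝ → ℝ≥0∞, ∫⁻ t, Nrm g t ^ s * v t =
      ∫⁻ t in Ico (0 : ℝ) N, (∫⁻ x, ‖g (t, x)‖ₑ ^ q) ^ (2 / q * s) * v t := by
    intro g s hs v
    rw [← lintegral_indicator measurableSet_Ico]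
    refine lintegral_congr fun t => ?_
    by_cases ht : t ∈ Ico (0 : ℝ) N
    · simp only [hNrm]
      rw [indicator_of_mem ht, indicator_of_mem ht, ENNReal.rpow_mul]
    · simp only [hNrm]
      rw [indicator_of_notMem ht, indicator_of_notMem ht, ENNReal.zero_rpow_of_pos hs, zero_mul]
  have hFm := (stronglyMeasurable_parabolicOp (m := m) (ε := ε) hb Φ hf).measurable
  have hslab : ∀ g : ℝ × UnitAddTorus (Fin d) → ℂ, Measurable g → ∀ v : ℝ → ℝ≥0∞, Measurable v →
      ∫⁻ t, Nrm g t ^ (q / 2) * v t = ∫⁻ z, ‖g z‖ₑ ^ (2 * (q / 2)) * v z.1 ∂(slabMeasure d N) := by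
    intro g hg v hv
    have hmv : Measurable fun z : ℝ × UnitAddTorus (Fin d) => ‖g z‖ₑ ^ (2 * (q / 2)) * v z.1 :=
      (hg.enorm.pow_const _).mul (hv.comp measurable_fst)
    rw [hN1 g _ (by positivity), slabMeasure, lintegral_prod _ hmv.aemeasurable]
    refine lintegral_congr fun t => ?_
    have hgt : Measurable fun x => ‖g (t, x)‖ₑ ^ (2 * (q / 2)) :=
      (hg.comp measurable_prodMk_left).enorm.pow_const _
    simp only
    rw [lintegral_mul_const _ hgt, show 2 / q * (q / 2) = 1 by field_simp, ENNReal.rpow_one,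
      show 2 * (q / 2) = q by ring]
  have key := (isDyadicFamily_timeLabel n).extrapolation hr₀ hr hK hA0 hAt
    (hNm _ hFm) (hNm f hf) (fun v hvm hv hvA => by
      rw [hslab _ hFm v hvm, hslab f hf v hvm]
      exact (hC₁ b ε hb hε hε1 f hf B hB hsupp v hvm hv hvA).trans
        (mul_le_mul_left (by rw [hA]; exact le_self_add) _)) hwm hw hcell ?_
  · rw [hN1 _ _ (by positivity), hN1 _ _ (by positivity),
      show 2 / q * (p / 2) = p / q by field_simp] at key
    exact key
  -- Extrapolation presupposes a finite left-hand side, supplied by the ε-dependent uniform bound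
  -- and the integrability of `w` on the coarsest cell.
  · rw [hN1 _ _ (by positivity), show 2 / q * (p / 2) = p / q by field_simp]
    obtain ⟨M, hM0, hM⟩ := norm_parabolicOp_le hb hε hε1 hm Φ N B
    have hle : ∫⁻ t in Ico (0 : ℝ) N, (∫⁻ x, ‖parabolicOp m Φ b ε f (t, x)‖ₑ ^ q) ^ (p / q) * w t ≤
        ∫⁻ t in Ico (0 : ℝ) N, (ENNReal.ofReal M ^ q) ^ (p / q) * w t := by
      refine setLIntegral_mono' measurableSet_Ico fun t ht => mul_le_mul_left ?_ _
      refine ENNReal.rpow_le_rpow ?_ (by positivity)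
      have : ∫⁻ x : UnitAddTorus (Fin d), ‖parabolicOp m Φ b ε f (t, x)‖ₑ ^ q ≤
          ∫⁻ _x : UnitAddTorus (Fin d), ENNReal.ofReal M ^ q := by
        refine lintegral_mono fun x => ENNReal.rpow_le_rpow ?_ hq0.le
        rw [← ofReal_norm]
        exact ENNReal.ofReal_le_ofReal (hM f hB (t, x) ht.2.le)
      simpa using this
    refine ne_top_of_le_ne_top ?_ hle
    rw [lintegral_const_mul _ hwm]
    refine ENNReal.mul_ne_top (ENNReal.rpow_ne_top_of_nonneg (by positivity)
      (ENNReal.rpow_ne_top_of_nonneg hq0.le ENNReal.ofReal_ne_top)) ?_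
    refine ne_top_of_le_ne_top (hcell.lintegral_ne_top (isDyadicFamily_timeLabel n) hr
      hK hwm hw 0 0 0).1 (lintegral_mono_set ?_)
    intro t ht
    have hN : (0 : ℝ) ≤ N := Nat.cast_nonneg N
    have h2 : (0 : ℝ) < 2 ^ n := by positivity
    simp only [labelCell, timeLabel, mem_ofPred_eq]
    simp only [pow_zero, Fin.val_zero, Nat.cast_zero, zero_div, sub_zero, one_mul, Int.floor_zero,
      Int.floor_eq_zero_iff, mem_Ico]
    exact ⟨div_nonneg ht.1 h2.le, by rw [div_lt_one h2]; linarith [ht.2]⟩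

end WeightedBounds
open scoped SchwartzMap

/-! ### Schwartz profiles of the derivatives of the biharmonic heat kernel -/

section Profile

/-- Derivatives of the Gaussian are Hermite polynomials times the Gaussian, so this bound is the
Schwartz decay. For a monomial, a power of |s| is dominated by exp|s|. -/
theorem exists_pow_mul_aeval_mul_gaussian_le (k : ℕ) (P : Polynomial ℤ) :
    ∃ C, ∀ s : ℝ, |s| ^ k * |Polynomial.aeval s P| * Real.exp (-(s ^ 2 / 2)) ≤ C := by
  induction P using Polynomial.induction_on' with
  | add P Q hP hQ =>
    obtain ⟨C, hC⟩ := hP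
    obtain ⟨D, hD⟩ := hQ
    refine ⟨C + D, fun s => le_trans ?_ (add_le_add (hC s) (hD s))⟩
    rw [map_add, ← add_mul, ← mul_add]
    gcongr
    exact abs_add_le _ _
  | monomial n a =>
    refine ⟨|(a : ℝ)| * ((k + n).factorial * Real.exp (1 / 2)), fun s => ?_⟩
    have h1 := Real.pow_div_factorial_le_exp |s| (abs_nonneg s) (k + n)
    rw [div_le_iff₀ (by positivity)] at h1
    have h2 : Real.exp |s| * Real.exp (-(s ^ 2 / 2)) ≤ Real.exp (1 / 2) := by
      rw [← Real.exp_add, Real.exp_le_exp]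
      nlinarith [sq_nonneg (|s| - 1), sq_abs s]
    rw [Polynomial.aeval_monomial, abs_mul, abs_pow]
    calc |s| ^ k * (|algebraMap ℤ ℝ a| * |s| ^ n) * Real.exp (-(s ^ 2 / 2))
        = |(a : ℝ)| * (|s| ^ (k + n) * Real.exp (-(s ^ 2 / 2))) := by
          simp only [algebraMap_int_eq, eq_intCast]; ring
      _ ≤ |(a : ℝ)| * (Real.exp |s| * (k + n).factorial * Real.exp (-(s ^ 2 / 2))) := by gcongr
      _ = |(a : ℝ)| * ((k + n).factorial * (Real.exp |s| * Real.exp (-(s ^ 2 / 2)))) := by ring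
      _ ≤ _ := by gcongr

/-- The Gaussian `exp (-s² / 2)` as a Schwartz function. -/
noncomputable def schwartzGaussian : 𝓢(ℝ, ℝ) where
  toFun s := Real.exp (-(s ^ 2 / 2))
  smooth' := by fun_prop
  decay' k n := by
    obtain ⟨C, hC⟩ := exists_pow_mul_aeval_mul_gaussian_le k (Polynomial.hermite n)
    refine ⟨C, fun s => le_trans (le_of_eq ?_) (hC s)⟩
    rw [norm_iteratedFDeriv_eq_norm_iteratedDeriv, iteratedDeriv_eq_iterate,
      Polynomial.deriv_gaussian_eq_hermite_mul_gaussian, norm_mul, norm_mul, norm_pow, norm_neg,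
      norm_one, one_pow, one_mul, Real.norm_eq_abs, Real.norm_eq_abs, Real.norm_eq_abs,
      Real.abs_exp, mul_assoc]

variable {d : ℕ}

/-- The function `exp (-‖2πξ‖⁴)`. -/
noncomputable def quarticGaussian (d : ℕ) : 𝓢(EuclideanSpace ℝ (Fin d), ℝ) :=
  -- The quartic exponential is the Gaussian exp(-s²/2) composed with a multiple of ‖ξ‖²; the factor
  -- √2 cancels the one half. The composition is Schwartz because the inner function is tempered and
  -- grows at infinity.
  SchwartzMap.compCLM ℝ (g := fun ξ : EuclideanSpace ℝ (Fin d) =>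
      (√2 * (2 * Real.pi) ^ 2) * ‖ξ‖ ^ 2)
    ((Function.HasTemperateGrowth.const _).mul
      (Function.hasTemperateGrowth_norm_sq (EuclideanSpace ℝ (Fin d))))
    ⟨1, 1, fun ξ => by
      have h1 : (1 : ℝ) ≤ √2 * (2 * Real.pi) ^ 2 := by
        have := Real.one_le_sqrt.2 (show (1 : ℝ) ≤ 2 by norm_num)
        nlinarith [Real.pi_gt_three]
      rw [Real.norm_of_nonneg (by positivity)]
      nlinarith [sq_nonneg (‖ξ‖ - 1), sq_nonneg ‖ξ‖, norm_nonneg ξ]⟩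
    schwartzGaussian

theorem quarticGaussian_apply (ξ : EuclideanSpace ℝ (Fin d)) :
    quarticGaussian d ξ = Real.exp (-(((2 * Real.pi) ^ 2 * ‖ξ‖ ^ 2) ^ 2)) := by
  change Real.exp (-((√2 * (2 * Real.pi) ^ 2 * ‖ξ‖ ^ 2) ^ 2 / 2)) = _
  congr 2
  rw [mul_assoc, mul_pow, Real.sq_sqrt (by norm_num)]
  ring

/-- The Fourier multiplier of the derivative `∂^α`. -/
noncomputable def derivSymbol (α : Fin d → ℕ) (ξ : Fin d → ℝ) : ℂ :=
  ∏ i, (2 * Real.pi * Complex.I * ξ i) ^ α i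

theorem hasTemperateGrowth_derivSymbol (α : Fin d → ℕ) :
    (fun ξ : EuclideanSpace ℝ (Fin d) => derivSymbol α ξ.ofLp).HasTemperateGrowth := by
  unfold derivSymbol
  induction (Finset.univ : Finset (Fin d)) using Finset.induction_on with
  | empty => simpa using Function.HasTemperateGrowth.const (1 : ℂ)
  | insert i s hi ih =>
    simp only [Finset.prod_insert hi]
    refine Function.HasTemperateGrowth.mul (.pow (.mul (.const _) ?_) _) ih
    exact Function.HasTemperateGrowth.comp Function.Complex.hasTemperateGrowth_ofReal
      (EuclideanSpace.proj (𝕜 := ℝ) i).hasTemperateGrowth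

/-- The symbol `(2πiξ)^α exp (-‖2πξ‖⁴)`. -/
noncomputable def biharmonicSymbol (α : Fin d → ℕ) : 𝓢(EuclideanSpace ℝ (Fin d), ℂ) :=
  SchwartzMap.bilinLeftCLM ((ContinuousLinearMap.lsmul ℝ ℝ (E := ℂ)))
    (hasTemperateGrowth_derivSymbol α) (quarticGaussian d)

theorem biharmonicSymbol_apply (α : Fin d → ℕ) (ξ : EuclideanSpace ℝ (Fin d)) :
    biharmonicSymbol α ξ = derivSymbol α ξ.ofLp *
      (Real.exp (-(((2 * Real.pi) ^ 2 * ‖ξ‖ ^ 2) ^ 2)) : ℂ) := by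
  change quarticGaussian d ξ • derivSymbol α ξ.ofLp = _
  rw [quarticGaussian_apply, Complex.real_smul, mul_comm]

open FourierTransform in
/-- The derivative `∂^α` of the biharmonic heat kernel at time one. -/
noncomputable def biharmonicProfile (α : Fin d → ℕ) : 𝓢(EuclideanSpace ℝ (Fin d), ℂ) :=
  𝓕⁻ (biharmonicSymbol α)

/-- Integrating the rescaled profile against a character of the torus evaluates its Fourier
transform at the dilated frequency r n. The homogeneity factor r^{|α|} of the symbol cancels the one
in the normalization of the kernel. -/
theorem hasParabolicSymbol_biharmonicProfile (α : Fin d → ℕ) :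
    HasParabolicSymbol (∑ i, α i) (biharmonicProfile α)
      (fun n => derivSymbol α fun i => (n i : ℝ)) := by
  intro r hr n
  set ξ : EuclideanSpace ℝ (Fin d) := WithLp.toLp 2 fun i => r * (n i : ℝ) with hξ
  have hF : ∫ y, biharmonicProfile α y * Complex.exp (-(2 * Real.pi * Complex.I * inner ℝ y ξ)) =
      biharmonicSymbol α ξ := by
    have h := congrArg (fun g : 𝓢(EuclideanSpace ℝ (Fin d), ℂ) => g ξ)
      (FourierTransform.fourier_fourierInv_eq (F := 𝓢(EuclideanSpace ℝ (Fin d), ℂ))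
        (biharmonicSymbol α))
    rw [← h, SchwartzMap.fourier_coe, Real.fourier_eq']
    refine integral_congr_ae (Filter.Eventually.of_forall fun y => ?_)
    simp only [smul_eq_mul, biharmonicProfile]
    rw [mul_comm]
    congr 2
    push_cast
    ring
  have hscale : ∫ y, scaledKernel (∑ i, α i) (biharmonicProfile α) r y *
      UnitAddTorus.mFourier (-n) (torusMk y.ofLp) =
      ((r ^ (d + ∑ i, α i))⁻¹ : ℝ) • ∫ y, (fun z : EuclideanSpace ℝ (Fin d) =>
        biharmonicProfile α z * Complex.exp (-(2 * Real.pi * Complex.I * inner ℝ z ξ))) (r⁻¹ • y) := by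
    rw [← integral_smul]
    refine integral_congr_ae (Filter.Eventually.of_forall fun y => ?_)
    simp only [scaledKernel, mFourier_torusMk, Pi.neg_apply, smul_mul_assoc]
    congr 3
    rw [EuclideanSpace.inner_eq_star_dotProduct]
    simp only [dotProduct, hξ, PiLp.smul_apply, smul_eq_mul, Pi.star_apply, star_trivial]
    push_cast
    rw [Finset.mul_sum, Finset.mul_sum, ← Finset.sum_neg_distrib]
    refine Finset.sum_congr rfl fun i _ => ?_
    have : (r : ℂ) ≠ 0 := by exact_mod_cast hr.ne'
    field_simp
  have hchange := Measure.integral_comp_inv_smul_of_nonneg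
    (volume : Measure (EuclideanSpace ℝ (Fin d)))
    (fun z => biharmonicProfile α z * Complex.exp (-(2 * Real.pi * Complex.I * inner ℝ z ξ))) hr.le
  rw [hscale, hchange, hF, biharmonicSymbol_apply,
    finrank_euclideanSpace_fin, smul_smul]
  have hsym : derivSymbol α ξ.ofLp = (r ^ ∑ i, α i : ℝ) • derivSymbol α fun i => (n i : ℝ) := by
    simp only [derivSymbol, hξ]
    rw [← Finset.prod_pow_eq_pow_sum, Complex.real_smul]
    push_cast
    rw [← Finset.prod_mul_distrib]
    refine Finset.prod_congr rfl fun i _ => ?_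
    rw [← mul_pow]
    congr 1
    ring
  have hexp : ((2 * Real.pi) ^ 2 * ‖ξ‖ ^ 2) ^ 2 = r ^ 4 * bilapSymbol n := by
    rw [EuclideanSpace.real_norm_sq_eq, bilapSymbol, Finset.mul_sum,
      show r ^ 4 = (r ^ 2) ^ 2 by ring, ← mul_pow, Finset.mul_sum]
    congr 1
    refine Finset.sum_congr rfl fun i _ => ?_
    simp only [hξ]
    ring
  rw [hsym, hexp, smul_mul_assoc, smul_smul, pow_add, mul_inv]
  rw [show (r ^ d)⁻¹ * (r ^ ∑ i, α i)⁻¹ * r ^ d * r ^ ∑ i, α i = 1 by field_simp, one_smul]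

/-- The symbol has size at most |2πn|^{|α|}; a power of order at most four lies below 1 or below the
fourth power. -/
theorem norm_derivSymbol_le (α : Fin d → ℕ) (hα : ∑ i, α i ≤ 4) (n : Fin d → ℤ) :
    ‖derivSymbol α fun i => (n i : ℝ)‖ ≤ max 1 (bilapSymbol n) := by
  set R := √(∑ i, (2 * Real.pi * (n i : ℝ)) ^ 2) with hR
  have hsum : 0 ≤ ∑ i, (2 * Real.pi * (n i : ℝ)) ^ 2 := Finset.sum_nonneg fun _ _ => sq_nonneg _
  have h1 : ‖derivSymbol α fun i => (n i : ℝ)‖ ≤ R ^ ∑ i, α i := by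
    rw [derivSymbol, norm_prod, ← Finset.prod_pow_eq_pow_sum]
    refine Finset.prod_le_prod (fun _ _ => norm_nonneg _) fun i _ => ?_
    rw [norm_pow]
    refine pow_le_pow_left₀ (norm_nonneg _) ?_ _
    have : ‖(2 * Real.pi * Complex.I * (n i : ℝ) : ℂ)‖ = |2 * Real.pi * (n i : ℝ)| := by
      simp [abs_mul, Real.pi_pos.le]
    rw [this]
    exact Real.abs_le_sqrt (Finset.single_le_sum (f := fun i => (2 * Real.pi * (n i : ℝ)) ^ 2)
      (fun _ _ => sq_nonneg _) (Finset.mem_univ i))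
  have h2 : bilapSymbol n = R ^ 4 := by
    rw [bilapSymbol, show R ^ 4 = (R ^ 2) ^ 2 by ring, hR, Real.sq_sqrt hsum]
  rw [h2]
  refine h1.trans ?_
  rcases le_total R 1 with h | h
  · exact le_max_of_le_left (pow_le_one₀ (Real.sqrt_nonneg _) h)
  · exact le_max_of_le_right (pow_le_pow_right₀ h hα)

end Profile
open scoped SchwartzMap

/-! ### Calculus of trigonometric polynomials on the torus -/

section TorusCalculus

open UnitAddTorus (mFourier)

variable {d : ℕ}

theorem TorusSmooth.hasDerivAt {φ : UnitAddTorus (Fin d) → ℝ} (h : TorusSmooth φ) (i : Fin d)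
    (x : UnitAddTorus (Fin d)) (s : ℝ) :
    HasDerivAt (fun s : ℝ => φ (x + torusMk (Pi.single i s)))
      (_root_.torusPartial i φ (x + torusMk (Pi.single i s))) s := by
  have hd : DifferentiableAt ℝ (fun s : ℝ => φ (x + torusMk (Pi.single i s))) s := by
    obtain ⟨y, rfl⟩ := torusMk_surjective x
    simp only [← torusMk_add]
    have h1 : Differentiable ℝ fun x : Fin d → ℝ => φ (torusMk x) :=
      ContDiff.differentiable h (by simp)
    have h2 : Differentiable ℝ fun s : ℝ => y + Pi.single i s :=
      (differentiable_const y).add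
        (ContinuousLinearMap.single ℝ (fun _ : Fin d => ℝ) i).differentiable
    exact (h1.comp h2) s
  have key : _root_.torusPartial i φ (x + torusMk (Pi.single i s)) =
      deriv (fun s : ℝ => φ (x + torusMk (Pi.single i s))) s := by
    have h3 := deriv_comp_const_add (fun s : ℝ => φ (x + torusMk (Pi.single i s))) s 0
    rw [add_zero] at h3
    rw [← h3, _root_.torusPartial]
    congr 1
    funext r
    rw [add_assoc, ← torusMk_add, ← Pi.single_add]
  rw [key]
  exact hd.hasDerivAt

theorem TorusSmooth.mul {φ ψ : UnitAddTorus (Fin d) → ℝ} (hφ : TorusSmooth φ)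
    (hψ : TorusSmooth ψ) : TorusSmooth fun x => φ x * ψ x :=
  ContDiff.mul hφ hψ

theorem TorusSmooth.torusPartial_mul {φ ψ : UnitAddTorus (Fin d) → ℝ} (hφ : TorusSmooth φ)
    (hψ : TorusSmooth ψ) (i : Fin d) (x : UnitAddTorus (Fin d)) :
    _root_.torusPartial i (fun x => φ x * ψ x) x =
      _root_.torusPartial i φ x * ψ x + φ x * _root_.torusPartial i ψ x := by
  have h := (hφ.mul hψ).hasDerivAt i x 0
  have h' := (hφ.hasDerivAt i x 0).mul (hψ.hasDerivAt i x 0)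
  have h0 : x + torusMk (Pi.single i 0) = x := by
    rw [Pi.single_zero]
    exact add_zero x
  have := h.unique h'
  rwa [h0] at this

theorem exists_norm_le_of_continuous {φ : UnitAddTorus (Fin d) → ℝ} (h : Continuous φ) :
    ∃ C, 0 ≤ C ∧ ∀ x, ‖φ x‖ ≤ C := by
  obtain ⟨C, hC⟩ := isCompact_univ.exists_bound_of_continuousOn h.continuousOn
  exact ⟨C, (norm_nonneg _).trans (hC 0 (mem_univ _)), fun x => hC x (mem_univ x)⟩

theorem integrable_of_continuous {φ : UnitAddTorus (Fin d) → ℝ} (h : Continuous φ) :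
    Integrable φ := by
  obtain ⟨C, -, hC⟩ := exists_norm_le_of_continuous h
  exact (MemLp.of_bound h.aestronglyMeasurable C (Filter.Eventually.of_forall hC)
    (p := 1)).integrable le_rfl

/-- The integral of a translate does not depend on the translation, so its derivative vanishes. -/
theorem TorusSmooth.integral_torusPartial {φ : UnitAddTorus (Fin d) → ℝ} (h : TorusSmooth φ)
    (i : Fin d) : ∫ x, _root_.torusPartial i φ x = 0 := by
  have hc := (h.torusPartial i).continuous
  obtain ⟨C, -, hC⟩ := exists_norm_le_of_continuous hc
  have h1 := (hasDerivAt_integral_of_dominated_loc_of_deriv_le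
    (μ := (volume : Measure (UnitAddTorus (Fin d)))) (s := univ) (x₀ := (0 : ℝ))
    (F := fun s x => φ (x + torusMk (Pi.single i s)))
    (F' := fun s x => _root_.torusPartial i φ (x + torusMk (Pi.single i s))) (bound := fun _ => C)
    Filter.univ_mem
    (Filter.Eventually.of_forall fun s =>
      (h.continuous.comp (continuous_add_const _)).aestronglyMeasurable)
    (integrable_of_continuous (h.continuous.comp (continuous_add_const _)))
    (hc.comp (continuous_add_const _)).aestronglyMeasurable
    (Filter.Eventually.of_forall fun x s _ => hC _) (integrable_const C)
    (Filter.Eventually.of_forall fun x s _ => h.hasDerivAt i x s)).2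
  simp only [integral_add_right_eq_self] at h1
  exact h1.unique (hasDerivAt_const _ _)

/-- The trigonometric function `Re (c eₙ)`. -/
noncomputable def torusTrig (n : Fin d → ℤ) (c : ℂ) (x : UnitAddTorus (Fin d)) : ℝ :=
  (c * mFourier n x).re

theorem continuous_torusTrig (n : Fin d → ℤ) (c : ℂ) : Continuous (torusTrig n c) :=
  Complex.continuous_re.comp (continuous_const.mul (mFourier n).continuous)

theorem torusSmooth_torusTrig (n : Fin d → ℤ) (c : ℂ) : TorusSmooth (torusTrig n c) := by
  unfold TorusSmooth torusTrig
  simp only [mFourier_torusMk]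
  refine Complex.reCLM.contDiff.comp (contDiff_const.mul (Complex.contDiff_exp.comp
    (contDiff_const.mul (ContDiff.sum fun i _ => contDiff_const.mul ?_))))
  exact Complex.ofRealCLM.contDiff.comp (contDiff_apply ℝ ℝ i)

/-- Differentiation only multiplies the complex amplitude `c`, so the real functions Re(c eₙ) form a
family closed under derivatives. They are admissible test functions, and this treats the real and
the complex scalar field at once. -/
theorem torusPartial_torusTrig (i : Fin d) (n : Fin d → ℤ) (c : ℂ) :
    torusPartial i (torusTrig n c) = torusTrig n (2 * Real.pi * Complex.I * (n i : ℝ) * c) := by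
  funext x
  have hin : ∀ s : ℝ, ∑ j, (n j : ℂ) * ((Pi.single i s : Fin d → ℝ) j : ℂ) = n i * s := fun s => by
    rw [Finset.sum_eq_single i (fun j _ hj => by simp [Pi.single_eq_of_ne hj])
      (fun h => absurd (Finset.mem_univ i) h), Pi.single_eq_same]
  have h1 : HasDerivAt (fun s : ℝ => c * mFourier n x *
      Complex.exp (2 * Real.pi * Complex.I * (n i * s)))
      (c * mFourier n x * (Complex.exp (2 * Real.pi * Complex.I * (n i * (0 : ℝ))) *
        (2 * Real.pi * Complex.I * (n i * 1)))) 0 :=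
    ((((hasDerivAt_id (0 : ℝ)).ofReal_comp.const_mul (n i : ℂ)).const_mul
      (2 * Real.pi * Complex.I)).cexp).const_mul _
  have h2 := Complex.reCLM.hasFDerivAt.comp_hasDerivAt (0 : ℝ) h1
  have h3 : (fun s : ℝ => torusTrig n c (x + torusMk (Pi.single i s))) =
      fun s : ℝ => Complex.reCLM (c * mFourier n x *
        Complex.exp (2 * Real.pi * Complex.I * (n i * s))) := by
    funext s
    simp only [torusTrig, mFourier_apply_add, mFourier_torusMk, hin, Complex.reCLM_apply, mul_assoc]
  rw [torusPartial, h3]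
  refine h2.deriv.trans ?_
  simp only [Complex.reCLM_apply, torusTrig]
  congr 1
  push_cast
  rw [mul_zero, mul_zero, Complex.exp_zero]
  ring

theorem integral_torusPartial_mul_torusTrig {φ : UnitAddTorus (Fin d) → ℝ} (h : TorusSmooth φ)
    (i : Fin d) (n : Fin d → ℤ) (c : ℂ) :
    ∫ x, torusPartial i φ x * torusTrig n c x =
      -∫ x, φ x * torusTrig n (2 * Real.pi * Complex.I * (n i : ℝ) * c) x := by
  have ht := torusSmooth_torusTrig n c
  have h1 := (h.mul ht).integral_torusPartial i
  simp only [h.torusPartial_mul ht] at h1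
  have hi1 : Integrable fun x => torusPartial i φ x * torusTrig n c x :=
    integrable_of_continuous ((h.torusPartial i).continuous.mul ht.continuous)
  have hi2 : Integrable fun x => φ x * torusPartial i (torusTrig n c) x :=
    integrable_of_continuous (h.continuous.mul (ht.torusPartial i).continuous)
  rw [integral_add hi1 hi2, torusPartial_torusTrig] at h1
  exact eq_neg_of_add_eq_zero_left h1

theorem TorusSmooth.foldr_torusPartial {φ : UnitAddTorus (Fin d) → ℝ} (h : TorusSmooth φ)
    (α : Fin d → ℕ) (l : List (Fin d)) :
    TorusSmooth (l.foldr (fun i ψ => (_root_.torusPartial i)^[α i] ψ) φ) := by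
  induction l with
  | nil => exact h
  | cons i l ih =>
    rw [List.foldr_cons]
    generalize α i = k
    induction k with
    | zero => exact ih
    | succ k ihk =>
      rw [Function.iterate_succ_apply']
      exact ihk.torusPartial i

theorem derivSymbol_eq_list_prod (α : Fin d → ℕ) (ξ : Fin d → ℝ) :
    derivSymbol α ξ =
      ((List.finRange d).map fun i => (2 * Real.pi * Complex.I * ξ i) ^ α i).prod := by
  rw [derivSymbol, Fin.prod_univ_def]

theorem integral_torusIteratedPartial_mul_torusTrig {φ : UnitAddTorus (Fin d) → ℝ}
    (h : TorusSmooth φ) (α : Fin d → ℕ) (n : Fin d → ℤ) (c : ℂ) :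
    ∫ x, torusIteratedPartial α φ x * torusTrig n c x =
      (-1 : ℝ) ^ (∑ i, α i) *
        ∫ x, φ x * torusTrig n (derivSymbol α (fun i => (n i : ℝ)) * c) x := by
  rw [derivSymbol_eq_list_prod, Fin.sum_univ_def, torusIteratedPartial]
  induction List.finRange d generalizing c with
  | nil => simp
  | cons i l ih =>
    simp only [List.foldr_cons, List.map_cons, List.prod_cons, List.sum_cons]
    have hs := h.foldr_torusPartial α l
    have key : ∀ k, ∀ c, ∫ x, ((torusPartial i)^[k]
        (l.foldr (fun i ψ => (torusPartial i)^[α i] ψ) φ)) x * torusTrig n c x =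
        (-1 : ℝ) ^ k * ∫ x, (l.foldr (fun i ψ => (torusPartial i)^[α i] ψ) φ) x *
          torusTrig n ((2 * Real.pi * Complex.I * (n i : ℝ)) ^ k * c) x := by
      intro k
      induction k with
      | zero => intro c; simp
      | succ k ihk =>
        intro c
        have hsk : TorusSmooth ((torusPartial i)^[k]
            (l.foldr (fun i ψ => (torusPartial i)^[α i] ψ) φ)) := by
          clear ihk
          induction k with
          | zero => exact hs
          | succ k ih2 =>
            rw [Function.iterate_succ_apply']
            exact ih2.torusPartial i
        rw [Function.iterate_succ_apply', integral_torusPartial_mul_torusTrig hsk, ihk]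
        rw [pow_succ, pow_succ, ← mul_assoc]
        ring
    rw [key, ih, ← mul_assoc, pow_add]
    congr 2
    funext x
    congr 2
    ring

theorem torusIteratedPartial_torusTrig (α : Fin d → ℕ) (n : Fin d → ℤ) (c : ℂ) :
    torusIteratedPartial α (torusTrig n c) =
      torusTrig n (derivSymbol α (fun i => (n i : ℝ)) * c) := by
  rw [derivSymbol_eq_list_prod, torusIteratedPartial]
  induction List.finRange d with
  | nil => simp
  | cons i l ih =>
    simp only [List.foldr_cons, List.map_cons, List.prod_cons, ih]
    generalize α i = k
    induction k with
    | zero => simp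
    | succ k ihk =>
      rw [Function.iterate_succ_apply', ihk, torusPartial_torusTrig]
      congr 1
      ring

variable {𝕜 : Type*} [RCLike 𝕜]

/-- The continuous function `Re (c eₙ) z`. -/
noncomputable def torusTrigC (n : Fin d → ℤ) (c : ℂ) (z : 𝕜) : C(UnitAddTorus (Fin d), 𝕜) :=
  ⟨fun x => torusTrig n c x • z, (continuous_torusTrig n c).smul continuous_const⟩

/-- Multiplication of the real part of a continuous function by a scalar. -/
noncomputable def reSmulHom (z : 𝕜) : C(UnitAddTorus (Fin d), ℂ) →+ C(UnitAddTorus (Fin d), 𝕜) where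
  toFun h := ⟨fun x => (h x).re • z, by fun_prop⟩
  map_zero' := by ext x; simp
  map_add' h g := by ext x; simp [add_smul]

theorem continuous_reSmulHom (z : 𝕜) : Continuous (reSmulHom (d := d) z) :=
  (AddMonoidHomClass.lipschitz_of_bound (reSmulHom z) ‖z‖ fun h => by
    refine (ContinuousMap.norm_le _ (by positivity)).2 fun x => ?_
    change ‖(h x).re • z‖ ≤ _
    rw [norm_smul, mul_comm]
    gcongr
    exact (Complex.abs_re_le_norm _).trans (h.norm_coe_le_norm x)).continuous

/-- Stone–Weierstrass for complex exponentials, transported by h ↦ Re(h) z. Additive combinations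
suffice since scalars can be moved into `c` and `z`. -/
theorem closure_torusTrigC_eq_top (𝕜 : Type*) [RCLike 𝕜] (d : ℕ) :
    closure (AddSubgroup.closure
      {g : C(UnitAddTorus (Fin d), 𝕜) | ∃ n c z, g = torusTrigC n c z} :
        Set C(UnitAddTorus (Fin d), 𝕜)) = univ := by
  set A := AddSubgroup.closure {g : C(UnitAddTorus (Fin d), 𝕜) | ∃ n c z, g = torusTrigC n c z}
  have h1 : ∀ (z : 𝕜) (h : C(UnitAddTorus (Fin d), ℂ)), reSmulHom z h ∈ closure (A : Set _) := by
    intro z h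
    have hcl : h ∈ closure (Submodule.span ℂ (range (mFourier (d := Fin d))) : Set _) := by
      have := (UnitAddTorus.span_mFourier_closure_eq_top (d := Fin d)).ge (Submodule.mem_top (x := h))
      exact this
    refine map_mem_closure (continuous_reSmulHom z) hcl fun g hg => ?_
    have : ∀ c : ℂ, reSmulHom z (c • g) ∈ A := by
      induction hg using Submodule.span_induction with
      | mem g hg =>
        obtain ⟨n, rfl⟩ := hg
        exact fun c => AddSubgroup.subset_closure ⟨n, c, z, rfl⟩
      | zero => intro c; rw [smul_zero, map_zero]; exact A.zero_mem
      | add g g' _ _ ih ih' =>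
        intro c
        have he : c • (g + g') = c • g + c • g' := by
          ext x
          exact mul_add c (g x) (g' x)
        rw [he, map_add]
        exact A.add_mem (ih c) (ih' c)
      | smul a g _ ih =>
        intro c
        rw [smul_smul]
        exact ih _
    simpa using this 1
  refine eq_univ_of_forall fun g => ?_
  have h2 : g = reSmulHom (1 : 𝕜) ⟨fun x => ((RCLike.re (g x) : ℝ) : ℂ), by fun_prop⟩ +
      reSmulHom (RCLike.I : 𝕜) ⟨fun x => ((RCLike.im (g x) : ℝ) : ℂ), by fun_prop⟩ := by
    ext x
    change g x = RCLike.re (g x) • (1 : 𝕜) + RCLike.im (g x) • (RCLike.I : 𝕜)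
    rw [RCLike.real_smul_eq_coe_mul, RCLike.real_smul_eq_coe_mul, mul_one, RCLike.re_add_im]
  rw [h2, ← AddSubgroup.topologicalClosure_coe]
  exact A.topologicalClosure.add_mem (h1 _ _) (h1 _ _)

end TorusCalculus

/-! ### Trigonometric functions in Sobolev spaces and injectivity of trigonometric moments -/

section TorusSobolev

open UnitAddTorus (mFourier)

variable {𝕜 : Type*} [RCLike 𝕜] {d : ℕ} {q : ℝ≥0∞} [Fact (1 ≤ q)]

/-- The function `Re (c eₙ) z` as an element of `L^q`. -/
noncomputable def torusTrigLp (q : ℝ≥0∞) [Fact (1 ≤ q)] (n : Fin d → ℤ) (c : ℂ) (z : 𝕜) :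
    TorusLp 𝕜 d q :=
  ContinuousMap.toLp q volume 𝕜 (torusTrigC n c z)

theorem coeFn_torusTrigLp (n : Fin d → ℤ) (c : ℂ) (z : 𝕜) :
    torusTrigLp q n c z =ᵐ[volume] fun x => torusTrig n c x • z :=
  ContinuousMap.coeFn_toLp (p := q) (𝕜 := 𝕜) volume (torusTrigC n c z)

theorem closure_torusTrigLp_eq_top (hq : q ≠ ⊤) :
    closure (AddSubgroup.closure
      {g : TorusLp 𝕜 d q | ∃ n c z, g = torusTrigLp q n c z} : Set (TorusLp 𝕜 d q)) = univ := by
  set L : C(UnitAddTorus (Fin d), 𝕜) →L[𝕜] TorusLp 𝕜 d q := ContinuousMap.toLp q volume 𝕜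
  refine eq_univ_of_univ_subset ?_
  have hd : DenseRange L := ContinuousMap.toLp_denseRange 𝕜 volume 𝕜 hq
  rw [← hd.closure_range]
  refine closure_minimal ?_ isClosed_closure
  rintro _ ⟨g, rfl⟩
  have hg : g ∈ closure (AddSubgroup.closure
      {g : C(UnitAddTorus (Fin d), 𝕜) | ∃ n c z, g = torusTrigC n c z} :
        Set C(UnitAddTorus (Fin d), 𝕜)) := by
    rw [closure_torusTrigC_eq_top]
    exact mem_univ g
  refine map_mem_closure L.continuous hg fun h hh => ?_
  induction hh using AddSubgroup.closure_induction with
  | mem h hh =>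
    obtain ⟨n, c, z, rfl⟩ := hh
    exact AddSubgroup.subset_closure ⟨n, c, z, rfl⟩
  | zero => rw [map_zero]; exact AddSubgroup.zero_mem _
  | add g h _ _ ih ih' => rw [map_add]; exact AddSubgroup.add_mem _ ih ih'
  | neg h _ ih => rw [map_neg]; exact AddSubgroup.neg_mem _ ih

theorem integral_norm_torusLp_le (u : TorusLp 𝕜 d q) : ∫ x, ‖u x‖ ≤ ‖u‖ := by
  have hq : 1 ≤ q := Fact.out
  rw [integral_norm_eq_lintegral_enorm (Lp.aestronglyMeasurable u), Lp.norm_def,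
    ← eLpNorm_one_eq_lintegral_enorm]
  exact ENNReal.toReal_mono (Lp.eLpNorm_ne_top u)
    (eLpNorm_le_eLpNorm_of_exponent_le hq (Lp.aestronglyMeasurable u))

/-- Integration against a continuous function. -/
noncomputable def torusPairing (ψ : UnitAddTorus (Fin d) → ℝ) (hψ : Continuous ψ) :
    TorusLp 𝕜 d q →L[𝕜] 𝕜 :=
  LinearMap.mkContinuous
    { toFun := fun u => ∫ x, ψ x • u x
      map_add' := fun u v => by
        rw [← integral_add (integrable_smul_torusLp hψ u) (integrable_smul_torusLp hψ v)]
        refine integral_congr_ae ?_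
        filter_upwards [Lp.coeFn_add u v] with x hx
        rw [hx, Pi.add_apply, smul_add]
      map_smul' := fun c u => by
        rw [RingHom.id_apply, ← integral_smul]
        refine integral_congr_ae ?_
        filter_upwards [Lp.coeFn_smul c u] with x hx
        simp only [hx, Pi.smul_apply]
        exact smul_comm _ _ _ }
    (exists_norm_le_of_continuous hψ).choose fun u => by
      obtain ⟨hC, hψC⟩ := (exists_norm_le_of_continuous hψ).choose_spec
      refine (norm_integral_le_integral_norm _).trans
        (le_trans ?_ (mul_le_mul_of_nonneg_left (integral_norm_torusLp_le u) hC))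
      rw [← integral_const_mul]
      refine integral_mono (integrable_smul_torusLp hψ u).norm
        ((((Lp.memLp u).integrable Fact.out).norm).const_mul _) fun x => ?_
      simp only [norm_smul]
      exact mul_le_mul_of_nonneg_right (hψC x) (norm_nonneg _)

theorem torusPairing_apply {ψ : UnitAddTorus (Fin d) → ℝ} (hψ : Continuous ψ)
    (u : TorusLp 𝕜 d q) : torusPairing ψ hψ u = ∫ x, ψ x • u x := rfl

theorem isClosed_sobolevTorus (𝕜 : Type*) [RCLike 𝕜] (d k : ℕ) (q : ℝ≥0∞) [Fact (1 ≤ q)] :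
    IsClosed (sobolevTorus 𝕜 d k q : Set (PiLp q fun _ : MultiIndex d k => TorusLp 𝕜 d q)) := by
  have : (sobolevTorus 𝕜 d k q : Set (PiLp q fun _ : MultiIndex d k => TorusLp 𝕜 d q)) =
      ⋂ (α : MultiIndex d k) (φ : UnitAddTorus (Fin d) → ℝ) (hφ : TorusSmooth φ),
        {U | torusPairing _ (hφ.torusIteratedPartial α.1).continuous (U (MultiIndex.zero d k)) =
          (-1 : ℝ) ^ (∑ i, α.1 i) • torusPairing _ hφ.continuous (U α)} := by
    ext U
    simp only [mem_iInter]
    rfl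
  rw [this]
  refine isClosed_iInter fun α => isClosed_iInter fun φ => isClosed_iInter fun hφ =>
    isClosed_eq ?_ ?_
  · exact (torusPairing _ _).continuous.comp (PiLp.continuous_apply _ _ _)
  · exact ((torusPairing _ _).continuous.comp (PiLp.continuous_apply _ _ _)).const_smul _

instance (𝕜 : Type*) [RCLike 𝕜] (d k : ℕ) (q : ℝ≥0∞) [Fact (1 ≤ q)] :
    CompleteSpace (sobolevTorus 𝕜 d k q) :=
  (isClosed_sobolevTorus 𝕜 d k q).completeSpace_coe

/-- The function `Re (c eₙ) z` as an element of the Sobolev space. -/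
noncomputable def torusTrigSobolev (k : ℕ) (q : ℝ≥0∞) [Fact (1 ≤ q)] (n : Fin d → ℤ) (c : ℂ)
    (z : 𝕜) : sobolevTorus 𝕜 d k q :=
  ⟨WithLp.toLp q fun α => torusTrigLp q n (derivSymbol α.1 (fun i => (n i : ℝ)) * c) z, by
    intro α φ hφ
    have h0 : derivSymbol (MultiIndex.zero d k).1 (fun i => (n i : ℝ)) = 1 := by
      simp [MultiIndex.zero, derivSymbol]
    have key : ∀ (ψ : UnitAddTorus (Fin d) → ℝ) (c : ℂ), ∫ x, ψ x • torusTrigLp q n c z x =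
        (∫ x, ψ x * torusTrig n c x) • z := by
      intro ψ c
      rw [← integral_smul_const]
      refine integral_congr_ae ?_
      filter_upwards [coeFn_torusTrigLp (q := q) n c z] with x hx
      rw [hx, smul_smul]
    simp only [h0, one_mul]
    rw [key, key, integral_torusIteratedPartial_mul_torusTrig hφ, smul_smul]⟩

theorem torusTrigSobolev_apply {k : ℕ} (n : Fin d → ℤ) (c : ℂ) (z : 𝕜) (α : MultiIndex d k) :
    (torusTrigSobolev k q n c z).1 α =
      torusTrigLp q n (derivSymbol α.1 (fun i => (n i : ℝ)) * c) z := rfl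

theorem toTorusLp_torusTrigSobolev {k : ℕ} (n : Fin d → ℤ) (c : ℂ) (z : 𝕜) :
    sobolevTorus.toTorusLp (torusTrigSobolev k q n c z) = torusTrigLp q n c z := by
  rw [sobolevTorus.toTorusLp, torusTrigSobolev_apply]
  simp [MultiIndex.zero, derivSymbol]

theorem sum_derivSymbol_twoTwo (n : Fin d → ℤ) :
    ∑ i : Fin d, ∑ j : Fin d, derivSymbol (MultiIndex.twoTwo i j).1 (fun i => (n i : ℝ)) =
      (bilapSymbol n : ℂ) := by
  have h : ∀ i j : Fin d, derivSymbol (MultiIndex.twoTwo i j).1 (fun i => (n i : ℝ)) =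
      ((2 * Real.pi * n i) ^ 2 * (2 * Real.pi * n j) ^ 2 : ℂ) := by
    intro i j
    have h1 : ∀ i : Fin d, ∏ k, (2 * Real.pi * Complex.I * ((n k : ℝ) : ℂ)) ^
        (Pi.single i 2 : Fin d → ℕ) k = -(2 * Real.pi * n i : ℂ) ^ 2 := by
      intro i
      rw [Finset.prod_eq_single i (fun k _ hk => by rw [Pi.single_eq_of_ne hk, pow_zero])
        (fun h => absurd (Finset.mem_univ i) h), Pi.single_eq_same]
      push_cast
      linear_combination (2 * Real.pi * n i : ℂ) ^ 2 * Complex.I_sq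
    simp only [MultiIndex.twoTwo, derivSymbol, Pi.add_apply, pow_add, Finset.prod_mul_distrib]
    rw [h1, h1]
    ring
  simp only [h, ← Finset.mul_sum, ← Finset.sum_mul]
  rw [bilapSymbol]
  push_cast
  ring

theorem torusTrigLp_sum {ι : Type*} (s : Finset ι) (n : Fin d → ℤ) (c : ι → ℂ) (z : 𝕜) :
    torusTrigLp q n (∑ i ∈ s, c i) z = ∑ i ∈ s, torusTrigLp q n (c i) z := by
  have h : torusTrigC n (∑ i ∈ s, c i) z = ∑ i ∈ s, torusTrigC n (c i) z := by
    ext x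
    rw [ContinuousMap.sum_apply]
    simp only [torusTrigC, torusTrig, ContinuousMap.coe_mk]
    rw [Finset.sum_mul, Complex.re_sum, Finset.sum_smul]
  rw [torusTrigLp, h, map_sum]
  rfl

theorem torusTrigLp_ofReal_mul (r : ℝ) (n : Fin d → ℤ) (c : ℂ) (z : 𝕜) :
    torusTrigLp q n ((r : ℂ) * c) z = (r : 𝕜) • torusTrigLp q n c z := by
  rw [torusTrigLp, torusTrigLp, ← map_smul]
  congr 1
  ext x
  change ((r : ℂ) * c * mFourier n x).re • z = (r : 𝕜) • ((c * mFourier n x).re • z)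
  rw [mul_assoc, Complex.re_ofReal_mul, mul_smul, RCLike.real_smul_eq_coe_smul (K := 𝕜) r]

theorem bilaplacian_torusTrigSobolev (n : Fin d → ℤ) (c : ℂ) (z : 𝕜) :
    sobolevTorus.bilaplacian (torusTrigSobolev 4 q n c z) = ((bilapSymbol n : ℝ) : 𝕜) • torusTrigLp q n c z := by
  rw [← torusTrigLp_ofReal_mul, ← sum_derivSymbol_twoTwo, sobolevTorus.bilaplacian, Finset.sum_mul,
    torusTrigLp_sum]
  refine Finset.sum_congr rfl fun i _ => ?_
  rw [Finset.sum_mul, torusTrigLp_sum]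
  rfl

theorem norm_rclike_map_complex (z : 𝕜) : ‖RCLike.map 𝕜 ℂ z‖ = ‖z‖ := by
  rw [← sq_eq_sq₀ (norm_nonneg _) (norm_nonneg _), ← RCLike.normSq_eq_def', ← RCLike.normSq_eq_def',
    RCLike.normSq_apply, RCLike.normSq_apply]
  simp [RCLike.map_apply]

/-- As q ≥ 2, the function is square integrable, and Parseval applies. The amplitudes c = 1 and c =
i recover the complex exponential from the real test functions. -/
theorem eq_zero_of_torusPairing_torusTrig_eq_zero (hq : 2 ≤ q) (u : TorusLp 𝕜 d q)
    (h : ∀ n c, torusPairing _ (continuous_torusTrig n c) u = 0) : u = 0 := by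
  set ι := RCLike.map 𝕜 ℂ with hι
  have hu2 : MemLp (fun x => ι (u x)) 2 := by
    refine ((Lp.memLp u).mono_exponent hq).congr_norm
      (ι.continuous.comp_aestronglyMeasurable (Lp.aestronglyMeasurable u))
      (Filter.Eventually.of_forall fun x => (norm_rclike_map_complex _).symm)
  have hcoeff : ∀ n, torusCoeff (fun x => ι (u x)) n = 0 := by
    intro n
    have e : ∀ c, ∫ x, (torusTrig n c x : ℂ) * ι (u x) = 0 := by
      intro c
      have h1 := congrArg ι (h n c)
      rw [torusPairing_apply, map_zero,
        ← ι.integral_comp_comm (integrable_smul_torusLp (continuous_torusTrig n c) u)] at h1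
      simpa [map_smul] using h1
    have hi : ∀ c, Integrable fun x => (torusTrig n c x : ℂ) * ι (u x) := by
      intro c
      refine (ι.integrable_comp (integrable_smul_torusLp (continuous_torusTrig n c) u)).congr
        (Filter.Eventually.of_forall fun x => ?_)
      simp only [map_smul, Complex.real_smul]
    have hpt : ∀ x, mFourier (-n) x = (torusTrig n 1 x : ℂ) + Complex.I * (torusTrig n Complex.I x) := by
      intro x
      rw [UnitAddTorus.mFourier_neg]
      apply Complex.ext <;> simp [torusTrig]
    rw [torusCoeff]
    simp only [hpt, add_mul, mul_assoc]
    rw [integral_add (hi 1) ((hi Complex.I).const_mul _), integral_const_mul, e, e]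
    simp
  have hsum := tsum_enorm_sq_torusCoeff hu2
  simp only [hcoeff, enorm_zero] at hsum
  norm_num at hsum
  have hz := (lintegral_eq_zero_iff' (hu2.1.enorm.pow_const 2)).1 hsum.symm
  rw [Lp.eq_zero_iff_ae_eq_zero]
  filter_upwards [hz] with x hx
  have : ‖ι (u x)‖ₑ = 0 := by simpa using hx
  rw [enorm_eq_zero, ← norm_eq_zero, hι, norm_rclike_map_complex, norm_eq_zero] at this
  exact this

/-- Trigonometric functions are eigenfunctions. The four derivatives are moved onto the test
function with the sign (-1)⁴ = 1, so the equation turns into scalar ones. -/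
theorem torusPairing_torusTrig_bilaplacian (n : Fin d → ℤ) (c : ℂ) (u : sobolevTorus 𝕜 d 4 q) :
    torusPairing _ (continuous_torusTrig n c) (sobolevTorus.bilaplacian u) =
      ((bilapSymbol n : ℝ) : 𝕜) * torusPairing _ (continuous_torusTrig n c)
        (sobolevTorus.toTorusLp u) := by
  have h1 : ∀ i j : Fin d, torusPairing _ (continuous_torusTrig n c)
      (u.1 (MultiIndex.twoTwo i j)) = ∫ x, torusTrig n (derivSymbol (MultiIndex.twoTwo i j).1
        (fun i => (n i : ℝ)) * c) x • sobolevTorus.toTorusLp u x := by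
    intro i j
    have h := u.2 (MultiIndex.twoTwo i j) _ (torusSmooth_torusTrig n c)
    rw [torusIteratedPartial_torusTrig] at h
    have h4 : ∑ k, (MultiIndex.twoTwo i j).1 k = 4 := by
      simp [MultiIndex.twoTwo, Finset.sum_add_distrib]
    rw [h4] at h
    norm_num at h
    exact h.symm
  have hint : ∀ i j : Fin d, Integrable fun x => torusTrig n (derivSymbol (MultiIndex.twoTwo i j).1
        (fun i => (n i : ℝ)) * c) x • sobolevTorus.toTorusLp u x :=
    fun i j => integrable_smul_torusLp (continuous_torusTrig _ _) _
  rw [sobolevTorus.bilaplacian, map_sum]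
  simp only [map_sum, h1]
  simp only [← integral_finset_sum _ fun j _ => hint _ j]
  rw [← integral_finset_sum _ fun i _ => integrable_finset_sum _ fun j _ => hint i j,
    torusPairing_apply, ← smul_eq_mul, ← integral_smul]
  refine integral_congr_ae (Filter.Eventually.of_forall fun x => ?_)
  simp only [← Finset.sum_smul]
  rw [← RCLike.real_smul_eq_coe_smul (K := 𝕜), smul_smul]
  congr 1
  simp only [torusTrig, ← Complex.re_sum, ← Finset.sum_mul]
  rw [sum_derivSymbol_twoTwo, mul_assoc, Complex.re_ofReal_mul]

end TorusSobolev
open scoped SchwartzMap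

/-! ### Weak derivatives in time and scalar differential equations -/

section TimeDerivative

variable {E : Type*} [NormedAddCommGroup E] [NormedSpace ℝ E] [CompleteSpace E] {T : ℝ}

/-- Fubini on the triangle s < t. -/
theorem setIntegral_smul_primitive {h : ℝ → E} (hh : IntegrableOn h (Ioo 0 T)) {ψ : ℝ → ℝ}
    (hψ : Continuous ψ) :
    ∫ t in Ioo 0 T, ψ t • (∫ s in (0 : ℝ)..t, h s) =
      ∫ s in Ioo 0 T, (∫ t in s..T, ψ t) • h s := by
  set μ := (volume : Measure ℝ).restrict (Ioo 0 T) with hμ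
  have hψi : Integrable ψ μ := (hψ.integrableOn_Icc (a := 0) (b := T)).mono_set Ioo_subset_Icc_self
  set S : Set (ℝ × ℝ) := {z | z.2 < z.1} with hS
  have hSm : MeasurableSet S := measurableSet_lt measurable_snd measurable_fst
  have hK : Integrable (Function.uncurry fun t s => S.indicator (fun z => ψ z.1 • h z.2) (t, s))
      (μ.prod μ) := (hψi.smul_prod hh).indicator hSm
  have hl : ∀ t ∈ Ioo 0 T, ψ t • (∫ s in (0 : ℝ)..t, h s) =
      ∫ s, S.indicator (fun z => ψ z.1 • h z.2) (t, s) ∂μ := by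
    intro t ht
    have e : (fun s => S.indicator (fun z => ψ z.1 • h z.2) (t, s)) =
        (Iio t).indicator fun s => ψ t • h s := rfl
    rw [e, hμ, setIntegral_indicator measurableSet_Iio, intervalIntegral.integral_of_le ht.1.le,
      integral_Ioc_eq_integral_Ioo, ← integral_smul, Ioo_inter_Iio, min_eq_right ht.2.le]
  have hr : ∀ s ∈ Ioo 0 T, (∫ t in s..T, ψ t) • h s =
      ∫ t, S.indicator (fun z => ψ z.1 • h z.2) (t, s) ∂μ := by
    intro s hs
    have e : (fun t => S.indicator (fun z => ψ z.1 • h z.2) (t, s)) =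
        (Ioi s).indicator fun t => ψ t • h s := rfl
    rw [e, hμ, setIntegral_indicator measurableSet_Ioi, intervalIntegral.integral_of_le hs.2.le,
      integral_Ioc_eq_integral_Ioo, ← integral_smul_const, Ioo_inter_Ioi, max_eq_right hs.1.le]
  rw [setIntegral_congr_fun measurableSet_Ioo hl, integral_integral_swap hK,
    ← setIntegral_congr_fun measurableSet_Ioo hr]

/-- The primitive vanishes at time zero, so the test function has to vanish only at T. Allowing φ(0)
≠ 0 is what makes this identity detect the initial value. -/
theorem setIntegral_deriv_smul_primitive {h : ℝ → E} (hh : IntegrableOn h (Ioo 0 T)) {φ : ℝ → ℝ}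
    (hφ : ContDiff ℝ ∞ φ) (hφT : φ T = 0) :
    ∫ t in Ioo 0 T, deriv φ t • (∫ s in (0 : ℝ)..t, h s) = -∫ s in Ioo 0 T, φ s • h s := by
  have hc : Continuous (deriv φ) := hφ.continuous_deriv (by simp)
  rw [setIntegral_smul_primitive hh hc, ← integral_neg]
  refine integral_congr_ae (Filter.Eventually.of_forall fun s => ?_)
  simp only
  rw [intervalIntegral.integral_deriv_eq_sub (fun t _ => (hφ.differentiable (by simp)) t)
    (hc.intervalIntegrable _ _), hφT, zero_sub, neg_smul]

theorem continuousOn_primitive_of_integrableOn {h : ℝ → E} (hT : 0 ≤ T)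
    (hh : IntegrableOn h (Ioo 0 T)) :
    ContinuousOn (fun t => ∫ s in (0 : ℝ)..t, h s) (Icc 0 T) := by
  have := intervalIntegral.continuousOn_primitive_interval' (a := 0) (b₁ := 0) (b₂ := T)
    (f := h) (μ := volume)
    ((intervalIntegrable_iff_integrableOn_Ioo_of_le hT).2 hh) (left_mem_uIcc)
  rwa [uIcc_of_le hT] at this

theorem locallyIntegrableOn_primitive {h : ℝ → E} (hh : IntegrableOn h (Ioo 0 T)) :
    LocallyIntegrableOn (fun t => ∫ s in (0 : ℝ)..t, h s) (Ioo 0 T) := by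
  rcases le_or_gt T 0 with hT | hT
  · rw [Ioo_eq_empty (not_lt.2 hT)]
    intro x hx
    exact absurd hx (notMem_empty x)
  exact ((continuousOn_primitive_of_integrableOn hT.le hh).mono Ioo_subset_Icc_self).locallyIntegrableOn
    measurableSet_Ioo

theorem exists_contDiff_deriv_eq {ψ : ℝ → ℝ} (hψ : ContDiff ℝ ∞ ψ) (a : ℝ) :
    ContDiff ℝ ∞ (fun t => ∫ s in a..t, ψ s) ∧ deriv (fun t => ∫ s in a..t, ψ s) = ψ := by
  have hd : ∀ t, HasDerivAt (fun t => ∫ s in a..t, ψ s) (ψ t) t := fun t =>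
    (hψ.continuous.integral_hasStrictDerivAt a t).hasDerivAt
  have he : deriv (fun t => ∫ s in a..t, ψ s) = ψ := funext fun t => (hd t).deriv
  refine ⟨contDiff_infty_iff_deriv.2 ⟨fun t => (hd t).differentiableAt, ?_⟩, he⟩
  rwa [he]

theorem setIntegral_smul_of_tsupport_subset {g : ℝ → ℝ} (hg : tsupport g ⊆ Ioo 0 T) (f : ℝ → E) :
    ∫ t in Ioo 0 T, g t • f t = ∫ t, g t • f t :=
  setIntegral_eq_integral_of_forall_compl_eq_zero fun t ht => by
    rw [image_eq_zero_of_notMem_tsupport fun h => ht (hg h), zero_smul]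

theorem integrableOn_smul_of_tsupport_subset {g : ℝ → ℝ} (hg : Continuous g)
    (hgc : HasCompactSupport g) (hgT : tsupport g ⊆ Ioo 0 T) {f : ℝ → E}
    (hf : LocallyIntegrableOn f (Ioo 0 T)) : IntegrableOn (fun t => g t • f t) (Ioo 0 T) := by
  have h1 : IntegrableOn (fun t => g t • f t) (tsupport g) :=
    (hf.integrableOn_compact_subset hgT hgc).continuousOn_smul hg.continuousOn hgc
  refine (h1.integrable_of_forall_notMem_eq_zero fun t ht => ?_).integrableOn
  rw [image_eq_zero_of_notMem_tsupport ht, zero_smul]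

/-- A function that is tested by all `φ` with `φ(T) = 0` vanishes at time zero and is the primitive
of its weak derivative. -/
theorem ae_eq_primitive_of_forall_test {v v' : ℝ → E} (hv : LocallyIntegrableOn v (Ioo 0 T))
    (hv' : IntegrableOn v' (Ioo 0 T))
    (h : ∀ φ : ℝ → ℝ, ContDiff ℝ ∞ φ → φ T = 0 →
      ∫ t in Ioo 0 T, deriv φ t • v t = -∫ t in Ioo 0 T, φ t • v' t) :
    ∀ᵐ t ∂volume.restrict (Ioo 0 T), v t = ∫ s in (0 : ℝ)..t, v' s := by
  have hloc := locallyIntegrableOn_primitive hv'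
  have := isOpen_Ioo.ae_eq_zero_of_integral_contDiff_smul_eq_zero (μ := volume) (hv.sub hloc)
    (fun ψ hψ hψc hψT => by
      rw [← setIntegral_smul_of_tsupport_subset hψT]
      obtain ⟨h1, h2⟩ := exists_contDiff_deriv_eq hψ T
      have e1 := h _ h1 intervalIntegral.integral_same
      have e2 := setIntegral_deriv_smul_primitive hv' h1 intervalIntegral.integral_same
      rw [h2] at e1 e2
      simp only [Pi.sub_apply, smul_sub]
      rw [integral_sub (integrableOn_smul_of_tsupport_subset hψ.continuous hψc hψT hv)
        (integrableOn_smul_of_tsupport_subset hψ.continuous hψc hψT hloc), e1, e2, sub_self])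
  rw [ae_restrict_iff' measurableSet_Ioo]
  filter_upwards [this] with t ht hT
  exact sub_eq_zero.1 (ht hT)

/-- The du Bois-Reymond lemma: the difference of the function and the primitive of its weak
derivative has weak derivative zero. Compactly supported tests see it only up to a constant, which
is its mean against the fixed bump η. -/
theorem HasWeakTimeDeriv.exists_ae_eq {v v' : ℝ → E} (hT : 0 < T) (h : HasWeakTimeDeriv T v v')
    (hv' : IntegrableOn v' (Ioo 0 T)) :
    ∃ c, ∀ᵐ t ∂volume.restrict (Ioo 0 T), v t = c + ∫ s in (0 : ℝ)..t, v' s := by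
  have hloc := locallyIntegrableOn_primitive hv'
  have hH := h.locallyIntegrableOn.sub hloc
  obtain ⟨η, hηT, hηc, hη, hη0, hη1⟩ : ∃ η : ℝ → ℝ, tsupport η ⊆ Ioo 0 T ∧ HasCompactSupport η ∧
      ContDiff ℝ ∞ η ∧ (∀ t, 0 ≤ η t) ∧ η (T / 2) = 1 := by
    obtain ⟨η, h1, h2, h3, h4, h5⟩ := exists_contDiff_tsupport_subset (n := ⊤) (x := T / 2)
      (Ioo_mem_nhds (a := 0) (b := T) (by linarith) (by linarith))
    exact ⟨η, h1, h2, h3, fun t => (h4 ⟨t, rfl⟩).1, h5⟩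
  have hm : 0 < ∫ t, η t :=
    hη.continuous.integral_pos_of_hasCompactSupport_nonneg_nonzero hηc hη0
      (x := T / 2) (by rw [hη1]; exact one_ne_zero)
  set m := ∫ t, η t with hmdef
  set H : ℝ → E := v - fun t => ∫ s in (0 : ℝ)..t, v' s with hHdef
  refine ⟨m⁻¹ • ∫ t, η t • H t, ?_⟩
  set c := m⁻¹ • ∫ t, η t • H t with hc
  have hcl : LocallyIntegrableOn (fun _ : ℝ => c) (Ioo 0 T) :=
    (locallyIntegrable_const c).locallyIntegrableOn _
  have := isOpen_Ioo.ae_eq_zero_of_integral_contDiff_smul_eq_zero (μ := volume) (hH.sub hcl)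
    (fun ψ hψ hψc hψT => by
      -- Subtracting this multiple of the bump makes the test function mean-free. Its primitive from
      -- T is then compactly supported in (0, T), hence admissible in the definition of the weak
      -- derivative.
      set κ := (∫ t, ψ t) / m with hκ
      set ρ : ℝ → ℝ := fun t => ψ t - κ * η t with hρ
      have hρs : ContDiff ℝ ∞ ρ := hψ.sub (contDiff_const.mul hη)
      obtain ⟨h1, h2⟩ := exists_contDiff_deriv_eq hρs T
      have hρc : HasCompactSupport ρ := hψc.sub (hηc.mul_left)
      have hρ0 : ∫ t, ρ t = 0 := by
        rw [integral_sub (hψ.continuous.integrable_of_hasCompactSupport hψc)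
          ((hη.continuous.integrable_of_hasCompactSupport hηc).const_mul _), integral_const_mul,
          ← hmdef, hκ, div_mul_cancel₀ _ hm.ne', sub_self]
      have hK : IsCompact (tsupport ψ ∪ tsupport η) := hψc.union hηc
      have hKT : tsupport ψ ∪ tsupport η ⊆ Ioo 0 T := union_subset hψT hηT
      have hKne : (tsupport ψ ∪ tsupport η).Nonempty :=
        ⟨T / 2, Or.inr (subset_tsupport _ (by rw [Function.mem_support, hη1]; exact one_ne_zero))⟩
      set α := sInf (tsupport ψ ∪ tsupport η)
      set β := sSup (tsupport ψ ∪ tsupport η)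
      have hα : α ∈ Ioo 0 T := hKT (hK.sInf_mem hKne)
      have hβ : β ∈ Ioo 0 T := hKT (hK.sSup_mem hKne)
      have hout : ∀ t, t < α ∨ β < t → ρ t = 0 := by
        intro t ht
        have hn : t ∉ tsupport ψ ∪ tsupport η := fun hmem => by
          rcases ht with ht | ht
          · exact absurd (csInf_le hK.bddBelow hmem) (not_le.2 ht)
          · exact absurd (le_csSup hK.bddAbove hmem) (not_le.2 ht)
        simp only [hρ]
        rw [image_eq_zero_of_notMem_tsupport fun h => hn (Or.inl h),
          image_eq_zero_of_notMem_tsupport fun h => hn (Or.inr h), mul_zero, sub_zero]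
      have hρi : Integrable ρ := hρs.continuous.integrable_of_hasCompactSupport hρc
      have hφ0 : ∀ t, t < α ∨ β < t → ∫ s in T..t, ρ s = 0 := by
        rintro t (ht | ht)
        · rw [intervalIntegral.integral_symm, intervalIntegral.integral_of_le (by linarith [hα.2]),
            setIntegral_eq_integral_of_forall_compl_eq_zero, hρ0, neg_zero]
          intro s hs
          rcases le_or_gt s t with h | h
          · exact hout s (Or.inl (h.trans_lt ht))
          · exact hout s (Or.inr (hβ.2.trans (not_le.1 fun h' => hs ⟨h, h'⟩)))
        · refine intervalIntegral.integral_zero_ae (Filter.Eventually.of_forall fun s hs => ?_)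
          exact hout s (Or.inr ((lt_min hβ.2 ht).trans hs.1))
      have hts : tsupport (fun t => ∫ s in T..t, ρ s) ⊆ Icc α β := by
        refine closure_minimal (fun t ht => ?_) isClosed_Icc
        by_contra hcon
        refine ht (hφ0 t ?_)
        by_contra h'
        push Not at h'
        exact hcon ⟨h'.1, h'.2⟩
      have htsT := hts.trans (Icc_subset_Ioo hα.1 hβ.2)
      have e1 := h.integral_eq _ h1 (HasCompactSupport.of_support_subset_isCompact isCompact_Icc
        ((subset_tsupport _).trans hts)) htsT
      have e2 := setIntegral_deriv_smul_primitive hv' h1 intervalIntegral.integral_same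
      rw [h2] at e1 e2
      have hintρ : ∀ {f : ℝ → E}, LocallyIntegrableOn f (Ioo 0 T) →
          IntegrableOn (fun t => ρ t • f t) (Ioo 0 T) := by
        intro f hf
        have := (integrableOn_smul_of_tsupport_subset hψ.continuous hψc hψT hf).sub
          ((integrableOn_smul_of_tsupport_subset hη.continuous hηc hηT hf).smul κ)
        refine this.congr (Filter.Eventually.of_forall fun t => ?_)
        simp only [hρ, Pi.sub_apply, Pi.smul_apply, sub_smul, mul_smul]
      have e3 : ∫ t in Ioo 0 T, ρ t • H t = 0 := by
        simp only [hHdef, Pi.sub_apply, smul_sub]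
        rw [integral_sub (hintρ h.locallyIntegrableOn) (hintρ hloc), e1, e2, sub_self]
      have e4 : ∫ t in Ioo 0 T, ρ t • H t = (∫ t, ψ t • H t) - κ • ∫ t, η t • H t := by
        simp only [hρ, sub_smul, mul_smul]
        have e7 : IntegrableOn (fun t => κ • η t • H t) (Ioo 0 T) :=
          (integrableOn_smul_of_tsupport_subset hη.continuous hηc hηT hH).smul κ
        rw [integral_sub (integrableOn_smul_of_tsupport_subset hψ.continuous hψc hψT hH) e7,
          integral_smul,
          setIntegral_smul_of_tsupport_subset hψT, setIntegral_smul_of_tsupport_subset hηT]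
      rw [e3] at e4
      rw [← setIntegral_smul_of_tsupport_subset hψT]
      simp only [Pi.sub_apply, smul_sub]
      have e5 := integrableOn_smul_of_tsupport_subset hψ.continuous hψc hψT hH
      have e6 := integrableOn_smul_of_tsupport_subset hψ.continuous hψc hψT hcl
      rw [integral_sub e5 e6, setIntegral_smul_of_tsupport_subset hψT,
        setIntegral_smul_of_tsupport_subset hψT, sub_eq_zero.1 e4.symm, integral_smul_const,
        hc, smul_smul, hκ, div_eq_mul_inv, sub_self])
  rw [ae_restrict_iff' measurableSet_Ioo]
  filter_upwards [this] with t ht htT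
  have := ht htT
  simp only [hHdef, Pi.sub_apply] at this
  rw [sub_sub, sub_eq_zero] at this
  rw [this, add_comm]

end TimeDerivative

/-! ### Gronwall's lemma and the scalar Duhamel formula -/

section ScalarEquation

variable {E : Type*} [NormedAddCommGroup E] [NormedSpace ℝ E] {T : ℝ}

/-- Gronwall's lemma: the integral of ‖y‖ starts at zero and its derivative is at most L times
itself. -/
theorem eq_zero_of_norm_le_mul_integral_norm {L : ℝ} {y : ℝ → E} (hT : 0 ≤ T)
    (hy : ContinuousOn y (Icc 0 T))
    (h : ∀ t ∈ Icc 0 T, ‖y t‖ ≤ L * ∫ s in (0 : ℝ)..t, ‖y s‖) : ∀ t ∈ Icc 0 T, y t = 0 := by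
  have hi : IntegrableOn (fun s => ‖y s‖) (Ioo 0 T) :=
    (hy.norm.integrableOn_Icc).mono_set Ioo_subset_Icc_self
  have hG : ∀ t ∈ Icc 0 T, ∫ s in (0 : ℝ)..t, ‖y s‖ = 0 := by
    refine eq_zero_of_abs_deriv_le_mul_abs_self_of_eq_zero_right (K := L) (f' := fun t => ‖y t‖)
      (continuousOn_primitive_of_integrableOn hT hi) (fun t ht => ?_)
      intervalIntegral.integral_same (fun t ht => ?_)
    · refine intervalIntegral.integral_hasDerivWithinAt_right (t := Ioi t) (s := Ici t) ?_ ?_ ?_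
      · exact (hy.norm.mono (by rw [uIcc_of_le ht.1]; exact Icc_subset_Icc_right ht.2.le)).intervalIntegrable
      · refine ⟨Ico t T, ?_, ?_⟩
        · rw [← Ici_inter_Iio]
          refine Filter.inter_mem ?_ (mem_nhdsWithin_of_mem_nhds (Iio_mem_nhds ht.2))
          exact Filter.mem_of_superset self_mem_nhdsWithin Ioi_subset_Ici_self
        · exact ((hy.norm.mono (Icc_subset_Icc_left ht.1)).mono
            Ico_subset_Icc_self).aestronglyMeasurable measurableSet_Ico
      · refine (hy.norm t (Ico_subset_Icc_self ht)).mono_of_mem_nhdsWithin ?_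
        · refine Filter.mem_of_superset (Filter.inter_mem self_mem_nhdsWithin
            (mem_nhdsWithin_of_mem_nhds (Iio_mem_nhds ht.2))) fun s hs => ?_
          exact ⟨ht.1.trans (show t < s from hs.1).le, (show s < T from hs.2).le⟩
    · have h0 : 0 ≤ ∫ s in (0 : ℝ)..t, ‖y s‖ :=
        intervalIntegral.integral_nonneg ht.1 fun _ _ => norm_nonneg _
      rw [norm_norm, Real.norm_of_nonneg h0]
      exact h t (Ico_subset_Icc_self ht)
  intro t ht
  have := h t ht
  rw [hG t ht, mul_zero] at this
  exact norm_le_zero_iff.1 this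

/-- The solution of `θ' + κ a θ = 1_E`, `θ(0) = 0`, where `b` is a primitive of `a`. -/
noncomputable def duhamel (b : ℝ → ℝ) (κ : ℝ) (S : Set ℝ) (t : ℝ) : ℝ :=
  ∫ s in (0 : ℝ)..t, S.indicator (fun s => Real.exp (-(κ * (b t - b s)))) s

variable {a b : ℝ → ℝ} {lam κ : ℝ} {S : Set ℝ}

theorem duhamel_eq (b : ℝ → ℝ) (κ : ℝ) (S : Set ℝ) (t : ℝ) :
    duhamel b κ S t = Real.exp (-(κ * b t)) *
      ∫ s in (0 : ℝ)..t, S.indicator (fun s => Real.exp (κ * b s)) s := by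
  rw [duhamel, ← intervalIntegral.integral_const_mul]
  refine intervalIntegral.integral_congr fun s _ => ?_
  by_cases hs : s ∈ S
  · rw [indicator_of_mem hs, indicator_of_mem hs, ← Real.exp_add]
    congr 1
    ring
  · rw [indicator_of_notMem hs, indicator_of_notMem hs, mul_zero]

theorem intervalIntegrable_indicator_exp (hb : Continuous b) (κ : ℝ) (hS : MeasurableSet S)
    (s t : ℝ) :
    IntervalIntegrable (S.indicator fun s => Real.exp (κ * b s)) volume s t :=
  ⟨((by fun_prop : Continuous fun s => Real.exp (κ * b s)).intervalIntegrable s t).1.indicator hS,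
    ((by fun_prop : Continuous fun s => Real.exp (κ * b s)).intervalIntegrable s t).2.indicator hS⟩

theorem continuous_duhamel (hb : Continuous b) (κ : ℝ) (hS : MeasurableSet S) :
    Continuous (duhamel b κ S) := by
  have h : duhamel b κ S = fun t => Real.exp (-(κ * b t)) *
      ∫ s in (0 : ℝ)..t, S.indicator (fun s => Real.exp (κ * b s)) s :=
    funext fun t => duhamel_eq b κ S t
  rw [h]
  exact (by fun_prop : Continuous fun t => Real.exp (-(κ * b t))).mul
    (intervalIntegral.continuous_primitive
      (fun s t => intervalIntegrable_indicator_exp hb κ hS s t) 0)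

theorem locallyIntegrable_of_abs_le (ha : Measurable a) (hab : ∀ t, |a t| ≤ lam) :
    LocallyIntegrable a :=
  (locallyIntegrable_const lam).mono ha.aestronglyMeasurable
    (Filter.Eventually.of_forall fun t => (hab t).trans (le_abs_self lam))

/-- The coefficient is merely measurable, so the product rule for exp(-κb) times the integral holds
only almost everywhere. Both factors are absolutely continuous, and the fundamental theorem of
calculus for such functions gives the integrated equation. -/
theorem duhamel_eq_integral (ha : Measurable a) (hab : ∀ t, |a t| ≤ lam)
    (hb : ∀ t, b t = ∫ s in (0 : ℝ)..t, a s) (κ : ℝ) (hS : MeasurableSet S) (t : ℝ) :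
    duhamel b κ S t =
      ∫ s in (0 : ℝ)..t, (S.indicator (fun _ => 1) s - κ * a s * duhamel b κ S s) := by
  have hla := locallyIntegrable_of_abs_le ha hab
  have hai : ∀ s t, IntervalIntegrable a volume s t := fun s t => intervalIntegrable_iff.2
    ((hla.integrableOn_isCompact isCompact_uIcc).mono_set uIoc_subset_uIcc)
  have hbe : b = fun t => ∫ s in (0 : ℝ)..t, a s := funext hb
  have hbc : Continuous b := by
    rw [hbe]
    exact intervalIntegral.continuous_primitive hai 0
  have hbac : AbsolutelyContinuousOnInterval b 0 t := by
    rw [hbe]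
    exact (hai 0 t).absolutelyContinuousOnInterval_intervalIntegral (c := 0) left_mem_uIcc
  set e : ℝ → ℝ := fun t => Real.exp (-(κ * b t)) with he
  have hblip : LipschitzWith lam.toNNReal b := by
    refine LipschitzWith.of_dist_le_mul fun s r => ?_
    rw [hb, hb, Real.dist_eq, Real.dist_eq, intervalIntegral.integral_interval_sub_left (hai _ _)
      (hai _ _), ← Real.norm_eq_abs]
    rw [Real.coe_toNNReal _ ((abs_nonneg _).trans (hab 0))]
    exact intervalIntegral.norm_integral_le_of_norm_le_const fun x _ => hab x
  have heac : AbsolutelyContinuousOnInterval e 0 t := by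
    have hec : ContDiff ℝ 1 fun x : ℝ => Real.exp (-(κ * x)) := by fun_prop
    obtain ⟨K, hK⟩ := hec.contDiffOn.exists_lipschitzOnWith (s := Icc (sInf (b '' uIcc 0 t)) (sSup (b '' uIcc 0 t))) one_ne_zero
      (convex_Icc _ _) isCompact_Icc
    have hbK : IsCompact (b '' uIcc 0 t) := isCompact_uIcc.image hbc
    exact (hK.comp (hblip.lipschitzOnWith (s := uIcc 0 t)) fun s hs =>
      ⟨csInf_le hbK.bddBelow ⟨s, hs, rfl⟩, le_csSup hbK.bddAbove ⟨s, hs, rfl⟩⟩).absolutelyContinuousOnInterval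
  set h : ℝ → ℝ := S.indicator fun s => Real.exp (κ * b s) with hh
  have hhi := intervalIntegrable_indicator_exp hbc κ hS
  have hHac : AbsolutelyContinuousOnInterval (fun t => ∫ s in (0 : ℝ)..t, h s) 0 t :=
    (hhi 0 t).absolutelyContinuousOnInterval_intervalIntegral (c := 0) left_mem_uIcc
  have hloc : LocallyIntegrable h :=
    ((by fun_prop : Continuous fun s => Real.exp (κ * b s)).locallyIntegrable).indicator hS
  have hac := heac.fun_mul hHac
  have hfun : duhamel b κ S = fun t => e t * ∫ s in (0 : ℝ)..t, h s :=
    funext fun t => duhamel_eq b κ S t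
  have hft := hac.integral_deriv_eq_sub
  rw [intervalIntegral.integral_same, mul_zero, sub_zero] at hft
  rw [show duhamel b κ S t = e t * ∫ s in (0 : ℝ)..t, h s from duhamel_eq b κ S t, ← hft]
  refine intervalIntegral.integral_congr_ae ?_
  filter_upwards [LocallyIntegrable.ae_hasDerivAt_integral hla,
    LocallyIntegrable.ae_hasDerivAt_integral hloc] with s hs hs' _
  have hbs : HasDerivAt b (a s) s := by
    rw [hbe]
    exact hs 0
  have hes : HasDerivAt e (Real.exp (-(κ * b s)) * -(κ * a s)) s := (hbs.const_mul κ).neg.exp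
  refine (hes.mul (hs' 0)).deriv.trans ?_
  rw [duhamel_eq]
  by_cases hsS : s ∈ S
  · rw [hh, indicator_of_mem hsS, indicator_of_mem hsS]
    simp only [he]
    rw [← Real.exp_add, neg_add_cancel, Real.exp_zero]
    ring
  · rw [hh, indicator_of_notMem hsS, indicator_of_notMem hsS]
    ring

end ScalarEquation
open scoped SchwartzMap

/-! ### Weighted `L^p` spaces in time -/

section WeightedTime

variable {r p T : ℝ} {w w' : ℝ → ℝ}

theorem apCharacteristic_congr (h : w =ᵐ[volume] w') :
    apCharacteristic r w = apCharacteristic r w' := by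
  unfold apCharacteristic
  refine iSup_congr fun s => iSup_congr fun t => iSup_congr fun _ => ?_
  have h' := ae_restrict_of_ae (s := Ioo s t) h
  rw [laverage_congr (f := fun x => ENNReal.ofReal (w x)) (g := fun x => ENNReal.ofReal (w' x))
      (h'.mono fun x hx => by simp only [hx]),
    laverage_congr (f := fun x => ENNReal.ofReal (w x) ^ (1 - r.conjExponent))
      (g := fun x => ENNReal.ofReal (w' x) ^ (1 - r.conjExponent))
      (h'.mono fun x hx => by simp only [hx])]

theorem IsMuckenhoupt.aemeasurable (hw : IsMuckenhoupt r w) :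
    AEMeasurable (fun t => ENNReal.ofReal (w t)) :=
  hw.locallyIntegrable.aestronglyMeasurable.aemeasurable.ennreal_ofReal

/-- A Muckenhoupt weight has a measurable version satisfying the cell conditions. -/
theorem IsMuckenhoupt.exists_cellAp (hw : IsMuckenhoupt r w) (hr : 1 < r) {K : ℝ≥0∞}
    (hK : apCharacteristic r w ≤ K) :
    ∃ v : ℝ → ℝ≥0∞, Measurable v ∧ (∀ᵐ t, v t = ENNReal.ofReal (w t)) ∧
      (∀ᵐ t, 0 < v t ∧ v t < ⊤) ∧ ∀ n, CellAp (timeLabel n) volume r K v := by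
  have hm := hw.locallyIntegrable.aestronglyMeasurable
  have he : w =ᵐ[volume] hm.mk w := hm.ae_eq_mk
  refine ⟨fun t => ENNReal.ofReal (hm.mk w t), hm.stronglyMeasurable_mk.measurable.ennreal_ofReal,
    he.mono fun t ht => by simp only [ht], ?_, fun n => ?_⟩
  · filter_upwards [he, hw.pos] with t ht hp
    exact ⟨ENNReal.ofReal_pos.2 (ht ▸ hp), ENNReal.ofReal_lt_top⟩
  · exact cellAp_timeLabel_of_apCharacteristic_le hr (by rwa [← apCharacteristic_congr he]) n

theorem IsMuckenhoupt.lintegral_ne_top (hw : IsMuckenhoupt r w) (T : ℝ) :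
    ∫⁻ t in Ioo 0 T, ENNReal.ofReal (w t) ≠ ⊤ := by
  have h := (hw.locallyIntegrable.integrableOn_isCompact (isCompact_Icc (a := (0 : ℝ)) (b := T))).mono_set
    Ioo_subset_Icc_self
  exact (ne_of_lt (lt_of_le_of_lt (lintegral_mono fun t => by
    rw [← ofReal_norm]
    exact ENNReal.ofReal_le_ofReal (le_abs_self _)) h.2))

theorem IsMuckenhoupt.isFiniteMeasure (hw : IsMuckenhoupt r w) (T : ℝ) :
    IsFiniteMeasure (weightedMeasure w T) :=
  isFiniteMeasure_withDensity (hw.lintegral_ne_top T)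

theorem weightedMeasure_absolutelyContinuous (w : ℝ → ℝ) (T : ℝ) :
    weightedMeasure w T ≪ volume.restrict (Ioo 0 T) :=
  withDensity_absolutelyContinuous _ _

theorem IsMuckenhoupt.absolutelyContinuous (hw : IsMuckenhoupt r w) (T : ℝ) :
    volume.restrict (Ioo 0 T) ≪ weightedMeasure w T :=
  withDensity_absolutelyContinuous' hw.aemeasurable.restrict
    ((ae_restrict_of_ae hw.pos).mono fun _ h => (ENNReal.ofReal_pos.2 h).ne')

theorem IsMuckenhoupt.lintegral_weightedMeasure (hw : IsMuckenhoupt r w) {g : ℝ → ℝ≥0∞}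
    (hg : AEMeasurable g (volume.restrict (Ioo 0 T))) :
    ∫⁻ t, g t ∂(weightedMeasure w T) = ∫⁻ t in Ioo 0 T, g t * ENNReal.ofReal (w t) := by
  rw [weightedMeasure, lintegral_withDensity_eq_lintegral_mul₀ hw.aemeasurable.restrict hg]
  refine lintegral_congr fun t => ?_
  rw [Pi.mul_apply, mul_comm]

/-- The interval (0, T) is one of those in the supremum, and the mean of w over it is positive. -/
theorem IsMuckenhoupt.lintegral_rpow_ne_top (hw : IsMuckenhoupt r w) (hr : 1 < r) (hT : 0 < T) :
    ∫⁻ t in Ioo 0 T, ENNReal.ofReal (w t) ^ (1 - r.conjExponent) ≠ ⊤ := by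
  have h := hw.characteristic_lt_top
  have h1 : (⨍⁻ x, ENNReal.ofReal (w x) ∂volume.restrict (Ioo 0 T)) *
      (⨍⁻ x, ENNReal.ofReal (w x) ^ (1 - r.conjExponent) ∂volume.restrict (Ioo 0 T)) ^ (r - 1) < ⊤ :=
    lt_of_le_of_lt (le_iSup_of_le (0 : ℝ) (le_iSup_of_le T (le_iSup (fun _ : 0 < T =>
      (⨍⁻ x, ENNReal.ofReal (w x) ∂volume.restrict (Ioo 0 T)) * (⨍⁻ x, ENNReal.ofReal (w x) ^
        (1 - r.conjExponent) ∂volume.restrict (Ioo 0 T)) ^ (r - 1)) hT))) h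
  have hv : volume.restrict (Ioo 0 T) univ = ENNReal.ofReal T := by
    rw [Measure.restrict_apply_univ, Real.volume_Ioo, sub_zero]
  have h2 : (⨍⁻ x, ENNReal.ofReal (w x) ∂volume.restrict (Ioo 0 T)) ≠ 0 := by
    rw [laverage_eq, hv]
    refine (ENNReal.div_pos ?_ ENNReal.ofReal_ne_top).ne'
    intro h0
    rw [lintegral_eq_zero_iff' hw.aemeasurable.restrict] at h0
    have : ∀ᵐ t ∂volume.restrict (Ioo 0 T), False := by
      filter_upwards [h0, ae_restrict_of_ae hw.pos] with t ht hp
      exact (ENNReal.ofReal_pos.2 hp).ne' ht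
    rw [Filter.eventually_false_iff_eq_bot, ae_eq_bot, Measure.restrict_eq_zero, Real.volume_Ioo,
      sub_zero, ENNReal.ofReal_eq_zero] at this
    linarith
  intro htop
  have h3 : (⨍⁻ x, ENNReal.ofReal (w x) ^ (1 - r.conjExponent) ∂volume.restrict (Ioo 0 T)) = ⊤ := by
    rw [laverage_eq, hv, htop, ENNReal.top_div_of_ne_top ENNReal.ofReal_ne_top]
  rw [h3, ENNReal.top_rpow_of_pos (by linarith), ENNReal.mul_top h2] at h1
  exact lt_irrefl _ h1

/-- On a bounded interval, integrability of a negative power of the weight passes to smaller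
negative powers. `A_{p/2}` provides the exponent 2/(p-2), while Hölder's inequality in L^p(w) needs
only 1/(p-1). -/
theorem rpow_neg_le_one_add_rpow_neg (x : ℝ≥0∞) {a b : ℝ} (ha : 0 < a) (hab : a ≤ b) :
    x ^ (-a) ≤ 1 + x ^ (-b) := by
  rcases le_total x 1 with hx | hx
  · exact (ENNReal.rpow_le_rpow_of_exponent_ge hx (by linarith)).trans le_add_self
  · rw [ENNReal.rpow_neg]
    exact (ENNReal.inv_le_one.2 (ENNReal.one_le_rpow hx ha)).trans le_self_add

/-- Hölder's inequality: the weighted space embeds in `L¹`. -/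
theorem IsMuckenhoupt.exists_lintegral_enorm_le {E : Type*} [NormedAddCommGroup E] (hp : 2 < p)
    (hw : IsMuckenhoupt (p / 2) w) (hT : 0 < T) :
    ∃ M : ℝ≥0, ∀ g : ℝ → E, AEStronglyMeasurable g (volume.restrict (Ioo 0 T)) →
      ∫⁻ t in Ioo 0 T, ‖g t‖ₑ ≤
        M * (∫⁻ t in Ioo 0 T, ‖g t‖ₑ ^ p * ENNReal.ofReal (w t)) ^ (1 / p) := by
  have hconj : p.HolderConjugate p.conjExponent := Real.HolderConjugate.conjExponent (by linarith)
  set s := p.conjExponent with hs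
  have hs0 : 0 < s := hconj.symm.pos
  set I := ∫⁻ t in Ioo 0 T, (ENNReal.ofReal (w t) ^ (-(1 / p))) ^ s with hI
  have hItop : I ≠ ⊤ := by
    have hle : I ≤ ∫⁻ t in Ioo 0 T, (1 + ENNReal.ofReal (w t) ^ (1 - (p / 2).conjExponent)) := by
      refine lintegral_mono fun t => ?_
      simp only
      rw [← ENNReal.rpow_mul, show -(1 / p) * s = -(1 / (p - 1)) by
        rw [hs, Real.conjExponent]; field_simp,
        show 1 - (p / 2).conjExponent = -(2 / (p - 2)) by
          rw [Real.conjExponent]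
          have : p - 2 ≠ 0 := by linarith
          have : p / 2 - 1 ≠ 0 := by linarith
          field_simp
          ring]
      refine rpow_neg_le_one_add_rpow_neg _ (by apply div_pos <;> linarith) ?_
      rw [div_le_div_iff₀ (by linarith) (by linarith)]
      linarith
    refine ne_top_of_le_ne_top ?_ hle
    rw [lintegral_add_left measurable_const]
    refine ENNReal.add_ne_top.2 ⟨?_, hw.lintegral_rpow_ne_top (by linarith) hT⟩
    rw [lintegral_const, Measure.restrict_apply_univ, Real.volume_Ioo, one_mul]
    exact ENNReal.ofReal_ne_top
  refine ⟨(I ^ (1 / s)).toNNReal, fun g hg => ?_⟩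
  rw [ENNReal.coe_toNNReal (ENNReal.rpow_ne_top_of_nonneg (by positivity) hItop)]
  have hwm := (hw.aemeasurable).restrict (s := Ioo 0 T)
  have hH := ENNReal.lintegral_mul_le_Lp_mul_Lq (volume.restrict (Ioo 0 T)) hconj
    (f := fun t => ‖g t‖ₑ * ENNReal.ofReal (w t) ^ (1 / p))
    (g := fun t => ENNReal.ofReal (w t) ^ (-(1 / p)))
    (hg.enorm.mul (hwm.pow_const _)) (hwm.pow_const _)
  refine le_trans (le_of_eq ?_) (hH.trans (le_of_eq ?_))
  · refine lintegral_congr_ae ?_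
    filter_upwards [ae_restrict_of_ae hw.pos] with t ht
    have h0 := (ENNReal.ofReal_pos.2 ht).ne'
    rw [Pi.mul_apply, mul_assoc, ← ENNReal.rpow_add _ _ h0 ENNReal.ofReal_ne_top, add_neg_cancel,
      ENNReal.rpow_zero, mul_one]
  · rw [mul_comm]
    congr 2
    refine lintegral_congr fun t => ?_
    rw [ENNReal.mul_rpow_of_nonneg _ _ (by linarith), ← ENNReal.rpow_mul,
      one_div_mul_cancel (by linarith), ENNReal.rpow_one]

variable {E : Type*} [NormedAddCommGroup E]

theorem IsMuckenhoupt.aestronglyMeasurable_coeFn (hw : IsMuckenhoupt r w) {P : ℝ≥0∞}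
    (g : Lp E P (weightedMeasure w T)) : AEStronglyMeasurable g (volume.restrict (Ioo 0 T)) :=
  (Lp.aestronglyMeasurable g).mono_ac (hw.absolutelyContinuous T)

theorem IsMuckenhoupt.enorm_rpow_eq (hp : 0 < p) (hw : IsMuckenhoupt r w)
    (g : Lp E (ENNReal.ofReal p) (weightedMeasure w T)) :
    ‖g‖ₑ ^ p = ∫⁻ t in Ioo 0 T, ‖g t‖ₑ ^ p * ENNReal.ofReal (w t) := by
  rw [Lp.enorm_def, eLpNorm_eq_lintegral_rpow_enorm_toReal (ENNReal.ofReal_pos.2 hp).ne'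
    ENNReal.ofReal_ne_top, ENNReal.toReal_ofReal hp.le, ← ENNReal.rpow_mul,
    one_div_mul_cancel hp.ne', ENNReal.rpow_one,
    hw.lintegral_weightedMeasure ((hw.aestronglyMeasurable_coeFn g).enorm.pow_const _)]

theorem IsMuckenhoupt.exists_integral_norm_le (E : Type*) [NormedAddCommGroup E] (hp : 2 < p)
    (hw : IsMuckenhoupt (p / 2) w) (hT : 0 < T) :
    ∃ M : ℝ≥0, ∀ g : Lp E (ENNReal.ofReal p) (weightedMeasure w T),
      IntegrableOn g (Ioo 0 T) ∧ ∫ t in Ioo 0 T, ‖g t‖ ≤ M * ‖g‖ := by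
  obtain ⟨M, hM⟩ := hw.exists_lintegral_enorm_le (E := E) hp hT
  refine ⟨M, fun g => ?_⟩
  have hm := hw.aestronglyMeasurable_coeFn g
  have h := hM g hm
  rw [← hw.enorm_rpow_eq (by linarith), ← ENNReal.rpow_mul, mul_one_div_cancel (by linarith),
    ENNReal.rpow_one] at h
  have htop : (M : ℝ≥0∞) * ‖g‖ₑ ≠ ⊤ := ENNReal.mul_ne_top ENNReal.coe_ne_top enorm_ne_top
  refine ⟨⟨hm, lt_of_le_of_lt h htop.lt_top⟩, ?_⟩
  rw [integral_norm_eq_lintegral_enorm hm]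
  refine (ENNReal.toReal_mono htop h).trans (le_of_eq ?_)
  rw [ENNReal.toReal_mul, Lp.enorm_def, ← Lp.norm_def, ENNReal.coe_toReal]

/-- Integration in time against a continuous function is continuous on the weighted space. -/
theorem IsMuckenhoupt.exists_addMonoidHom_setIntegral_smul (E : Type*) [NormedAddCommGroup E]
    [NormedSpace ℝ E] [Fact (1 ≤ ENNReal.ofReal p)] (hp : 2 < p) (hw : IsMuckenhoupt (p / 2) w)
    (hT : 0 < T) {ψ : ℝ → ℝ} (hψ : Continuous ψ) :
    ∃ L : Lp E (ENNReal.ofReal p) (weightedMeasure w T) →+ E, Continuous L ∧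
      ∀ g, L g = ∫ t in Ioo 0 T, ψ t • g t := by
  obtain ⟨M, hM⟩ := hw.exists_integral_norm_le E hp hT
  obtain ⟨B, hB⟩ := (isCompact_Icc (a := (0 : ℝ)) (b := T)).exists_bound_of_continuousOn
    hψ.continuousOn
  have hB0 : 0 ≤ B := (norm_nonneg _).trans (hB 0 ⟨le_rfl, hT.le⟩)
  have hi : ∀ g : Lp E (ENNReal.ofReal p) (weightedMeasure w T),
      IntegrableOn (fun t => ψ t • g t) (Ioo 0 T) := fun g =>
    (hM g).1.bdd_smul B hψ.aestronglyMeasurable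
      ((ae_restrict_iff' measurableSet_Ioo).2 (Filter.Eventually.of_forall fun t ht =>
        hB t (Ioo_subset_Icc_self ht)))
  set L : Lp E (ENNReal.ofReal p) (weightedMeasure w T) →+ E :=
    AddMonoidHom.mk' (fun g => ∫ t in Ioo 0 T, ψ t • g t) fun g g' => by
      rw [← integral_add (hi g) (hi g')]
      refine integral_congr_ae ?_
      filter_upwards [(hw.absolutelyContinuous T).ae_le (Lp.coeFn_add g g')] with t ht
      rw [ht, Pi.add_apply, smul_add]
  refine ⟨L, (AddMonoidHomClass.lipschitz_of_bound L (B * M) fun g => ?_).continuous,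
    fun g => rfl⟩
  refine (norm_integral_le_integral_norm _).trans ?_
  rw [mul_assoc]
  refine le_trans ?_ (mul_le_mul_of_nonneg_left (hM g).2 hB0)
  rw [← integral_const_mul]
  refine integral_mono_ae (hi g).norm ((hM g).1.norm.const_mul B) ?_
  refine (ae_restrict_iff' measurableSet_Ioo).2 (Filter.Eventually.of_forall fun t ht => ?_)
  simp only [norm_smul]
  exact mul_le_mul_of_nonneg_right (hB t (Ioo_subset_Icc_self ht)) (norm_nonneg _)

end WeightedTime
open scoped SchwartzMap

/-! ### The parabolic operator on trigonometric functions -/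

section ParabolicTrig

open UnitAddTorus (mFourier)

variable {d : ℕ} {lam ε : ℝ} {b : ℝ → ℝ} {m : ℕ}

theorem mFourier_sub_torusMk (n : Fin d → ℤ) (x : UnitAddTorus (Fin d)) (y : Fin d → ℝ) :
    mFourier n (x - torusMk y) = mFourier n x * mFourier (-n) (torusMk y) := by
  rw [sub_eq_add_neg, ← torusMk_neg, mFourier_apply_add, mFourier_torusMk, mFourier_torusMk]
  congr 3
  exact Finset.sum_congr rfl fun i _ => by simp

theorem bilapSymbol_neg (n : Fin d → ℤ) : bilapSymbol (-n) = bilapSymbol n := by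
  simp [bilapSymbol]

theorem derivSymbol_neg (α : Fin d → ℕ) (n : Fin d → ℤ) :
    derivSymbol α (fun i => ((-n) i : ℝ)) =
      starRingEnd ℂ (derivSymbol α fun i => (n i : ℝ)) := by
  simp only [derivSymbol, map_prod, map_pow, map_mul, Complex.conj_I, Complex.conj_ofReal,
    Complex.conj_ofNat]
  refine Finset.prod_congr rfl fun i _ => ?_
  congr 1
  simp

/-- Characters are eigenfunctions of the convolution in space. What remains is the scalar Duhamel
integral, damped by exp(-ε|2πn|⁴), a factor that tends to 1 as ε → 0. -/
theorem parabolicOp_indicator_mul_mFourier (hb : IsEllipticPrimitive lam b) (hε : 0 < ε)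
    (hε1 : ε ≤ 1) (hm : m ≤ 4) {Φ : 𝓢(EuclideanSpace ℝ (Fin d), ℂ)} {σ : (Fin d → ℤ) → ℂ}
    (hΦ : HasParabolicSymbol m Φ σ) {S : Set ℝ} (hS : MeasurableSet S) (n : Fin d → ℤ) {t : ℝ}
    (ht : 0 ≤ t) (x : UnitAddTorus (Fin d)) :
    parabolicOp m Φ b ε (fun z => S.indicator 1 z.1 * mFourier n z.2) (t, x) =
      (Real.exp (-(ε * bilapSymbol n)) * duhamel b (bilapSymbol n) S t : ℝ) *
        (σ n * mFourier n x) := by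
  have hc : Continuous (mFourier n : UnitAddTorus (Fin d) → ℂ) := (mFourier n).continuous
  have hf : Measurable fun z : ℝ × UnitAddTorus (Fin d) => S.indicator (1 : ℝ → ℂ) z.1 *
      mFourier n z.2 :=
    ((measurable_one.indicator hS).comp measurable_fst).mul (hc.measurable.comp measurable_snd)
  have hint := integrable_causalKernel_mul hb hε hε1 hm Φ hf (B := 1) (fun z => by
    rw [norm_mul, norm_mFourier_apply, mul_one]
    refine (norm_indicator_le_norm_self _ _).trans ?_
    simp) (t, x)
  rw [parabolicOp, Measure.volume_eq_prod, integral_prod _ (by rwa [Measure.volume_eq_prod] at hint),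
    duhamel, intervalIntegral.integral_of_le ht, integral_Ioc_eq_integral_Ioo,
    ← integral_const_mul, ← integral_complex_ofReal, ← integral_mul_const,
    ← integral_indicator measurableSet_Ioo]
  refine integral_congr_ae (Filter.Eventually.of_forall fun s => ?_)
  simp only
  by_cases hs : s ∈ Ioo 0 t
  swap
  · simp [causalKernel, indicator_of_notMem hs]
  simp only [causalKernel, indicator_of_mem hs]
  by_cases hsS : s ∈ S
  swap
  · simp [indicator_of_notMem hsS]
  have hr : 0 < parabolicRadius b ε t s := (Real.sqrt_pos.2 (Real.sqrt_pos.2 hε)).trans_le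
    (hb.sqrt_sqrt_le_radius hs.2.le)
  have h4 := hb.radius_pow_four hε hs.2.le
  simp only [indicator_of_mem hsS, Pi.one_apply, one_mul, mFourier_sub_torusMk]
  have e1 : ∀ y : EuclideanSpace ℝ (Fin d), scaledKernel m Φ (parabolicRadius b ε t s) y *
      (mFourier n x * mFourier (-n) (torusMk y.ofLp)) = mFourier n x *
        (scaledKernel m Φ (parabolicRadius b ε t s) y * mFourier (-n) (torusMk y.ofLp)) :=
    fun y => by ring
  simp only [e1]
  rw [integral_const_mul, hΦ _ hr, h4]
  have e2 : Real.exp (-((b t - b s + ε) * bilapSymbol n)) = Real.exp (-(ε * bilapSymbol n)) *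
      Real.exp (-(bilapSymbol n * (b t - b s))) := by
    rw [← Real.exp_add]
    congr 1
    ring
  rw [e2]
  push_cast
  ring

theorem parabolicOp_const_mul (m : ℕ) (Φ : EuclideanSpace ℝ (Fin d) → ℂ) (b : ℝ → ℝ) (ε : ℝ)
    (A : ℂ) (f : ℝ × UnitAddTorus (Fin d) → ℂ) (z : ℝ × UnitAddTorus (Fin d)) :
    parabolicOp m Φ b ε (fun y => A * f y) z = A * parabolicOp m Φ b ε f z := by
  rw [parabolicOp, parabolicOp, ← integral_const_mul]
  refine integral_congr_ae (Filter.Eventually.of_forall fun y => ?_)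
  simp only
  ring

theorem torusTrig_eq (n : Fin d → ℤ) (c : ℂ) (x : UnitAddTorus (Fin d)) :
    (torusTrig n c x : ℂ) =
      c / 2 * mFourier n x + starRingEnd ℂ c / 2 * mFourier (-n) x := by
  rw [UnitAddTorus.mFourier_neg, torusTrig, Complex.re_eq_add_conj, map_mul]
  ring

/-- The parabolic operator with the kernel `∂^α` of the heat kernel, on a product of an indicator
in time and a trigonometric function. -/
theorem parabolicOp_biharmonicProfile_torusTrig (hb : IsEllipticPrimitive lam b) (hε : 0 < ε)
    (hε1 : ε ≤ 1) {α : Fin d → ℕ} (hα : ∑ i, α i ≤ 4) {S : Set ℝ} (hS : MeasurableSet S)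
    (n : Fin d → ℤ) (c A : ℂ) {t : ℝ} (ht : 0 ≤ t) (x : UnitAddTorus (Fin d)) :
    parabolicOp (∑ i, α i) (biharmonicProfile α) b ε
      (fun z => A * (S.indicator 1 z.1 * (torusTrig n c z.2 : ℂ))) (t, x) =
      (Real.exp (-(ε * bilapSymbol n)) : ℝ) * (A * (duhamel b (bilapSymbol n) S t *
        (torusTrig n (derivSymbol α (fun i => (n i : ℝ)) * c) x : ℂ))) := by
  have hmeas : ∀ (k : Fin d → ℤ) (a : ℂ), Measurable fun z : ℝ × UnitAddTorus (Fin d) =>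
      a * (S.indicator (1 : ℝ → ℂ) z.1 * mFourier k z.2) := fun k a =>
    (((measurable_one.indicator hS).comp measurable_fst).mul
      ((mFourier k).continuous.measurable.comp measurable_snd)).const_mul a
  have hbd : ∀ (k : Fin d → ℤ) (a : ℂ) (z : ℝ × UnitAddTorus (Fin d)), ‖a‖ ≤ ‖c‖ →
      ‖a * (S.indicator (1 : ℝ → ℂ) z.1 * mFourier k z.2)‖ ≤ ‖c‖ := by
    intro k a z ha
    rw [norm_mul, norm_mul, norm_mFourier_apply, mul_one]
    refine (mul_le_of_le_one_right (norm_nonneg _) ?_).trans ha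
    refine (norm_indicator_le_norm_self _ _).trans ?_
    simp
  have hn2 : ‖c / 2‖ ≤ ‖c‖ := by
    rw [norm_div, RCLike.norm_ofNat]
    linarith [norm_nonneg c]
  have hn2' : ‖starRingEnd ℂ c / 2‖ ≤ ‖c‖ := by
    rw [norm_div, RCLike.norm_ofNat, RCLike.norm_conj]
    linarith [norm_nonneg c]
  have hΦ := hasParabolicSymbol_biharmonicProfile α
  -- The real part is split into the frequencies n and -n. Both have the same Duhamel factor and
  -- conjugate symbols, so the two images again add up to a real part.
  have hfun : (fun z : ℝ × UnitAddTorus (Fin d) =>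
      (S.indicator (1 : ℝ → ℂ) z.1 * (torusTrig n c z.2 : ℂ))) = fun z =>
      c / 2 * (S.indicator 1 z.1 * mFourier n z.2) +
        starRingEnd ℂ c / 2 * (S.indicator 1 z.1 * mFourier (-n) z.2) := by
    funext z
    rw [torusTrig_eq]
    ring
  rw [parabolicOp_const_mul, hfun, parabolicOp_add hb hε hε1 hα (biharmonicProfile α) (hmeas n _)
    (hmeas (-n) _) (B := ‖c‖) (fun z => hbd _ _ z hn2) (fun z => hbd _ _ z hn2'),
    parabolicOp_const_mul, parabolicOp_const_mul,
    parabolicOp_indicator_mul_mFourier hb hε hε1 hα hΦ hS n ht,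
    parabolicOp_indicator_mul_mFourier hb hε hε1 hα hΦ hS (-n) ht, derivSymbol_neg, bilapSymbol_neg,
    torusTrig_eq, map_mul]
  push_cast
  ring

end ParabolicTrig

/-! ### Fatou's lemma for mixed norms -/

section Fatou

/-- Fatou's lemma in the inner and in the outer integral, the power and the finite weight being
increasing and continuous in between. It removes ε from the uniform estimates. -/
theorem lintegral_rpow_lintegral_le_of_tendsto {α β : Type*} [MeasurableSpace α]
    [MeasurableSpace β] {μ : Measure α} {ν : Measure β} [SFinite ν] {q s : ℝ} (hq : 0 < q)
    (hs : 0 < s) {v : α → ℝ≥0∞} (hvm : Measurable v) (hv : ∀ᵐ t ∂μ, v t ≠ ⊤)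
    {G : ℕ → α × β → ℂ} (hG : ∀ j, Measurable (G j)) {U : α × β → ℂ}
    (hU : ∀ᵐ t ∂μ, ∀ x, Filter.Tendsto (fun j => G j (t, x)) Filter.atTop (nhds (U (t, x))))
    {A : ℝ≥0∞} (hA : ∀ j, ∫⁻ t, (∫⁻ x, ‖G j (t, x)‖ₑ ^ q ∂ν) ^ s * v t ∂μ ≤ A) :
    ∫⁻ t, (∫⁻ x, ‖U (t, x)‖ₑ ^ q ∂ν) ^ s * v t ∂μ ≤ A := by
  have hmi : ∀ j, Measurable fun t => ∫⁻ x, ‖G j (t, x)‖ₑ ^ q ∂ν := fun j =>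
    ((hG j).enorm.pow_const q).lintegral_prod_right'
  have hpt : ∀ᵐ t ∂μ, (∫⁻ x, ‖U (t, x)‖ₑ ^ q ∂ν) ^ s * v t ≤
      Filter.liminf (fun j => (∫⁻ x, ‖G j (t, x)‖ₑ ^ q ∂ν) ^ s * v t) Filter.atTop := by
    filter_upwards [hU, hv] with t ht htv
    have h1 : ∫⁻ x, ‖U (t, x)‖ₑ ^ q ∂ν ≤
        Filter.liminf (fun j => ∫⁻ x, ‖G j (t, x)‖ₑ ^ q ∂ν) Filter.atTop := by
      refine le_trans (le_of_eq ?_) (lintegral_liminf_le fun j =>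
        (((hG j).comp measurable_prodMk_left).enorm.pow_const q))
      refine lintegral_congr fun x => ?_
      exact ((((ENNReal.continuous_rpow_const (y := q)).tendsto _).comp
        ((continuous_enorm.tendsto _).comp (ht x))).liminf_eq).symm
    have hmono : Monotone fun y : ℝ≥0∞ => y ^ s * v t := fun y y' h =>
      mul_le_mul_left (ENNReal.rpow_le_rpow h hs.le) _
    have hcont : Continuous fun y : ℝ≥0∞ => y ^ s * v t :=
      (ENNReal.continuous_mul_const htv).comp ENNReal.continuous_rpow_const
    refine (hmono h1).trans (le_of_eq ?_)
    exact hmono.map_liminf_of_continuousAt _ hcont.continuousAt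
  refine (lintegral_mono_ae hpt).trans ((lintegral_liminf_le fun j =>
    ((hmi j).pow_const s).mul hvm).trans ?_)
  exact Filter.liminf_le_of_le (by isBoundedDefault) fun y hy => by
    obtain ⟨j, hj⟩ := hy.exists
    exact hj.trans (hA j)

end Fatou
open scoped SchwartzMap

/-! ### The evolution operator -/

section EvolutionOperator

/-- The weighted space `L^p(0,T,w;E)`. -/
abbrev TimeLp (E : Type*) [NormedAddCommGroup E] (p T : ℝ) (w : ℝ → ℝ) : Type _ :=
  Lp E (ENNReal.ofReal p) (weightedMeasure w T)

/-- The space `L^q(𝕋ᵈ)` with a real exponent. -/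
abbrev TorusLq (𝕜 : Type*) [RCLike 𝕜] (d : ℕ) (q : ℝ) : Type _ := TorusLp 𝕜 d (ENNReal.ofReal q)

/-- The space `W^{4,q}(𝕋ᵈ)` with a real exponent. -/
abbrev SobolevFour (𝕜 : Type*) [RCLike 𝕜] (d : ℕ) (q : ℝ) [Fact (2 < q)] : Type _ :=
  sobolevTorus 𝕜 d 4 (ENNReal.ofReal q)

variable {𝕜 : Type*} [RCLike 𝕜] {d : ℕ} {p q T lam : ℝ} [Fact (2 < p)] [Fact (2 < q)]
  {w a : ℝ → ℝ}

/-- The derivative `∂^α` as a bounded operator. -/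
noncomputable def sobolevDerivL (𝕜 : Type*) [RCLike 𝕜] (d : ℕ) (q : ℝ) [Fact (2 < q)]
    (α : MultiIndex d 4) : SobolevFour 𝕜 d q →L[𝕜] TorusLq 𝕜 d q :=
  (PiLp.proj (ENNReal.ofReal q) (fun _ : MultiIndex d 4 => TorusLq 𝕜 d q) α).comp
    (sobolevTorus 𝕜 d 4 (ENNReal.ofReal q)).subtypeL

theorem sobolevDerivL_apply (α : MultiIndex d 4) (u : SobolevFour 𝕜 d q) :
    sobolevDerivL 𝕜 d q α u = u.1 α := rfl

theorem sobolevDerivL_zero_apply (u : SobolevFour 𝕜 d q) :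
    sobolevDerivL 𝕜 d q (MultiIndex.zero d 4) u = sobolevTorus.toTorusLp u := rfl

/-- The bilaplacian as a bounded operator. -/
noncomputable def bilaplacianL (𝕜 : Type*) [RCLike 𝕜] (d : ℕ) (q : ℝ) [Fact (2 < q)] :
    SobolevFour 𝕜 d q →L[𝕜] TorusLq 𝕜 d q :=
  ∑ i : Fin d, ∑ j : Fin d, sobolevDerivL 𝕜 d q (MultiIndex.twoTwo i j)

theorem bilaplacianL_apply (u : SobolevFour 𝕜 d q) :
    bilaplacianL 𝕜 d q u = sobolevTorus.bilaplacian u := by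
  simp only [bilaplacianL, ContinuousLinearMap.sum_apply, sobolevDerivL_apply]
  rfl

/-- The function `u`, its derivatives forgotten. -/
noncomputable def timeToTorusLp (𝕜 : Type*) [RCLike 𝕜] (d : ℕ) (p q T : ℝ) [Fact (2 < p)]
    [Fact (2 < q)] (w : ℝ → ℝ) : TimeLp (SobolevFour 𝕜 d q) p T w →L[𝕜] TimeLp (TorusLq 𝕜 d q) p T w :=
  (sobolevDerivL 𝕜 d q (MultiIndex.zero d 4)).compLpL (ENNReal.ofReal p) (weightedMeasure w T)

theorem coeFn_timeToTorusLp (hw : IsMuckenhoupt (p / 2) w) (u : TimeLp (SobolevFour 𝕜 d q) p T w) :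
    ∀ᵐ t ∂volume.restrict (Ioo 0 T),
      timeToTorusLp 𝕜 d p q T w u t = sobolevTorus.toTorusLp (u t) :=
  (hw.absolutelyContinuous T).ae_le
    ((sobolevDerivL 𝕜 d q (MultiIndex.zero d 4)).coeFn_compLpL u)

theorem memLp_smul_bilaplacian (ha : Measurable a) (hab : ∀ t, |a t| ≤ lam)
    (u : TimeLp (SobolevFour 𝕜 d q) p T w) :
    MemLp (fun t => (a t : 𝕜) • bilaplacianL 𝕜 d q (u t)) (ENNReal.ofReal p)
      (weightedMeasure w T) := by
  refine (Lp.memLp u).of_le_mul (c := lam * ‖bilaplacianL 𝕜 d q‖) ?_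
    (Filter.Eventually.of_forall fun t => ?_)
  · exact ((RCLike.measurable_ofReal (𝕜 := 𝕜)).comp ha).aestronglyMeasurable.smul
      ((bilaplacianL 𝕜 d q).continuous.comp_aestronglyMeasurable (Lp.aestronglyMeasurable u))
  · rw [norm_smul, RCLike.norm_ofReal, mul_assoc]
    exact mul_le_mul (hab t) ((bilaplacianL 𝕜 d q).le_opNorm _) (norm_nonneg _)
      ((abs_nonneg _).trans (hab t))

/-- The operator `u ↦ a Δ² u`. -/
noncomputable def timeBilaplacian (ha : Measurable a) (hab : ∀ t, |a t| ≤ lam) :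
    TimeLp (SobolevFour 𝕜 d q) p T w →+ TimeLp (TorusLq 𝕜 d q) p T w :=
  AddMonoidHom.mk' (fun u => (memLp_smul_bilaplacian ha hab u).toLp _) fun u v => by
    refine Lp.ext ?_
    filter_upwards [(memLp_smul_bilaplacian ha hab (u + v)).coeFn_toLp,
      (memLp_smul_bilaplacian ha hab u).coeFn_toLp, (memLp_smul_bilaplacian ha hab v).coeFn_toLp,
      Lp.coeFn_add u v, Lp.coeFn_add ((memLp_smul_bilaplacian ha hab u).toLp _)
        ((memLp_smul_bilaplacian ha hab v).toLp _)] with t h1 h2 h3 h4 h5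
    rw [h1, h5, Pi.add_apply, h2, h3, h4, Pi.add_apply, map_add, smul_add]

theorem coeFn_timeBilaplacian (ha : Measurable a) (hab : ∀ t, |a t| ≤ lam)
    (u : TimeLp (SobolevFour 𝕜 d q) p T w) :
    timeBilaplacian ha hab u =ᵐ[weightedMeasure w T]
      fun t => (a t : 𝕜) • sobolevTorus.bilaplacian (u t) :=
  (memLp_smul_bilaplacian ha hab u).coeFn_toLp.trans
    (Filter.Eventually.of_forall fun t => by simp only [bilaplacianL_apply])

theorem norm_timeBilaplacian_le (ha : Measurable a) (hab : ∀ t, |a t| ≤ lam)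
    (u : TimeLp (SobolevFour 𝕜 d q) p T w) :
    ‖timeBilaplacian ha hab u‖ ≤ lam * ‖bilaplacianL 𝕜 d q‖ * ‖u‖ := by
  refine Lp.norm_le_mul_norm_of_ae_le_mul ?_
  filter_upwards [coeFn_timeBilaplacian ha hab u] with t ht
  rw [ht, ← bilaplacianL_apply, norm_smul, RCLike.norm_ofReal, mul_assoc]
  exact mul_le_mul (hab t) ((bilaplacianL 𝕜 d q).le_opNorm _) (norm_nonneg _)
    ((abs_nonneg _).trans (hab t))

/-- The pairs `(u, u')` such that `u'` is the weak time derivative of `u` and `u(0) = 0`. -/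
def evolutionGroup (𝕜 : Type*) [RCLike 𝕜] (d : ℕ) (q : ℝ) [Fact (2 < q)]
    (hw : IsMuckenhoupt (p / 2) w) (hT : 0 < T) :
    AddSubgroup (TimeLp (SobolevFour 𝕜 d q) p T w × TimeLp (TorusLq 𝕜 d q) p T w) where
  -- Test functions need not vanish at time zero, so the weak derivative and the condition u(0) = 0
  -- are encoded together. Each condition is continuous in the pair, so the group is closed.
  carrier := {z | ∀ φ : ℝ → ℝ, ContDiff ℝ ∞ φ → φ T = 0 →
    ∫ t in Ioo 0 T, deriv φ t • timeToTorusLp 𝕜 d p q T w z.1 t = -∫ t in Ioo 0 T, φ t • z.2 t}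
  zero_mem' := by
    intro φ hφ _
    obtain ⟨L, -, hL⟩ := hw.exists_addMonoidHom_setIntegral_smul (TorusLq 𝕜 d q) Fact.out hT
      (hφ.continuous_deriv (by simp))
    obtain ⟨L', -, hL'⟩ := hw.exists_addMonoidHom_setIntegral_smul (TorusLq 𝕜 d q) Fact.out hT
      hφ.continuous
    rw [← hL, ← hL', Prod.fst_zero, Prod.snd_zero, map_zero, map_zero, map_zero, neg_zero]
  add_mem' := by
    intro z z' hz hz' φ hφ hφT
    obtain ⟨L, -, hL⟩ := hw.exists_addMonoidHom_setIntegral_smul (TorusLq 𝕜 d q) Fact.out hT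
      (hφ.continuous_deriv (by simp))
    obtain ⟨L', -, hL'⟩ := hw.exists_addMonoidHom_setIntegral_smul (TorusLq 𝕜 d q) Fact.out hT
      hφ.continuous
    have h1 := hz φ hφ hφT
    have h2 := hz' φ hφ hφT
    rw [← hL, ← hL'] at h1 h2 ⊢
    rw [Prod.fst_add, Prod.snd_add, map_add, map_add, map_add, h1, h2, neg_add]
  neg_mem' := by
    intro z hz φ hφ hφT
    obtain ⟨L, -, hL⟩ := hw.exists_addMonoidHom_setIntegral_smul (TorusLq 𝕜 d q) Fact.out hT
      (hφ.continuous_deriv (by simp))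
    obtain ⟨L', -, hL'⟩ := hw.exists_addMonoidHom_setIntegral_smul (TorusLq 𝕜 d q) Fact.out hT
      hφ.continuous
    have h1 := hz φ hφ hφT
    rw [← hL, ← hL'] at h1 ⊢
    rw [Prod.fst_neg, Prod.snd_neg, map_neg, map_neg, map_neg, h1]

theorem isClosed_evolutionGroup (hw : IsMuckenhoupt (p / 2) w) (hT : 0 < T) :
    IsClosed (evolutionGroup 𝕜 d q hw hT :
      Set (TimeLp (SobolevFour 𝕜 d q) p T w × TimeLp (TorusLq 𝕜 d q) p T w)) := by
  have : (evolutionGroup 𝕜 d q hw hT :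
      Set (TimeLp (SobolevFour 𝕜 d q) p T w × TimeLp (TorusLq 𝕜 d q) p T w)) =
      ⋂ (φ : ℝ → ℝ) (_ : ContDiff ℝ ∞ φ) (_ : φ T = 0),
        {z | ∫ t in Ioo 0 T, deriv φ t • timeToTorusLp 𝕜 d p q T w z.1 t =
          -∫ t in Ioo 0 T, φ t • z.2 t} := by
    ext z
    simp only [mem_iInter]
    rfl
  rw [this]
  refine isClosed_iInter fun φ => isClosed_iInter fun hφ => isClosed_iInter fun _ => ?_
  obtain ⟨L, hLc, hL⟩ := hw.exists_addMonoidHom_setIntegral_smul (TorusLq 𝕜 d q) Fact.out hT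
    (hφ.continuous_deriv (by simp))
  obtain ⟨L', hLc', hL'⟩ := hw.exists_addMonoidHom_setIntegral_smul (TorusLq 𝕜 d q) Fact.out hT
    hφ.continuous
  simp only [← hL, ← hL']
  exact isClosed_eq (hLc.comp ((timeToTorusLp 𝕜 d p q T w).continuous.comp continuous_fst))
    (hLc'.comp continuous_snd).neg

/-- The operator `(u, u') ↦ u' + a Δ² u` on functions with `u(0) = 0`. -/
noncomputable def evolutionHom (𝕜 : Type*) [RCLike 𝕜] (d : ℕ) (q : ℝ) [Fact (2 < q)]
    (hw : IsMuckenhoupt (p / 2) w) (hT : 0 < T) (ha : Measurable a) (hab : ∀ t, |a t| ≤ lam) :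
    NormedAddGroupHom (evolutionGroup 𝕜 d q hw hT) (TimeLp (TorusLq 𝕜 d q) p T w) :=
  AddMonoidHom.mkNormedAddGroupHom
    (AddMonoidHom.mk' (fun z => z.1.2 + timeBilaplacian ha hab z.1.1) fun z z' => by
      simp only [AddSubgroup.coe_add, Prod.snd_add, Prod.fst_add, map_add]
      abel)
    (1 + lam * ‖bilaplacianL 𝕜 d q‖) fun z => by
      refine (norm_add_le _ _).trans ?_
      have h1 : ‖z.1.2‖ ≤ ‖z‖ := norm_snd_le z.1
      have h2 : ‖z.1.1‖ ≤ ‖z‖ := norm_fst_le z.1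
      have hl : 0 ≤ lam := (abs_nonneg _).trans (hab 0)
      rw [add_mul, one_mul]
      exact add_le_add h1 ((norm_timeBilaplacian_le ha hab _).trans (by gcongr))

theorem evolutionHom_apply (hw : IsMuckenhoupt (p / 2) w) (hT : 0 < T) (ha : Measurable a)
    (hab : ∀ t, |a t| ≤ lam) (z : evolutionGroup 𝕜 d q hw hT) :
    evolutionHom 𝕜 d q hw hT ha hab z = z.1.2 + timeBilaplacian ha hab z.1.1 := rfl

end EvolutionOperator
open scoped SchwartzMap

/-! ### The a priori estimate -/

section APrioriEstimate

variable {𝕜 : Type*} [RCLike 𝕜] {d : ℕ} {p q T lam : ℝ} [Fact (2 < p)] [Fact (2 < q)]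
  {w a b : ℝ → ℝ}

theorem enorm_rclike_map_complex (z : 𝕜) : ‖RCLike.map 𝕜 ℂ z‖ₑ = ‖z‖ₑ := by
  rw [← ofReal_norm, ← ofReal_norm, norm_rclike_map_complex]

theorem enorm_torusLq_rpow (g : TorusLq 𝕜 d q) (p : ℝ) :
    ‖g‖ₑ ^ p = (∫⁻ x, ‖g x‖ₑ ^ q) ^ (p / q) := by
  have hq : 0 < q := by linarith [(Fact.out : 2 < q)]
  rw [Lp.enorm_def, eLpNorm_eq_lintegral_rpow_enorm_toReal (ENNReal.ofReal_pos.2 hq).ne'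
    ENNReal.ofReal_ne_top, ENNReal.toReal_ofReal hq.le, ← ENNReal.rpow_mul]
  congr 1
  field_simp

theorem norm_sobolevFour_le (u : SobolevFour 𝕜 d q) : ‖u‖ₑ ≤ ∑ α, ‖u.1 α‖ₑ := by
  classical
  have h : u.1 = ∑ α, PiLp.single (ENNReal.ofReal q) α (u.1 α) := by
    ext1 β
    rw [WithLp.ofLp_sum, Finset.sum_apply, Finset.sum_eq_single β (fun α _ hα => by
      simp [PiLp.single_apply, hα.symm]) (fun h => absurd (Finset.mem_univ β) h)]
    simp [PiLp.single_apply]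
  change ‖u.1‖ₑ ≤ _
  conv_lhs => rw [h]
  refine (enorm_sum_le _ _).trans (Finset.sum_le_sum fun α _ => le_of_eq ?_)
  rw [← ofReal_norm, ← ofReal_norm, PiLp.norm_single]

/-- The function `f` has a bounded representative supported in `(0,T)`, and the derivatives of `u`
are the limits of the regularized kernels applied to this representative. -/
def HasKernelRep (b : ℝ → ℝ) (f : TimeLp (TorusLq 𝕜 d q) p T w)
    (u : TimeLp (SobolevFour 𝕜 d q) p T w) : Prop :=
  ∃ F : ℝ × UnitAddTorus (Fin d) → ℂ, Measurable F ∧ (∃ B, ∀ z, ‖F z‖ ≤ B) ∧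
    (∀ z : ℝ × UnitAddTorus (Fin d), z.1 ∉ Ioo 0 T → F z = 0) ∧
    (∀ᵐ t ∂volume.restrict (Ioo 0 T), ∀ᵐ x, F (t, x) = RCLike.map 𝕜 ℂ (f t x)) ∧
    ∀ α : MultiIndex d 4, ∃ U : ℝ × UnitAddTorus (Fin d) → ℂ,
      (∀ᵐ t ∂volume.restrict (Ioo 0 T), ∀ᵐ x, U (t, x) = RCLike.map 𝕜 ℂ ((u t).1 α x)) ∧
      ∀ z : ℝ × UnitAddTorus (Fin d), z.1 ∈ Ioo 0 T → Filter.Tendsto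
        (fun j : ℕ => parabolicOp (∑ i, α.1 i) (biharmonicProfile α.1) b (1 / ((j : ℝ) + 1)) F z)
        Filter.atTop (nhds (U z))

theorem one_div_succ_pos_le_one (j : ℕ) : 0 < 1 / ((j : ℝ) + 1) ∧ 1 / ((j : ℝ) + 1) ≤ 1 := by
  have : (1 : ℝ) ≤ (j : ℝ) + 1 := by linarith [Nat.cast_nonneg (α := ℝ) j]
  exact ⟨by positivity, (div_le_one (by linarith)).2 this⟩

theorem HasKernelRep.add (hw : IsMuckenhoupt (p / 2) w) (hb : IsEllipticPrimitive lam b)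
    {f f' : TimeLp (TorusLq 𝕜 d q) p T w} {u u' : TimeLp (SobolevFour 𝕜 d q) p T w}
    (h : HasKernelRep b f u) (h' : HasKernelRep b f' u') : HasKernelRep b (f + f') (u + u') := by
  obtain ⟨F, hF, ⟨B, hB⟩, hsupp, hrep, hU⟩ := h
  obtain ⟨F', hF', ⟨B', hB'⟩, hsupp', hrep', hU'⟩ := h'
  refine ⟨fun z => F z + F' z, hF.add hF', ⟨B + B', fun z => (norm_add_le _ _).trans
    (add_le_add (hB z) (hB' z))⟩, fun z hz => by simp only [hsupp z hz, hsupp' z hz, add_zero], ?_, fun α => ?_⟩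
  · filter_upwards [hrep, hrep', (hw.absolutelyContinuous T).ae_le (Lp.coeFn_add f f')]
      with t h1 h2 h3
    rw [h3]
    filter_upwards [h1, h2, Lp.coeFn_add (f t) (f' t)] with x h4 h5 h6
    rw [h4, h5, Pi.add_apply, h6, Pi.add_apply, map_add]
  · obtain ⟨U, hU1, hU2⟩ := hU α
    obtain ⟨U', hU1', hU2'⟩ := hU' α
    refine ⟨fun z => U z + U' z, ?_, fun z hz => ?_⟩
    · filter_upwards [hU1, hU1', (hw.absolutelyContinuous T).ae_le (Lp.coeFn_add u u')]
        with t h1 h2 h3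
      rw [h3]
      filter_upwards [h1, h2, Lp.coeFn_add ((u t).1 α) ((u' t).1 α)] with x h4 h5 h6
      rw [h4, h5, ← map_add, ← Pi.add_apply (f := (u t).1 α), ← h6]
      rfl
    · refine ((hU2 z hz).add (hU2' z hz)).congr fun j => ?_
      obtain ⟨hj0, hj1⟩ := one_div_succ_pos_le_one j
      exact (parabolicOp_add hb hj0 hj1 α.2 (biharmonicProfile α.1) hF hF' (B := max B B')
        (fun z => (hB z).trans (le_max_left _ _)) (fun z => (hB' z).trans (le_max_right _ _)) z).symm

/-- The a priori estimate. The weighted bound for the regularized operator is applied to each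
derivative of order at most four, with f extended by zero to [0, ⌈T⌉); its constant does not depend
on ε, and Fatou's lemma gives the limit. -/
theorem exists_enorm_rpow_le_of_hasKernelRep (𝕜 : Type*) [RCLike 𝕜] (hd : 1 ≤ d) (lam : ℝ)
    (hlam : 1 ≤ lam) (T p q : ℝ) [Fact (2 < p)] [Fact (2 < q)] (K : ℝ≥0) :
    ∃ C : ℝ≥0, ∀ (b w : ℝ → ℝ), IsEllipticPrimitive lam b → IsMuckenhoupt (p / 2) w →
      apCharacteristic (p / 2) w ≤ K → ∀ (f : TimeLp (TorusLq 𝕜 d q) p T w)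
        (u : TimeLp (SobolevFour 𝕜 d q) p T w), HasKernelRep b f u → ‖u‖ₑ ^ p ≤ C * ‖f‖ₑ ^ p := by
  have hp : 2 < p := Fact.out
  have hq : 2 < q := Fact.out
  set N := ⌈T⌉₊ with hN
  obtain ⟨n, hn⟩ := pow_unbounded_of_one_lt (3 * (N : ℝ)) (one_lt_two (α := ℝ))
  have hα := fun α : MultiIndex d 4 => exists_lintegral_rpow_lintegral_parabolicOp_le hd lam hlam
    hn.le α.2 (biharmonicProfile α.1) (hasParabolicSymbol_biharmonicProfile α.1)
    (norm_derivSymbol_le α.1 α.2) hp hq (K := K) ENNReal.coe_ne_top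
  choose C hC using hα
  -- The power of the cardinality comes from convexity, when the p-th power of the sum over the
  -- multi-indices is split.
  refine ⟨(Fintype.card (MultiIndex d 4) : ℝ≥0) ^ (p - 1) * ∑ α, C α,
    fun b w hb hw hK f u hrep => ?_⟩
  obtain ⟨F, hF, ⟨B, hB⟩, hsupp, hFf, hU⟩ := hrep
  obtain ⟨v, hvm, hvw, hv0, hcell⟩ := hw.exists_cellAp (by linarith) hK
  have hIN : Ioo 0 T ⊆ Ico (0 : ℝ) N := fun t ht => ⟨ht.1.le, ht.2.trans_le (Nat.le_ceil T)⟩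
  have hRHS : ∫⁻ t in Ico (0 : ℝ) N, (∫⁻ x, ‖F (t, x)‖ₑ ^ q) ^ (p / q) * v t = ‖f‖ₑ ^ p := by
    rw [hw.enorm_rpow_eq (by linarith)]
    have e1 : ∫⁻ t in Ico (0 : ℝ) N, (∫⁻ x, ‖F (t, x)‖ₑ ^ q) ^ (p / q) * v t =
        ∫⁻ t in Ioo 0 T, (∫⁻ x, ‖F (t, x)‖ₑ ^ q) ^ (p / q) * v t := by
      rw [← lintegral_indicator measurableSet_Ico, ← lintegral_indicator measurableSet_Ioo]
      refine lintegral_congr fun t => ?_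
      by_cases ht : t ∈ Ioo 0 T
      · rw [indicator_of_mem ht, indicator_of_mem (hIN ht)]
      · have h0 : ∀ x, F (t, x) = 0 := fun x => hsupp (t, x) ht
        rw [indicator_of_notMem ht]
        refine indicator_apply_eq_zero.2 fun _ => ?_
        simp only [h0, enorm_zero]
        rw [ENNReal.zero_rpow_of_pos (by linarith), lintegral_zero, ENNReal.zero_rpow_of_pos
          (by apply div_pos <;> linarith), zero_mul]
    rw [e1]
    refine lintegral_congr_ae ?_
    filter_upwards [hFf, ae_restrict_of_ae hvw] with t ht htv
    rw [htv, enorm_torusLq_rpow]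
    congr 2
    refine lintegral_congr_ae ?_
    filter_upwards [ht] with x hx
    rw [hx, enorm_rclike_map_complex]
  have hcomp : ∀ α, ∫⁻ t in Ioo 0 T, ‖(u t).1 α‖ₑ ^ p * ENNReal.ofReal (w t) ≤
      C α * ‖f‖ₑ ^ p := by
    intro α
    obtain ⟨U, hU1, hU2⟩ := hU α
    have e1 : ∫⁻ t in Ioo 0 T, ‖(u t).1 α‖ₑ ^ p * ENNReal.ofReal (w t) =
        ∫⁻ t in Ioo 0 T, (∫⁻ x, ‖U (t, x)‖ₑ ^ q) ^ (p / q) * v t := by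
      refine lintegral_congr_ae ?_
      filter_upwards [hU1, ae_restrict_of_ae hvw] with t ht htv
      rw [htv, enorm_torusLq_rpow]
      congr 2
      refine lintegral_congr_ae ?_
      filter_upwards [ht] with x hx
      rw [hx, enorm_rclike_map_complex]
    rw [e1]
    refine lintegral_rpow_lintegral_le_of_tendsto (by linarith) (by apply div_pos <;> linarith) hvm
      (ae_restrict_of_ae (hv0.mono fun _ h => h.2.ne))
      (G := fun j => parabolicOp (∑ i, α.1 i) (biharmonicProfile α.1) b (1 / ((j : ℝ) + 1)) F)
      (fun j => (stronglyMeasurable_parabolicOp hb _ hF).measurable)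
      ((ae_restrict_iff' measurableSet_Ioo).2 (Filter.Eventually.of_forall fun t ht x =>
        hU2 (t, x) ht)) fun j => ?_
    obtain ⟨hj0, hj1⟩ := one_div_succ_pos_le_one j
    refine (lintegral_mono_set hIN).trans ?_
    rw [← hRHS]
    exact hC α b _ hb hj0 hj1 F hF B hB (fun z hz => hsupp z fun h => hz (hIN h)) v hvm hv0 (hcell n)
  have hum : ∀ α, AEMeasurable (fun t => ‖(u t).1 α‖ₑ ^ p * ENNReal.ofReal (w t))
      (volume.restrict (Ioo 0 T)) := fun α =>
    ((((sobolevDerivL 𝕜 d q α).continuous.comp_aestronglyMeasurable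
      (hw.aestronglyMeasurable_coeFn u)).enorm).pow_const p).mul hw.aemeasurable.restrict
  rw [hw.enorm_rpow_eq (by linarith)]
  calc ∫⁻ t in Ioo 0 T, ‖u t‖ₑ ^ p * ENNReal.ofReal (w t)
      ≤ ∫⁻ t in Ioo 0 T, (Fintype.card (MultiIndex d 4) : ℝ≥0∞) ^ (p - 1) *
          ∑ α, ‖(u t).1 α‖ₑ ^ p * ENNReal.ofReal (w t) := by
        refine lintegral_mono fun t => ?_
        rw [← Finset.sum_mul, ← mul_assoc]
        refine mul_le_mul_left ((ENNReal.rpow_le_rpow (norm_sobolevFour_le (u t))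
          (by linarith)).trans ?_) _
        exact ENNReal.rpow_sum_le_const_mul_sum_rpow _ _ (by linarith)
    _ = (Fintype.card (MultiIndex d 4) : ℝ≥0∞) ^ (p - 1) *
          ∑ α, ∫⁻ t in Ioo 0 T, ‖(u t).1 α‖ₑ ^ p * ENNReal.ofReal (w t) := by
        rw [lintegral_const_mul'' _ (Finset.aemeasurable_fun_sum _ fun α _ => hum α),
          lintegral_finset_sum' _ fun α _ => hum α]
    _ ≤ (Fintype.card (MultiIndex d 4) : ℝ≥0∞) ^ (p - 1) * ∑ α, C α * ‖f‖ₑ ^ p := by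
        gcongr with α
        exact hcomp α
    _ = _ := by
        rw [← Finset.sum_mul, ← mul_assoc]
        push_cast
        rw [ENNReal.coe_rpow_of_nonneg _ (by linarith)]
        push_cast
        rfl

end APrioriEstimate
open scoped SchwartzMap

/-! ### Existence of solutions -/

section Existence

variable {𝕜 : Type*} [RCLike 𝕜] {d : ℕ} {p q T lam : ℝ} [Fact (2 < p)] [Fact (2 < q)]
  {w a b : ℝ → ℝ}

theorem HasKernelRep.neg (hw : IsMuckenhoupt (p / 2) w) {f : TimeLp (TorusLq 𝕜 d q) p T w}
    {u : TimeLp (SobolevFour 𝕜 d q) p T w} (h : HasKernelRep b f u) : HasKernelRep b (-f) (-u) := by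
  obtain ⟨F, hF, ⟨B, hB⟩, hsupp, hrep, hU⟩ := h
  refine ⟨fun z => -1 * F z, hF.const_mul _, ⟨B, fun z => by simpa using hB z⟩,
    fun z hz => by simp only [hsupp z hz, mul_zero], ?_, fun α => ?_⟩
  · filter_upwards [hrep, (hw.absolutelyContinuous T).ae_le (Lp.coeFn_neg f)] with t h1 h2
    rw [h2]
    filter_upwards [h1, Lp.coeFn_neg (f t)] with x h3 h4
    rw [h3, Pi.neg_apply, h4, Pi.neg_apply, map_neg, neg_one_mul]
  · obtain ⟨U, hU1, hU2⟩ := hU α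
    refine ⟨fun z => -1 * U z, ?_, fun z hz => ?_⟩
    · filter_upwards [hU1, (hw.absolutelyContinuous T).ae_le (Lp.coeFn_neg u)] with t h1 h2
      rw [h2]
      filter_upwards [h1, Lp.coeFn_neg ((u t).1 α)] with x h3 h4
      rw [h3, neg_one_mul, ← map_neg, ← Pi.neg_apply, ← h4]
      rfl
    · simp only [parabolicOp_const_mul]
      exact (hU2 z hz).const_mul _

theorem IsMuckenhoupt.memLp_of_bound_on {E : Type*} [NormedAddCommGroup E] {r : ℝ}
    (hw : IsMuckenhoupt r w) {f : ℝ → E} (hf : AEStronglyMeasurable f) {M : ℝ}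
    (hM : ∀ t ∈ Ioo 0 T, ‖f t‖ ≤ M) (P : ℝ≥0∞) : MemLp f P (weightedMeasure w T) := by
  have := hw.isFiniteMeasure T
  have hac := weightedMeasure_absolutelyContinuous w T
  exact MemLp.of_bound (hf.restrict.mono_ac hac) M
    (hac.ae_le ((ae_restrict_iff' measurableSet_Ioo).2 (Filter.Eventually.of_forall hM)))

/-- The solution with the right-hand side `1_S(t) Re (c eₙ) z`. -/
theorem exists_solution_of_indicator (hw : IsMuckenhoupt (p / 2) w) (hT : 0 < T)
    (ha : Measurable a) (hab : ∀ t, |a t| ≤ lam) (hb : ∀ t, b t = ∫ s in (0 : ℝ)..t, a s)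
    (hbl : IsEllipticPrimitive lam b) {S : Set ℝ} (hS : MeasurableSet S)
    (hμS : weightedMeasure w T S ≠ ⊤) (n : Fin d → ℤ) (c : ℂ) (z : 𝕜) :
    ∃ y : evolutionGroup 𝕜 d q hw hT, evolutionHom 𝕜 d q hw hT ha hab y =
        indicatorConstLp (ENNReal.ofReal p) hS hμS (torusTrigLp (ENNReal.ofReal q) n c z) ∧
      HasKernelRep b (indicatorConstLp (ENNReal.ofReal p) hS hμS
        (torusTrigLp (ENNReal.ofReal q) n c z)) y.1.1 := by
  set κ := bilapSymbol n with hκ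
  set g : TorusLq 𝕜 d q := torusTrigLp (ENNReal.ofReal q) n c z with hg
  set S' := S ∩ Ioo 0 T with hS'
  have hS'm : MeasurableSet S' := hS.inter measurableSet_Ioo
  -- Separation of variables: u = θ(t) Re(c eₙ) z, where θ' + κ a θ is the indicator of S' and θ(0)
  -- = 0. The function η below is the derivative of θ.
  set θ := duhamel b κ S' with hθ
  have hθc : Continuous θ := continuous_duhamel hbl.continuous κ hS'm
  obtain ⟨M, hM⟩ := (isCompact_Icc (a := (0 : ℝ)) (b := T)).exists_bound_of_continuousOn
    hθc.continuousOn
  set η : ℝ → ℝ := fun t => S'.indicator (fun _ => 1) t - κ * a t * θ t with hη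
  have hηm : Measurable η :=
    (measurable_const.indicator hS'm).sub ((ha.const_mul κ).mul hθc.measurable)
  have hηM : ∀ t ∈ Ioo 0 T, ‖η t‖ ≤ 1 + κ * lam * M := by
    intro t ht
    refine (norm_sub_le _ _).trans (add_le_add ?_ ?_)
    · refine (norm_indicator_le_norm_self _ _).trans ?_
      simp
    · rw [norm_mul, norm_mul, Real.norm_of_nonneg (bilapSymbol_nonneg n)]
      have := hM t (Ioo_subset_Icc_self ht)
      have := hab t
      have hκ0 := bilapSymbol_nonneg n
      have : 0 ≤ lam := (abs_nonneg _).trans (hab 0)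
      rw [Real.norm_eq_abs (a t)]
      gcongr
  have hofReal : ∀ {h : ℝ → ℝ}, Measurable h → AEStronglyMeasurable (fun t => (h t : 𝕜)) volume :=
    fun hh => ((RCLike.measurable_ofReal (𝕜 := 𝕜)).comp hh).aestronglyMeasurable
  have hum : MemLp (fun t => (θ t : 𝕜) • (torusTrigSobolev 4 (ENNReal.ofReal q) n c z :
      SobolevFour 𝕜 d q)) (ENNReal.ofReal p) (weightedMeasure w T) :=
    hw.memLp_of_bound_on ((hofReal hθc.measurable).smul aestronglyMeasurable_const)
      (M := M * ‖(torusTrigSobolev 4 (ENNReal.ofReal q) n c z : SobolevFour 𝕜 d q)‖) (fun t ht => by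
      rw [Pi.smul_apply', norm_smul, RCLike.norm_ofReal]
      exact mul_le_mul_of_nonneg_right (hM t (Ioo_subset_Icc_self ht)) (norm_nonneg _)) _
  have hum' : MemLp (fun t => η t • g) (ENNReal.ofReal p) (weightedMeasure w T) :=
    hw.memLp_of_bound_on (hηm.aestronglyMeasurable.smul aestronglyMeasurable_const)
      (M := (1 + κ * lam * M) * ‖g‖) (fun t ht => by
      rw [Pi.smul_apply', norm_smul]
      exact mul_le_mul_of_nonneg_right (hηM t ht) (norm_nonneg _)) _
  have hac := hw.absolutelyContinuous T
  have hue := hac.ae_le hum.coeFn_toLp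
  have hue' := hac.ae_le hum'.coeFn_toLp
  have hηi : IntegrableOn (fun t => η t • g) (Ioo 0 T) := by
    refine Measure.integrableOn_of_bounded (M := (1 + κ * lam * M) * ‖g‖)
      (measure_Ioo_lt_top.ne) (hηm.aestronglyMeasurable.smul aestronglyMeasurable_const) ?_
    refine (ae_restrict_iff' measurableSet_Ioo).2 (Filter.Eventually.of_forall fun t ht => ?_)
    rw [norm_smul]
    exact mul_le_mul_of_nonneg_right (hηM t ht) (norm_nonneg _)
  have hmem : (hum.toLp _, hum'.toLp _) ∈ evolutionGroup 𝕜 d q hw hT := by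
    intro φ hφ hφT
    have h1 := setIntegral_deriv_smul_primitive hηi hφ hφT
    refine Eq.trans (integral_congr_ae ?_) (h1.trans (congrArg _ (integral_congr_ae ?_)))
    · filter_upwards [coeFn_timeToTorusLp hw (hum.toLp _), hue] with t h2 h3
      rw [h2, h3, intervalIntegral.integral_smul_const, ← duhamel_eq_integral ha hab hb κ hS'm t,
        ← sobolevDerivL_zero_apply, map_smul, sobolevDerivL_zero_apply, toTorusLp_torusTrigSobolev,
        ← RCLike.real_smul_eq_coe_smul (K := 𝕜)]
    · filter_upwards [hue'] with t h2
      rw [h2]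
  have hind := hac.ae_le (indicatorConstLp_coeFn (p := ENNReal.ofReal p) (hs := hS) (hμs := hμS)
    (c := g))
  have hSS' : ∀ t ∈ Ioo 0 T, S.indicator (fun _ => g) t = S'.indicator (fun _ => (1 : ℝ)) t • g := by
    intro t ht
    by_cases htS : t ∈ S
    · rw [indicator_of_mem htS, indicator_of_mem (show t ∈ S' from ⟨htS, ht⟩), one_smul]
    · rw [indicator_of_notMem htS, indicator_of_notMem (fun h => htS h.1), zero_smul]
  refine ⟨⟨_, hmem⟩, ?_, ?_⟩
  · rw [evolutionHom_apply]
    refine Lp.ext ?_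
    filter_upwards [Lp.coeFn_add (hum'.toLp _) (timeBilaplacian ha hab (hum.toLp _)),
      coeFn_timeBilaplacian ha hab (hum.toLp _), hum.coeFn_toLp, hum'.coeFn_toLp,
      indicatorConstLp_coeFn (p := ENNReal.ofReal p) (hs := hS) (hμs := hμS) (c := g),
      (weightedMeasure_absolutelyContinuous w T).ae_le (ae_restrict_mem measurableSet_Ioo)]
      with t h1 h2 h3 h4 h5 ht
    rw [h1, Pi.add_apply, h2, h3, h4, h5, hSS' t ht, ← bilaplacianL_apply, map_smul,
      bilaplacianL_apply, bilaplacian_torusTrigSobolev, ← hg, ← hκ]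
    simp only [← RCLike.real_smul_eq_coe_smul (K := 𝕜), smul_smul, ← add_smul, hη]
    congr 1
    ring
  · have hind1 : ∀ t, ‖(S'.indicator 1 t : ℂ)‖ ≤ 1 := fun t =>
      (norm_indicator_le_norm_self _ _).trans (by simp)
    refine ⟨fun y => RCLike.map 𝕜 ℂ z * (S'.indicator 1 y.1 * (torusTrig n c y.2 : ℂ)), ?_,
      ⟨‖z‖ * ‖c‖, fun y => ?_⟩, fun y hy => ?_, ?_, fun α => ?_⟩
    · exact (((measurable_one.indicator hS'm).comp measurable_fst).mul
        (Complex.measurable_ofReal.comp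
          ((continuous_torusTrig n c).measurable.comp measurable_snd))).const_mul _
    · rw [norm_mul, norm_mul, norm_rclike_map_complex]
      refine mul_le_mul_of_nonneg_left ?_ (norm_nonneg _)
      refine (mul_le_of_le_one_left (norm_nonneg _) (hind1 _)).trans ?_
      rw [Complex.norm_real]
      refine (Complex.abs_re_le_norm _).trans ?_
      rw [norm_mul, norm_mFourier_apply, mul_one]
    · simp only [indicator_of_notMem (fun h : y.1 ∈ S' => hy h.2), zero_mul, mul_zero]
    · filter_upwards [hind, ae_restrict_mem measurableSet_Ioo] with t h1 ht
      rw [h1]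
      by_cases htS : t ∈ S
      · rw [indicator_of_mem htS, indicator_of_mem (show t ∈ S' from ⟨htS, ht⟩)]
        filter_upwards [coeFn_torusTrigLp (q := ENNReal.ofReal q) n c z] with x hx
        rw [hg, hx, map_smul, Complex.real_smul, Pi.one_apply, one_mul, mul_comm]
      · rw [indicator_of_notMem htS, indicator_of_notMem (fun h => htS h.1)]
        filter_upwards [Lp.coeFn_zero 𝕜 (ENNReal.ofReal q)
          (volume : Measure (UnitAddTorus (Fin d)))] with x hx
        rw [hx, Pi.zero_apply, map_zero, zero_mul, mul_zero]
    · refine ⟨fun y => RCLike.map 𝕜 ℂ z * (θ y.1 *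
        (torusTrig n (derivSymbol α.1 (fun i => (n i : ℝ)) * c) y.2 : ℂ)), ?_, fun y hy => ?_⟩
      · filter_upwards [hue] with t h1
        rw [h1]
        change ∀ᵐ x, _ = RCLike.map 𝕜 ℂ (((θ t : 𝕜) • torusTrigLp (ENNReal.ofReal q) n
          (derivSymbol α.1 (fun i => (n i : ℝ)) * c) z : TorusLq 𝕜 d q) x)
        filter_upwards [Lp.coeFn_smul (θ t : 𝕜) (torusTrigLp (ENNReal.ofReal q) n
          (derivSymbol α.1 (fun i => (n i : ℝ)) * c) z : TorusLq 𝕜 d q),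
          coeFn_torusTrigLp (q := ENNReal.ofReal q) n
            (derivSymbol α.1 (fun i => (n i : ℝ)) * c) z] with x h2 h3
        rw [h2, Pi.smul_apply, h3, ← RCLike.real_smul_eq_coe_smul (K := 𝕜), map_smul, map_smul,
          Complex.real_smul, Complex.real_smul]
        ring
      · have hlim : Filter.Tendsto (fun j : ℕ =>
            ((Real.exp (-(1 / ((j : ℝ) + 1) * κ)) : ℝ) : ℂ)) Filter.atTop (nhds 1) := by
          have h1 : Filter.Tendsto (fun j : ℕ => Real.exp (-(1 / ((j : ℝ) + 1) * κ))) Filter.atTop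
              (nhds (Real.exp (-(0 * κ)))) :=
            (Real.continuous_exp.tendsto _).comp
              ((tendsto_one_div_add_atTop_nhds_zero_nat.mul_const κ).neg)
          rw [zero_mul, neg_zero, Real.exp_zero] at h1
          exact_mod_cast (Complex.continuous_ofReal.tendsto 1).comp h1
        have h2 := hlim.mul_const (RCLike.map 𝕜 ℂ z * ((θ y.1 : ℂ) *
          (torusTrig n (derivSymbol α.1 (fun i => (n i : ℝ)) * c) y.2 : ℂ)))
        rw [one_mul] at h2
        refine h2.congr fun j => ?_
        obtain ⟨hj0, hj1⟩ := one_div_succ_pos_le_one j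
        exact (parabolicOp_biharmonicProfile_torusTrig hbl hj0 hj1 α.2 hS'm n c _ hy.1.le y.2).symm

/-- The finite sums of right-hand sides `1_S(t) Re (c eₙ) z`. -/
noncomputable def trigGroup (𝕜 : Type*) [RCLike 𝕜] (d : ℕ) (p q T : ℝ) [Fact (2 < p)] [Fact (2 < q)] (w : ℝ → ℝ) :
    AddSubgroup (TimeLp (TorusLq 𝕜 d q) p T w) :=
  AddSubgroup.closure {f | ∃ (S : Set ℝ) (hS : MeasurableSet S) (hμS : weightedMeasure w T S ≠ ⊤)
    (n : Fin d → ℤ) (c : ℂ) (z : 𝕜), f = indicatorConstLp (ENNReal.ofReal p) hS hμS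
      (torusTrigLp (ENNReal.ofReal q) n c z)}

/-- Simple functions are dense in time, and their values can be approximated by trigonometric
polynomials in L^q; for a fixed set, the indicator depends continuously on its value. -/
theorem topologicalClosure_trigGroup (𝕜 : Type*) [RCLike 𝕜] (d : ℕ) (p q T : ℝ) [Fact (2 < p)]
    [Fact (2 < q)] (w : ℝ → ℝ) (f : TimeLp (TorusLq 𝕜 d q) p T w) :
    f ∈ (trigGroup 𝕜 d p q T w).topologicalClosure := by
  refine Lp.induction ENNReal.ofReal_ne_top (fun f => f ∈ (trigGroup 𝕜 d p q T w).topologicalClosure)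
    (fun g S hS hμS => ?_) (fun _ _ _ _ _ ihf ihg => AddSubgroup.add_mem _ ihf ihg)
    (trigGroup 𝕜 d p q T w).isClosed_topologicalClosure f
  · rw [Lp.simpleFunc.coe_indicatorConst]
    set I : TorusLq 𝕜 d q →+ TimeLp (TorusLq 𝕜 d q) p T w :=
      AddMonoidHom.mk' (fun g => indicatorConstLp (ENNReal.ofReal p) hS hμS.ne g)
        fun g g' => indicatorConstLp_add.symm with hI
    have hIc : Continuous I := (AddMonoidHomClass.lipschitz_of_bound I
      ((weightedMeasure w T).real S ^ (1 / (ENNReal.ofReal p).toReal)) fun g => by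
        rw [mul_comm]
        exact norm_indicatorConstLp_le (hs := hS) (hμs := hμS.ne)).continuous
    have hg : g ∈ closure (AddSubgroup.closure {g : TorusLq 𝕜 d q |
        ∃ n c z, g = torusTrigLp (ENNReal.ofReal q) n c z} : Set (TorusLq 𝕜 d q)) := by
      rw [closure_torusTrigLp_eq_top ENNReal.ofReal_ne_top]
      exact mem_univ g
    refine map_mem_closure hIc hg fun h hh => ?_
    change I h ∈ trigGroup 𝕜 d p q T w
    induction hh using AddSubgroup.closure_induction with
    | mem h hh =>
      obtain ⟨n, c, z, rfl⟩ := hh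
      exact AddSubgroup.subset_closure ⟨S, hS, hμS.ne, n, c, z, rfl⟩
    | zero => rw [map_zero]; exact AddSubgroup.zero_mem _
    | add g h _ _ ih ih' => rw [map_add]; exact AddSubgroup.add_mem _ ih ih'
    | neg h _ ih => rw [map_neg]; exact AddSubgroup.neg_mem _ ih

theorem exists_solution_of_mem_trigGroup (hw : IsMuckenhoupt (p / 2) w) (hT : 0 < T)
    (ha : Measurable a) (hab : ∀ t, |a t| ≤ lam) (hb : ∀ t, b t = ∫ s in (0 : ℝ)..t, a s)
    (hbl : IsEllipticPrimitive lam b) {f : TimeLp (TorusLq 𝕜 d q) p T w}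
    (hf : f ∈ trigGroup 𝕜 d p q T w) :
    ∃ y : evolutionGroup 𝕜 d q hw hT, evolutionHom 𝕜 d q hw hT ha hab y = f ∧
      HasKernelRep b f y.1.1 := by
  have hadd : ∀ {f f' : TimeLp (TorusLq 𝕜 d q) p T w},
      (∃ y : evolutionGroup 𝕜 d q hw hT, evolutionHom 𝕜 d q hw hT ha hab y = f ∧
        HasKernelRep b f y.1.1) →
      (∃ y : evolutionGroup 𝕜 d q hw hT, evolutionHom 𝕜 d q hw hT ha hab y = f' ∧
        HasKernelRep b f' y.1.1) →
      ∃ y : evolutionGroup 𝕜 d q hw hT, evolutionHom 𝕜 d q hw hT ha hab y = f + f' ∧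
        HasKernelRep b (f + f') y.1.1 := by
    rintro f f' ⟨y, h1, h2⟩ ⟨y', h1', h2'⟩
    exact ⟨y + y', by rw [map_add, h1, h1'], h2.add hw hbl h2'⟩
  have hneg : ∀ {f : TimeLp (TorusLq 𝕜 d q) p T w},
      (∃ y : evolutionGroup 𝕜 d q hw hT, evolutionHom 𝕜 d q hw hT ha hab y = f ∧
        HasKernelRep b f y.1.1) →
      ∃ y : evolutionGroup 𝕜 d q hw hT, evolutionHom 𝕜 d q hw hT ha hab y = -f ∧
        HasKernelRep b (-f) y.1.1 := by
    rintro f ⟨y, h1, h2⟩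
    exact ⟨-y, by rw [map_neg, h1], h2.neg hw⟩
  induction hf using AddSubgroup.closure_induction with
  | mem f hf =>
    obtain ⟨S, hS, hμS, n, c, z, rfl⟩ := hf
    exact exists_solution_of_indicator hw hT ha hab hb hbl hS hμS n c z
  | zero =>
    have h := exists_solution_of_indicator (𝕜 := 𝕜) (d := d) (q := q) hw hT ha hab hb hbl
      MeasurableSet.empty (by simp) 0 0 0
    have h' := hadd h (hneg h)
    rwa [add_neg_cancel] at h'
  | add f f' _ _ ih ih' => exact hadd ih ih'
  | neg f _ ih => exact hneg ih

/-- Existence and the estimate for the solutions, with a constant which does not depend on the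
coefficient and the weight. -/
theorem exists_solution_norm_le (𝕜 : Type*) [RCLike 𝕜] (hd : 1 ≤ d) (hlam : 1 ≤ lam) (hT : 0 < T)
    (p q : ℝ) [Fact (2 < p)] [Fact (2 < q)] (K : ℝ≥0) :
    ∃ C : ℝ≥0, ∀ (a b : ℝ → ℝ) (ha : Measurable a) (hab : ∀ t, |a t| ≤ lam),
      (∀ t, b t = ∫ s in (0 : ℝ)..t, a s) → IsEllipticPrimitive lam b →
      ∀ (w : ℝ → ℝ) (hw : IsMuckenhoupt (p / 2) w), apCharacteristic (p / 2) w ≤ K →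
      ∀ f : TimeLp (TorusLq 𝕜 d q) p T w, ∃ y : evolutionGroup 𝕜 d q hw hT,
        evolutionHom 𝕜 d q hw hT ha hab y = f ∧ ‖y‖ ≤ C * ‖f‖ := by
  have hp : 2 < p := Fact.out
  obtain ⟨C, hC⟩ := exists_enorm_rpow_le_of_hasKernelRep 𝕜 hd lam hlam T p q K
  set C' : ℝ≥0 := C ^ (1 / p) with hC'
  set L : ℝ := lam * ‖bilaplacianL 𝕜 d q‖ with hL
  have hL0 : 0 ≤ L := by positivity
  set A : ℝ := 1 + (1 + L) * C' with hA
  have hA0 : 0 < A := by positivity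
  refine ⟨(A + 1).toNNReal, fun a b ha hab hb hbl w hw hK f => ?_⟩
  rw [Real.coe_toNNReal _ (by positivity)]
  have : CompleteSpace (evolutionGroup 𝕜 d q hw hT) :=
    (isClosed_evolutionGroup hw hT).completeSpace_coe
  -- Successive approximation: f is a series of elements of the dense subgroup with rapidly
  -- decreasing norms, each of them is solved with the constant A, and the solutions sum up in the
  -- complete group of pairs. The constant becomes A + 1.
  refine controlled_closure_of_complete (f := evolutionHom 𝕜 d q hw hT ha hab)
    (K := trigGroup 𝕜 d p q T w) hA0 one_pos (fun f hf => ?_) f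
    (topologicalClosure_trigGroup 𝕜 d p q T w f)
  obtain ⟨y, hy, hrep⟩ := exists_solution_of_mem_trigGroup hw hT ha hab hb hbl hf
  refine ⟨y, hy, ?_⟩
  have h1 : ‖y.1.1‖ ≤ C' * ‖f‖ := by
    have h := ENNReal.rpow_le_rpow (hC b w hbl hw hK f y.1.1 hrep) (z := 1 / p) (by positivity)
    rw [ENNReal.mul_rpow_of_nonneg _ _ (by positivity), ← ENNReal.rpow_mul, ← ENNReal.rpow_mul,
      mul_one_div_cancel (by linarith), ENNReal.rpow_one, ENNReal.rpow_one,
      ← ENNReal.coe_rpow_of_nonneg _ (by positivity)] at h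
    have h' := ENNReal.toReal_mono (ENNReal.mul_ne_top ENNReal.coe_ne_top (by
      rw [Lp.enorm_def]; exact Lp.eLpNorm_ne_top f)) h
    rwa [ENNReal.toReal_mul, Lp.enorm_def, Lp.enorm_def, ← Lp.norm_def, ← Lp.norm_def,
      ENNReal.coe_toReal] at h'
  -- The time derivative is estimated through the equation, u' = f - aΔ²u.
  have h2 : ‖y.1.2‖ ≤ ‖f‖ + L * (C' * ‖f‖) := by
    rw [evolutionHom_apply] at hy
    rw [← sub_eq_iff_eq_add.2 hy.symm]
    refine (norm_sub_le _ _).trans (add_le_add le_rfl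
      ((norm_timeBilaplacian_le ha hab _).trans ?_))
    exact mul_le_mul_of_nonneg_left h1 hL0
  have hf0 := norm_nonneg f
  have hC0 : (0 : ℝ) ≤ C' := C'.2
  refine max_le ?_ ?_
  · refine h1.trans ?_
    rw [hA]
    nlinarith [mul_nonneg hC0 hf0, mul_nonneg (mul_nonneg hL0 hC0) hf0]
  · refine h2.trans ?_
    rw [hA]
    nlinarith [mul_nonneg hC0 hf0, mul_nonneg (mul_nonneg hL0 hC0) hf0]

end Existence
open scoped SchwartzMap

/-! ### Uniqueness and the main theorem -/

section Uniqueness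

variable {𝕜 : Type*} [RCLike 𝕜] {d : ℕ} {p q T lam : ℝ} [Fact (2 < p)] [Fact (2 < q)]
  {w a a' : ℝ → ℝ}

theorem two_le_ofReal (q : ℝ) [hq : Fact (2 < q)] : 2 ≤ ENNReal.ofReal q := by
  rw [← ENNReal.ofReal_ofNat]
  exact ENNReal.ofReal_le_ofReal hq.out.le

/-- Weak derivatives are determined by the function, since their trigonometric moments are. So an
element of the Sobolev space, stored as a family, is determined by its member of order zero. -/
theorem toTorusLp_injective :
    Function.Injective (sobolevTorus.toTorusLp : SobolevFour 𝕜 d q → TorusLq 𝕜 d q) := by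
  intro u v huv
  refine Subtype.ext (PiLp.ext fun α => sub_eq_zero.1 ?_)
  refine eq_zero_of_torusPairing_torusTrig_eq_zero (two_le_ofReal q) _ fun n c => ?_
  rw [map_sub, sub_eq_zero, torusPairing_apply, torusPairing_apply]
  have h1 := u.2 α _ (torusSmooth_torusTrig n c)
  have h2 := v.2 α _ (torusSmooth_torusTrig n c)
  have h0 : u.1 (MultiIndex.zero d 4) = v.1 (MultiIndex.zero d 4) := huv
  rw [h0, h2] at h1
  exact (smul_right_injective 𝕜 (pow_ne_zero _ (neg_ne_zero.2 (one_ne_zero (α := ℝ)))) h1).symm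

/-- The constant in the du Bois-Reymond lemma is the initial value: two continuous functions on [0,
T] that agree almost everywhere agree at 0, where the given representative vanishes. -/
theorem IsParabolicSolution.ae_eq_primitive (hw : IsMuckenhoupt (p / 2) w) (hT : 0 < T)
    {f u' : TimeLp (TorusLq 𝕜 d q) p T w} {u : TimeLp (SobolevFour 𝕜 d q) p T w}
    (h : IsParabolicSolution T w a f u u') :
    ∀ᵐ t ∂volume.restrict (Ioo 0 T), sobolevTorus.toTorusLp (u t) = ∫ s in (0 : ℝ)..t, u' s := by
  obtain ⟨M, hM⟩ := hw.exists_integral_norm_le (TorusLq 𝕜 d q) Fact.out hT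
  obtain ⟨c, hc⟩ := h.hasWeakTimeDeriv.exists_ae_eq hT (hM u').1
  obtain ⟨v, hv, hvu, hv0⟩ := h.initial
  have hcont := continuousOn_primitive_of_integrableOn hT.le (hM u').1
  have hae : v =ᵐ[volume.restrict (Icc 0 T)] fun t => c + ∫ s in (0 : ℝ)..t, u' s := by
    rw [← Measure.restrict_congr_set Ioo_ae_eq_Icc]
    filter_upwards [hc, hvu] with t h1 h2
    rw [← h2, h1]
  have h0 := Measure.eqOn_Icc_of_ae_eq volume hT.ne hae hv (continuousOn_const.add hcont)
    (left_mem_Icc.2 hT.le)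
  simp only [intervalIntegral.integral_same, add_zero] at h0
  rw [hv0] at h0
  filter_upwards [hc] with t ht
  rw [ht, ← h0, zero_add]

/-- Testing the difference of two solutions with a trigonometric function yields a linear scalar
equation with bounded coefficient and zero initial value. Gronwall's lemma annihilates every such
moment, hence the difference. -/
theorem IsParabolicSolution.unique (hw : IsMuckenhoupt (p / 2) w) (hT : 0 < T)
    (hab : ∀ t, |a t| ≤ lam) {f u' v' : TimeLp (TorusLq 𝕜 d q) p T w}
    {u v : TimeLp (SobolevFour 𝕜 d q) p T w} (hu : IsParabolicSolution T w a f u u')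
    (hv : IsParabolicSolution T w a f v v') : v = u ∧ v' = u' := by
  obtain ⟨M, hM⟩ := hw.exists_integral_norm_le (TorusLq 𝕜 d q) Fact.out hT
  have hpu := hu.ae_eq_primitive hw hT
  have hpv := hv.ae_eq_primitive hw hT
  have hii : ∀ g : TimeLp (TorusLq 𝕜 d q) p T w, ∀ t ∈ Icc 0 T,
      IntervalIntegrable g volume 0 t := fun g t ht =>
    (intervalIntegrable_iff_integrableOn_Ioo_of_le ht.1).2
      ((hM g).1.mono_set (Ioo_subset_Ioo_right ht.2))
  set Y : ℝ → TorusLq 𝕜 d q := fun t => (∫ s in (0 : ℝ)..t, v' s) - ∫ s in (0 : ℝ)..t, u' s with hY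
  have hYc : ContinuousOn Y (Icc 0 T) :=
    (continuousOn_primitive_of_integrableOn hT.le (hM v').1).sub
      (continuousOn_primitive_of_integrableOn hT.le (hM u').1)
  have hY0 : ∀ t ∈ Icc 0 T, Y t = 0 := by
    intro t ht
    refine eq_zero_of_torusPairing_torusTrig_eq_zero (two_le_ofReal q) _ fun n c => ?_
    set ℓ : TorusLq 𝕜 d q →L[𝕜] 𝕜 := torusPairing _ (continuous_torusTrig n c) with hℓ
    have hder : ∀ᵐ s ∂volume.restrict (Ioo 0 T),
        ℓ (v' s - u' s) = -((a s : 𝕜) * (((bilapSymbol n : ℝ) : 𝕜) * ℓ (Y s))) := by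
      filter_upwards [hu.equation, hv.equation, hpu, hpv] with s h1 h2 h3 h4
      have h5 : v' s - u' s = -((a s : 𝕜) • (sobolevTorus.bilaplacian (v s) -
          sobolevTorus.bilaplacian (u s))) := by
        rw [smul_sub, eq_sub_of_add_eq h1, eq_sub_of_add_eq h2]
        abel
      rw [h5, map_neg, map_smul, map_sub, torusPairing_torusTrig_bilaplacian,
        torusPairing_torusTrig_bilaplacian, h3, h4, ← mul_sub, ← map_sub, smul_eq_mul]
    refine eq_zero_of_norm_le_mul_integral_norm (y := fun t => ℓ (Y t)) (L := lam * bilapSymbol n)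
      hT.le (ℓ.continuous.comp_continuousOn hYc) (fun r hr => ?_) t ht
    have hi := (hii v' r hr).sub (hii u' r hr)
    have e1 : ℓ (Y r) = ∫ s in (0 : ℝ)..r, ℓ (v' s - u' s) := by
      rw [ℓ.intervalIntegral_comp_comm hi, intervalIntegral.integral_sub (hii v' r hr) (hii u' r hr)]
    rw [e1, ← intervalIntegral.integral_const_mul]
    refine intervalIntegral.norm_integral_le_of_norm_le hr.1 ?_ ?_
    · have h6 := (ae_restrict_iff' measurableSet_Ioo).1 hder
      filter_upwards [h6, compl_mem_ae_iff.2 (measure_singleton T)] with s hs hsT hsr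
      rw [hs ⟨hsr.1, lt_of_le_of_ne (hsr.2.trans hr.2) hsT⟩, norm_neg, norm_mul, norm_mul,
        RCLike.norm_ofReal, RCLike.norm_ofReal, abs_of_nonneg (bilapSymbol_nonneg n), ← mul_assoc]
      exact mul_le_mul_of_nonneg_right (mul_le_mul_of_nonneg_right (hab s) (bilapSymbol_nonneg n))
        (norm_nonneg _)
    · refine ContinuousOn.intervalIntegrable ?_
      rw [uIcc_of_le hr.1]
      exact continuousOn_const.mul
        ((ℓ.continuous.comp_continuousOn (hYc.mono (Icc_subset_Icc_right hr.2))).norm)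
  have huv : ∀ᵐ t ∂volume.restrict (Ioo 0 T), v t = u t := by
    filter_upwards [hpu, hpv, ae_restrict_mem measurableSet_Ioo] with t h1 h2 ht
    exact toTorusLp_injective (by rw [h1, h2]; exact sub_eq_zero.1 (hY0 t (Ioo_subset_Icc_self ht)))
  have hac := weightedMeasure_absolutelyContinuous w T
  refine ⟨Lp.ext (hac.ae_le huv), Lp.ext (hac.ae_le ?_)⟩
  filter_upwards [hu.equation, hv.equation, huv] with t h1 h2 h3
  rw [eq_sub_of_add_eq h1, eq_sub_of_add_eq h2, h3]

theorem IsParabolicSolution.congr {f u' : TimeLp (TorusLq 𝕜 d q) p T w}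
    {u : TimeLp (SobolevFour 𝕜 d q) p T w} (haa' : ∀ t ∈ Ioo 0 T, a t = a' t)
    (h : IsParabolicSolution T w a f u u') : IsParabolicSolution T w a' f u u' where
  hasWeakTimeDeriv := h.hasWeakTimeDeriv
  equation := by
    filter_upwards [h.equation, ae_restrict_mem measurableSet_Ioo] with t h1 ht
    rw [← haa' t ht, h1]
  initial := h.initial

/-- Functions compactly supported in (0, T) are among the tests with φ(T) = 0. The remaining tests
identify u with the primitive of u', which is the continuous representative with value 0 at time
zero. -/
theorem isParabolicSolution_of_evolutionHom_eq (hw : IsMuckenhoupt (p / 2) w) (hT : 0 < T)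
    (ha : Measurable a) (hab : ∀ t, |a t| ≤ lam) {f : TimeLp (TorusLq 𝕜 d q) p T w}
    (y : evolutionGroup 𝕜 d q hw hT) (hy : evolutionHom 𝕜 d q hw hT ha hab y = f) :
    IsParabolicSolution T w a f y.1.1 y.1.2 := by
  obtain ⟨M, hM⟩ := hw.exists_integral_norm_le (TorusLq 𝕜 d q) Fact.out hT
  obtain ⟨M', hM'⟩ := hw.exists_integral_norm_le (SobolevFour 𝕜 d q) Fact.out hT
  have hu := coeFn_timeToTorusLp hw y.1.1
  have hui : IntegrableOn (fun t => sobolevTorus.toTorusLp (y.1.1 t)) (Ioo 0 T) :=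
    (hM (timeToTorusLp 𝕜 d p q T w y.1.1)).1.congr hu
  have htest : ∀ φ : ℝ → ℝ, ContDiff ℝ ∞ φ → φ T = 0 →
      ∫ t in Ioo 0 T, deriv φ t • sobolevTorus.toTorusLp (y.1.1 t) =
        -∫ t in Ioo 0 T, φ t • y.1.2 t := by
    intro φ hφ hφT
    rw [← y.2 φ hφ hφT]
    refine integral_congr_ae ?_
    filter_upwards [hu] with t ht
    rw [ht]
  refine ⟨⟨hui.locallyIntegrableOn, (hM y.1.2).1.locallyIntegrableOn, fun φ hφ _ hφT =>
    htest φ hφ (image_eq_zero_of_notMem_tsupport fun h => lt_irrefl T (hφT h).2)⟩, ?_,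
    fun t => ∫ s in (0 : ℝ)..t, y.1.2 s, continuousOn_primitive_of_integrableOn hT.le (hM y.1.2).1,
    ae_eq_primitive_of_forall_test hui.locallyIntegrableOn (hM y.1.2).1 htest,
    intervalIntegral.integral_same⟩
  rw [evolutionHom_apply] at hy
  refine (hw.absolutelyContinuous T).ae_le ?_
  filter_upwards [Lp.coeFn_add y.1.2 (timeBilaplacian ha hab y.1.1),
    coeFn_timeBilaplacian ha hab y.1.1] with t h1 h2
  rw [← hy, h1, Pi.add_apply, h2]

theorem isEllipticPrimitive_integral (hlam : 1 ≤ lam) (ha : Measurable a)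
    (hab : ∀ t, lam⁻¹ ≤ a t ∧ a t ≤ lam) :
    IsEllipticPrimitive lam fun t => ∫ s in (0 : ℝ)..t, a s := by
  have h0 : 0 ≤ lam⁻¹ := by positivity
  have habs : ∀ t, |a t| ≤ lam := fun t => by
    rw [abs_of_nonneg (h0.trans (hab t).1)]
    exact (hab t).2
  have hi : ∀ s t, IntervalIntegrable a volume s t := fun s t => intervalIntegrable_iff.2
    (((locallyIntegrable_of_abs_le ha habs).integrableOn_isCompact isCompact_uIcc).mono_set
      uIoc_subset_uIcc)
  refine ⟨hlam, fun s t hst => ?_, fun s t hst => ?_⟩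
  · rw [intervalIntegral.integral_interval_sub_left (hi _ _) (hi _ _)]
    have := intervalIntegral.integral_mono_on hst (intervalIntegrable_const (c := lam⁻¹)) (hi s t)
      fun x _ => (hab x).1
    rwa [intervalIntegral.integral_const, smul_eq_mul, mul_comm] at this
  · rw [intervalIntegral.integral_interval_sub_left (hi _ _) (hi _ _)]
    have := intervalIntegral.integral_mono_on hst (hi s t) (intervalIntegrable_const (c := lam))
      fun x _ => (hab x).2
    rwa [intervalIntegral.integral_const, smul_eq_mul, mul_comm (t - s)] at this

end Uniqueness

theorem propositionB2 (𝕜 : Type*) [RCLike 𝕜] (d : ℕ) (hd : 1 ≤ d) (lam : ℝ) (hlam : 0 < lam)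
    (T : ℝ) (hT : 0 < T) (p : ℝ) (hp : 2 < p) (q : ℝ) [Fact (2 < q)] (K : ℝ≥0) :
    ∃ C : ℝ≥0, ∀ a : ℝ → ℝ, Measurable a → (∀ t, 0 < t → lam⁻¹ ≤ a t ∧ a t ≤ lam) →
      ∀ w : ℝ → ℝ, IsMuckenhoupt (p / 2) w → apCharacteristic (p / 2) w ≤ K →
        ∀ f : Lp (TorusLp 𝕜 d (ENNReal.ofReal q)) (ENNReal.ofReal p) (weightedMeasure w T),
          ∃ (u : Lp (sobolevTorus 𝕜 d 4 (ENNReal.ofReal q)) (ENNReal.ofReal p)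
              (weightedMeasure w T))
            (u' : Lp (TorusLp 𝕜 d (ENNReal.ofReal q)) (ENNReal.ofReal p) (weightedMeasure w T)),
            IsParabolicSolution T w a f u u' ∧
            (∀ v v', IsParabolicSolution T w a f v v' → v = u ∧ v' = u') ∧
            (∫⁻ t in Ioo 0 T, ‖u' t‖ₑ ^ p * ENNReal.ofReal (w t)) +
                (∫⁻ t in Ioo 0 T, ‖u t‖ₑ ^ p * ENNReal.ofReal (w t)) ≤
              C * ∫⁻ t in Ioo 0 T, ‖f t‖ₑ ^ p * ENNReal.ofReal (w t) := by
  have : Fact (2 < p) := ⟨hp⟩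
  have hp0 : 0 < p := by linarith
  obtain ⟨C, hC⟩ := exists_solution_norm_le 𝕜 hd (le_max_left 1 lam) hT p q K
  -- Both u' and u have norm at most C‖f‖, and the two p-th powers are added.
  refine ⟨2 * C ^ p, fun a ha hab w hw hK f => ?_⟩
  -- The constant is fixed before `a`. For lam < 1 no admissible `a` exists, and enlarging lam to at
  -- least 1 covers this case uniformly.
  set Λ := max 1 lam with hΛ
  have hΛ1 : 1 ≤ Λ := le_max_left _ _
  -- Nothing is assumed on `a` for t ≤ 0, whereas the primitive is required to be elliptic on the
  -- whole line. The change does not affect the equation on (0, T).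
  set a' : ℝ → ℝ := fun t => if 0 < t then a t else 1 with ha'
  have ham' : Measurable a' := Measurable.ite measurableSet_Ioi ha measurable_const
  have hab' : ∀ t, Λ⁻¹ ≤ a' t ∧ a' t ≤ Λ := by
    intro t
    simp only [ha']
    split_ifs with ht
    · exact ⟨(inv_anti₀ hlam (le_max_right _ _)).trans (hab t ht).1,
        (hab t ht).2.trans (le_max_right _ _)⟩
    · exact ⟨inv_le_one_of_one_le₀ hΛ1, hΛ1⟩
  have habs : ∀ t, |a' t| ≤ Λ := fun t => by
    rw [abs_of_nonneg ((by positivity : (0 : ℝ) ≤ Λ⁻¹).trans (hab' t).1)]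
    exact (hab' t).2
  have haa' : ∀ t ∈ Ioo 0 T, a' t = a t := fun t ht => if_pos ht.1
  obtain ⟨y, hy, hyC⟩ := hC a' _ ham' habs (fun _ => rfl)
    (isEllipticPrimitive_integral hΛ1 ham' hab') w hw hK f
  have hsol := isParabolicSolution_of_evolutionHom_eq hw hT ham' habs y hy
  refine ⟨y.1.1, y.1.2, hsol.congr haa', fun v v' hv =>
    hsol.unique hw hT habs (hv.congr fun t ht => (haa' t ht).symm), ?_⟩
  have hE : ∀ {E : Type _} [NormedAddCommGroup E] (g : TimeLp E p T w), ‖g‖ ≤ C * ‖f‖ →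
      ∫⁻ t in Ioo 0 T, ‖g t‖ₑ ^ p * ENNReal.ofReal (w t) ≤
        (C : ℝ≥0∞) ^ p * ∫⁻ t in Ioo 0 T, ‖f t‖ₑ ^ p * ENNReal.ofReal (w t) := by
    intro E _ g hg
    rw [← hw.enorm_rpow_eq hp0, ← hw.enorm_rpow_eq hp0, ← ENNReal.mul_rpow_of_nonneg _ _ hp0.le]
    refine ENNReal.rpow_le_rpow ?_ hp0.le
    have h := ENNReal.ofReal_le_ofReal hg
    rwa [ENNReal.ofReal_mul C.coe_nonneg, ENNReal.ofReal_coe_nnreal, ofReal_norm,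
      ofReal_norm] at h
  refine (add_le_add (hE y.1.2 ((norm_snd_le y.1).trans hyC))
    (hE y.1.1 ((norm_fst_le y.1).trans hyC))).trans (le_of_eq ?_)
  rw [← two_mul, ← mul_assoc, ENNReal.coe_mul, ENNReal.coe_rpow_of_nonneg _ hp0.le]
  rfl
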